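/- There is an absolute constant $C>0$ for which the following holds. Graphs are finite, connected and undirected, with vertex set $\{0,\dots,n-1\}$ and edge weights $w\ge 0$; $d_G$ denotes the shortest path distance (with $d=\infty$ between vertices that no path joins). The pathwidth of $G$ is the least width, i.e. the largest bag size minus one, of a path decomposition of $G$. For a weighted graph $G=(V,E,w)$ and a set $K\subseteq V$ of terminals (of any size), a solution of the Steiner Point Removal problem with distortion $\alpha$ is a weighted graph $M=(K,E',w')$, $w'\ge 0$, that is a minor of $G$ (there are pairwise disjoint connected sets $B_t\ni t$, $t\in K$, in $G$ such that every edge $\{t,t'\}$ of $M$ is witnessed by an edge of $G$ between $B_t$ and $B_{t'}$) and satisfies $$d_G(t,t')\le d_M(t,t')\le\alpha\cdot d_G(t,t')\qquad\text{for all }t,t'\in K .$$ Every weighted graph $G$ of pathwidth $\rho$ with any terminal set $K$ has a solution of the Steiner Point Removal problem with distortion at most $C\rho^9$, and such a solution can be computed efficiently, in the following sense. 1. There is one algorithm that, given $G$ and $K$, returns a solution with distortion at most $C\rho^9$, where $\rho$ is the pathwidth of $G$, and whose running time is, for each fixed $\rho$, bounded by a polynomial in $n$ (which may depend on $\rho$).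 2. There is one algorithm that, given $G$, $K$ and any path decomposition of $G$, of width $r$ and with $m$ bags, returns a solution with distortion at most $C r^9$, in time bounded by a single polynomial in $n+m$, independent of $r$. Here an algorithm is a program for a random access machine with integer and real memory cells whose only arithmetic operations are additions and subtractions, besides comparisons; every operation costs one step, and the weights may be arbitrary nonnegative reals. In particular neither the distortion nor the running time bounds depend on the number of terminals or on the size of the weights. -/

import Mathlib

open scoped NNReal ENNReal

/-! ### Weighted graphs, minors, Steiner point removal -/

/-- An undirected graph with nonnegative edge weights. Only the values of `weight` on the edges of
`graph` are ever used. -/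
structure WeightedGraph (V : Type*) where
  graph : SimpleGraph V
  weight : Sym2 V → ℝ≥0

namespace WeightedGraph

variable {V : Type*}

/-- The total weight of a walk. -/
def walkLength (G : WeightedGraph V) {u v : V} (p : G.graph.Walk u v) : ℝ≥0 :=
  (p.edges.map G.weight).sum

/-- The shortest path distance. It is `∞` between vertices that no walk joins. -/
noncomputable def dist (G : WeightedGraph V) (u v : V) : ℝ≥0∞ :=
  ⨅ p : G.graph.Walk u v, (G.walkLength p : ℝ≥0∞)

end WeightedGraph

/-- `M`, a graph whose vertices are the terminals `K` of `G`, is a minor of `G`: there are pairwise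
disjoint connected branch sets `B t`, each containing its own terminal `t`, such that every edge
`{t, t'}` of `M` is witnessed by an edge of `G` between `B t` and `B t'`. (Vertices outside all
branch sets are deleted, each branch set is contracted to its terminal, and the edges missing from
`M` are deleted.) -/
def IsTerminalMinor {V : Type*} (G : SimpleGraph V) (K : Finset V) (M : SimpleGraph K) : Prop :=
  ∃ B : K → Set V,
    (∀ t : K, (t : V) ∈ B t) ∧
    (∀ t : K, (G.induce (B t)).Connected) ∧
    (∀ t t' : K, t ≠ t' → Disjoint (B t) (B t')) ∧
    (∀ t t' : K, M.Adj t t' → ∃ u ∈ B t, ∃ v ∈ B t', G.Adj u v)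

/-- `M` is a solution with distortion `α` of the Steiner point removal problem for the weighted
graph `G` with terminal set `K`. -/
def IsSPRSolution {V : Type*} (G : WeightedGraph V) (K : Finset V) (M : WeightedGraph K)
    (α : ℝ≥0) : Prop :=
  IsTerminalMinor G.graph K M.graph ∧
    ∀ t t' : K, G.dist t t' ≤ M.dist t t' ∧ M.dist t t' ≤ (α : ℝ≥0∞) * G.dist t t'

/-! ### Path decompositions -/

/-- A path decomposition: a sequence of bags such that every vertex and every edge lies in a bag and
the bags that contain a given vertex are consecutive. -/
structure PathDecomposition {V : Type*} (G : SimpleGraph V) where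
  numBags : ℕ
  bag : Fin numBags → Finset V
  vertex_mem : ∀ v, ∃ i, v ∈ bag i
  edge_mem : ∀ u v, G.Adj u v → ∃ i, u ∈ bag i ∧ v ∈ bag i
  consecutive : ∀ v i j k, i ≤ j → j ≤ k → v ∈ bag i → v ∈ bag k → v ∈ bag j

/-- The width: the largest size of a bag, minus one. -/
def PathDecomposition.width {V : Type*} {G : SimpleGraph V} (D : PathDecomposition G) : ℕ :=
  (Finset.univ.sup fun i => (D.bag i).card) - 1

/-- The pathwidth: the least width of a path decomposition. -/
noncomputable def pathwidth {V : Type*} (G : SimpleGraph V) : ℕ :=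
  sInf {w | ∃ D : PathDecomposition G, D.width = w}

/-! ### The machine model

A random access machine with finitely many integer arrays and finitely many real arrays, all of
unbounded length, and structured control flow. Its only arithmetic operations are additions and
subtractions, and every operation costs one step. -/

/-- The memory: `nat a k` and `real a k` are the `k`-th cells of the `a`-th integer array and of the
`a`-th real array. -/
structure Memory where
  nat : ℕ → ℕ → ℕ
  real : ℕ → ℕ → ℝ

/-- Integer expressions. The array that is read is fixed in the expression, the cell is computed. -/
inductive NatExpr where
  | lit (c : ℕ)
  | read (a : ℕ) (i : NatExpr)
  | add (e f : NatExpr)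
  | sub (e f : NatExpr)

/-- Real expressions; the arrays are indexed by integer expressions. -/
inductive RealExpr where
  | zero
  | read (a : ℕ) (i : NatExpr)
  | add (e f : RealExpr)
  | sub (e f : RealExpr)

/-- Tests. -/
inductive Test where
  | natLe (e f : NatExpr)
  | realLe (e f : RealExpr)
  | not (b : Test)
  | and (b c : Test)

/-- Programs. `setNat a i e` writes the value of `e` into cell `i` of the integer array `a`. -/
inductive Program where
  | skip
  | setNat (a : ℕ) (i e : NatExpr)
  | setReal (a : ℕ) (i : NatExpr) (e : RealExpr)
  | seq (P Q : Program)
  | branch (b : Test) (P Q : Program)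
  | loop (b : Test) (P : Program)

/-- Subtraction of integers is truncated at `0`. -/
def NatExpr.eval (s : Memory) : NatExpr → ℕ
  | .lit c => c
  | .read a i => s.nat a (i.eval s)
  | .add e f => e.eval s + f.eval s
  | .sub e f => e.eval s - f.eval s

/-- The number of steps that the evaluation of an expression takes. -/
def NatExpr.cost : NatExpr → ℕ
  | .lit _ => 1
  | .read _ i => i.cost + 1
  | .add e f => e.cost + f.cost + 1
  | .sub e f => e.cost + f.cost + 1

noncomputable def RealExpr.eval (s : Memory) : RealExpr → ℝ
  | .zero => 0
  | .read a i => s.real a (i.eval s)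
  | .add e f => e.eval s + f.eval s
  | .sub e f => e.eval s - f.eval s

def RealExpr.cost : RealExpr → ℕ
  | .zero => 1
  | .read _ i => i.cost + 1
  | .add e f => e.cost + f.cost + 1
  | .sub e f => e.cost + f.cost + 1

def Test.Holds (s : Memory) : Test → Prop
  | .natLe e f => e.eval s ≤ f.eval s
  | .realLe e f => e.eval s ≤ f.eval s
  | .not b => ¬ b.Holds s
  | .and b c => b.Holds s ∧ c.Holds s

def Test.cost : Test → ℕ
  | .natLe e f => e.cost + f.cost + 1
  | .realLe e f => e.cost + f.cost + 1
  | .not b => b.cost + 1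
  | .and b c => b.cost + c.cost + 1

def Memory.writeNat (s : Memory) (a k x : ℕ) : Memory :=
  { s with nat := Function.update s.nat a (Function.update (s.nat a) k x) }

noncomputable def Memory.writeReal (s : Memory) (a k : ℕ) (x : ℝ) : Memory :=
  { s with real := Function.update s.real a (Function.update (s.real a) k x) }

/-- `Runs P s t s'`: started in memory `s`, the program `P` halts after exactly `t` steps, in
memory `s'`. -/
inductive Runs : Program → Memory → ℕ → Memory → Prop
  | skip (s) : Runs .skip s 1 s
  | setNat (a i e s) :
      Runs (.setNat a i e) s (i.cost + e.cost + 1) (s.writeNat a (i.eval s) (e.eval s))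
  | setReal (a i e s) :
      Runs (.setReal a i e) s (i.cost + e.cost + 1) (s.writeReal a (i.eval s) (e.eval s))
  | seq {P Q s₁ s₂ s₃ t₁ t₂} (h₁ : Runs P s₁ t₁ s₂) (h₂ : Runs Q s₂ t₂ s₃) :
      Runs (.seq P Q) s₁ (t₁ + t₂) s₃
  | branchTrue {b P Q s s' t} (hb : b.Holds s) (h : Runs P s t s') :
      Runs (.branch b P Q) s (b.cost + t) s'
  | branchFalse {b P Q s s' t} (hb : ¬ b.Holds s) (h : Runs Q s t s') :
      Runs (.branch b P Q) s (b.cost + t) s'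
  | loopDone {b P s} (hb : ¬ b.Holds s) : Runs (.loop b P) s b.cost s
  | loopStep {b P s₁ s₂ s₃ t₁ t₂} (hb : b.Holds s₁) (h₁ : Runs P s₁ t₁ s₂)
      (h₂ : Runs (.loop b P) s₂ t₂ s₃) : Runs (.loop b P) s₁ (b.cost + t₁ + t₂) s₃

/-- Programs are deterministic: the running time and the result depend on the input only. -/
theorem Runs.deterministic {P : Program} {s s₁ s₂ : Memory} {t₁ t₂ : ℕ}
    (h₁ : Runs P s t₁ s₁) (h₂ : Runs P s t₂ s₂) : t₁ = t₂ ∧ s₁ = s₂ := by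
  induction h₁ generalizing t₂ s₂ with
  | skip | setNat | setReal => cases h₂; exact ⟨rfl, rfl⟩
  | seq _ _ ih ih' =>
    cases h₂ with
    | seq h h' =>
      obtain ⟨rfl, rfl⟩ := ih h
      obtain ⟨rfl, rfl⟩ := ih' h'
      exact ⟨rfl, rfl⟩
  | branchTrue hb _ ih =>
    cases h₂ with
    | branchTrue _ h => obtain ⟨rfl, rfl⟩ := ih h; exact ⟨rfl, rfl⟩
    | branchFalse hb' _ => exact absurd hb hb'
  | branchFalse hb _ ih =>
    cases h₂ with
    | branchTrue hb' _ => exact absurd hb' hb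
    | branchFalse _ h => obtain ⟨rfl, rfl⟩ := ih h; exact ⟨rfl, rfl⟩
  | loopDone hb =>
    cases h₂ with
    | loopDone _ => exact ⟨rfl, rfl⟩
    | loopStep hb' _ _ => exact absurd hb' hb
  | loopStep hb _ _ ih ih' =>
    cases h₂ with
    | loopDone hb' => exact absurd hb hb'
    | loopStep _ h h' =>
      obtain ⟨rfl, rfl⟩ := ih h
      obtain ⟨rfl, rfl⟩ := ih' h'
      exact ⟨rfl, rfl⟩

/-! ### Input and output -/

/-- The array that holds an `m × n` matrix row by row, followed by zeros. -/
def rowMajor {α : Type*} [Zero α] {m n : ℕ} (f : Fin m → Fin n → α) (k : ℕ) : α :=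
  if h : k / n < m ∧ k % n < n then f ⟨k / n, h.1⟩ ⟨k % n, h.2⟩ else 0

theorem rowMajor_apply {α : Type*} [Zero α] {m n : ℕ} (f : Fin m → Fin n → α)
    (i : Fin m) (j : Fin n) : rowMajor f (i * n + j) = f i j := by
  have hn : 0 < n := j.pos
  have h₁ : ((i : ℕ) * n + j) / n = i := by
    rw [Nat.add_comm, Nat.add_mul_div_right _ _ hn, Nat.div_eq_of_lt j.isLt, Nat.zero_add]
  have h₂ : ((i : ℕ) * n + j) % n = j := by
    rw [Nat.add_comm, Nat.add_mul_mod_self_right, Nat.mod_eq_of_lt j.isLt]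
  unfold rowMajor
  rw [dif_pos ⟨by rw [h₁]; exact i.isLt, by rw [h₂]; exact j.isLt⟩]
  congr 1 <;> exact Fin.ext ‹_›

open Classical in
/-- The initial memory for a weighted graph on `{0, …, n - 1}`, a set of terminals, and a sequence
of `m` further vertex sets. Integer array `0` starts with `n` and `m`; integer array `1` is the
adjacency matrix, integer array `2` marks the terminals, integer array `3` marks in row `i` the
elements of the `i`-th vertex set; real array `0` is the matrix of the edge weights. All other cells
are zero. -/
noncomputable def initialMemory {n : ℕ} (G : WeightedGraph (Fin n)) (K : Finset (Fin n))
    {m : ℕ} (S : Fin m → Finset (Fin n)) : Memory where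
  nat
    | 0 => fun k => if k = 0 then n else if k = 1 then m else 0
    | 1 => rowMajor fun u v : Fin n => if G.graph.Adj u v then 1 else 0
    | 2 => fun k => if ∃ t ∈ K, (t : ℕ) = k then 1 else 0
    | 3 => rowMajor fun (i : Fin m) (v : Fin n) => if v ∈ S i then 1 else 0
    | _ => fun _ => 0
  real
    | 0 => rowMajor fun u v : Fin n => if G.graph.Adj u v then (G.weight s(u, v) : ℝ) else 0
    | _ => fun _ => 0

/-- The input that consists of the weighted graph `G` and the set of terminals `K` only. -/
noncomputable def inputMemory {n : ℕ} (G : WeightedGraph (Fin n)) (K : Finset (Fin n)) : Memory :=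
  initialMemory G K (Fin.elim0 : Fin 0 → Finset (Fin n))

/-- The input that consists of `G`, `K` and a path decomposition of `G`. -/
noncomputable def inputMemoryWith {n : ℕ} (G : WeightedGraph (Fin n)) (K : Finset (Fin n))
    (D : PathDecomposition G.graph) : Memory :=
  initialMemory G K D.bag

open Classical in
/-- The memory `s` holds the weighted graph `M` on the terminals as output: its adjacency matrix in
integer array `4`, its edge weights in real array `1`. -/
def Outputs {n : ℕ} {K : Finset (Fin n)} (s : Memory) (M : WeightedGraph K) : Prop :=
  (∀ t t' : K, s.nat 4 ((t : Fin n) * n + (t' : Fin n)) = if M.graph.Adj t t' then 1 else 0) ∧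
  (∀ t t' : K, M.graph.Adj t t' →
    s.real 1 ((t : Fin n) * n + (t' : Fin n)) = (M.weight s(t, t') : ℝ))

/-- Started in memory `s`, the program `P` halts within `T` steps and has then output a solution
with distortion `α` of the Steiner point removal problem for `G` and `K`. -/
def SolvesSPRWithin {n : ℕ} (P : Program) (s : Memory) (T : ℕ) (G : WeightedGraph (Fin n))
    (K : Finset (Fin n)) (α : ℝ≥0) : Prop :=
  ∃ t ≤ T, ∃ s' : Memory, Runs P s t s' ∧
    ∃ M : WeightedGraph K, Outputs s' M ∧ IsSPRSolution G K M α

/-! A solution is obtained from a map F from the vertices to the terminals that fixes the terminals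
and has connected fibers: contract the fibers and give an edge tt' the length d_G(t,t'). Then d_G ≤
d_M holds automatically (`isSPRSolution_contraction`), and the task is to choose F so that a short
walk of G passes through few fibers.

Scattering partitions. Fix a scale L ≥ 0. In every component C of what is left of a vertex set H,
take a shortest path, choose centers on it that are more than L apart in C, delete all that lies
within L of a center in C, and repeat; the level of a vertex is the round of its deletion. A vertex
v joins the center c that minimizes 2L·lev(c) plus the distance from c to v among the vertices of
level at least lev(c), ties going to the earlier center. With k levels the clusters are connected
and have radius at most 2kL (`Clustering.near_center`). A walk of length at most L meets at most τ =
k(4k+2) clusters (`Clustering.scattering`): the lowest level j on the walk offers a center so cheap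
that no vertex of the walk joins a center above level j. On each level i ≤ j, the centers in
question lie in one component, hence on one shortest path, where separated points that are mutually
close are few (`net_packing`).

Pathwidth bounds the number of levels. A path from a vertex in the first bag that meets C to one in
the last such bag meets all bags in between, so that each bag meeting C loses a vertex in each level
(`BagBound.step`). Hence k ≤ width + 1.

Stages. Let D be the distance to the terminals. At the start only terminals are assigned. A stage
raises the scale L, if necessary, to the least D of an unassigned vertex, partitions the unassigned
vertices at scale L, and hangs each cluster that contains a vertex with D ≤ L, as a whole, on
something assigned, in rounds. By scattering, τ rounds suffice, and each adds at most κL with κ =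
4k+1 to the distance from a vertex to its terminal (`attachB_spec`). The next scale is at least 2κL.
Thus a vertex assigned in a stage has D of the order of that scale up to factors of κ, and it lies
within O(τκ²)·D of its terminal, inside its fiber (`StageInv.step`).

Distortion (`Stages.hop`). From a vertex u with d = D u > 0, follow the walk for a length of d/(4κ).
There D changes by at most a factor 5/4, so the vertices met belong to at most two consecutive
stages, and scattering bounds the number of fibers by O(τ) for each stretch of one stage; jumping to
the last visit of a fiber gives O(τ²) hops of cost O(τκ²d) each. This is charged to the length
d/(4κ), which gives the factor O(τ³κ³) = O(k⁹) (`distortion_le`).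

Algorithms. Each stage assigns a vertex and each level deletes one, so n rounds of every loop
suffice whatever the weights are. All loops of a `Block` are bounded by fixed cells, which makes the
time polynomial in these cells (`Block.runs`). With a path decomposition at hand, the end vertices
of the paths are read off the bags. Without one, k = 1, 2, … levels are tried. The end vertices then
come from a search tree of depth k in which all pairs of vertices are tried, and which has about
n^(2k) nodes. `Forest.good_iff` evaluates it from the leaves upwards. The search ends as soon as the
number of levels observed is at most k, and this happens for k = pathwidth + 1 at the latest,
because the choice by bags shows that a good choice exists (`BagBound.good`). -/

/-! ### Programs with bounded loops -/

/-- Programs all of whose loops are bounded: `loop x b p` runs `p` with the cell `0` of the integer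
array `x` equal to `0, 1, …`, up to the value of cell `b` of integer array `0`. -/
inductive Block where
  | skip
  | setNat (a : ℕ) (i e : NatExpr)
  | setReal (a : ℕ) (i : NatExpr) (e : RealExpr)
  | seq (p q : Block)
  | ite (b : Test) (p q : Block)
  | loop (x b : ℕ) (p : Block)

namespace Block

/-- The program that a block stands for. -/
def compile : Block → Program
  | skip => .skip
  | setNat a i e => .setNat a i e
  | setReal a i e => .setReal a i e
  | seq p q => .seq p.compile q.compile
  | ite b p q => .branch b p.compile q.compile
  | loop x b p => .seq (.setNat x (.lit 0) (.lit 0))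
      (.loop (.not (.natLe (.read 0 (.lit b)) (.read x (.lit 0))))
        (.seq p.compile (.setNat x (.lit 0) (.add (.read x (.lit 0)) (.lit 1)))))

open Classical in
/-- The memory after a block has run. -/
noncomputable def run : Block → Memory → Memory
  | skip, s => s
  | setNat a i e, s => s.writeNat a (i.eval s) (e.eval s)
  | setReal a i e, s => s.writeReal a (i.eval s) (e.eval s)
  | seq p q, s => q.run (p.run s)
  | ite b p q, s => if b.Holds s then p.run s else q.run s
  | loop x b p, s =>
      Nat.rec (s.writeNat x 0 0) (fun k r => (p.run r).writeNat x 0 (k + 1)) (s.nat 0 b)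

/-- The integer arrays that a block may write. -/
def natW : Block → List ℕ
  | skip => []
  | setNat a _ _ => [a]
  | setReal _ _ _ => []
  | seq p q => p.natW ++ q.natW
  | ite _ p q => p.natW ++ q.natW
  | loop x _ p => x :: p.natW

/-- The real arrays that a block may write. -/
def realW : Block → List ℕ
  | skip => []
  | setNat _ _ _ => []
  | setReal a _ _ => [a]
  | seq p q => p.realW ++ q.realW
  | ite _ p q => p.realW ++ q.realW
  | loop _ _ p => p.realW

/-- Loop counters and loop bounds are not written by loop bodies. -/
def Ok : Block → Bool
  | skip => true
  | setNat a _ _ => a != 0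
  | setReal _ _ _ => true
  | seq p q => p.Ok && q.Ok
  | ite _ p q => p.Ok && q.Ok
  | loop x _ p => x != 0 && !(p.natW.contains x) && p.Ok

/-- A bound for the running time in terms of the largest loop bound. -/
noncomputable def time : Block → Polynomial ℕ
  | skip => 1
  | setNat _ i e => Polynomial.C (i.cost + e.cost + 1)
  | setReal _ i e => Polynomial.C (i.cost + e.cost + 1)
  | seq p q => p.time + q.time
  | ite b p q => Polynomial.C b.cost + (p.time + q.time)
  | loop _ _ p => Polynomial.C 20 + Polynomial.X * (p.time + Polynomial.C 20)

/-- The arrays that `p` does not write agree in `s` and `r`. -/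
def Same (p : Block) (s r : Memory) : Prop :=
  (∀ a, a ∉ p.natW → r.nat a = s.nat a) ∧ ∀ a, a ∉ p.realW → r.real a = s.real a

end Block

@[simp] theorem Memory.nat_writeNat (s : Memory) (a k x b : ℕ) :
    (s.writeNat a k x).nat b = if b = a then Function.update (s.nat b) k x else s.nat b := by
  unfold Memory.writeNat
  by_cases h : b = a
  · subst h; simp
  · simp [h]

@[simp] theorem Memory.real_writeNat (s : Memory) (a k x : ℕ) :
    (s.writeNat a k x).real = s.real := rfl

@[simp] theorem Memory.nat_writeReal (s : Memory) (a k : ℕ) (x : ℝ) :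
    (s.writeReal a k x).nat = s.nat := rfl

@[simp] theorem Memory.real_writeReal (s : Memory) (a k : ℕ) (x : ℝ) (b : ℕ) :
    (s.writeReal a k x).real b = if b = a then Function.update (s.real b) k x else s.real b := by
  unfold Memory.writeReal
  by_cases h : b = a
  · subst h; simp
  · simp [h]

attribute [simp] NatExpr.eval RealExpr.eval Test.Holds

/-! ### Semantics of blocks: what a run leaves unchanged, and induction along loops. -/

namespace Block

theorem run_skip (s : Memory) : skip.run s = s := rfl

theorem run_setNat (a : ℕ) (i e : NatExpr) (s : Memory) :
    (setNat a i e).run s = s.writeNat a (i.eval s) (e.eval s) := rfl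

theorem run_setReal (a : ℕ) (i : NatExpr) (e : RealExpr) (s : Memory) :
    (setReal a i e).run s = s.writeReal a (i.eval s) (e.eval s) := rfl

theorem run_seq (p q : Block) (s : Memory) : (seq p q).run s = q.run (p.run s) := rfl

theorem run_ite_pos {t : Test} {s : Memory} (h : t.Holds s) (p q : Block) :
    (ite t p q).run s = p.run s := if_pos h

theorem run_ite_neg {t : Test} {s : Memory} (h : ¬ t.Holds s) (p q : Block) :
    (ite t p q).run s = q.run s := if_neg h

/-- The bound is read once, in the initial memory, and the counter is rewritten after every round;
hence the invariant is demanded of the memory after that write. -/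
theorem loop_induction {x b : ℕ} {p : Block} {s : Memory} (I : ℕ → Memory → Prop)
    (h0 : I 0 (s.writeNat x 0 0))
    (hstep : ∀ k r, k < s.nat 0 b → r.nat x 0 = k → I k r →
      I (k + 1) ((p.run r).writeNat x 0 (k + 1))) :
    I (s.nat 0 b) ((loop x b p).run s) := by
  have key : ∀ k, k ≤ s.nat 0 b →
      (Nat.rec (s.writeNat x 0 0) (fun k r => (p.run r).writeNat x 0 (k + 1)) k : Memory).nat x 0
        = k ∧
      I k (Nat.rec (s.writeNat x 0 0) (fun k r => (p.run r).writeNat x 0 (k + 1)) k : Memory) := by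
    intro k
    induction k with
    | zero => intro _; exact ⟨by simp, h0⟩
    | succ k ih =>
      intro hk
      obtain ⟨h1, h2⟩ := ih (by omega)
      exact ⟨by simp, hstep k _ (by omega) h1 h2⟩
  exact (key _ le_rfl).2

/-- The frame rule: only arrays that occur as targets of writes can change. Since arrays are named
by numerals, later specifications settle what is untouched by `decide`. -/
theorem same_run (p : Block) : ∀ s, Same p s (p.run s) := by
  induction p with
  | skip => intro s; exact ⟨fun _ _ => rfl, fun _ _ => rfl⟩
  | setNat a i e =>
    intro s
    refine ⟨fun b hb => ?_, fun b hb => rfl⟩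
    simp only [natW, List.mem_singleton] at hb
    simp [run, hb]
  | setReal a i e =>
    intro s
    refine ⟨fun b hb => rfl, fun b hb => ?_⟩
    simp only [realW, List.mem_singleton] at hb
    simp [run, hb]
  | seq p q ihp ihq =>
    intro s
    refine ⟨fun b hb => ?_, fun b hb => ?_⟩
    · simp only [natW, List.mem_append, not_or] at hb
      exact ((ihq _).1 b hb.2).trans ((ihp _).1 b hb.1)
    · simp only [realW, List.mem_append, not_or] at hb
      exact ((ihq _).2 b hb.2).trans ((ihp _).2 b hb.1)
  | ite t p q ihp ihq =>
    intro s
    refine ⟨fun b hb => ?_, fun b hb => ?_⟩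
    · simp only [natW, List.mem_append, not_or] at hb
      unfold run; split
      · exact (ihp _).1 b hb.1
      · exact (ihq _).1 b hb.2
    · simp only [realW, List.mem_append, not_or] at hb
      unfold run; split
      · exact (ihp _).2 b hb.1
      · exact (ihq _).2 b hb.2
  | loop x c p ih =>
    intro s
    refine loop_induction (I := fun _ r => Same (loop x c p) s r) ?_ ?_
    · refine ⟨fun a ha => ?_, fun _ _ => rfl⟩
      simp only [natW, List.mem_cons, not_or] at ha
      simp [ha.1]
    · intro k r _ _ hr
      refine ⟨fun a ha => ?_, fun a ha => ?_⟩
      · have ha' := ha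
        simp only [natW, List.mem_cons, not_or] at ha
        simp only [Memory.nat_writeNat, ha.1, if_false]
        rw [(ih r).1 a ha.2, hr.1 a ha']
      · rw [Memory.real_writeNat, (ih r).2 a ha, hr.2 a ha]

theorem run_nat {p : Block} {a : ℕ} (h : a ∉ p.natW) (s : Memory) :
    (p.run s).nat a = s.nat a := (same_run p s).1 a h

theorem run_real {p : Block} {a : ℕ} (h : a ∉ p.realW) (s : Memory) :
    (p.run s).real a = s.real a := (same_run p s).2 a h

/-- Induction along a loop, for statements that do not depend on the loop counter. -/
theorem loop_rule {x b : ℕ} {p : Block} {s : Memory} {N : ℕ} (hN : s.nat 0 b = N)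
    (I : ℕ → Memory → Prop)
    (hx : ∀ k r j, I k r → I k (r.writeNat x 0 j)) (h0 : I 0 s)
    (hstep : ∀ k r, k < N → r.nat x 0 = k → Same (loop x b p) s r → I k r →
      I (k + 1) (p.run r)) :
    I N ((loop x b p).run s) := by
  subst hN
  have := loop_induction (x := x) (b := b) (p := p) (s := s)
    (fun k r => Same (loop x b p) s r ∧ I k r) ?_ ?_
  · exact this.2
  · refine ⟨⟨fun a ha => ?_, fun _ _ => rfl⟩, hx _ _ _ h0⟩
    simp only [natW, List.mem_cons, not_or] at ha
    simp [ha.1]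
  · intro k r hk hrx ⟨hs, hI⟩
    refine ⟨⟨fun a ha => ?_, fun a ha => ?_⟩, hx _ _ _ (hstep k r hk hrx hs hI)⟩
    · have ha' := ha
      simp only [natW, List.mem_cons, not_or] at ha
      simp only [Memory.nat_writeNat, ha.1, if_false]
      rw [run_nat ha.2, hs.1 a ha']
    · rw [Memory.real_writeNat, run_real (p := p) (by simpa only [realW] using ha), hs.2 a ha]

/-- A loop whose `k`-th round changes, among the cells of the array `A`, the `k`-th one only. -/
theorem loop_pointwise {x b : ℕ} {p : Block} {s : Memory} {N : ℕ} (hN : s.nat 0 b = N)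
    (A : ℕ) (hA : A ≠ x) (g : ℕ → ℕ)
    (hstep : ∀ k r, k < N → r.nat x 0 = k → Same (loop x b p) s r → r.nat A k = s.nat A k →
      (p.run r).nat A = Function.update (r.nat A) k (g k)) :
    ∀ k, ((loop x b p).run s).nat A k = if k < N then g k else s.nat A k := by
  refine loop_rule hN (fun j r => ∀ k, r.nat A k = if k < j then g k else s.nat A k) ?_ ?_ ?_
  · intro k r j h i; simpa [hA] using h i
  · intro k; simp
  · intro j r hj hx hs h k
    rw [hstep j r hj hx hs (by simpa using h j)]
    by_cases hk : k = j
    · subst hk; simp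
    · rw [Function.update_of_ne hk, h k]
      by_cases h1 : k < j
      · simp [h1, Nat.lt_succ_of_lt h1]
      · have : ¬ k < j + 1 := by omega
        simp [h1, this]

/-- Blocks halt, in time polynomial in the loop bounds. -/
theorem runs (p : Block) (hp : p.Ok = true) : ∀ (s : Memory) (N : ℕ), (∀ b, s.nat 0 b ≤ N) →
    ∃ t ≤ p.time.eval N, Runs p.compile s t (p.run s) := by
  -- Array `0` contains the loop bounds. As no block writes it, the bound N stays valid in every
  -- memory that occurs during the run.
  have zero_notin : ∀ p : Block, p.Ok = true → 0 ∉ p.natW := by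
    intro p
    induction p with
    | skip => simp [natW]
    | setNat a i e => simp [natW, Ok]; omega
    | setReal a i e => simp [natW]
    | seq p q ihp ihq => simp only [natW, Ok, Bool.and_eq_true, List.mem_append]; tauto
    | ite t p q ihp ihq => simp only [natW, Ok, Bool.and_eq_true, List.mem_append]; tauto
    | loop x c p ih =>
      simp only [natW, Ok, Bool.and_eq_true, List.mem_cons]
      rintro ⟨⟨h1, _⟩, h2⟩ (h | h)
      · simp [← h] at h1
      · exact ih h2 h
  induction p with
  | skip => intro s N _; exact ⟨1, by simp [time], .skip s⟩
  | setNat a i e => intro s N _; exact ⟨_, by simp [time], .setNat a i e s⟩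
  | setReal a i e => intro s N _; exact ⟨_, by simp [time], .setReal a i e s⟩
  | seq p q ihp ihq =>
    intro s N hN
    simp only [Ok, Bool.and_eq_true] at hp
    obtain ⟨t1, h1, r1⟩ := ihp hp.1 s N hN
    obtain ⟨t2, h2, r2⟩ := ihq hp.2 (p.run s) N (by rw [run_nat (zero_notin p hp.1)]; exact hN)
    exact ⟨t1 + t2, by simp only [time, Polynomial.eval_add]; omega, .seq r1 r2⟩
  | ite t p q ihp ihq =>
    intro s N hN
    simp only [Ok, Bool.and_eq_true] at hp
    by_cases hb : t.Holds s
    · obtain ⟨t1, h1, r1⟩ := ihp hp.1 s N hN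
      refine ⟨t.cost + t1, by simp only [time, Polynomial.eval_add, Polynomial.eval_C]; omega, ?_⟩
      simp only [run, hb, if_true]
      exact .branchTrue hb r1
    · obtain ⟨t1, h1, r1⟩ := ihq hp.2 s N hN
      refine ⟨t.cost + t1, by simp only [time, Polynomial.eval_add, Polynomial.eval_C]; omega, ?_⟩
      simp only [run, hb, if_false]
      exact .branchFalse hb r1
  | loop x c p ih =>
    intro s N hN
    simp only [Ok, Bool.and_eq_true, Bool.not_eq_true', bne_iff_ne, ne_eq] at hp
    obtain ⟨⟨hx0, hxp⟩, hp⟩ := hp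
    have hxp' : x ∉ p.natW := by simpa using hxp
    have h0p := zero_notin p hp
    set st : ℕ → Memory := fun k =>
      Nat.rec (s.writeNat x 0 0) (fun k r => (p.run r).writeNat x 0 (k + 1)) k with hst
    have st_succ : ∀ k, st (k + 1) = (p.run (st k)).writeNat x 0 (k + 1) := fun _ => rfl
    have hx : ∀ k, (st k).nat x 0 = k := by
      intro k; cases k <;> simp [hst]
    have hz : ∀ k, (st k).nat 0 = s.nat 0 := by
      intro k
      induction k with
      | zero => simp [hst, Ne.symm hx0]
      | succ k ihk => rw [st_succ]; simp only [Memory.nat_writeNat, Ne.symm hx0, if_false]; rw [run_nat h0p, ihk]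
    -- Induction on the number d of rounds that are left. The test and the increment take 6 steps
    -- each, which the slack of 20 per round absorbs; the last, failing test is paid by the 10.
    have hloop : ∀ d k, k + d = s.nat 0 c → ∃ t ≤ d * (p.time.eval N + 20) + 10,
        Runs (.loop (.not (.natLe (.read 0 (.lit c)) (.read x (.lit 0))))
          (.seq p.compile (.setNat x (.lit 0) (.add (.read x (.lit 0)) (.lit 1)))))
          (st k) t (st (s.nat 0 c)) := by
      intro d
      induction d with
      | zero =>
        intro k hk
        have : k = s.nat 0 c := by omega
        subst this
        refine ⟨_, ?_, .loopDone ?_⟩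
        · simp [Test.cost, NatExpr.cost]
        · simp [hz, hx]
      | succ d ihd =>
        intro k hk
        obtain ⟨t1, h1, r1⟩ := ih hp (st k) N (by rw [hz]; exact hN)
        obtain ⟨t2, h2, r2⟩ := ihd (k + 1) (by omega)
        have r3 := Runs.setNat x (.lit 0) (.add (.read x (.lit 0)) (.lit 1)) (p.run (st k))
        have e : (p.run (st k)).writeNat x (NatExpr.eval (p.run (st k)) (.lit 0))
            (NatExpr.eval (p.run (st k)) (.add (.read x (.lit 0)) (.lit 1))) = st (k + 1) := by
          rw [st_succ]; simp [run_nat hxp', hx]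
        rw [e] at r3
        refine ⟨_, ?_, .loopStep ?_ (.seq r1 r3) r2⟩
        · simp only [Test.cost, NatExpr.cost]
          have : (d + 1) * (p.time.eval N + 20) = d * (p.time.eval N + 20) + (p.time.eval N + 20) := by
            ring
          omega
        · simp [hz, hx]; omega
    obtain ⟨t, h, r⟩ := hloop (s.nat 0 c) 0 (by omega)
    refine ⟨_, ?_, .seq (.setNat x (.lit 0) (.lit 0) s) r⟩
    simp only [time, Polynomial.eval_add, Polynomial.eval_mul, Polynomial.eval_C, Polynomial.eval_X,
      NatExpr.cost]
    have := Nat.mul_le_mul_right (p.time.eval N + 20) (hN c)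
    omega

end Block

/-! ### Walks inside vertex sets -/

namespace WeightedGraph

variable {V : Type*} (G : WeightedGraph V)

/-- The length of the pair `u v`, as a real number. -/
def len (u v : V) : ℝ := (G.weight s(u, v) : ℝ)

theorem len_nonneg (u v : V) : 0 ≤ G.len u v := NNReal.coe_nonneg _

theorem len_comm (u v : V) : G.len u v = G.len v u := by unfold len; rw [Sym2.eq_swap]

/-- There is a walk of length `l` from `u` to `v` inside `S`. -/
def WalkIn (S : Set V) (u v : V) (l : ℝ) : Prop :=
  ∃ p : G.graph.Walk u v, (∀ x ∈ p.support, x ∈ S) ∧ (G.walkLength p : ℝ) = l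

/-- There is a walk of length at most `r` from `u` to `v` inside `S`. -/
def Near (S : Set V) (r : ℝ) (u v : V) : Prop := ∃ l ≤ r, G.WalkIn S u v l

/-- `d` is the distance of `u` and `v` inside `S`. -/
def IsDist (S : Set V) (u v : V) (d : ℝ) : Prop :=
  G.WalkIn S u v d ∧ ∀ l, G.WalkIn S u v l → d ≤ l

/-- The connected component of `z` inside `S`. -/
def comp (S : Set V) (z : V) : Set V := {v | ∃ l, G.WalkIn S z v l}

variable {G}

@[simp] theorem walkLength_nil (u : V) : G.walkLength (.nil : G.graph.Walk u u) = 0 := by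
  simp [walkLength]

theorem walkLength_cons {u v x : V} (h : G.graph.Adj u v) (p : G.graph.Walk v x) :
    G.walkLength (.cons h p) = G.weight s(u, v) + G.walkLength p := by
  simp [walkLength]

theorem walkLength_append {u v x : V} (p : G.graph.Walk u v) (q : G.graph.Walk v x) :
    G.walkLength (p.append q) = G.walkLength p + G.walkLength q := by
  simp [walkLength, SimpleGraph.Walk.edges_append]

theorem walkLength_reverse {u v : V} (p : G.graph.Walk u v) :
    G.walkLength p.reverse = G.walkLength p := by
  simp [walkLength, SimpleGraph.Walk.edges_reverse, List.map_reverse, List.sum_reverse]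

theorem WalkIn.refl {S : Set V} {u : V} (h : u ∈ S) : G.WalkIn S u u 0 :=
  ⟨.nil, by simpa using h, by simp⟩

theorem WalkIn.trans {S : Set V} {u v x : V} {l l' : ℝ} (h : G.WalkIn S u v l)
    (h' : G.WalkIn S v x l') : G.WalkIn S u x (l + l') := by
  obtain ⟨p, hp, rfl⟩ := h
  obtain ⟨q, hq, rfl⟩ := h'
  refine ⟨p.append q, fun y hy => ?_, by rw [walkLength_append]; push_cast; ring⟩
  rw [SimpleGraph.Walk.mem_support_append_iff] at hy
  exact hy.elim (hp y) (hq y)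

theorem WalkIn.symm {S : Set V} {u v : V} {l : ℝ} (h : G.WalkIn S u v l) : G.WalkIn S v u l := by
  obtain ⟨p, hp, rfl⟩ := h
  exact ⟨p.reverse, by simpa using hp, by rw [walkLength_reverse]⟩

theorem WalkIn.mono {S T : Set V} (hST : S ⊆ T) {u v : V} {l : ℝ} (h : G.WalkIn S u v l) :
    G.WalkIn T u v l := by
  obtain ⟨p, hp, rfl⟩ := h
  exact ⟨p, fun x hx => hST (hp x hx), rfl⟩

theorem WalkIn.left_mem {S : Set V} {u v : V} {l : ℝ} (h : G.WalkIn S u v l) : u ∈ S := by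
  obtain ⟨p, hp, rfl⟩ := h
  exact hp _ p.start_mem_support

theorem WalkIn.right_mem {S : Set V} {u v : V} {l : ℝ} (h : G.WalkIn S u v l) : v ∈ S := by
  obtain ⟨p, hp, rfl⟩ := h
  exact hp _ p.end_mem_support

theorem WalkIn.nonneg {S : Set V} {u v : V} {l : ℝ} (h : G.WalkIn S u v l) : 0 ≤ l := by
  obtain ⟨p, hp, rfl⟩ := h
  exact NNReal.coe_nonneg _

theorem WalkIn.edge {S : Set V} {u v : V} (h : G.graph.Adj u v) (hu : u ∈ S) (hv : v ∈ S) :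
    G.WalkIn S u v (G.len u v) :=
  ⟨.cons h .nil, by simp [hu, hv], by simp [walkLength_cons, len]⟩

theorem WalkIn.concat {S : Set V} {u v x : V} {l : ℝ} (h : G.WalkIn S u v l)
    (hvx : G.graph.Adj v x) (hx : x ∈ S) : G.WalkIn S u x (l + G.len v x) :=
  h.trans (.edge hvx h.right_mem hx)

/-- Induction along a walk, from its first vertex on. -/
theorem WalkIn.induction_left {S : Set V} {v : V} {P : V → ℝ → Prop} (h0 : v ∈ S → P v 0)
    (hs : ∀ u x l, u ∈ S → G.graph.Adj u x → G.WalkIn S x v l → P x l → P u (G.len u x + l)) :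
    ∀ {u l}, G.WalkIn S u v l → P u l := by
  rintro u l ⟨p, hp, rfl⟩
  induction p with
  | nil => simpa using h0 (hp _ (by simp))
  | cons h p ih =>
    rw [walkLength_cons]
    push_cast
    exact hs _ _ _ (hp _ (by simp)) h ⟨p, fun y hy => hp y (by simp [hy]), rfl⟩
      (ih h0 hs fun y hy => hp y (by simp [hy]))

/-- The vertex set of a walk is connected by shorter walks. -/
theorem WalkIn.split {S : Set V} {u v : V} (p : G.graph.Walk u v) (hp : ∀ x ∈ p.support, x ∈ S)
    {x : V} (hx : x ∈ p.support) :
    ∃ l l' : ℝ, l + l' = G.walkLength p ∧ G.WalkIn S u x l ∧ G.WalkIn S x v l' := by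
  classical
  refine ⟨_, _, ?_, ⟨p.takeUntil x hx, fun y hy => hp y (p.support_takeUntil_subset_support hx hy), rfl⟩,
    ⟨p.dropUntil x hx, fun y hy => hp y (p.support_dropUntil_subset_support hx hy), rfl⟩⟩
  rw [← NNReal.coe_add, ← walkLength_append, SimpleGraph.Walk.take_spec]

theorem Near.refl {S : Set V} {u : V} {r : ℝ} (hr : 0 ≤ r) (h : u ∈ S) : G.Near S r u u :=
  ⟨0, hr, .refl h⟩

theorem Near.trans {S : Set V} {u v x : V} {r r' : ℝ} (h : G.Near S r u v)
    (h' : G.Near S r' v x) : G.Near S (r + r') u x := by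
  obtain ⟨l, hl, h⟩ := h
  obtain ⟨l', hl', h'⟩ := h'
  exact ⟨l + l', add_le_add hl hl', h.trans h'⟩

theorem Near.symm {S : Set V} {u v : V} {r : ℝ} (h : G.Near S r u v) : G.Near S r v u := by
  obtain ⟨l, hl, h⟩ := h
  exact ⟨l, hl, h.symm⟩

theorem Near.mono {S T : Set V} (hST : S ⊆ T) {r r' : ℝ} (hr : r ≤ r') {u v : V}
    (h : G.Near S r u v) : G.Near T r' u v := by
  obtain ⟨l, hl, h⟩ := h
  exact ⟨l, hl.trans hr, h.mono hST⟩

theorem Near.nonneg {S : Set V} {u v : V} {r : ℝ} (h : G.Near S r u v) : 0 ≤ r := by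
  obtain ⟨l, hl, h⟩ := h
  exact h.nonneg.trans hl

theorem WalkIn.near {S : Set V} {u v : V} {l : ℝ} (h : G.WalkIn S u v l) : G.Near S l u v :=
  ⟨l, le_rfl, h⟩

theorem near_iff_of_isDist {S : Set V} {u v : V} {d r : ℝ} (h : G.IsDist S u v d) :
    G.Near S r u v ↔ d ≤ r :=
  ⟨fun ⟨l, hl, hw⟩ => (h.2 l hw).trans hl, fun hr => ⟨d, hr, h.1⟩⟩

theorem IsDist.unique {S : Set V} {u v : V} {d d' : ℝ} (h : G.IsDist S u v d)
    (h' : G.IsDist S u v d') : d = d' := le_antisymm (h.2 _ h'.1) (h'.2 _ h.1)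

/-- Any two vertices of a walk are joined by a piece of it. -/
theorem WalkIn.between {S : Set V} {u v : V} (p : G.graph.Walk u v) (hp : ∀ x ∈ p.support, x ∈ S)
    {x y : V} (hx : x ∈ p.support) (hy : y ∈ p.support) :
    ∃ l : ℝ, l ≤ G.walkLength p ∧ G.WalkIn S x y l := by
  classical
  have h := p.take_spec hx
  rw [← h, SimpleGraph.Walk.mem_support_append_iff] at hy
  have e : (G.walkLength p : ℝ) = G.walkLength (p.takeUntil x hx) + G.walkLength (p.dropUntil x hx) := by
    rw [← NNReal.coe_add, ← walkLength_append, h]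
  rcases hy with hy | hy
  · obtain ⟨l, l', e', h1, h2⟩ := WalkIn.split (S := S) (p.takeUntil x hx)
      (fun y hy => hp y (p.support_takeUntil_subset_support hx hy)) hy
    have := (NNReal.coe_nonneg (G.walkLength (p.dropUntil x hx)))
    have := h1.nonneg
    exact ⟨l', by linarith, h2.symm⟩
  · obtain ⟨l, l', e', h1, h2⟩ := WalkIn.split (S := S) (p.dropUntil x hx)
      (fun y hy => hp y (p.support_dropUntil_subset_support hx hy)) hy
    have := (NNReal.coe_nonneg (G.walkLength (p.takeUntil x hx)))
    have := h2.nonneg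
    exact ⟨l, by linarith, h1⟩

/-- Two vertices of a shortest walk are as far apart as their distances from its start differ. -/
theorem near_of_mem_geodesic {S : Set V} {u v : V} (p : G.graph.Walk u v)
    (hp : ∀ x ∈ p.support, x ∈ S) (hmin : ∀ l, G.WalkIn S u v l → (G.walkLength p : ℝ) ≤ l)
    {x y : V} (hx : x ∈ p.support) (hy : y ∈ p.support) {a b : ℝ} (ha : G.IsDist S u x a)
    (hb : G.IsDist S u y b) : G.Near S |a - b| x y := by
  classical
  -- An initial piece of a shortest walk is itself shortest, so its length is the distance of its
  -- end from u.
  have pos : ∀ {z l l' c}, G.IsDist S u z c → l + l' = (G.walkLength p : ℝ) → G.WalkIn S u z l →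
      G.WalkIn S z v l' → l = c := by
    intro z l l' c hc e h1 h2
    have := hmin _ (hc.1.trans h2)
    have := hc.2 _ h1
    linarith
  have h := p.take_spec hx
  rw [← h, SimpleGraph.Walk.mem_support_append_iff] at hy
  have e : (G.walkLength p : ℝ) = G.walkLength (p.takeUntil x hx) + G.walkLength (p.dropUntil x hx) := by
    rw [← NNReal.coe_add, ← walkLength_append, h]
  have w1 : G.WalkIn S u x (G.walkLength (p.takeUntil x hx)) :=
    ⟨_, fun y hy => hp y (p.support_takeUntil_subset_support hx hy), rfl⟩
  have w2 : G.WalkIn S x v (G.walkLength (p.dropUntil x hx)) :=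
    ⟨_, fun y hy => hp y (p.support_dropUntil_subset_support hx hy), rfl⟩
  have ea := pos ha e.symm w1 w2
  rcases hy with hy | hy
  · obtain ⟨l, l', e', h1, h2⟩ := WalkIn.split (S := S) (p.takeUntil x hx)
      (fun y hy => hp y (p.support_takeUntil_subset_support hx hy)) hy
    have eb := pos hb (by rw [← e'] at e; linarith) h1 (h2.trans w2)
    exact ⟨l', (by rw [le_abs]; left; linarith), h2.symm⟩
  · obtain ⟨l, l', e', h1, h2⟩ := WalkIn.split (S := S) (p.dropUntil x hx)
      (fun y hy => hp y (p.support_dropUntil_subset_support hx hy)) hy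
    have eb := pos hb (by rw [← e'] at e; linarith) (w1.trans h1) h2
    exact ⟨l, (by rw [le_abs]; right; linarith), h1⟩

theorem mem_comp_self {S : Set V} {z : V} (h : z ∈ S) : z ∈ G.comp S z := ⟨0, .refl h⟩

theorem comp_subset (S : Set V) (z : V) : G.comp S z ⊆ S := fun _ ⟨_, h⟩ => h.right_mem

theorem comp_adj {S : Set V} {z u v : V} (hu : u ∈ G.comp S z) (h : G.graph.Adj u v)
    (hv : v ∈ S) : v ∈ G.comp S z := by
  obtain ⟨l, hl⟩ := hu
  exact ⟨_, hl.concat h hv⟩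

/-- Walks do not leave a set that is closed under adjacency inside `S`. -/
theorem WalkIn.of_closed {S C : Set V} (hC : ∀ u v, u ∈ C → G.graph.Adj u v → v ∈ S → v ∈ C)
    {u v : V} {l : ℝ} (h : G.WalkIn S u v l) (hu : u ∈ C) : G.WalkIn C u v l := by
  revert hu
  refine WalkIn.induction_left (P := fun u l => u ∈ C → G.WalkIn C u v l) (fun _ hv => .refl hv) ?_ h
  intro u x l _ ha hw ih hu
  have hx := hC u x hu ha hw.left_mem
  exact (WalkIn.edge ha hu hx).trans (ih hx)

theorem WalkIn.in_comp {S : Set V} {z u v : V} {l : ℝ} (h : G.WalkIn S u v l)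
    (hu : u ∈ G.comp S z) : G.WalkIn (G.comp S z) u v l :=
  h.of_closed (fun _ _ h1 h2 h3 => comp_adj h1 h2 h3) hu

theorem comp_eq_of_mem {S : Set V} {z u : V} (hu : u ∈ G.comp S z) : G.comp S u = G.comp S z := by
  obtain ⟨l, hl⟩ := hu
  ext v
  exact ⟨fun ⟨l', h⟩ => ⟨_, hl.trans h⟩, fun ⟨l', h⟩ => ⟨_, hl.symm.trans h⟩⟩

theorem comp_comp {S : Set V} {z u : V} (hu : u ∈ G.comp S z) :
    G.comp (G.comp S z) u = G.comp S z := by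
  ext v
  constructor
  · exact fun ⟨l, h⟩ => h.right_mem
  · intro hv
    rw [← comp_eq_of_mem hu] at hv
    obtain ⟨l, h⟩ := hv
    exact ⟨l, h.in_comp hu⟩

/-- Every walk in a finite graph can be shortened to one with fewer edges than vertices. -/
theorem exists_short_walk [Fintype V] {S : Set V} {u v : V} (p : G.graph.Walk u v)
    (hp : ∀ x ∈ p.support, x ∈ S) :
    ∃ q : G.graph.Walk u v, (∀ x ∈ q.support, x ∈ S) ∧ q.length < Fintype.card V ∧
      G.walkLength q ≤ G.walkLength p := by
  classical
  refine ⟨p.bypass, fun x hx => hp x (p.support_bypass_subset_support hx), p.bypass_isPath.length_lt, ?_⟩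
  -- The edges of the bypass are distinct and occur in p, so they form a sub-multiset; as weights
  -- are nonnegative, dropping the other edges does not increase the sum.
  have h : p.bypass.edges.Subperm p.edges :=
    List.subperm_of_subset p.bypass_isPath.isTrail.edges_nodup p.edges_bypass_subset_edges
  obtain ⟨l, hl, hs⟩ := h
  unfold walkLength
  rw [← (hl.map G.weight).sum_eq]
  exact (hs.map G.weight).sum_le_sum (by simp)

end WeightedGraph

/-! ### Distances inside a vertex set -/

/-- An integer variable is cell `0` of an array. -/
abbrev vr (a : ℕ) : NatExpr := .read a (.lit 0)

/-- A real variable is cell `0` of an array. -/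
abbrev rv (a : ℕ) : RealExpr := .read a (.lit 0)

/-- The position of `(i, j)` in a matrix with `n` columns; array `10` holds the multiples of `n`. -/
abbrev ix (i j : NatExpr) : NatExpr := .add (.read 10 i) j

abbrev pos (e : NatExpr) : Test := .natLe (.lit 1) e

/-- The vertex set that an integer array marks. -/
def supp {n : ℕ} (f : ℕ → ℕ) : Set (Fin n) := {v | 0 < f v}

theorem mem_supp {n : ℕ} {f : ℕ → ℕ} {v : Fin n} : v ∈ supp f ↔ 0 < f v := Iff.rfl

/-- The memory holds the graph `G`. -/
structure HoldsGraph {n : ℕ} (G : WeightedGraph (Fin n)) (s : Memory) : Prop where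
  size : s.nat 0 0 = n
  adj : ∀ u v : Fin n, 0 < s.nat 1 (u * n + v) ↔ G.graph.Adj u v
  len : ∀ u v : Fin n, G.graph.Adj u v → s.real 0 (u * n + v) = G.len u v
  mul : ∀ i, i < s.nat 0 0 ∨ i < s.nat 0 1 → s.nat 10 i = i * n

/-- The input arrays are not written. -/
def Block.KeepsInput (p : Block) : Bool :=
  [0, 1, 2, 3, 10].all (fun a => !p.natW.contains a) && !p.realW.contains 0

theorem Block.Same.input {p : Block} {s r : Memory} (h : Block.Same p s r)
    (hp : p.KeepsInput = true) : r.nat 0 = s.nat 0 ∧ r.nat 1 = s.nat 1 ∧ r.nat 2 = s.nat 2 ∧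
      r.nat 3 = s.nat 3 ∧ r.nat 10 = s.nat 10 ∧ r.real 0 = s.real 0 := by
  simp only [Block.KeepsInput, List.all_cons, List.all_nil, Bool.and_eq_true, Bool.not_eq_true',
    List.contains_eq_mem, decide_eq_false_iff_not] at hp
  obtain ⟨⟨h0, h1, h2, h3, h4, -⟩, h5⟩ := hp
  exact ⟨h.1 _ h0, h.1 _ h1, h.1 _ h2, h.1 _ h3, h.1 _ h4, h.2 _ h5⟩

theorem HoldsGraph.of_eq {n : ℕ} {G : WeightedGraph (Fin n)} {s r : Memory} (h : HoldsGraph G s)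
    (h0 : r.nat 0 = s.nat 0) (h1 : r.nat 1 = s.nat 1) (h2 : r.nat 10 = s.nat 10)
    (h3 : r.real 0 = s.real 0) : HoldsGraph G r := by
  obtain ⟨a, b, c, d⟩ := h
  exact ⟨by rw [h0, a], by rw [h1]; exact b, by rw [h3]; exact c, by rw [h0, h2]; exact d⟩

theorem HoldsGraph.same {n : ℕ} {G : WeightedGraph (Fin n)} {s r : Memory} {p : Block}
    (h : HoldsGraph G s) (hs : Block.Same p s r) (hp : p.KeepsInput = true) : HoldsGraph G r :=
  h.of_eq (hs.input hp).1 (hs.input hp).2.1 (hs.input hp).2.2.2.2.1 (hs.input hp).2.2.2.2.2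

/-! ### Bellman–Ford inside a vertex set. -/

namespace Block

/-- Relax the edge between the vertices that the counters `42` and `43` point to. -/
def relaxB (S : ℕ) : Block :=
  .ite (.and (.and (pos (.read 11 (vr 42))) (pos (.read S (vr 43))))
      (.and (pos (.read 1 (ix (vr 42) (vr 43))))
        (.not (.and (pos (.read 11 (vr 43)))
          (.realLe (.read 11 (vr 43)) (.add (.read 11 (vr 42)) (.read 0 (ix (vr 42) (vr 43)))))))))
    (.seq (.setNat 11 (vr 43) (.lit 1))
      (.setReal 11 (vr 43) (.add (.read 11 (vr 42)) (.read 0 (ix (vr 42) (vr 43))))))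
    .skip

/-- Bellman-Ford: distances from the vertex in variable `X` inside the set in array `S`. Array `11`
marks the vertices that are reached, real array `11` holds their distances. -/
def distB (S X : ℕ) : Block :=
  .seq (.loop 40 0 (.setNat 11 (vr 40) (.lit 0))) <|
  .seq (.setNat 11 (vr X) (.lit 1)) <|
  .seq (.setReal 11 (vr X) .zero) <|
  .loop 41 0 (.loop 42 0 (.loop 43 0 (relaxB S)))

variable {n : ℕ} {G : WeightedGraph (Fin n)}

/-- Soundness, monotonicity and progress are kept apart because distances are updated in place: an
entry may have improved several times within a round, and only these three properties survive that.
-/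
theorem relaxB_spec {S : ℕ} {s : Memory} (hG : HoldsGraph G s)
    {x u v : Fin n} (hu : s.nat 42 0 = u) (hv : s.nat 43 0 = v)
    (hsound : ∀ y : Fin n, 0 < s.nat 11 y → G.WalkIn (supp (s.nat S)) x y (s.real 11 y)) :
    (∀ y : Fin n, 0 < ((relaxB S).run s).nat 11 y →
      G.WalkIn (supp (s.nat S)) x y (((relaxB S).run s).real 11 y)) ∧
    (∀ y : Fin n, 0 < s.nat 11 y → 0 < ((relaxB S).run s).nat 11 y ∧
      ((relaxB S).run s).real 11 y ≤ s.real 11 y) ∧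
    (0 < s.nat 11 u → v ∈ supp (s.nat S) → G.graph.Adj u v → 0 < ((relaxB S).run s).nat 11 v ∧
      ((relaxB S).run s).real 11 v ≤ s.real 11 u + G.len u v) := by
  have hm : s.nat 10 u = u * n := hG.mul u (by rw [hG.size]; exact Or.inl u.2)
  by_cases hc : (0 < s.nat 11 u ∧ 0 < s.nat S v) ∧ G.graph.Adj u v ∧
      ¬ (0 < s.nat 11 v ∧ s.real 11 v ≤ s.real 11 u + s.real 0 (u * n + v))
  · have hr : (relaxB S).run s = ((s.writeNat 11 v 1).writeReal 11 v
        (s.real 11 u + s.real 0 (u * n + v))) := by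
      have hc' := hc
      rw [← hG.adj u v] at hc'
      unfold relaxB
      rw [run, if_pos (by simpa [hu, hv, hm, Nat.one_le_iff_ne_zero, Nat.pos_iff_ne_zero] using hc')]
      simp [run, hu, hv, hm]
    rw [hr]
    obtain ⟨⟨h1, h2⟩, h3, h4⟩ := hc
    have hw := (hsound u h1).concat h3 h2
    rw [hG.len u v h3] at h4 ⊢
    refine ⟨fun y => ?_, fun y hy => ?_, fun _ _ _ => by simp⟩
    · by_cases hy : y = v
      · subst hy; intro _; simpa using hw
      · have : (y : ℕ) ≠ v := fun h => hy (Fin.ext h)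
        simpa [Function.update_of_ne this] using hsound y
    · by_cases hy' : y = v
      · subst hy'
        simp only [hy, true_and, not_le] at h4
        simpa using h4.le
      · have : (y : ℕ) ≠ v := fun h => hy' (Fin.ext h)
        simpa [Function.update_of_ne this] using hy
  · have hr : (relaxB S).run s = s := by
      have hc' := hc
      rw [← hG.adj u v] at hc'
      unfold relaxB
      rw [run, if_neg (by simpa [hu, hv, hm, Nat.one_le_iff_ne_zero, Nat.pos_iff_ne_zero] using hc')]
      rfl
    rw [hr]
    refine ⟨hsound, fun y hy => ⟨hy, le_rfl⟩, fun h1 h2 h3 => ?_⟩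
    by_contra h4
    exact hc ⟨⟨h1, h2⟩, h3, by rw [hG.len u v h3]; exact h4⟩

/-- After i rounds every walk with at most i edges is accounted for. As each walk can be replaced by
one that is no longer and has fewer than n edges, n rounds give the exact distances and exactly the
component of x. -/
theorem distB_spec {S X : ℕ} (hS : S ∉ (distB S X).natW) (hX : X ∉ (distB S X).natW) {s : Memory}
    (hG : HoldsGraph G s) {x : Fin n} (hx : s.nat X 0 = x) (hxS : x ∈ supp (s.nat S)) :
    ∀ v : Fin n, (0 < ((distB S X).run s).nat 11 v ↔ v ∈ G.comp (supp (s.nat S)) x) ∧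
      (0 < ((distB S X).run s).nat 11 v →
        G.IsDist (supp (s.nat S)) x v (((distB S X).run s).real 11 v)) := by
  set T : Set (Fin n) := supp (s.nat S) with hT
  have hS' : S ≠ 40 ∧ S ≠ 11 ∧ S ≠ 41 ∧ S ≠ 42 ∧ S ≠ 43 := by
    simp [distB, natW, relaxB] at hS
    omega
  have hX' : X ≠ 40 ∧ X ≠ 11 ∧ X ≠ 41 ∧ X ≠ 42 ∧ X ≠ 43 := by
    simp [distB, natW, relaxB] at hX
    omega
  set s1 := (Block.loop 40 0 (.setNat 11 (vr 40) (.lit 0))).run s with hs1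
  have sm1 : Same _ s s1 := same_run _ s
  have hR1 : ∀ k, s1.nat 11 k = if k < n then 0 else s.nat 11 k := by
    refine loop_pointwise hG.size 11 (by decide) (fun _ => 0) ?_
    intro k r hk hr _ _
    simp [run, hr]
  set s3 := (s1.writeNat 11 x 1).writeReal 11 x 0 with hs3
  have hS3 : s3.nat S = s.nat S := by
    simp only [hs3, Memory.nat_writeReal, Memory.nat_writeNat, hS'.2.1, if_false]
    exact sm1.1 S (by simp [natW, hS'])
  have hG3 : HoldsGraph G s3 := by
    refine (hG.same sm1 rfl).of_eq ?_ ?_ ?_ ?_ <;> simp [hs3]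
  have hrun : (distB S X).run s = (Block.loop 41 0 (.loop 42 0 (.loop 43 0 (relaxB S)))).run s3 := by
    have : s1.nat X 0 = x := by rw [sm1.1 X (by simp [natW, hX']), hx]
    have h11 : X ≠ 11 := hX'.2.1
    simp [distB, run_seq, run_setNat, run_setReal, ← hs1, this, h11, hs3]
  rw [hrun]
  have main := loop_rule (x := 41) (b := 0) (p := .loop 42 0 (.loop 43 0 (relaxB S))) (s := s3)
    hG3.size (fun i r => (∀ y : Fin n, 0 < r.nat 11 y → G.WalkIn T x y (r.real 11 y)) ∧
      ∀ (y : Fin n) (p : G.graph.Walk x y), (∀ z ∈ p.support, z ∈ T) → p.length ≤ i →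
        0 < r.nat 11 y ∧ r.real 11 y ≤ G.walkLength p) ?_ ?_ ?_
  · intro v
    refine ⟨⟨fun h => ⟨_, main.1 v h⟩, fun ⟨l, p, hp, _⟩ => ?_⟩, fun h => ⟨main.1 v h, fun l hl => ?_⟩⟩
    · obtain ⟨q, hq, hl, _⟩ := WeightedGraph.exists_short_walk p hp
      rw [Fintype.card_fin] at hl
      exact (main.2 v q hq hl.le).1
    · obtain ⟨p, hp, rfl⟩ := hl
      obtain ⟨q, hq, hl, hle⟩ := WeightedGraph.exists_short_walk p hp
      rw [Fintype.card_fin] at hl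
      exact (main.2 v q hq hl.le).2.trans (by exact_mod_cast hle)
  · intro i r j h
    simpa using h
  · constructor
    · intro y hy
      by_cases hyx : y = x
      · subst hyx
        have : s3.real 11 y = 0 := by simp [hs3]
        rw [this]; exact .refl hxS
      · have hne : (y : ℕ) ≠ x := fun h => hyx (Fin.ext h)
        have : s3.nat 11 y = 0 := by
          simp only [hs3, Memory.nat_writeReal, Memory.nat_writeNat, if_true,
            Function.update_of_ne hne, hR1, y.2]
        omega
    · intro y p hp hl
      cases p with
      | nil => simp [hs3]
      | cons h p => simp at hl
  · intro i r hi hr hs ⟨hsound, hprog⟩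
    have hGr : HoldsGraph G r := hG3.same hs rfl
    have hSr : r.nat S = s.nat S := by rw [← hS3]; exact hs.1 S (by simp [natW, relaxB, hS'])
    have round := loop_rule (x := 42) (b := 0) (p := .loop 43 0 (relaxB S)) (s := r)
      hGr.size (fun i r' => (∀ y : Fin n, 0 < r'.nat 11 y → G.WalkIn T x y (r'.real 11 y)) ∧
        (∀ y : Fin n, 0 < r.nat 11 y → 0 < r'.nat 11 y ∧ r'.real 11 y ≤ r.real 11 y) ∧
        ∀ u v : Fin n, (u : ℕ) < i → 0 < r.nat 11 u → v ∈ T → G.graph.Adj u v →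
          0 < r'.nat 11 v ∧ r'.real 11 v ≤ r.real 11 u + G.len u v) ?_ ?_ ?_
    · obtain ⟨h1, h2, h3⟩ := round
      refine ⟨h1, fun y p hp hl => ?_⟩
      -- A walk with i + 1 edges is cut before its last edge: the first part was settled in the
      -- earlier rounds, and the present round relaxes the last edge.
      rcases Nat.lt_or_ge i p.length with hlt | hge
      · cases p with
        | nil => simp at hlt
        | cons e p =>
          obtain ⟨z, q, e', heq⟩ := SimpleGraph.Walk.exists_cons_eq_concat e p
          rw [heq] at hp hl ⊢
          rw [SimpleGraph.Walk.length_concat] at hl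
          rw [SimpleGraph.Walk.support_concat] at hp
          obtain ⟨h4, h5⟩ := hprog z q (fun w hw => hp w (by simp [hw])) (by omega)
          have h6 := h3 z y z.2 h4 (hp y (by simp)) e'
          refine ⟨h6.1, h6.2.trans ?_⟩
          rw [SimpleGraph.Walk.concat_eq_append, WeightedGraph.walkLength_append,
            WeightedGraph.walkLength_cons, WeightedGraph.walkLength_nil]
          push_cast
          unfold WeightedGraph.len
          linarith
      · obtain ⟨h4, h5⟩ := hprog y p hp hge
        exact ⟨(h2 y h4).1, (h2 y h4).2.trans h5⟩
    · intro i r j h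
      simpa using h
    · exact ⟨hsound, fun y hy => ⟨hy, le_rfl⟩, fun u v h => absurd h (by omega)⟩
    · intro k r' hk hr' hs' ⟨h1, h2, h3⟩
      have hGr' : HoldsGraph G r' := hGr.same hs' rfl
      have hSr' : r'.nat S = s.nat S := by rw [← hSr]; exact hs'.1 S (by simp [natW, relaxB, hS'])
      have inner := loop_rule (x := 43) (b := 0) (p := relaxB S) (s := r')
        hGr'.size (fun j q => (∀ y : Fin n, 0 < q.nat 11 y → G.WalkIn T x y (q.real 11 y)) ∧
          (∀ y : Fin n, 0 < r'.nat 11 y → 0 < q.nat 11 y ∧ q.real 11 y ≤ r'.real 11 y) ∧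
          ∀ v : Fin n, (v : ℕ) < j → 0 < r'.nat 11 k → v ∈ T → G.graph.Adj ⟨k, hk⟩ v →
            0 < q.nat 11 v ∧ q.real 11 v ≤ r'.real 11 k + G.len ⟨k, hk⟩ v) ?_ ?_ ?_
      · obtain ⟨g1, g2, g3⟩ := inner
        refine ⟨g1, fun y hy => ?_, fun u v hu hu' hv ha => ?_⟩
        · have := h2 y hy
          have := g2 y this.1
          exact ⟨this.1, this.2.trans (h2 y hy).2⟩
        · rcases Nat.lt_succ_iff_lt_or_eq.1 hu with hlt | heq
          · have := h3 u v hlt hu' hv ha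
            have h' := g2 v this.1
            exact ⟨h'.1, h'.2.trans this.2⟩
          · have hu2 : u = ⟨k, hk⟩ := Fin.ext heq
            subst hu2
            have h' := h2 ⟨k, hk⟩ hu'
            have := g3 v v.2 h'.1 hv ha
            exact ⟨this.1, this.2.trans (by linarith [h'.2])⟩
      · intro i r j h
        simpa using h
      · exact ⟨h1, fun y hy => ⟨hy, le_rfl⟩, fun v h => absurd h (by omega)⟩
      · intro j q hj hq hsq ⟨g1, g2, g3⟩
        have hGq : HoldsGraph G q := hGr'.same hsq rfl
        have hSq : q.nat S = s.nat S := by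
          rw [← hSr']; exact hsq.1 S (by simp [natW, relaxB, hS'])
        have hq42 : q.nat 42 0 = k := by rw [hsq.1 42 (by simp [natW, relaxB]), hr']
        have hb := relaxB_spec (S := S) (x := x) (u := ⟨k, hk⟩) (v := ⟨j, hj⟩)
          hGq hq42 hq (by rw [hSq]; exact g1)
        rw [hSq] at hb
        obtain ⟨b1, b2, b3⟩ := hb
        refine ⟨b1, fun y hy => ?_, fun v hv hu hvT ha => ?_⟩
        · have := g2 y hy
          have h' := b2 y this.1
          exact ⟨h'.1, h'.2.trans this.2⟩
        · rcases Nat.lt_succ_iff_lt_or_eq.1 hv with hlt | heq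
          · have := g3 v hlt hu hvT ha
            have h' := b2 v this.1
            exact ⟨h'.1, h'.2.trans this.2⟩
          · have hv2 : v = ⟨j, hj⟩ := Fin.ext heq
            subst hv2
            have h' := g2 ⟨k, hk⟩ hu
            have := b3 h'.1 hvT ha
            exact ⟨this.1, this.2.trans (by linarith [h'.2])⟩

end Block

/-! ### Shortest paths and nets on them -/

namespace WeightedGraph

variable {n : ℕ} {G : WeightedGraph (Fin n)}

/-- `P` still contains a walk from `x` to `y` that is as short as any in `C`. -/
def KeepsDist (G : WeightedGraph (Fin n)) (C P : Set (Fin n)) (x y : Fin n) : Prop :=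
  ∀ l, G.WalkIn C x y l → G.Near P l x y

open Classical in
/-- Delete the vertices `0, …, k - 1` from `C` one by one whenever this keeps the distance of `x`
and `y`. -/
noncomputable def pathAux (G : WeightedGraph (Fin n)) (C : Set (Fin n)) (x y : Fin n) :
    ℕ → Set (Fin n)
  | 0 => C
  | k + 1 =>
    if h : k < n then
      if (⟨k, h⟩ : Fin n) ≠ x ∧ G.KeepsDist C (pathAux G C x y k \ {⟨k, h⟩}) x y then
        pathAux G C x y k \ {⟨k, h⟩}
      else pathAux G C x y k
    else pathAux G C x y k

/-- The vertex set of a shortest path from `x` to `y` in `C`. -/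
noncomputable def pathSet (G : WeightedGraph (Fin n)) (C : Set (Fin n)) (x y : Fin n) :
    Set (Fin n) := G.pathAux C x y n

/-- Once the distance is known, a single comparison decides whether a deletion is allowed; this is
the test that the program makes. -/
theorem keepsDist_iff {C P : Set (Fin n)} {x y : Fin n} {d : ℝ} (h : G.IsDist C x y d) :
    G.KeepsDist C P x y ↔ G.Near P d x y :=
  ⟨fun hk => hk d h.1, fun hn l hl => hn.mono subset_rfl (h.2 l hl)⟩

theorem pathAux_succ_subset (C : Set (Fin n)) (x y : Fin n) (k : ℕ) :
    G.pathAux C x y (k + 1) ⊆ G.pathAux C x y k := by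
  rw [pathAux]
  split_ifs
  · exact Set.sdiff_subset
  · exact subset_rfl
  · exact subset_rfl

theorem pathAux_anti (C : Set (Fin n)) (x y : Fin n) : Antitone (G.pathAux C x y) :=
  antitone_nat_of_succ_le fun k => pathAux_succ_subset C x y k

theorem pathSet_subset (C : Set (Fin n)) (x y : Fin n) : G.pathSet C x y ⊆ C :=
  pathAux_anti C x y (Nat.zero_le n)

theorem mem_pathAux {C : Set (Fin n)} {x y : Fin n} (hx : x ∈ C) (k : ℕ) :
    x ∈ G.pathAux C x y k := by
  induction k with
  | zero => exact hx
  | succ k ih =>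
    rw [pathAux]
    split_ifs with h1 h2
    · exact ⟨ih, fun h => h2.1 h.symm⟩
    · exact ih
    · exact ih

theorem keepsDist_pathAux (C : Set (Fin n)) (x y : Fin n) (k : ℕ) :
    G.KeepsDist C (G.pathAux C x y k) x y := by
  induction k with
  | zero => exact fun l hl => hl.near
  | succ k ih =>
    rw [pathAux]
    split_ifs with h1 h2
    · exact h2.2
    · exact ih
    · exact ih

/-- The final set still contains a shortest walk, and any vertex off this walk could have been
deleted when its turn came. So the set is the support of the walk. Working with a set that is
minimal in this sense avoids predecessor pointers, which would need care with edges of length 0. -/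
theorem exists_walk_pathSet {C : Set (Fin n)} {x y : Fin n} {d : ℝ} (hd : G.IsDist C x y d) :
    ∃ p : G.graph.Walk x y, (∀ v, v ∈ p.support ↔ v ∈ G.pathSet C x y) ∧
      (G.walkLength p : ℝ) = d := by
  obtain ⟨l, hl, p, hp, rfl⟩ := keepsDist_pathAux (G := G) C x y n d hd.1
  have hpd : (G.walkLength p : ℝ) = d :=
    le_antisymm hl (hd.2 _ ⟨p, fun v hv => pathSet_subset C x y (hp v hv), rfl⟩)
  refine ⟨p, fun v => ⟨hp v, fun hv => ?_⟩, hpd⟩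
  by_contra hvp
  have hvx : v ≠ x := fun h => hvp (h ▸ p.start_mem_support)
  -- The walk p misses v and lies in all earlier sets, so the deletion of v was allowed in round v.
  have hk : G.KeepsDist C (G.pathAux C x y v \ {v}) x y := by
    intro l hl
    refine ⟨d, hd.2 l hl, p, fun u hu => ⟨?_, fun h => hvp (h ▸ hu)⟩, hpd⟩
    exact pathAux_anti C x y v.2.le (hp u hu)
  have hmem : v ∈ G.pathAux C x y (v + 1) := pathAux_anti C x y v.2 hv
  rw [pathAux, dif_pos v.2, if_pos ⟨hvx, hk⟩] at hmem
  exact hmem.2 rfl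

theorem exists_isDist_of_mem_geodesic {V : Type*} {G : WeightedGraph V} {S : Set V} {u v : V}
    (p : G.graph.Walk u v) (hp : ∀ x ∈ p.support, x ∈ S)
    (hmin : ∀ l, G.WalkIn S u v l → (G.walkLength p : ℝ) ≤ l) {x : V} (hx : x ∈ p.support) :
    ∃ a, G.IsDist S u x a := by
  obtain ⟨l, l', e, h1, h2⟩ := WalkIn.split p hp hx
  exact ⟨l, h1, fun m hm => by have := hmin _ (hm.trans h2); linarith⟩

/-! ### Nets on a shortest path and their packing property. -/

open Classical in
/-- The centers among `0, …, k - 1`, and the set that they cover: going through the vertices of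
`P`, each one that is not yet covered becomes a center and covers the ball of radius `L` in `C`. -/
noncomputable def netAux (G : WeightedGraph (Fin n)) (C P : Set (Fin n)) (L : ℝ) :
    ℕ → List (Fin n) × Set (Fin n)
  | 0 => ([], ∅)
  | k + 1 =>
    if h : k < n then
      if (⟨k, h⟩ : Fin n) ∈ P ∧ (⟨k, h⟩ : Fin n) ∉ (netAux G C P L k).2 then
        ((netAux G C P L k).1 ++ [⟨k, h⟩],
          (netAux G C P L k).2 ∪ {v | G.Near C L ⟨k, h⟩ v})
      else netAux G C P L k
    else netAux G C P L k

/-- The centers on a shortest path. -/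
noncomputable def net (G : WeightedGraph (Fin n)) (L : ℝ) (C : Set (Fin n)) (x y : Fin n) :
    List (Fin n) := (G.netAux C (G.pathSet C x y) L n).1

/-- The vertices that the centers on a shortest path cover. -/
noncomputable def cov (G : WeightedGraph (Fin n)) (L : ℝ) (C : Set (Fin n)) (x y : Fin n) :
    Set (Fin n) := (G.netAux C (G.pathSet C x y) L n).2

/-- Greedy choice: a new center lies outside all balls around earlier ones, which gives the
separation, and each vertex of P is covered when its turn comes, if not before. -/
theorem netAux_spec (C P : Set (Fin n)) (L : ℝ) (k : ℕ) :
    (∀ c ∈ (G.netAux C P L k).1, c ∈ P) ∧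
    (∀ v, v ∈ (G.netAux C P L k).2 ↔ ∃ c ∈ (G.netAux C P L k).1, G.Near C L c v) ∧
    (G.netAux C P L k).1.Pairwise (fun c c' => ¬ G.Near C L c c') ∧
    (P ⊆ C → 0 ≤ L → ∀ v ∈ P, (v : ℕ) < k → v ∈ (G.netAux C P L k).2) := by
  induction k with
  | zero => simp [netAux]
  | succ k ih =>
    obtain ⟨h1, h2, h3, h4⟩ := ih
    rw [netAux]
    split_ifs with hk hc
    · refine ⟨fun c hc' => ?_, fun v => ?_, ?_, fun hPC hL v hv hvk => ?_⟩
      · rcases List.mem_append.1 hc' with h | h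
        · exact h1 c h
        · rw [List.mem_singleton.1 h]; exact hc.1
      · simp only [Set.mem_union, h2, List.mem_append, List.mem_singleton, Set.mem_ofPred_eq]
        constructor
        · rintro (⟨c, hc', hn⟩ | hn)
          · exact ⟨c, Or.inl hc', hn⟩
          · exact ⟨_, Or.inr rfl, hn⟩
        · rintro ⟨c, hc' | rfl, hn⟩
          · exact Or.inl ⟨c, hc', hn⟩
          · exact Or.inr hn
      · rw [List.pairwise_append]
        refine ⟨h3, List.pairwise_singleton _ _, fun c hc' c' hc'' hn => ?_⟩
        rw [List.mem_singleton.1 hc''] at hn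
        exact hc.2 ((h2 _).2 ⟨c, hc', hn⟩)
      · rcases Nat.lt_succ_iff_lt_or_eq.1 hvk with h | h
        · exact Or.inl (h4 hPC hL v hv h)
        · have : v = ⟨k, hk⟩ := Fin.ext h
          subst this
          exact Or.inr (Near.refl hL (hPC hv))
    · refine ⟨h1, h2, h3, fun hPC hL v hv hvk => ?_⟩
      rcases Nat.lt_succ_iff_lt_or_eq.1 hvk with h | h
      · exact h4 hPC hL v hv h
      · have : v = ⟨k, hk⟩ := Fin.ext h
        subst this
        by_contra hcon
        exact hc ⟨hv, hcon⟩
    · exact ⟨h1, h2, h3, fun hPC hL v hv _ => h4 hPC hL v hv (by omega)⟩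

theorem mem_of_mem_net {L : ℝ} {C : Set (Fin n)} {x y c : Fin n} (hc : c ∈ G.net L C x y) :
    c ∈ C := pathSet_subset C x y ((netAux_spec _ _ L n).1 c hc)

theorem mem_cov {L : ℝ} {C : Set (Fin n)} {x y v : Fin n} :
    v ∈ G.cov L C x y ↔ ∃ c ∈ G.net L C x y, G.Near C L c v := (netAux_spec _ _ L n).2.1 v

theorem pathSet_subset_cov {L : ℝ} (hL : 0 ≤ L) (C : Set (Fin n)) (x y : Fin n) :
    G.pathSet C x y ⊆ G.cov L C x y :=
  fun v hv => (netAux_spec _ _ L n).2.2.2 (pathSet_subset C x y) hL v hv v.2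

/-- Points on a line with gaps larger than L, in an interval of length ML: their cells ⌊(f c - min
f)/L⌋ are distinct numbers between 0 and M. For L = 0 the strict separation contradicts closeness
unless there is at most one point. -/
theorem card_le_of_separated {ι : Type*} (A : Finset ι) (f : ι → ℝ) {L : ℝ} (hL : 0 ≤ L) (M : ℕ)
    (hsep : ∀ c ∈ A, ∀ c' ∈ A, c ≠ c' → L < |f c - f c'|)
    (hclose : ∀ c ∈ A, ∀ c' ∈ A, |f c - f c'| ≤ M * L) : A.card ≤ M + 1 := by
  rcases hL.eq_or_lt with rfl | hL
  · have : A.card ≤ 1 := Finset.card_le_one.2 fun c hc c' hc' => by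
      by_contra hne
      have h1 := hsep c hc c' hc' hne
      have h2 := hclose c hc c' hc'
      simp at h2 h1
      exact h1 h2
    omega
  · rcases A.eq_empty_or_nonempty with rfl | hA
    · simp
    obtain ⟨m, hm, hmin⟩ := A.exists_min_image f hA
    have key : Set.InjOn (fun c => ⌊(f c - f m) / L⌋₊) A := by
      intro c hc c' hc' h
      by_contra hne
      have h1 := hsep c hc c' hc' hne
      have n1 : 0 ≤ (f c - f m) / L := div_nonneg (by linarith [hmin c hc]) hL.le
      have n2 : 0 ≤ (f c' - f m) / L := div_nonneg (by linarith [hmin c' hc']) hL.le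
      have a1 := Nat.floor_le n1
      have a2 := Nat.lt_floor_add_one ((f c - f m) / L)
      have b1 := Nat.floor_le n2
      have b2 := Nat.lt_floor_add_one ((f c' - f m) / L)
      simp only at h
      rw [h] at a1 a2
      have e : |f c - f c'| / L < 1 := by
        have e1 : |f c - f c'| / L = |(f c - f m) / L - (f c' - f m) / L| := by
          rw [← sub_div, sub_sub_sub_cancel_right, abs_div, abs_of_pos hL]
        rw [e1, abs_lt]
        constructor <;> linarith
      rw [div_lt_one hL] at e
      linarith
    calc A.card = (A.image fun c => ⌊(f c - f m) / L⌋₊).card := (Finset.card_image_of_injOn key).symm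
      _ ≤ (Finset.range (M + 1)).card := Finset.card_le_card fun k hk => by
        obtain ⟨c, hc, rfl⟩ := Finset.mem_image.1 hk
        rw [Finset.mem_range, Nat.lt_succ_iff]
        have h2 := (abs_le.1 (hclose c hc m hm)).2
        have : (f c - f m) / L ≤ M := by rw [div_le_iff₀ hL]; exact h2
        exact Nat.floor_le_of_le this
      _ = M + 1 := Finset.card_range _

/-- Few centers of one net are close to one another. -/
theorem net_packing {L : ℝ} (hL : 0 ≤ L) {C : Set (Fin n)} {x y : Fin n} {d : ℝ}
    (hd : G.IsDist C x y d) (A : Finset (Fin n)) (M : ℕ) (hA : ∀ c ∈ A, c ∈ G.net L C x y)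
    (hclose : ∀ c ∈ A, ∀ c' ∈ A, G.Near C (M * L) c c') : A.card ≤ M + 1 := by
  classical
  obtain ⟨p, hp, hpd⟩ := exists_walk_pathSet hd
  have hpC : ∀ v ∈ p.support, v ∈ C := fun v hv => pathSet_subset C x y ((hp v).1 hv)
  have hmin : ∀ l, G.WalkIn C x y l → (G.walkLength p : ℝ) ≤ l := fun l hl => hpd ▸ hd.2 l hl
  have hsup : ∀ c ∈ A, c ∈ p.support := fun c hc =>
    (hp c).2 ((netAux_spec _ _ L n).1 c (hA c hc))
  -- The position of a center is its distance from x; the value 0 off A is never used. On a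
  -- geodesic, distances in C between two points are differences of positions, so the net becomes a
  -- separated set on the line.
  have hpos : ∀ c : Fin n, ∃ a, c ∈ A → G.IsDist C x c a := fun c => by
    by_cases hc : c ∈ A
    · obtain ⟨a, ha⟩ := exists_isDist_of_mem_geodesic p hpC hmin (hsup c hc)
      exact ⟨a, fun _ => ha⟩
    · exact ⟨0, fun h => absurd h hc⟩
  choose f hf using hpos
  refine card_le_of_separated A f hL M (fun c hc c' hc' hne => ?_) (fun c hc c' hc' => ?_)
  · by_contra hcon
    have hn : G.Near C L c c' := (near_of_mem_geodesic p hpC hmin (hsup c hc) (hsup c' hc')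
      (hf c hc) (hf c' hc')).mono subset_rfl (not_lt.1 hcon)
    have hpw := (netAux_spec (G := G) C (G.pathSet C x y) L n).2.2.1
    have key : ∀ c ∈ G.net L C x y, ∀ c' ∈ G.net L C x y, c ≠ c' → ¬ G.Near C L c c' := by
      intro c hc c' hc' hne
      have hs : Std.Symm (fun c c' => ¬ G.Near C L c c') := ⟨fun a b h h' => h h'.symm⟩
      exact hpw.forall hc hc' hne
    exact key c (hA c hc) c' (hA c' hc') hne hn
  · obtain ⟨l, hl, hw⟩ := hclose c hc c' hc'
    have h1 := (hf c' hc').2 _ ((hf c hc).1.trans hw)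
    have h2 := (hf c hc).2 _ ((hf c' hc').1.trans hw.symm)
    rw [abs_le]
    constructor <;> linarith

end WeightedGraph

/-! ### Partitions into clusters -/

namespace WeightedGraph

variable {V : Type*}

/-- The vertices of `H` whose level is at least `i`. -/
def levelSet (H : Set V) (lev : V → ℕ) (i : ℕ) : Set V := {v | v ∈ H ∧ i ≤ lev v}

theorem levelSet_anti (H : Set V) (lev : V → ℕ) {i j : ℕ} (h : i ≤ j) :
    levelSet H lev j ⊆ levelSet H lev i := fun _ hv => ⟨hv.1, h.trans hv.2⟩

/-- `l` is the length of a walk from the center `c` to `v`, inside the vertices of level at least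
that of `c`, plus a constant that depends on the level. -/
def Val (G : WeightedGraph V) (L : ℝ) (H : Set V) (lev : V → ℕ) (c v : V) (l : ℝ) : Prop :=
  ∃ d, G.WalkIn (levelSet H lev (lev c)) c v d ∧ l = 2 * L * lev c + d

/-- `u` is the first center in the list `cs` with the least value at `v`, and this value is `b`. -/
def Best (val : V → V → ℝ → Prop) (cs : List V) (v u : V) (b : ℝ) : Prop :=
  ∃ l₁ l₂, cs = l₁ ++ u :: l₂ ∧ val u v b ∧ (∀ c ∈ l₁, ∀ l, val c v l → b < l) ∧
    ∀ c ∈ l₂, ∀ l, val c v l → b ≤ l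

/-- Only minimality at the winner u itself is missing from the order relations in `Best`, and it is
supplied as a hypothesis. -/
theorem Best.le {val : V → V → ℝ → Prop} {cs : List V} {v u : V} {b : ℝ} (h : Best val cs v u b)
    (hu : ∀ l, val u v l → b ≤ l) {c : V} (hc : c ∈ cs) {l : ℝ} (hl : val c v l) : b ≤ l := by
  obtain ⟨l₁, l₂, rfl, _, h1, h2⟩ := h
  rcases List.mem_append.1 hc with hc | hc
  · exact (h1 c hc l hl).le
  · rcases List.mem_cons.1 hc with rfl | hc
    · exact hu l hl
    · exact h2 c hc l hl

/-- Of two different entries, the one that comes first lies in the initial segment belonging to the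
other. With this the tie-breaking rule can be used from both sides. -/
theorem append_cons_eq {cs l₁ l₂ l₁' l₂' : List V} {u u' : V} (h : cs = l₁ ++ u :: l₂)
    (h' : cs = l₁' ++ u' :: l₂') (hne : u ≠ u') :
    (u ∈ l₁' ∧ u' ∈ l₂) ∨ (u' ∈ l₁ ∧ u ∈ l₂') := by
  rw [h] at h'
  rcases List.append_eq_append_iff.1 h' with ⟨a, rfl, e⟩ | ⟨a, rfl, e⟩
  · left
    cases a with
    | nil => simp at e; exact absurd e.1 hne
    | cons x a => simp at e; obtain ⟨rfl, rfl⟩ := e; simp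
  · right
    cases a with
    | nil => simp at e; exact absurd e.1.symm hne
    | cons x a => simp at e; obtain ⟨rfl, rfl⟩ := e; simp

/-- A partition of `H` into clusters: the clusters of level `i` have their centers on shortest
paths that were chosen in the components of the set of vertices of level at least `i`. -/
structure Clustering (G : WeightedGraph V) (L : ℝ) (H : Set V) (lev : V → ℕ) (cs : List V)
    (asg : V → V) (best : V → ℝ) (K : ℕ) : Prop where
  nonneg : 0 ≤ L
  mem : ∀ c ∈ cs, c ∈ H
  sorted : cs.Pairwise fun c c' => lev c ≤ lev c'
  cover : ∀ v ∈ H, ∃ c ∈ cs, lev c = lev v ∧ G.Near (levelSet H lev (lev v)) L c v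
  packing : ∀ (i : ℕ) (A : Finset V) (M : ℕ), (∀ c ∈ A, c ∈ cs ∧ lev c = i) →
    (∀ c ∈ A, ∀ c' ∈ A, G.Near (levelSet H lev i) (M * L) c c') → A.card ≤ M + 1
  asg_best : ∀ v ∈ H, Best (G.Val L H lev) cs v (asg v) (best v)
  asg_le : ∀ v ∈ H, ∀ l, G.Val L H lev (asg v) v l → best v ≤ l
  lt : ∀ v ∈ H, lev v < K

/-! ### Connectedness, radius and scattering of the clusters. -/

namespace Clustering

variable {G : WeightedGraph V} {L : ℝ} {H : Set V} {lev : V → ℕ} {cs : List V}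
  {asg : V → V} {best : V → ℝ} {K : ℕ}

theorem best_le (h : Clustering G L H lev cs asg best K) {v c : V} (hv : v ∈ H) (hc : c ∈ cs)
    {l : ℝ} (hl : G.Val L H lev c v l) : best v ≤ l :=
  (h.asg_best v hv).le (h.asg_le v hv) hc hl

theorem asg_mem (h : Clustering G L H lev cs asg best K) {v : V} (hv : v ∈ H) : asg v ∈ cs := by
  obtain ⟨l₁, l₂, e, _⟩ := h.asg_best v hv
  rw [e]; simp

/-- The center that covered v when v was deleted has the same level as v and is at distance at most
L, so what it offers is already cheap. -/
theorem best_le_of_level (h : Clustering G L H lev cs asg best K) {v : V} (hv : v ∈ H) :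
    ∃ c ∈ cs, lev c = lev v ∧ G.Near (levelSet H lev (lev v)) L c v ∧
      best v ≤ 2 * L * lev v + L := by
  obtain ⟨c, hc, hl, hn⟩ := h.cover v hv
  refine ⟨c, hc, hl, hn, ?_⟩
  obtain ⟨d, hd, hw⟩ := hn
  have := h.best_le hv hc ⟨d, by rw [hl]; exact hw, rfl⟩
  rw [hl] at this
  linarith

/-- Levels are at most K - 1, and 2L(K - 1) + L ≤ 2KL. -/
theorem best_le_radius (h : Clustering G L H lev cs asg best K) {v : V} (hv : v ∈ H) :
    best v ≤ 2 * K * L := by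
  obtain ⟨c, -, -, -, hb⟩ := h.best_le_of_level hv
  have h1 : (lev v : ℝ) + 1 ≤ K := by exact_mod_cast h.lt v hv
  have := mul_le_mul_of_nonneg_right h1 h.nonneg
  have := h.nonneg
  linarith

/-- The next vertex on a shortest path to the center lies in the same cluster. -/
theorem asg_next (h : Clustering G L H lev cs asg best K) {v x : V} {l : ℝ}
    (hv : v ∈ levelSet H lev (lev (asg v))) (hadj : G.graph.Adj v x)
    (hw : G.WalkIn (levelSet H lev (lev (asg v))) x (asg v) l)
    (hb : best v = 2 * L * lev (asg v) + (G.len v x + l)) :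
    asg x = asg v ∧ best x = 2 * L * lev (asg v) + l := by
  have hxS := hw.left_mem
  have hx := hxS.1
  have hlen := G.len_nonneg v x
  have hL := h.nonneg
  have hvx : G.Val L H lev (asg v) x (2 * L * lev (asg v) + l) := ⟨l, hw.symm, rfl⟩
  have hle : best x ≤ 2 * L * lev (asg v) + l := h.best_le hx (h.asg_mem hv.1) hvx
  obtain ⟨l₁, l₂, e, ⟨d, hd, hbv⟩, h1, h2⟩ := h.asg_best v hv.1
  obtain ⟨l₁', l₂', e', ⟨d', hd', hbx⟩, h1', h2'⟩ := h.asg_best x hx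
  have hxa : lev (asg x) ≤ lev x := hd'.right_mem.2
  by_cases hne : asg v = asg x
  · refine ⟨hne.symm, le_antisymm hle ?_⟩
    have hw' := hd'.concat hadj.symm (by rw [← hne]; exact hv)
    have := h.best_le hv.1 (h.asg_mem hx) ⟨_, hw', rfl⟩
    rw [G.len_comm x v] at this
    linarith
  · exfalso
    -- If v is visible to the center of x, the walk from that center can be prolonged to v. Then
    -- both centers compete at x and at v with the same difference of values, and the tie-breaking
    -- rule selects the same one at both.
    by_cases hlev : lev (asg x) ≤ lev v
    · have hw' := hd'.concat hadj.symm ⟨hv.1, hlev⟩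
      have hval : G.Val L H lev (asg x) v (best x + G.len v x) :=
        ⟨_, hw', by rw [G.len_comm x v, hbx]; ring⟩
      rcases append_cons_eq e e' hne with ⟨hu, hu'⟩ | ⟨hu, hu'⟩
      · have a1 := h1' _ hu _ hvx
        have a2 := h2 _ hu' _ hval
        linarith
      · have a1 := h1 _ hu _ hval
        linarith
    -- Otherwise the center of x has a level above that of v, so its value is at least 2L(lev v +
    -- 1), while the center of v offers x at most 2L·lev v + L. For L = 0 this is no contradiction
    -- yet; strictness comes from the order of the list, in which lower levels precede.
    · push Not at hlev
      obtain ⟨c, hc, hcl, hcn, hbl⟩ := h.best_le_of_level hv.1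
      have h3 : (lev v : ℝ) + 1 ≤ lev (asg x) := by exact_mod_cast hlev
      have h4 := mul_le_mul_of_nonneg_left h3 hL
      have h5 := hd'.nonneg
      have hu : asg v ∈ l₁' := by
        rcases append_cons_eq e e' hne with ⟨hu, hu'⟩ | ⟨hu, hu'⟩
        · exact hu
        · have := h.sorted
          rw [e, List.pairwise_append] at this
          have h6 := this.2.2 _ hu _ (List.mem_cons_self)
          have h7 := hv.2
          omega
      have := h1' _ hu _ hvx
      linarith

/-- Clusters are connected and have bounded radius. -/
theorem near_center (h : Clustering G L H lev cs asg best K) {v : V} (hv : v ∈ H) :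
    G.Near {x | x ∈ H ∧ asg x = asg v} (2 * K * L) (asg v) v := by
  obtain ⟨-, -, -, ⟨d, hd, hb⟩, -, -⟩ := h.asg_best v hv
  -- Going from x towards its center along a walk that realizes the minimum, no step leaves the
  -- cluster.
  have key : ∀ u : V, ∀ x l, G.WalkIn (levelSet H lev (lev u)) x u l → asg x = u →
      best x = 2 * L * lev u + l → G.WalkIn {x | x ∈ H ∧ asg x = u} x u l := by
    intro u x l hw
    refine WalkIn.induction_left (P := fun x l => asg x = u → best x = 2 * L * lev u + l →
      G.WalkIn {x | x ∈ H ∧ asg x = u} x u l) (fun hu e _ => .refl ⟨hu.1, e⟩) ?_ hw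
    rintro x z l hx ha hw ih rfl hb
    obtain ⟨e1, e2⟩ := h.asg_next hx ha hw hb
    have hz := ih e1 e2
    have hx' : x ∈ {y | y ∈ H ∧ asg y = asg x} := ⟨hx.1, rfl⟩
    exact (WalkIn.edge ha hx' hz.left_mem).trans hz
  refine ⟨d, ?_, (key _ v d hd.symm rfl hb).symm⟩
  have h1 := h.best_le_radius hv
  have h2 : 0 ≤ 2 * L * lev (asg v) := by have := h.nonneg; positivity
  linarith

/-- A short walk meets few clusters. -/
theorem scattering [DecidableEq V] (h : Clustering G L H lev cs asg best K) {u v : V}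
    (p : G.graph.Walk u v) (hp : ∀ x ∈ p.support, x ∈ H) (hlen : (G.walkLength p : ℝ) ≤ L) :
    (p.support.toFinset.image asg).card ≤ K * (4 * K + 2) := by
  have hL := h.nonneg
  -- The vertex of lowest level j: the whole walk lies in the set of level at least j, so the center
  -- c that covers q reaches every vertex of the walk within 2L.
  obtain ⟨q, hq, hqmin⟩ := p.support.toFinset.exists_min_image lev ⟨u, by simp⟩
  rw [List.mem_toFinset] at hq
  set j := lev q with hj
  have hpS : ∀ x ∈ p.support, x ∈ levelSet H lev j :=
    fun x hx => ⟨hp x hx, hqmin x (List.mem_toFinset.2 hx)⟩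
  obtain ⟨c, hc, hcl, hcn, -⟩ := h.best_le_of_level (hp q hq)
  have hcq : ∀ x ∈ p.support, ∃ l ≤ 2 * L, G.WalkIn (levelSet H lev (lev c)) c x l := by
    intro x hx
    obtain ⟨l, hl, hw⟩ := WalkIn.between p hpS hq hx
    have := hcn.trans (hw.near.mono subset_rfl (hl.trans hlen))
    rw [hcl]
    obtain ⟨m, hm, hw⟩ := this
    exact ⟨m, by linarith, hw⟩
  -- A center above level j costs at least 2L(j + 1), which is not less than the offer of c; and c
  -- precedes it in the list, so c wins ties as well.
  have hlev : ∀ x ∈ p.support, lev (asg x) ≤ j := by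
    intro x hx
    by_contra hcon
    push Not at hcon
    obtain ⟨m, hm, hw⟩ := hcq x hx
    obtain ⟨l₁, l₂, e, ⟨d, hd, hb⟩, h1, h2⟩ := h.asg_best x (hp x hx)
    have hv : G.Val L H lev c x (2 * L * lev c + m) := ⟨m, hw, rfl⟩
    have hc' : c ∈ l₁ := by
      have hc2 := hc
      have hs := h.sorted
      rw [e] at hc2 hs
      rcases List.mem_append.1 hc2 with hc2 | hc2
      · exact hc2
      · exfalso
        rcases List.mem_cons.1 hc2 with rfl | hc2
        · omega
        · rw [List.pairwise_append, List.pairwise_cons] at hs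
          have := hs.2.1.1 c hc2
          omega
    have h3 := h1 c hc' _ hv
    have h4 : (j : ℝ) + 1 ≤ lev (asg x) := by exact_mod_cast hcon
    have h5 := mul_le_mul_of_nonneg_left h4 hL
    have h6 := hd.nonneg
    rw [hcl] at h3
    linarith
  have hjK : j < K := h.lt q (hp q hq)
  set I := p.support.toFinset.image asg with hI
  have hlevI : ∀ a ∈ I, lev a ∈ Finset.range K := by
    intro a ha
    obtain ⟨x, hx, rfl⟩ := Finset.mem_image.1 ha
    have := hlev x (List.mem_toFinset.1 hx)
    exact Finset.mem_range.2 (by omega)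
  rw [Finset.card_eq_sum_card_fiberwise (t := Finset.range K) (f := lev) hlevI]
  refine (Finset.sum_le_card_nsmul _ _ (4 * K + 2) fun i hi => ?_).trans (by simp)
  -- Two centers of level i are joined by a walk of length at most 2KL + L + 2KL = (4K + 1)L inside
  -- the set of level at least i.
  refine (h.packing i _ (4 * K + 1) ?_ ?_).trans (by omega)
  · intro a ha
    obtain ⟨ha1, rfl⟩ := Finset.mem_filter.1 ha
    obtain ⟨x, hx, rfl⟩ := Finset.mem_image.1 ha1
    exact ⟨h.asg_mem (hp x (List.mem_toFinset.1 hx)), rfl⟩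
  · have near : ∀ a ∈ I.filter (fun a => lev a = i), ∃ x ∈ p.support,
        G.Near (levelSet H lev i) (2 * K * L) a x := by
      intro a ha
      obtain ⟨ha1, rfl⟩ := Finset.mem_filter.1 ha
      obtain ⟨x, hx, rfl⟩ := Finset.mem_image.1 ha1
      rw [List.mem_toFinset] at hx
      obtain ⟨-, -, -, ⟨d, hd, hb⟩, -, -⟩ := h.asg_best x (hp x hx)
      refine ⟨x, hx, d, ?_, hd⟩
      have h1 := h.best_le_radius (hp x hx)
      have h2 : 0 ≤ 2 * L * lev (asg x) := by positivity
      linarith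
    intro a ha a' ha'
    obtain ⟨x, hx, hn⟩ := near a ha
    obtain ⟨x', hx', hn'⟩ := near a' ha'
    have hij : i ≤ j := by
      obtain ⟨ha1, rfl⟩ := Finset.mem_filter.1 ha
      obtain ⟨y, hy, rfl⟩ := Finset.mem_image.1 ha1
      exact hlev y (List.mem_toFinset.1 hy)
    obtain ⟨l, hl, hw⟩ := WalkIn.between p hpS hx hx'
    have hxx : G.Near (levelSet H lev i) L x x' :=
      ⟨l, hl.trans hlen, hw.mono (levelSet_anti H lev hij)⟩
    refine ((hn.trans hxx).trans hn'.symm).mono subset_rfl (le_of_eq ?_)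
    push_cast
    ring

end Clustering

end WeightedGraph

/-! ### The distortion of the contracted graph -/

namespace WeightedGraph

variable {V : Type*} {G : WeightedGraph V}

/-- In the contracted graph it costs nothing to move to the last vertex of the walk in the same
fiber; the rest of the walk then avoids the fiber, which makes counting fibers an induction. -/
theorem exists_last {u v : V} (p : G.graph.Walk u v) (P : V → Prop) (hx : ∃ x ∈ p.support, P x)
    (hv : ¬ P v) :
    ∃ (a b : V) (r : G.graph.Walk b v), P a ∧ G.graph.Adj a b ∧ a ∈ p.support ∧
      (∀ x ∈ r.support, x ∈ p.support ∧ ¬ P x) ∧ G.walkLength r ≤ G.walkLength p ∧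
      G.len a b ≤ G.walkLength p := by
  induction p with
  | nil => obtain ⟨y, hy, hPy⟩ := hx; simp at hy; subst hy; exact absurd hPy hv
  | @cons u x v h p ih =>
    by_cases hx' : ∃ z ∈ p.support, P z
    · obtain ⟨a, b, r, h1, h2, h3, h4, h5, h6⟩ := ih hx' hv
      refine ⟨a, b, r, h1, h2, by simp [h3], fun y hy => ⟨by simp [(h4 y hy).1], (h4 y hy).2⟩, ?_⟩
      rw [walkLength_cons]
      exact ⟨h5.trans le_add_self, h6.trans (NNReal.coe_le_coe.2 le_add_self)⟩
    · push Not at hx'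
      obtain ⟨y, hy, hPy⟩ := hx
      have hyu : y = u := by
        simp at hy
        rcases hy with hy | hy
        · exact hy
        · exact absurd hPy (hx' y hy)
      subst hyu
      refine ⟨y, x, p, hPy, h, by simp, fun z hz => ⟨by simp [hz], hx' z hz⟩, ?_⟩
      rw [walkLength_cons]
      exact ⟨le_add_self, NNReal.coe_le_coe.2 le_self_add⟩

theorem exists_first {u v : V} (p : G.graph.Walk u v) (P : V → Prop) (hu : ¬ P u)
    (hx : ∃ x ∈ p.support, P x) :
    ∃ (a b : V) (q : G.graph.Walk u a) (r : G.graph.Walk b v), P b ∧ G.graph.Adj a b ∧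
      (∀ x ∈ q.support, x ∈ p.support ∧ ¬ P x) ∧ (∀ x ∈ r.support, x ∈ p.support) ∧
      G.walkLength q ≤ G.walkLength p ∧ G.walkLength r ≤ G.walkLength p ∧
      G.len a b ≤ G.walkLength p := by
  induction p with
  | nil => obtain ⟨x, hx, hP⟩ := hx; simp at hx; subst hx; exact absurd hP hu
  | @cons u x v h p ih =>
    by_cases hPx : P x
    · refine ⟨u, x, .nil, p, hPx, h, by simpa using hu, fun y hy => by simp [hy], by simp, ?_⟩
      rw [walkLength_cons]
      exact ⟨le_add_self, NNReal.coe_le_coe.2 le_self_add⟩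
    · obtain ⟨y, hy, hPy⟩ := hx
      have hy' : y ∈ p.support := by
        simp at hy
        rcases hy with rfl | hy
        · exact absurd hPy hu
        · exact hy
      obtain ⟨a, b, q, r, h1, h2, h3, h4, h5, h6, h7⟩ := ih hPx ⟨y, hy', hPy⟩
      refine ⟨a, b, .cons h q, r, h1, h2, ?_, fun z hz => by simp [h4 z hz], ?_, ?_, ?_⟩
      · intro z hz
        simp at hz
        rcases hz with rfl | hz
        · exact ⟨by simp, hu⟩
        · exact ⟨by simp [(h3 z hz).1], (h3 z hz).2⟩
      · rw [walkLength_cons, walkLength_cons]; gcongr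
      · rw [walkLength_cons]; exact h6.trans le_add_self
      · rw [walkLength_cons]; exact h7.trans (NNReal.coe_le_coe.2 le_add_self)

/-- The bound δ is passed by a single edge ab, whose length is not controlled. Hence this edge is
separated from both pieces. -/
theorem exists_split_length {u v : V} (p : G.graph.Walk u v) (δ : ℝ) (hδ : 0 ≤ δ)
    (hp : δ < G.walkLength p) :
    ∃ (a b : V) (q : G.graph.Walk u a) (r : G.graph.Walk b v), G.graph.Adj a b ∧
      (G.walkLength q : ℝ) ≤ δ ∧ δ < G.walkLength q + G.len a b ∧
      (G.walkLength p : ℝ) = G.walkLength q + G.len a b + G.walkLength r ∧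
      r.length < p.length := by
  induction p generalizing δ with
  | nil => simp at hp; linarith
  | @cons u x v h p ih =>
    have e : (G.walkLength (.cons h p) : ℝ) = G.len u x + G.walkLength p := by
      rw [walkLength_cons]; push_cast; rfl
    by_cases hw : δ < G.len u x
    · exact ⟨u, x, .nil, p, h, by simpa using hδ, by simpa using hw, by rw [e]; simp, by simp⟩
    · rw [e] at hp
      obtain ⟨a, b, q, r, h1, h2, h3, h4, h5⟩ := ih (δ - G.len u x) (by linarith) (by linarith)
      have e' : (G.walkLength (.cons h q) : ℝ) = G.len u x + G.walkLength q := by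
        rw [walkLength_cons]; push_cast; rfl
      refine ⟨a, b, .cons h q, r, h1, by rw [e']; linarith, by rw [e']; linarith,
        by rw [e, e', h4]; ring, by simp; omega⟩

/-- `R r s t` says that the distance of `s` and `t` in a contracted graph is at most `r`; the
vertex `v` has been contracted to `F v`. -/
structure HopRel (R : ℝ → V → V → Prop) (G : WeightedGraph V) (F : V → V) : Prop where
  refl : ∀ r u, 0 ≤ r → R r (F u) (F u)
  trans : ∀ r r' a b c, R r a b → R r' b c → R (r + r') a c
  mono : ∀ r r' a b, r ≤ r' → R r a b → R r' a b
  edge : ∀ r u v, G.graph.Adj u v → G.Near Set.univ r (F u) (F v) → R r (F u) (F v)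

variable {R : ℝ → V → V → Prop} {F : V → V}

/-- Leave a fiber from its last vertex on the walk: each fiber is left at most once, so the number
of hops is at most the number of fibers. -/
theorem HopRel.of_card [DecidableEq V] (hR : HopRel R G F) {T : Set V} {h : ℝ} (h0 : 0 ≤ h)
    (hT : ∀ a ∈ T, ∀ b ∈ T, G.graph.Adj a b → R h (F a) (F b)) (s : ℕ) :
    ∀ {u v : V} (p : G.graph.Walk u v), (∀ x ∈ p.support, x ∈ T) →
      (p.support.toFinset.image F).card ≤ s → R (s * h) (F u) (F v) := by
  induction s with
  | zero =>
    intro u v p _ hs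
    have : F u ∈ p.support.toFinset.image F := Finset.mem_image_of_mem _ (by simp)
    rw [Finset.card_eq_zero.1 (Nat.le_zero.1 hs)] at this
    simp at this
  | succ s ih =>
    intro u v p hp hs
    by_cases huv : F v = F u
    · rw [huv]; exact hR.refl _ _ (by positivity)
    · obtain ⟨a, b, r, h1, h2, h3, h4, -⟩ := exists_last p (fun x => F x = F u) ⟨u, p.start_mem_support, rfl⟩ huv
      have hb : b ∈ T := hp b (h4 b r.start_mem_support).1
      have hab := hT a (hp a h3) b hb h2
      have hr := ih r (fun x hx => hp x (h4 x hx).1) ?_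
      · rw [h1] at hab
        refine hR.mono _ _ _ _ ?_ (hR.trans _ _ _ _ _ hab hr)
        push_cast; linarith
      · have hsub : r.support.toFinset.image F ⊆ (p.support.toFinset.image F).erase (F u) := by
          intro y hy
          obtain ⟨x, hx, rfl⟩ := Finset.mem_image.1 hy
          rw [List.mem_toFinset] at hx
          refine Finset.mem_erase.2 ⟨(h4 x hx).2, Finset.mem_image_of_mem _ ?_⟩
          exact List.mem_toFinset.2 (h4 x hx).1
        have := Finset.card_le_card hsub
        rw [Finset.card_erase_of_mem (Finset.mem_image_of_mem _ (by simp))] at this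
        omega

/-- The walk mixes two kinds of vertices. Those in A meet at most N fibers altogether, but the
stretches off A are only known to meet s fibers each. Walk to the first vertex in A (s + 1 hops),
jump to the last vertex of its fiber, take one more hop, and go on with N - 1: this makes (s + 2)
hops for each of the N fibers and s for the last stretch. -/
theorem HopRel.of_card_two [DecidableEq V] (hR : HopRel R G F) {T : Set V} {h : ℝ} (h0 : 0 ≤ h)
    (hT : ∀ a ∈ T, ∀ b ∈ T, G.graph.Adj a b → R h (F a) (F b)) (A : V → Prop) [DecidablePred A]
    (s : ℕ) (δ : ℝ) (hB : ∀ {u v : V} (p : G.graph.Walk u v), (∀ x ∈ p.support, x ∈ T ∧ ¬ A x) →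
      (G.walkLength p : ℝ) ≤ δ → (p.support.toFinset.image F).card ≤ s) (N : ℕ) :
    ∀ {u v : V} (p : G.graph.Walk u v), (∀ x ∈ p.support, x ∈ T) → (G.walkLength p : ℝ) ≤ δ →
      ((p.support.toFinset.filter A).image F).card ≤ N →
        R ((N + 1) * (s + 2) * h) (F u) (F v) := by
  induction N with
  | zero =>
    intro u v p hp hδ hN
    have hnA : ∀ x ∈ p.support, ¬ A x := by
      intro x hx hA
      have : F x ∈ (p.support.toFinset.filter A).image F :=
        Finset.mem_image_of_mem _ (Finset.mem_filter.2 ⟨List.mem_toFinset.2 hx, hA⟩)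
      rw [Finset.card_eq_zero.1 (Nat.le_zero.1 hN)] at this
      simp at this
    refine hR.mono _ _ _ _ ?_ (hR.of_card h0 hT s p hp (hB p (fun x hx => ⟨hp x hx, hnA x hx⟩) hδ))
    push_cast; nlinarith
  | succ N ih =>
    intro u v p hp hδ hN
    have hs0 : (0 : ℝ) ≤ s := Nat.cast_nonneg s
    have hN0 : (0 : ℝ) ≤ N := Nat.cast_nonneg N
    -- From a vertex of A: after the jump the fiber of b is used up, so one fiber of A less remains.
    have fromA : ∀ {b : V} (r : G.graph.Walk b v), A b → (∀ x ∈ r.support, x ∈ p.support) →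
        (G.walkLength r : ℝ) ≤ δ → R (h + (N + 1) * (s + 2) * h) (F b) (F v) := by
      intro b r hA hr hrδ
      by_cases hbv : F v = F b
      · rw [hbv]; exact hR.refl _ _ (by positivity)
      · obtain ⟨a, c, q, h1, h2, h3, h4, h5, -⟩ := exists_last r (fun x => F x = F b) ⟨b, r.start_mem_support, rfl⟩ hbv
        have hac := hT a (hp a (hr a h3)) c (hp c (hr c (h4 c q.start_mem_support).1)) h2
        rw [h1] at hac
        refine hR.trans _ _ _ _ _ hac (ih q (fun x hx => hp x (hr x (h4 x hx).1)) ?_ ?_)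
        · exact le_trans (by exact_mod_cast h5) hrδ
        · have hsub : (q.support.toFinset.filter A).image F ⊆
              ((p.support.toFinset.filter A).image F).erase (F b) := by
            intro y hy
            obtain ⟨x, hx, rfl⟩ := Finset.mem_image.1 hy
            obtain ⟨hx, hxA⟩ := Finset.mem_filter.1 hx
            rw [List.mem_toFinset] at hx
            refine Finset.mem_erase.2 ⟨(h4 x hx).2, Finset.mem_image_of_mem _ ?_⟩
            exact Finset.mem_filter.2 ⟨List.mem_toFinset.2 (hr x (h4 x hx).1), hxA⟩
          have := Finset.card_le_card hsub
          rw [Finset.card_erase_of_mem (Finset.mem_image_of_mem _ (Finset.mem_filter.2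
            ⟨List.mem_toFinset.2 (hr b r.start_mem_support), hA⟩))] at this
          omega
    by_cases hAu : A u
    · refine hR.mono _ _ _ _ ?_ (fromA p hAu (fun x hx => hx) hδ)
      push_cast; nlinarith
    · by_cases hx : ∃ x ∈ p.support, A x
      · obtain ⟨a, b, q, r, h1, h2, h3, h4, h5, h6, -⟩ := exists_first p A hAu hx
        have hq := hR.of_card h0 hT s q (fun x hx => hp x (h3 x hx).1)
          (hB q (fun x hx => ⟨hp x (h3 x hx).1, (h3 x hx).2⟩) (le_trans (by exact_mod_cast h5) hδ))
        have hab := hT a (hp a (h3 a q.end_mem_support).1) b (hp b (h4 b r.start_mem_support)) h2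
        have hr := fromA r h1 h4 (le_trans (by exact_mod_cast h6) hδ)
        refine hR.mono _ _ _ _ ?_ (hR.trans _ _ _ _ _ (hR.trans _ _ _ _ _ hq hab) hr)
        push_cast; nlinarith
      · push Not at hx
        refine hR.mono _ _ _ _ ?_
          (hR.of_card h0 hT s p hp (hB p (fun x hx' => ⟨hp x hx', hx x hx'⟩) hδ))
        push_cast
        have : 0 ≤ (N : ℝ) * s * h := by positivity
        nlinarith

/-- What is known about the first `i` stages. The set `K` consists of the terminals, `D` is the
distance to `K`, a vertex outside `K` is assigned in stage `st v` if `st v < i` and is not yet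
assigned if `st v = i`, it is assigned to `F v`, `Δ j` is the scale of stage `j`, and `cl j v` is the
cluster of `v` in stage `j`. -/
structure Stages [DecidableEq V] (G : WeightedGraph V) (K : Set V) (D : V → ℝ) (F : V → V)
    (st : V → ℕ) (Δ : ℕ → ℝ) (cl : ℕ → V → V) (i : ℕ) (τ : ℕ) (κ : ℝ) : Prop where
  le : ∀ v, v ∉ K → st v ≤ i
  scattering : ∀ j < i, ∀ {u v : V} (p : G.graph.Walk u v),
    (∀ x ∈ p.support, x ∉ K ∧ j ≤ st x) → (G.walkLength p : ℝ) ≤ Δ j →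
      (p.support.toFinset.image (cl j)).card ≤ τ
  const : ∀ u v, u ∉ K → v ∉ K → st u < i → st u = st v → cl (st u) u = cl (st u) v → F u = F v
  upper : ∀ v, v ∉ K → st v < i → D v ≤ κ * Δ (st v)
  half : ∀ v, v ∉ K → ∀ j < i, st v < j → 2 * D v ≤ Δ j
  lower : ∀ v, v ∉ K → ∀ j < st v, Δ j < D v
  scale : ∀ v, v ∉ K → st v < i → Δ (st v) ≤ 2 * κ * D v
  near : ∀ v, v ∉ K → st v < i → G.Near Set.univ (2 * τ * κ * Δ (st v)) v (F v)

/-- The distortion that the stages achieve. -/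
def distortion (τ κ : ℝ) : ℝ :=
  12 * κ * (4 * τ * κ ^ 2 + 1) * ((τ + 1) * (τ + 2) + 1) + 2 * (4 * τ * κ ^ 2 + 1)

/-- Induction on the number of edges. A first piece of the walk, of length about D u / (4κ), is
replaced by boundedly many hops whose cost is proportional to that length, and the rest is shorter.
-/
theorem Stages.hop [DecidableEq V] {K : Set V} {D : V → ℝ} {st : V → ℕ} {Δ : ℕ → ℝ}
    {cl : ℕ → V → V} {i τ : ℕ} {κ : ℝ} (hS : Stages G K D F st Δ cl i τ κ) (hκ : 1 ≤ κ)
    (hR : HopRel R G F) (hall : ∀ v, v ∉ K → st v < i) (hFK : ∀ t ∈ K, F t = t)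
    (hDK : ∀ t ∈ K, D t = 0) (hD0 : ∀ v, 0 ≤ D v)
    (hD : ∀ u v, G.graph.Adj u v → D v ≤ D u + G.len u v) {t : V} (ht : t ∈ K) (N : ℕ) :
    ∀ {u : V} (p : G.graph.Walk u t), p.length ≤ N →
      R (distortion τ κ * G.walkLength p) (F u) (F t) := by
  have hτ : (0 : ℝ) ≤ τ := Nat.cast_nonneg τ
  set β : ℝ := 4 * τ * κ ^ 2 + 1 with hβ
  have hβ1 : 1 ≤ β := by rw [hβ]; nlinarith [mul_nonneg hτ (sq_nonneg κ)]
  have hα : distortion τ κ = 12 * κ * β * ((τ + 1) * (τ + 2) + 1) + 2 * β := rfl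
  have hα2 : 2 * β ≤ distortion τ κ := by
    rw [hα]
    have : 0 ≤ 12 * κ * β * ((τ + 1) * (τ + 2) + 1) := by positivity
    linarith
  have hDw : ∀ {u v : V} (p : G.graph.Walk u v), D v ≤ D u + G.walkLength p := by
    intro u v p
    induction p with
    | nil => simp
    | cons h p ih =>
      rw [walkLength_cons]; push_cast
      have := hD _ _ h
      unfold len at this
      linarith
  -- The bound 2τκΔ from the stage, together with Δ ≤ 2κ D v, gives 4τκ² D v; the additional 1 in β
  -- makes β ≥ 1.
  have hnear : ∀ v, G.Near Set.univ (β * D v) v (F v) := by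
    intro v
    by_cases hv : v ∈ K
    · rw [hFK v hv]
      exact .refl (mul_nonneg (by linarith) (hD0 v)) trivial
    · refine (hS.near v hv (hall v hv)).mono subset_rfl ?_
      have := hS.scale v hv (hall v hv)
      have h1 : 2 * τ * κ * Δ (st v) ≤ 2 * τ * κ * (2 * κ * D v) :=
        mul_le_mul_of_nonneg_left this (by positivity)
      have := hD0 v
      rw [hβ]; nlinarith
  have hedge : ∀ u v, G.graph.Adj u v → R (β * D u + G.len u v + β * D v) (F u) (F v) := by
    intro u v h
    refine hR.edge _ u v h ?_
    exact ((hnear u).symm.trans (WalkIn.edge (S := Set.univ) h trivial trivial).near).trans (hnear v)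
  induction N with
  | zero =>
    intro u p hp
    cases p with
    | nil => exact hR.refl _ _ (by simp)
    | cons h p => simp at hp
  | succ N ih =>
    intro u p hp
    have hℓ : (0 : ℝ) ≤ G.walkLength p := NNReal.coe_nonneg _
    rcases (hD0 u).eq_or_lt with hd | hd
    · cases p with
      | nil => exact hR.refl _ _ (by simp)
      | @cons _ x _ h p =>
        have h1 := hedge _ _ h
        have h2 := ih p (by simp at hp; omega)
        refine hR.mono _ _ _ _ ?_ (hR.trans _ _ _ _ _ h1 h2)
        rw [walkLength_cons]
        push_cast
        have h3 := hD _ _ h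
        have h4 := G.len_nonneg u x
        rw [← hd] at h3 ⊢
        have h5 : β * D x ≤ β * G.len u x := mul_le_mul_of_nonneg_left (by linarith) (by linarith)
        have h6 : 2 * β * G.len u x ≤ distortion τ κ * G.len u x :=
          mul_le_mul_of_nonneg_right hα2 h4
        have h7 : G.len u x ≤ β * G.len u x := le_mul_of_one_le_left h4 hβ1
        have e : (G.weight s(u, x) : ℝ) = G.len u x := rfl
        rw [e, mul_add]
        linarith
    · set d := D u with hdd
      -- With this length D changes by at most d/4 along the piece, and δ stays below the scale of
      -- every stage that occurs on it.
      set δ := d / (4 * κ) with hδ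
      have hδ0 : 0 ≤ δ := by positivity
      have hδd : δ * (4 * κ) = d := by rw [hδ]; field_simp
      have hδ4 : δ ≤ d / 4 := by nlinarith
      have hpd : d ≤ G.walkLength p := by
        have := hDw p.reverse
        rw [hDK t ht, walkLength_reverse] at this
        linarith
      obtain ⟨a, b, q, r, hab, hq1, hq2, hsum, hlen⟩ := exists_split_length p δ hδ0 (by linarith)
      have hDq : ∀ x ∈ q.support, 3 / 4 * d ≤ D x ∧ D x ≤ 5 / 4 * d := by
        intro x hx
        obtain ⟨l, hl, w, -, hw⟩ := WalkIn.between (S := Set.univ) q (fun _ _ => trivial)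
          q.start_mem_support hx
        have h1 := hDw w
        have h2 := hDw w.reverse
        rw [walkLength_reverse] at h2
        rw [hw] at h1 h2
        constructor <;> linarith
      have hnK : ∀ x ∈ q.support, x ∉ K := fun x hx hK => by
        have := (hDq x hx).1; rw [hDK x hK] at this; linarith
      obtain ⟨m, hm, hmin⟩ := q.support.toFinset.exists_min_image st ⟨u, by simp⟩
      rw [List.mem_toFinset] at hm
      have hΔ : δ ≤ Δ (st m) := by
        have h1 := hS.upper m (hnK m hm) (hall m (hnK m hm))
        have h2 := (hDq m hm).1
        nlinarith
      -- If a stage lay strictly between, its scale would be at least 2 D m ≥ 3d/2 by `half` and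
      -- less than D x ≤ 5d/4 by `lower`.
      have hst : ∀ x ∈ q.support, st x = st m ∨ st x = st m + 1 := by
        intro x hx
        have h1 := hmin x (List.mem_toFinset.2 hx)
        by_contra hcon
        have h2 : st m + 1 < st x := by omega
        have h3 := hS.lower x (hnK x hx) _ h2
        have h4 := hS.half m (hnK m hm) (st m + 1) (h2.trans (hall x (hnK x hx))) (by omega)
        have h5 := (hDq m hm).1
        have h6 := (hDq x hx).2
        linarith
      set T : Set V := {x | x ∈ q.support} with hT
      -- Along an edge inside the piece, the two ways to the terminals cost at most 5/4·βd each, and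
      -- the ends are at most δ ≤ d/4 apart.
      set h := 3 * β * d with hh
      have hh0 : 0 ≤ h := by positivity
      have hTedge : ∀ x ∈ T, ∀ y ∈ T, G.graph.Adj x y → R h (F x) (F y) := by
        intro x hx y hy hxy
        obtain ⟨l, hl, hw⟩ := WalkIn.between (S := Set.univ) q (fun _ _ => trivial) hx hy
        refine hR.mono _ _ _ _ ?_ (hR.edge _ x y hxy
          (((hnear x).symm.trans hw.near).trans (hnear y)))
        have h1 := mul_le_mul_of_nonneg_left (hDq x hx).2 (by linarith : 0 ≤ β)
        have h2 := mul_le_mul_of_nonneg_left (hDq y hy).2 (by linarith : 0 ≤ β)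
        rw [hh]
        nlinarith
      have hcard : ∀ j < i, δ ≤ Δ j → ∀ {v w : V} (p : G.graph.Walk v w),
          (∀ x ∈ p.support, x ∈ T ∧ j ≤ st x) → (G.walkLength p : ℝ) ≤ δ →
          ((p.support.toFinset.filter fun x => st x = j).image F).card ≤ τ := by
        intro j hj hjδ v w p hp hpδ
        refine le_trans ?_ (hS.scattering j hj p (fun x hx => ⟨hnK x (hp x hx).1, (hp x hx).2⟩)
          (hpδ.trans hjδ))
        have hf : ∀ y ∈ (p.support.toFinset.filter fun x => st x = j).image F,
            ∃ x ∈ p.support, st x = j ∧ F x = y := by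
          intro y hy
          obtain ⟨x, hx, rfl⟩ := Finset.mem_image.1 hy
          obtain ⟨hx, hxj⟩ := Finset.mem_filter.1 hx
          exact ⟨x, List.mem_toFinset.1 hx, hxj, rfl⟩
        -- Pick a vertex for each value of F: within one stage the cluster determines the terminal,
        -- so different values give different clusters, and scattering bounds the number of values.
        choose! g hg using hf
        refine Finset.card_le_card_of_injOn (fun y => cl j (g y)) ?_ ?_
        · intro y hy
          exact Finset.mem_coe.2 (Finset.mem_image_of_mem _ (List.mem_toFinset.2 (hg y hy).1))
        · intro y hy z hz hyz
          obtain ⟨h1, h2, h3⟩ := hg y hy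
          obtain ⟨h4, h5, h6⟩ := hg z hz
          rw [← h3, ← h6]
          refine hS.const _ _ (hnK _ (hp _ h1).1) (hnK _ (hp _ h4).1) (by omega) (by omega) ?_
          rw [h2]
          exact hyz
      -- A is the earlier of the two stages. The whole piece runs through vertices of stage at least
      -- st m, so scattering applies to it in that stage. In the later stage it applies only to
      -- stretches off A, where the earlier vertices are absent.
      have hqa := hR.of_card_two hh0 hTedge (fun x => st x = st m) τ δ ?_ τ q (fun x hx => hx) hq1
        (hcard (st m) (hall m (hnK m hm)) hΔ q
          (fun x hx => ⟨hx, hmin x (List.mem_toFinset.2 hx)⟩) hq1)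
      · have hab' := hedge a b hab
        have hbt := ih r (by omega)
        refine hR.mono _ _ _ _ ?_ (hR.trans _ _ _ _ _ (hR.trans _ _ _ _ _ hqa hab') hbt)
        have hDa := (hDq a q.end_mem_support).2
        have hDb : D b ≤ 5 / 4 * d + G.len a b := (hD a b hab).trans (by linarith)
        set ℓ : ℝ := G.walkLength q + G.len a b with hℓ'
        have hq0 : (0 : ℝ) ≤ G.walkLength q := NNReal.coe_nonneg _
        have hl0 := G.len_nonneg a b
        -- Including the edge ab, the piece is longer than δ; this is where the cost, measured in d,
        -- is charged to length.
        have hdl : d ≤ 4 * κ * ℓ := by rw [← hδd]; nlinarith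
        rw [hsum, mul_add (distortion _ _)]
        have e1 : β * D a ≤ β * (5 / 4 * d) := mul_le_mul_of_nonneg_left hDa (by linarith)
        have e2 : β * D b ≤ β * (5 / 4 * d + ℓ) :=
          mul_le_mul_of_nonneg_left (by linarith) (by linarith)
        have e3 : G.len a b ≤ β * ℓ := by nlinarith
        have e4 : 3 * β * d * ((τ + 1) * (τ + 2) + 1) ≤
            3 * β * (4 * κ * ℓ) * ((τ + 1) * (τ + 2) + 1) := by gcongr
        have e5 : distortion τ κ * ℓ =
            3 * β * (4 * κ * ℓ) * ((τ + 1) * (τ + 2) + 1) + 2 * β * ℓ := by rw [hα]; ring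
        have e6 : 0 ≤ β * d := by positivity
        rw [e5, hh]
        linarith
      · intro v w p hp hpδ
        by_cases hj : st m + 1 < i
        · have h1 : ∀ x ∈ p.support, st x = st m + 1 := fun x hx =>
            (hst x (hp x hx).1).resolve_left (hp x hx).2
          have h2 := hS.half m (hnK m hm) (st m + 1) hj (by omega)
          have h3 := (hDq m hm).1
          have := hcard (st m + 1) hj (by linarith) p (fun x hx => ⟨(hp x hx).1, (h1 x hx).ge⟩) hpδ
          rwa [Finset.filter_true_of_mem fun x hx => h1 x (List.mem_toFinset.1 hx)] at this
        · exfalso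
          have hx := hp v p.start_mem_support
          have h1 := (hst v hx.1).resolve_left hx.2
          have := hall v (hnK v hx.1)
          omega

end WeightedGraph

/-! ### Programs for shortest paths and nets -/

theorem supp_update_zero {n : ℕ} (f : ℕ → ℕ) (v : Fin n) :
    (supp (Function.update f v 0) : Set (Fin n)) = supp f \ {v} := by
  ext u
  by_cases h : u = v
  · subst h; simp [supp]
  · have : (u : ℕ) ≠ v := fun e => h (Fin.ext e)
    simp [supp, h, Function.update_of_ne this]

theorem supp_update_one {n : ℕ} (f : ℕ → ℕ) (v : Fin n) :
    (supp (Function.update f v 1) : Set (Fin n)) = supp f ∪ {v} := by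
  ext u
  by_cases h : u = v
  · subst h; simp [supp]
  · have : (u : ℕ) ≠ v := fun e => h (Fin.ext e)
    simp [supp, h, Function.update_of_ne this]

namespace Block

/-- The vertex set of a shortest path in the set in array `C`, from the vertex in variable `X` to
the one in variable `Y`. -/
def pathB (C X Y : ℕ) : Block :=
  .seq (distB C X) <|
  .seq (.setReal 12 (.lit 0) (.read 11 (vr Y))) <|
  .seq (.loop 44 0 (.setNat 12 (vr 44) (.read C (vr 44)))) <|
  .loop 45 0 (.ite (.and (pos (.read 12 (vr 45)))
      (.not (.and (.natLe (vr 45) (vr X)) (.natLe (vr X) (vr 45)))))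
    (.seq (.setNat 12 (vr 45) (.lit 0)) <|
      .seq (distB 12 X) <|
      .ite (.and (pos (.read 11 (vr Y))) (.realLe (.read 11 (vr Y)) (rv 12))) .skip
        (.setNat 12 (vr 45) (.lit 1)))
    .skip)

/-- Offer the center in variable `47` to all vertices whose distances have been computed. Array `18`
marks the vertices that have a center, which is stored in array `19`, its value in real array `15`;
real variable `14` is the constant that is added to distances. -/
def updB : Bool → Block
  | false => .skip
  | true =>
    .loop 49 0 (.ite (.and (pos (.read 11 (vr 49))) (.not (.and (pos (.read 18 (vr 49)))
        (.realLe (.read 15 (vr 49)) (.add (rv 14) (.read 11 (vr 49)))))))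
      (.seq (.setNat 18 (vr 49) (.lit 1)) <|
        .seq (.setReal 15 (vr 49) (.add (rv 14) (.read 11 (vr 49))))
        (.setNat 19 (vr 49) (vr 47)))
      .skip)

/-- Choose centers on the path in array `12` and mark in array `13` what they cover in the set in
array `C`. The radius is in real variable `13`. -/
def covB (C : ℕ) (b : Bool) : Block :=
  .seq (.loop 46 0 (.setNat 13 (vr 46) (.lit 0))) <|
  .loop 47 0 (.ite (.and (pos (.read 12 (vr 47))) (.not (pos (.read 13 (vr 47)))))
    (.seq (distB C 47) <|
      .seq (.loop 48 0 (.ite (.and (pos (.read 11 (vr 48))) (.realLe (.read 11 (vr 48)) (rv 13)))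
        (.setNat 13 (vr 48) (.lit 1)) .skip))
      (updB b))
    .skip)

variable {n : ℕ} {G : WeightedGraph (Fin n)}

/-- The program carries out the deletions of `pathAux` one by one: delete, recompute the distance,
and restore the vertex if the distance has grown or y is no longer reached. The start x is never
deleted, as the distance computation must start inside the set. -/
theorem pathB_spec {C X Y : ℕ} (hC : C ∉ (pathB C X Y).natW) (hX : X ∉ (pathB C X Y).natW)
    (hY : Y ∉ (pathB C X Y).natW) {s : Memory} (hG : HoldsGraph G s) {x y : Fin n}
    (hx : s.nat X 0 = x) (hy : s.nat Y 0 = y) (hxC : x ∈ supp (s.nat C))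
    (hyC : y ∈ G.comp (supp (s.nat C)) x) :
    supp (((pathB C X Y).run s).nat 12) = G.pathSet (supp (s.nat C)) x y := by
  set T : Set (Fin n) := supp (s.nat C) with hT
  have hC' : C ≠ 40 ∧ C ≠ 11 ∧ C ≠ 41 ∧ C ≠ 42 ∧ C ≠ 43 ∧ C ≠ 12 ∧ C ≠ 44 ∧ C ≠ 45 := by
    simp [pathB, distB, natW, relaxB] at hC; omega
  have hX' : X ≠ 40 ∧ X ≠ 11 ∧ X ≠ 41 ∧ X ≠ 42 ∧ X ≠ 43 ∧ X ≠ 12 ∧ X ≠ 44 ∧ X ≠ 45 := by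
    simp [pathB, distB, natW, relaxB] at hX; omega
  have hY' : Y ≠ 40 ∧ Y ≠ 11 ∧ Y ≠ 41 ∧ Y ≠ 42 ∧ Y ≠ 43 ∧ Y ≠ 12 ∧ Y ≠ 44 ∧ Y ≠ 45 := by
    simp [pathB, distB, natW, relaxB] at hY; omega
  have hd := distB_spec (S := C) (X := X) (by simp [distB, natW, relaxB, hC'])
    (by simp [distB, natW, relaxB, hX']) hG hx hxC y
  set s1 := (distB C X).run s with hs1
  have sm1 : Same _ s s1 := same_run _ s
  have hG1 : HoldsGraph G s1 := hG.same sm1 rfl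
  set s2 := s1.writeReal 12 0 (s1.real 11 y) with hs2
  have hG2 : HoldsGraph G s2 := by refine hG1.of_eq ?_ ?_ ?_ ?_ <;> simp [hs2]
  have hdist : G.IsDist T x y (s2.real 12 0) := by
    simpa [hs2] using hd.2 (hd.1.2 hyC)
  have hY1 : s1.nat Y 0 = y := by rw [sm1.1 Y (by simp [distB, natW, relaxB, hY']), hy]
  have hrun2 : (setReal 12 (.lit 0) (.read 11 (vr Y))).run s1 = s2 := by
    simp [run_setReal, hY1, hs2]
  set s3 := (loop 44 0 (.setNat 12 (vr 44) (.read C (vr 44)))).run s2 with hs3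
  have sm3 : Same _ s2 s3 := same_run _ s2
  have hG3 : HoldsGraph G s3 := hG2.same sm3 rfl
  have hC2 : s2.nat C = s.nat C := sm1.1 C (by simp [distB, natW, relaxB, hC'])
  have hP3 : ∀ k, s3.nat 12 k = if k < n then s.nat C k else s2.nat 12 k := by
    refine loop_pointwise hG2.size 12 (by decide) (fun k => s.nat C k) ?_
    intro k r hk hr hsr _
    have : r.nat C = s.nat C := by rw [← hC2]; exact hsr.1 C (by simp [natW, hC'])
    simp [run_setNat, hr, this]
  have hrun : (pathB C X Y).run s = (loop 45 0 (.ite (.and (pos (.read 12 (vr 45)))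
      (.not (.and (.natLe (vr 45) (vr X)) (.natLe (vr X) (vr 45)))))
    (.seq (.setNat 12 (vr 45) (.lit 0)) <|
      .seq (distB 12 X) <|
      .ite (.and (pos (.read 11 (vr Y))) (.realLe (.read 11 (vr Y)) (rv 12))) .skip
        (.setNat 12 (vr 45) (.lit 1)))
    .skip)).run s3 := by
    rw [pathB, run_seq, ← hs1, run_seq, hrun2, run_seq]
  rw [hrun]
  have hX3 : s3.nat X 0 = x := by
    rw [sm3.1 X (by simp [natW, hX'])]
    change s1.nat X 0 = x
    rw [sm1.1 X (by simp [distB, natW, relaxB, hX']), hx]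
  have hY3 : s3.nat Y 0 = y := by
    rw [sm3.1 Y (by simp [natW, hY'])]; exact hY1
  have hD3 : s3.real 12 = s2.real 12 := sm3.2 12 (by simp [realW])
  rw [← hD3] at hdist
  refine loop_rule (N := n) hG3.size (fun k r => supp (r.nat 12) = G.pathAux T x y k) ?_ ?_ ?_
  · intro k r j h; simpa using h
  · ext v
    simp [supp, hP3, WeightedGraph.pathAux, hT]
  · intro k r hk hr hsr hI
    have hGr : HoldsGraph G r := hG3.same hsr rfl
    have hXr : r.nat X 0 = x := by
      rw [hsr.1 X (by simp [distB, natW, relaxB, hX']), hX3]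
    have hYr : r.nat Y 0 = y := by
      rw [hsr.1 Y (by simp [distB, natW, relaxB, hY']), hY3]
    have hDr : r.real 12 = s3.real 12 := hsr.2 12 (by simp [distB, realW, relaxB])
    have hmem : (⟨k, hk⟩ : Fin n) ∈ G.pathAux T x y k ↔ 0 < r.nat 12 k := by rw [← hI]; rfl
    rw [WeightedGraph.pathAux, dif_pos hk]
    by_cases hc : 0 < r.nat 12 k ∧ k ≠ x
    · rw [run_ite_pos (by
        simp only [Test.Holds, NatExpr.eval, hr, hXr]
        exact ⟨hc.1, fun h => hc.2 (le_antisymm h.1 h.2)⟩)]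
      set r1 := r.writeNat 12 k 0 with hr1
      have hS1 : supp (r1.nat 12) = G.pathAux T x y k \ {⟨k, hk⟩} := by
        rw [← hI, ← supp_update_zero]; simp [hr1]
      have hG1 : HoldsGraph G r1 := by refine hGr.of_eq ?_ ?_ ?_ ?_ <;> simp [hr1]
      have hXr1 : r1.nat X 0 = x := by simp [hr1, hX', hXr]
      have hxne : (⟨k, hk⟩ : Fin n) ≠ x := fun h => hc.2 (congrArg Fin.val h)
      have hx1 : x ∈ supp (r1.nat 12) := by
        rw [hS1]; exact ⟨WeightedGraph.mem_pathAux hxC k, fun h => hxne h.symm⟩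
      have hd1 := distB_spec (S := 12) (X := X) (by simp [distB, natW, relaxB])
        (by simp [distB, natW, relaxB, hX']) hG1 hXr1 hx1 y
      rw [run_seq, run_setNat]
      have e1 : r.writeNat 12 ((vr 45).eval r) ((NatExpr.lit 0).eval r) = r1 := by simp [hr1, hr]
      rw [e1, run_seq]
      set r2 := (distB 12 X).run r1 with hr2
      have sm2 : Same _ r1 r2 := same_run _ r1
      have h12 : r2.nat 12 = r1.nat 12 := sm2.1 12 (by simp [distB, natW, relaxB])
      have hY2 : r2.nat Y 0 = y := by
        rw [sm2.1 Y (by simp [distB, natW, relaxB, hY'])]; simp [hr1, hY', hYr]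
      have h45 : r2.nat 45 0 = k := by
        rw [sm2.1 45 (by simp [distB, natW, relaxB])]; simp [hr1, hr]
      have hD2 : r2.real 12 0 = s3.real 12 0 := by
        rw [sm2.2 12 (by simp [distB, realW, relaxB])]
        change r.real 12 0 = _
        rw [hDr]
      have hiff : (0 < r2.nat 11 y ∧ r2.real 11 y ≤ s3.real 12 0) ↔
          G.KeepsDist T (G.pathAux T x y k \ {⟨k, hk⟩}) x y := by
        rw [WeightedGraph.keepsDist_iff hdist, ← hS1]
        constructor
        · rintro ⟨h1, h2⟩
          exact (WeightedGraph.near_iff_of_isDist (hd1.2 h1)).2 h2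
        · rintro ⟨l, hl, hw⟩
          have h1 := hd1.1.2 ⟨l, hw⟩
          exact ⟨h1, ((hd1.2 h1).2 l hw).trans hl⟩
      by_cases hkeep : G.KeepsDist T (G.pathAux T x y k \ {⟨k, hk⟩}) x y
      · rw [if_pos ⟨hxne, hkeep⟩, run_ite_pos, run_skip, h12, hS1]
        simp only [Test.Holds, NatExpr.eval, RealExpr.eval, hY2, hD2]
        exact hiff.2 hkeep
      · rw [if_neg (fun h => hkeep h.2), run_ite_neg, run_setNat]
        · have e2 : (r2.writeNat 12 ((vr 45).eval r2) ((NatExpr.lit 1).eval r2)).nat 12 =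
              Function.update (r2.nat 12) k 1 := by simp [h45]
          rw [e2, h12]
          have := supp_update_one (n := n) (r1.nat 12) ⟨k, hk⟩
          rw [show ((⟨k, hk⟩ : Fin n) : ℕ) = k from rfl] at this
          rw [this, hS1, Set.sdiff_union_self]
          exact Set.union_eq_left.2 (Set.singleton_subset_iff.2 (hmem.2 hc.1))
        · simp only [Test.Holds, NatExpr.eval, RealExpr.eval, hY2, hD2]
          exact fun h => hkeep (hiff.1 h)
    · rw [run_ite_neg (by
        simp only [Test.Holds, NatExpr.eval, hr, hXr]
        rintro ⟨h1, h2⟩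
        exact hc ⟨h1, fun h => h2 ⟨h.le, h.ge⟩⟩), run_skip, hI]
      split_ifs with h
      · by_cases hm : (⟨k, hk⟩ : Fin n) ∈ G.pathAux T x y k
        · exfalso
          exact hc ⟨hmem.1 hm, fun e => h.1 (Fin.ext e)⟩
        · exact (Set.sdiff_singleton_eq_self hm).symm
      · rfl

/-- A vertex changes its center only for a strictly smaller value, or if it had none; so ties go to
the earlier center. -/
theorem updB_spec {s : Memory} (hN : s.nat 0 0 = n) (v : Fin n) :
    ((0 < s.nat 11 v ∧ ¬ (0 < s.nat 18 v ∧ s.real 15 v ≤ s.real 14 0 + s.real 11 v)) →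
      ((updB true).run s).nat 18 v = 1 ∧ ((updB true).run s).nat 19 v = s.nat 47 0 ∧
      ((updB true).run s).real 15 v = s.real 14 0 + s.real 11 v) ∧
    (¬ (0 < s.nat 11 v ∧ ¬ (0 < s.nat 18 v ∧ s.real 15 v ≤ s.real 14 0 + s.real 11 v)) →
      ((updB true).run s).nat 18 v = s.nat 18 v ∧ ((updB true).run s).nat 19 v = s.nat 19 v ∧
      ((updB true).run s).real 15 v = s.real 15 v) := by
  have main := loop_rule (x := 49) (b := 0) (p := (.ite (.and (pos (.read 11 (vr 49)))
      (.not (.and (pos (.read 18 (vr 49)))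
        (.realLe (.read 15 (vr 49)) (.add (rv 14) (.read 11 (vr 49)))))))
      (.seq (.setNat 18 (vr 49) (.lit 1)) <|
        .seq (.setReal 15 (vr 49) (.add (rv 14) (.read 11 (vr 49))))
        (.setNat 19 (vr 49) (vr 47)))
      .skip)) (s := s) (N := n) hN (fun k r => ∀ v : ℕ,
      (v < k → (0 < s.nat 11 v ∧ ¬ (0 < s.nat 18 v ∧ s.real 15 v ≤ s.real 14 0 + s.real 11 v)) →
        r.nat 18 v = 1 ∧ r.nat 19 v = s.nat 47 0 ∧ r.real 15 v = s.real 14 0 + s.real 11 v) ∧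
      (¬ (v < k ∧ 0 < s.nat 11 v ∧
          ¬ (0 < s.nat 18 v ∧ s.real 15 v ≤ s.real 14 0 + s.real 11 v)) →
        r.nat 18 v = s.nat 18 v ∧ r.nat 19 v = s.nat 19 v ∧ r.real 15 v = s.real 15 v)) ?_ ?_ ?_
  · exact ⟨fun h => (main v).1 v.2 h, fun h => (main v).2 fun h' => h h'.2⟩
  · intro k r j h; simpa using h
  · intro v; exact ⟨fun h => absurd h (by omega), fun _ => ⟨rfl, rfl, rfl⟩⟩
  · intro k r hk hr hs hI
    have h11 : r.nat 11 = s.nat 11 := hs.1 11 (by simp [natW])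
    have h47 : r.nat 47 = s.nat 47 := hs.1 47 (by simp [natW])
    have hr11 : r.real 11 = s.real 11 := hs.2 11 (by simp [realW])
    have hr14 : r.real 14 = s.real 14 := hs.2 14 (by simp [realW])
    obtain ⟨a1, a2, a3⟩ := (hI k).2 (fun h => absurd h.1 (by omega))
    by_cases hc : 0 < s.nat 11 k ∧
        ¬ (0 < s.nat 18 k ∧ s.real 15 k ≤ s.real 14 0 + s.real 11 k)
    · rw [run_ite_pos (by
        simp only [Test.Holds, NatExpr.eval, RealExpr.eval, hr, h11, hr11, hr14, a1, a3]; exact hc)]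
      intro v
      by_cases hv : v = k
      · subst hv
        exact ⟨fun _ _ => by simp [run_seq, run_setNat, run_setReal, hr, h47, hr11, hr14],
          fun h => absurd ⟨Nat.lt_succ_self _, hc⟩ h⟩
      · have e : v < k + 1 ↔ v < k := by omega
        simpa [run_seq, run_setNat, run_setReal, hr, Function.update_of_ne hv, e] using hI v
    · rw [run_ite_neg (by
        simp only [Test.Holds, NatExpr.eval, RealExpr.eval, hr, h11, hr11, hr14, a1, a3]; exact hc)]
      rw [run_skip]
      intro v
      by_cases hv : v = k
      · subst hv
        exact ⟨fun _ h => absurd h hc, fun _ => ⟨a1, a2, a3⟩⟩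
      · have e : v < k + 1 ↔ v < k := by omega
        simpa [e] using hI v

/-- The invariant J on the list of centers and the assignment arrays is left open: for the
clustering it says that the best centers are recorded, and for the search tree, which only needs the
covered set, it is trivial. -/
theorem covB_spec {C : ℕ} {b : Bool} (hC : C ∉ (covB C true).natW) {s : Memory}
    (hG : HoldsGraph G s) (hP : (supp (s.nat 12) : Set (Fin n)) ⊆ supp (s.nat C))
    (J : List (Fin n) → (ℕ → ℕ) → (ℕ → ℕ) → (ℕ → ℝ) → Prop)
    (h0 : J [] (s.nat 18) (s.nat 19) (s.real 15))
    (hJ : ∀ (l : List (Fin n)) (c : Fin n) (r : Memory), Same (covB C b) s r → r.nat 47 0 = c →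
      c ∈ supp (s.nat C) →
      (∀ v : Fin n, (0 < r.nat 11 v ↔ v ∈ G.comp (supp (s.nat C)) c) ∧
        (0 < r.nat 11 v → G.IsDist (supp (s.nat C)) c v (r.real 11 v))) →
      J l (r.nat 18) (r.nat 19) (r.real 15) →
      J (l ++ [c]) (((updB b).run r).nat 18) (((updB b).run r).nat 19)
        (((updB b).run r).real 15)) :
    supp (((covB C b).run s).nat 13) =
      (G.netAux (supp (s.nat C)) (supp (s.nat 12)) (s.real 13 0) n).2 ∧
    J (G.netAux (supp (s.nat C)) (supp (s.nat 12)) (s.real 13 0) n).1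
      (((covB C b).run s).nat 18) (((covB C b).run s).nat 19) (((covB C b).run s).real 15) := by
  set T : Set (Fin n) := supp (s.nat C) with hT
  set P : Set (Fin n) := supp (s.nat 12) with hPdef
  set L := s.real 13 0 with hL
  have hC' : C ≠ 40 ∧ C ≠ 11 ∧ C ≠ 41 ∧ C ≠ 42 ∧ C ≠ 43 ∧ C ≠ 46 ∧ C ≠ 47 ∧ C ≠ 48 ∧ C ≠ 49 ∧
      C ≠ 13 ∧ C ≠ 18 ∧ C ≠ 19 := by
    simp [covB, distB, natW, relaxB, updB] at hC; omega
  have hw : (covB C b).natW ⊆ (covB C true).natW := by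
    cases b
    · intro a ha; simp [covB, distB, natW, relaxB, updB] at ha ⊢; omega
    · exact fun a ha => ha
  set s1 := (loop 46 0 (.setNat 13 (vr 46) (.lit 0))).run s with hs1
  have sm1 : Same _ s s1 := same_run _ s
  have hG1 : HoldsGraph G s1 := hG.same sm1 rfl
  have h13 : ∀ k, s1.nat 13 k = if k < n then 0 else s.nat 13 k := by
    refine loop_pointwise hG.size 13 (by decide) (fun _ => 0) ?_
    intro k r hk hr _ _
    simp [run_setNat, hr]
  have hrun : (covB C b).run s = (loop 47 0
    (.ite (.and (pos (.read 12 (vr 47))) (.not (pos (.read 13 (vr 47)))))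
    (.seq (distB C 47) <|
      .seq (.loop 48 0 (.ite (.and (pos (.read 11 (vr 48))) (.realLe (.read 11 (vr 48)) (rv 13)))
        (.setNat 13 (vr 48) (.lit 1)) .skip))
      (updB b))
    .skip)).run s1 := rfl
  have sm1' : ∀ r, Same (loop 47 0
    (.ite (.and (pos (.read 12 (vr 47))) (.not (pos (.read 13 (vr 47)))))
    (.seq (distB C 47) <|
      .seq (.loop 48 0 (.ite (.and (pos (.read 11 (vr 48))) (.realLe (.read 11 (vr 48)) (rv 13)))
        (.setNat 13 (vr 48) (.lit 1)) .skip))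
      (updB b))
    .skip)) s1 r → Same (covB C b) s r := by
    intro r hr
    refine ⟨fun a ha => ?_, fun a ha => ?_⟩
    · have ha' := ha
      simp only [covB, natW, List.mem_append, not_or] at ha
      rw [hr.1 a (by simpa only [natW] using ha.2), sm1.1 a (by simpa only [natW] using ha.1)]
    · simp only [covB, realW, List.mem_append, not_or] at ha
      rw [hr.2 a (by simpa only [realW, List.mem_append, not_or] using ha.2), sm1.2 a (by simp [realW])]
  rw [hrun]
  refine loop_rule (N := n) hG1.size (fun k r => supp (r.nat 13) = (G.netAux T P L k).2 ∧
    J (G.netAux T P L k).1 (r.nat 18) (r.nat 19) (r.real 15)) ?_ ?_ ?_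
  · intro k r j h; simpa using h
  · refine ⟨?_, ?_⟩
    · ext v
      simp [supp, h13, WeightedGraph.netAux]
    · rw [sm1.1 18 (by simp [natW]), sm1.1 19 (by simp [natW]), sm1.2 15 (by simp [realW])]
      exact h0
  · intro k r hk hr hsr ⟨hI1, hI2⟩
    have hsame := sm1' r hsr
    have hnw : ∀ a, a ∉ (covB C true).natW → r.nat a = s.nat a :=
      fun a ha => hsame.1 a (fun h => ha (hw h))
    have hrw : ∀ a, a ≠ 11 → a ≠ 15 → r.real a = s.real a := by
      intro a h1 h2
      refine hsame.2 a ?_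
      cases b <;> simp [covB, distB, realW, relaxB, updB, h1, h2]
    have hGr : HoldsGraph G r := hG.of_eq
      (hnw 0 (by simp [covB, distB, natW, relaxB, updB]))
      (hnw 1 (by simp [covB, distB, natW, relaxB, updB]))
      (hnw 10 (by simp [covB, distB, natW, relaxB, updB])) (hrw 0 (by decide) (by decide))
    have h12 : r.nat 12 = s.nat 12 := hnw 12 (by simp [covB, distB, natW, relaxB, updB])
    have hCr : r.nat C = s.nat C := hnw C hC
    have hmem : (⟨k, hk⟩ : Fin n) ∈ P ↔ 0 < r.nat 12 k := by rw [h12]; rfl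
    have hmem2 : (⟨k, hk⟩ : Fin n) ∈ (G.netAux T P L k).2 ↔ 0 < r.nat 13 k := by rw [← hI1]; rfl
    rw [WeightedGraph.netAux, dif_pos hk]
    by_cases hc : (⟨k, hk⟩ : Fin n) ∈ P ∧ (⟨k, hk⟩ : Fin n) ∉ (G.netAux T P L k).2
    · rw [if_pos hc, run_ite_pos (by
        rw [hmem, hmem2] at hc
        simpa [hr, Nat.one_le_iff_ne_zero, Nat.pos_iff_ne_zero] using hc), run_seq, run_seq]
      have hkT : (⟨k, hk⟩ : Fin n) ∈ supp (r.nat C) := by rw [hCr]; exact hP hc.1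
      have hd := distB_spec (S := C) (X := 47) (by simp [distB, natW, relaxB, hC'])
        (by simp [distB, natW, relaxB]) hGr (x := ⟨k, hk⟩) hr hkT
      rw [hCr] at hd hkT
      set r1 := (distB C 47).run r with hr1
      have smr1 : Same _ r r1 := same_run _ r
      have hGr1 : HoldsGraph G r1 := hGr.same smr1 rfl
      set r2 := (loop 48 0 (.ite (.and (pos (.read 11 (vr 48)))
        (.realLe (.read 11 (vr 48)) (rv 13))) (.setNat 13 (vr 48) (.lit 1)) .skip)).run r1 with hr2
      have smr2 : Same _ r1 r2 := same_run _ r1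
      have hL1 : r1.real 13 0 = L := by
        rw [smr1.2 13 (by simp [distB, realW, relaxB]), hrw 13 (by decide) (by decide)]
      have h131 : r1.nat 13 = r.nat 13 := smr1.1 13 (by simp [distB, natW, relaxB])
      have key : ∀ j, r2.nat 13 j = if j < n then
          (if 0 < r1.nat 11 j ∧ r1.real 11 j ≤ L then 1 else r1.nat 13 j) else r1.nat 13 j := by
        refine loop_pointwise hGr1.size 13 (by decide)
          (fun j => if 0 < r1.nat 11 j ∧ r1.real 11 j ≤ L then 1 else r1.nat 13 j) ?_
        intro j q hj hq hsq h13q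
        have q11 : q.nat 11 = r1.nat 11 := hsq.1 11 (by simp [natW])
        have qr11 : q.real 11 = r1.real 11 := hsq.2 11 (by simp [realW])
        have qr13 : q.real 13 = r1.real 13 := hsq.2 13 (by simp [realW])
        by_cases hjc : 0 < r1.nat 11 j ∧ r1.real 11 j ≤ L
        · rw [run_ite_pos (by
            simp only [Test.Holds, NatExpr.eval, RealExpr.eval, hq, q11, qr11, qr13, hL1]
            exact hjc), run_setNat, if_pos hjc]
          simp [hq]
        · rw [run_ite_neg (by
            simp only [Test.Holds, NatExpr.eval, RealExpr.eval, hq, q11, qr11, qr13, hL1]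
            exact hjc), run_skip, if_neg hjc, ← h13q, Function.update_eq_self]
      have hr2same : Same (covB C b) s r2 := by
        refine ⟨fun a ha => ?_, fun a ha => ?_⟩
        · have ha' := ha
          simp only [covB, natW, List.mem_append, List.mem_cons, not_or] at ha
          rw [smr2.1 a (by simp only [natW, List.mem_append, List.mem_cons, not_or]; exact ha.2.2.1.2.1),
            smr1.1 a ha.2.2.1.1, hsame.1 a ha']
        · have ha' := ha
          simp only [covB, realW, List.mem_append, not_or] at ha
          rw [smr2.2 a (by simp [realW]), smr1.2 a ha.2.1.1, hsame.2 a ha']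
      refine ⟨?_, ?_⟩
      · have h13u : ((updB b).run r2).nat 13 = r2.nat 13 := by
          cases b
          · rfl
          · exact run_nat (by simp [updB, natW]) _
        rw [h13u]
        ext v
        rw [mem_supp, key v, if_pos v.2, h131, Set.mem_union, ← hI1, mem_supp]
        have hv := hd v
        change _ ↔ _ ∨ G.Near T L ⟨k, hk⟩ v
        constructor
        · intro h
          split_ifs at h with h1
          · exact Or.inr ((WeightedGraph.near_iff_of_isDist (hv.2 h1.1)).2 h1.2)
          · exact Or.inl h
        · intro h
          split_ifs with h1
          · exact Nat.one_pos
          · rcases h with h | ⟨l, hl, hw⟩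
            · exact h
            · have h2 := hv.1.2 ⟨l, hw⟩
              exact absurd ⟨h2, ((hv.2 h2).2 l hw).trans hl⟩ h1
      · refine hJ _ ⟨k, hk⟩ r2 hr2same ?_ hkT ?_ ?_
        · rw [smr2.1 47 (by simp [natW]), smr1.1 47 (by simp [distB, natW, relaxB]), hr]
        · rw [smr2.1 11 (by simp [natW]), smr2.2 11 (by simp [realW])]
          exact hd
        · rw [smr2.1 18 (by simp [natW]), smr2.1 19 (by simp [natW]), smr2.2 15 (by simp [realW]),
            smr1.1 18 (by simp [distB, natW, relaxB]), smr1.1 19 (by simp [distB, natW, relaxB]),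
            smr1.2 15 (by simp [distB, realW, relaxB])]
          exact hI2
    · rw [if_neg hc, run_ite_neg (by
        rw [hmem, hmem2] at hc
        simpa [hr, Nat.one_le_iff_ne_zero, Nat.pos_iff_ne_zero] using hc), run_skip]
      exact ⟨hI1, hI2⟩

end Block

/-! ### Building a clustering level by level -/

namespace WeightedGraph

variable {n : ℕ} {G : WeightedGraph (Fin n)}

/-- The arrays `has`, `asg` and `best` hold for every vertex the best center in the list `cs`. -/
def AssignsBest (val : Fin n → Fin n → ℝ → Prop) (cs : List (Fin n)) (has asg : ℕ → ℕ)
    (best : ℕ → ℝ) : Prop :=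
  ∀ v : Fin n, (∀ c ∈ cs, ∀ l, val c v l → 0 < has v) ∧
    (0 < has v → ∃ u : Fin n, asg v = u ∧ Best val cs v u (best v) ∧ ∀ l, val u v l → best v ≤ l)

/-- Only the values of listed centers matter. This allows levels of other vertices to be raised
afterwards. -/
theorem AssignsBest.congr {val val' : Fin n → Fin n → ℝ → Prop} {cs : List (Fin n)}
    {has asg : ℕ → ℕ} {best : ℕ → ℝ} (h : AssignsBest val cs has asg best)
    (hv : ∀ c ∈ cs, ∀ v l, val c v l ↔ val' c v l) : AssignsBest val' cs has asg best := by
  intro v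
  refine ⟨fun c hc l hl => (h v).1 c hc l ((hv c hc v l).2 hl), fun hh => ?_⟩
  obtain ⟨u, h1, ⟨l₁, l₂, e, h2, h3, h4⟩, h5⟩ := (h v).2 hh
  subst e
  exact ⟨u, h1, ⟨l₁, l₂, rfl, (hv u (by simp) _ _).1 h2,
    fun c hc l hl => h3 c hc l ((hv c (by simp [hc]) _ _).2 hl),
    fun c hc l hl => h4 c hc l ((hv c (by simp [hc]) _ _).2 hl)⟩,
    fun l hl => h5 l ((hv u (by simp) _ _).2 hl)⟩

/-- Processing the centers online: the incumbent keeps its place when values are equal, which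
matches the rule that the first of the best centers wins. -/
theorem AssignsBest.append {val : Fin n → Fin n → ℝ → Prop} {cs : List (Fin n)}
    {has asg has' asg' : ℕ → ℕ} {best best' : ℕ → ℝ} (h : AssignsBest val cs has asg best)
    (c : Fin n) (reached : ℕ → ℕ) (dist : ℕ → ℝ) (off : ℝ)
    (hr : ∀ v : Fin n, ∀ l, val c v l → 0 < reached v ∧ off + dist v ≤ l)
    (hr' : ∀ v : Fin n, 0 < reached v → val c v (off + dist v))
    (hnew : ∀ v : Fin n, 0 < reached v ∧ ¬ (0 < has v ∧ best v ≤ off + dist v) →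
      has' v = 1 ∧ asg' v = c ∧ best' v = off + dist v)
    (hold : ∀ v : Fin n, ¬ (0 < reached v ∧ ¬ (0 < has v ∧ best v ≤ off + dist v)) →
      has' v = has v ∧ asg' v = asg v ∧ best' v = best v) :
    AssignsBest val (cs ++ [c]) has' asg' best' := by
  intro v
  obtain ⟨h1, h2⟩ := h v
  by_cases hc : 0 < reached v ∧ ¬ (0 < has v ∧ best v ≤ off + dist v)
  · obtain ⟨e1, e2, e3⟩ := hnew v hc
    refine ⟨fun _ _ _ _ => by omega, fun _ => ⟨c, e2, ⟨cs, [], rfl, ?_, ?_, by simp⟩, ?_⟩⟩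
    · rw [e3]; exact hr' v hc.1
    · intro c' hc' l hl
      have h3 := h1 c' hc' l hl
      obtain ⟨u, -, hb, hm⟩ := h2 h3
      have h4 := hb.le hm hc' hl
      have h5 : ¬ best v ≤ off + dist v := fun h => hc.2 ⟨h3, h⟩
      rw [e3]; linarith
    · intro l hl
      rw [e3]; exact (hr v l hl).2
  · obtain ⟨e1, e2, e3⟩ := hold v hc
    rw [e1, e2, e3]
    refine ⟨fun c' hc' l hl => ?_, fun hh => ?_⟩
    · rcases List.mem_append.1 hc' with hc' | hc'
      · exact h1 c' hc' l hl
      · rw [List.mem_singleton.1 hc'] at hl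
        by_contra hcon
        exact hc ⟨(hr v l hl).1, fun h => hcon h.1⟩
    · obtain ⟨u, h3, ⟨l₁, l₂, e, h4, h5, h6⟩, h7⟩ := h2 hh
      refine ⟨u, h3, ⟨l₁, l₂ ++ [c], by simp [e], h4, h5, fun c' hc' l hl => ?_⟩, h7⟩
      rcases List.mem_append.1 hc' with hc' | hc'
      · exact h6 c' hc' l hl
      · rw [List.mem_singleton.1 hc'] at hl
        have h8 := hr v l hl
        by_contra hcon
        exact hc ⟨h8.1, fun h => hcon (h.2.trans h8.2)⟩

/-- The state inside level `j`: `S` is the set of vertices of level at least `j`, the components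
inside `D` have been dealt with, and the vertices of `N` are left for the next level. -/
structure LevelState (G : WeightedGraph (Fin n)) (Bd : ℕ → Set (Fin n) → Prop) (L : ℝ)
    (H S D N : Set (Fin n)) (j : ℕ) (lev : Fin n → ℕ) (cs : List (Fin n)) (has asg : ℕ → ℕ)
    (best : ℕ → ℝ) : Prop where
  sub : N ⊆ D
  closed : ∀ u v, u ∈ D → G.graph.Adj u v → v ∈ S → v ∈ D
  D_sub : D ⊆ S
  memS : ∀ v, v ∈ S ↔ v ∈ H ∧ j ≤ lev v
  memN : ∀ v, v ∈ N ↔ v ∈ H ∧ lev v = j + 1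
  le : ∀ v ∈ H, lev v ≤ j + 1
  mem : ∀ c ∈ cs, c ∈ H ∧ lev c ≤ j ∧ (lev c = j → c ∈ D)
  sorted : cs.Pairwise fun c c' => lev c ≤ lev c'
  cover : ∀ v ∈ H, lev v < j ∨ (v ∈ D ∧ v ∉ N) →
    ∃ c ∈ cs, lev c = lev v ∧ G.Near (levelSet H lev (lev v)) L c v
  packing : ∀ (i : ℕ) (A : Finset (Fin n)) (M : ℕ), (∀ c ∈ A, c ∈ cs ∧ lev c = i) →
    (∀ c ∈ A, ∀ c' ∈ A, G.Near (levelSet H lev i) (M * L) c c') → A.card ≤ M + 1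
  best : AssignsBest (G.Val L H lev) cs has asg best
  bd : ∀ z ∈ N, Bd (j + 1) (G.comp N z)
  progress : D.Nonempty → ∃ v ∈ D, v ∉ N

/-- N and T lie in different components of S, so joining T to N does not enlarge the components of
N. -/
theorem comp_union_eq {S D N T : Set (Fin n)} (hD : ∀ u v, u ∈ D → G.graph.Adj u v → v ∈ S → v ∈ D)
    (hN : N ⊆ D) (hT : T ⊆ S) (hTD : ∀ v ∈ T, v ∉ D) {z : Fin n} (hz : z ∈ N) :
    G.comp (N ∪ T) z = G.comp N z := by
  ext v
  constructor
  · rintro ⟨l, hl⟩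
    refine ⟨l, hl.of_closed (fun u w hu ha hw => ?_) hz⟩
    rcases hw with hw | hw
    · exact hw
    · exact absurd (hD u w (hN hu) ha (hT hw)) (hTD w hw)
  · rintro ⟨l, hl⟩
    exact ⟨l, hl.mono Set.subset_union_left⟩

theorem comp_union_eq_right {S D N T : Set (Fin n)}
    (hD : ∀ u v, u ∈ D → G.graph.Adj u v → v ∈ S → v ∈ D)
    (hN : N ⊆ D) (hT : T ⊆ S) (hTD : ∀ v ∈ T, v ∉ D) {z : Fin n} (hz : z ∈ T) :
    G.comp (N ∪ T) z = G.comp T z := by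
  ext v
  constructor
  · rintro ⟨l, hl⟩
    refine ⟨l, hl.of_closed (fun u w hu ha hw => ?_) hz⟩
    rcases hw with hw | hw
    · exact absurd (hD w u (hN hw) ha.symm (hT hu)) (hTD u hu)
    · exact hw
  · rintro ⟨l, hl⟩
    exact ⟨l, hl.mono Set.subset_union_right⟩

open Classical in
/-- The levels after the component `C` has been dealt with. -/
noncomputable def raise (lev : Fin n → ℕ) (T : Set (Fin n)) (j : ℕ) (v : Fin n) : ℕ :=
  if v ∈ T then j + 1 else lev v

/-- Raising vertices from level j to j + 1 is invisible to level sets up to j. As all centers chosen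
so far have level at most j, their values, the covering and the packing are unaffected. -/
theorem levelSet_raise {H T : Set (Fin n)} {lev : Fin n → ℕ} {j i : ℕ} (hT : ∀ v ∈ T, lev v = j)
    (hi : i ≤ j) : levelSet H (raise lev T j) i = levelSet H lev i := by
  ext v
  simp only [levelSet, raise, Set.mem_ofPred_eq]
  split_ifs with h
  · have := hT v h
    constructor <;> rintro ⟨h1, h2⟩ <;> exact ⟨h1, by omega⟩
  · rfl

/-- Dealing with one component. -/
theorem LevelState.step {Bd : ℕ → Set (Fin n) → Prop} {L : ℝ} {H S D N : Set (Fin n)} {j : ℕ}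
    {lev : Fin n → ℕ} {cs : List (Fin n)} {has asg has' asg' : ℕ → ℕ} {best best' : ℕ → ℝ}
    (h : LevelState G Bd L H S D N j lev cs has asg best) (hL : 0 ≤ L) {z x y : Fin n}
    (hzD : z ∉ D) (hx : x ∈ G.comp S z)
    {d : ℝ} (hd : G.IsDist (G.comp S z) x y d)
    (hbest : AssignsBest (G.Val L H lev) (cs ++ G.net L (G.comp S z) x y) has' asg' best')
    (hbd : ∀ u ∈ G.comp S z \ G.cov L (G.comp S z) x y,
      Bd (j + 1) (G.comp (G.comp S z \ G.cov L (G.comp S z) x y) u)) :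
    LevelState G Bd L H S (D ∪ G.comp S z) (N ∪ (G.comp S z \ G.cov L (G.comp S z) x y)) j
      (raise lev (G.comp S z \ G.cov L (G.comp S z) x y) j) (cs ++ G.net L (G.comp S z) x y)
      has' asg' best' := by
  set C := G.comp S z with hC
  set T := C \ G.cov L C x y with hT
  have hCS : C ⊆ S := comp_subset S z
  -- D is a union of components of S, and z lies outside it.
  have hCD : ∀ v ∈ C, v ∉ D := by
    rintro v ⟨l, hl⟩ hv
    exact hzD (hl.symm.of_closed h.closed hv).right_mem
  have hlevC : ∀ v ∈ C, lev v = j := by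
    intro v hv
    have h1 := (h.memS v).1 (hCS hv)
    have h2 := h.le v h1.1
    by_contra hne
    exact hCD v hv (h.sub ((h.memN v).2 ⟨h1.1, by omega⟩))
  have hlevT : ∀ v ∈ T, lev v = j := fun v hv => hlevC v hv.1
  have hSj : levelSet H lev j = S := by
    ext v; rw [h.memS v]; rfl
  have hset : ∀ i ≤ j, levelSet H (raise lev T j) i = levelSet H lev i := fun i hi =>
    levelSet_raise hlevT hi
  have hnetC : ∀ c ∈ G.net L C x y, c ∈ C := fun c hc => mem_of_mem_net hc
  -- Centers cover themselves, since L ≥ 0, so they are never handed to the next level.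
  have hnetT : ∀ c ∈ G.net L C x y, c ∉ T := fun c hc hcT =>
    hcT.2 (mem_cov.2 ⟨c, hc, Near.refl hL (hnetC c hc)⟩)
  have hcsT : ∀ c ∈ cs, c ∉ T := fun c hc hcT =>
    hCD c hcT.1 ((h.mem c hc).2.2 (hlevT c hcT))
  have hraise : ∀ c ∈ cs ++ G.net L C x y, raise lev T j c = lev c := by
    intro c hc
    refine if_neg ?_
    rcases List.mem_append.1 hc with hc | hc
    · exact hcsT c hc
    · exact hnetT c hc
  have hlevcs : ∀ c ∈ cs ++ G.net L C x y, lev c ≤ j := by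
    intro c hc
    rcases List.mem_append.1 hc with hc | hc
    · exact (h.mem c hc).2.1
    · exact (hlevC c (hnetC c hc)).le
  refine ⟨?_, ?_, ?_, ?_, ?_, ?_, ?_, ?_, ?_, ?_, ?_, ?_, ?_⟩
  · exact Set.union_subset_union h.sub (fun v hv => hv.1)
  · rintro u v (hu | hu) ha hv
    · exact Or.inl (h.closed u v hu ha hv)
    · exact Or.inr (comp_adj hu ha hv)
  · exact Set.union_subset h.D_sub hCS
  · intro v
    rw [h.memS v]
    have := congrArg (fun X => v ∈ X) (hset j le_rfl)
    simpa [levelSet] using this.symm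
  · intro v
    simp only [Set.mem_union, raise]
    split_ifs with hv
    · simp [hv, ((h.memS v).1 (hCS hv.1)).1]
    · simp [hv, h.memN v]
  · intro v hv
    simp only [raise]
    split_ifs
    · exact le_rfl
    · exact h.le v hv
  · intro c hc
    rw [hraise c hc]
    refine ⟨?_, hlevcs c hc, fun hcj => ?_⟩
    · rcases List.mem_append.1 hc with hc | hc
      · exact (h.mem c hc).1
      · exact ((h.memS c).1 (hCS (hnetC c hc))).1
    · rcases List.mem_append.1 hc with hc | hc
      · exact Or.inl ((h.mem c hc).2.2 hcj)
      · exact Or.inr (hnetC c hc)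
  · have hp : (cs ++ G.net L C x y).Pairwise fun c c' => lev c ≤ lev c' := by
      rw [List.pairwise_append]
      refine ⟨h.sorted, List.Pairwise.imp_of_mem (fun {a b} ha hb _ => ?_)
        (netAux_spec C (G.pathSet C x y) L n).2.2.1, fun a ha b hb => ?_⟩
      · rw [hlevC a (hnetC a ha), hlevC b (hnetC b hb)]
      · rw [hlevC b (hnetC b hb)]; exact (h.mem a ha).2.1
    refine List.Pairwise.imp_of_mem (fun {a b} ha hb hab => ?_) hp
    rw [hraise a ha, hraise b hb]; exact hab
  · intro v hvH hv
    have hvT : v ∉ T := by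
      intro hvT
      rcases hv with hv | hv
      · simp only [raise, if_pos hvT] at hv; omega
      · exact hv.2 (Or.inr hvT)
    have hlv : raise lev T j v = lev v := if_neg hvT
    have hlvj : lev v ≤ j := by
      rcases hv with hv | ⟨hv, hvN⟩
      · rw [hlv] at hv; omega
      · have h1 := h.le v hvH
        by_contra hne
        exact hvN (Or.inl ((h.memN v).2 ⟨hvH, by omega⟩))
    rw [hlv, hset _ hlvj]
    by_cases hvC : v ∈ C
    · have hcov : v ∈ G.cov L C x y := by
        by_contra hcon; exact hvT ⟨hvC, hcon⟩
      obtain ⟨c, hc, hn⟩ := mem_cov.1 hcov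
      refine ⟨c, by simp [hc], ?_, ?_⟩
      · rw [hraise c (by simp [hc]), hlevC c (hnetC c hc), hlevC v hvC]
      · rw [hlevC v hvC, hSj]; exact hn.mono hCS le_rfl
    · obtain ⟨c, hc, e, hn⟩ := h.cover v hvH (by
        rcases hv with hv | ⟨hv, hvN⟩
        · left; rwa [hlv] at hv
        · exact Or.inr ⟨hv.resolve_right hvC, fun h => hvN (Or.inl h)⟩)
      exact ⟨c, by simp [hc], by rw [hraise c (by simp [hc]), e], hn⟩
  · intro i A M hA hclose
    rcases A.eq_empty_or_nonempty with rfl | ⟨a, ha⟩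
    · simp
    have hij : i ≤ j := by
      have := hA a ha
      rw [hraise a this.1] at this
      exact this.2 ▸ hlevcs a this.1
    rw [hset i hij] at hclose
    have hA' : ∀ c ∈ A, c ∈ cs ++ G.net L C x y ∧ lev c = i := fun c hc => by
      have := hA c hc
      rw [hraise c this.1] at this
      exact this
    by_cases hall : ∀ c ∈ A, c ∈ cs
    · exact h.packing i A M (fun c hc => ⟨hall c hc, (hA' c hc).2⟩) hclose
    -- If A contains a new center, closeness inside S puts all of A into the component C. The old
    -- centers of level j lie in D, so A consists of centers of one net and `net_packing` applies.
    · push Not at hall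
      obtain ⟨c, hc, hcc⟩ := hall
      have hcn : c ∈ G.net L C x y := (List.mem_append.1 (hA' c hc).1).resolve_left hcc
      have hi : i = j := by rw [← (hA' c hc).2, hlevC c (hnetC c hcn)]
      subst hi
      rw [hSj] at hclose
      have hAC : ∀ c' ∈ A, c' ∈ C := by
        intro c' hc'
        obtain ⟨l, hl, hw⟩ := hclose c hc c' hc'
        exact (hw.in_comp (z := z) (hnetC c hcn)).right_mem
      refine net_packing hL hd A M (fun c' hc' => ?_) (fun c' hc' c'' hc'' => ?_)
      · refine (List.mem_append.1 (hA' c' hc').1).resolve_left fun hcs => ?_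
        exact hCD c' (hAC c' hc') ((h.mem c' hcs).2.2 (hA' c' hc').2)
      · obtain ⟨l, hl, hw⟩ := hclose c' hc' c'' hc''
        exact ⟨l, hl, hw.in_comp (hAC c' hc')⟩
  · refine hbest.congr fun c hc v l => ?_
    unfold Val
    rw [hraise c hc, hset _ (hlevcs c hc)]
  · rintro u (hu | hu)
    · rw [comp_union_eq h.closed h.sub (fun v hv => hCS hv.1) (fun v hv => hCD v hv.1) hu]
      exact h.bd u hu
    · rw [comp_union_eq_right h.closed h.sub (fun v hv => hCS hv.1) (fun v hv => hCD v hv.1) hu]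
      exact hbd u hu
  · intro _
    -- The end x of the path is covered. So even a poor choice deletes a vertex, which bounds the
    -- number of levels by n.
    have hxC : x ∈ G.cov L C x y := pathSet_subset_cov hL C x y (mem_pathAux hx n)
    refine ⟨x, Or.inr hx, ?_⟩
    rintro (hxN | hxN)
    · exact hCD x hx (h.sub hxN)
    · exact hxN.2 hxC

/-- The state between two levels. -/
def LevelStart (G : WeightedGraph (Fin n)) (Bd : ℕ → Set (Fin n) → Prop) (L : ℝ)
    (H S : Set (Fin n)) (j : ℕ) (lev : Fin n → ℕ) (cs : List (Fin n)) (has asg : ℕ → ℕ)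
    (best : ℕ → ℝ) : Prop :=
  LevelState G Bd L H S ∅ ∅ j lev cs has asg best ∧ ∀ z ∈ S, Bd j (G.comp S z)

/-- When D has become all of S, the leftover N is exactly the set of level at least j + 1 and serves
as the next S. -/
theorem LevelState.finish {Bd : ℕ → Set (Fin n) → Prop} {L : ℝ} {H S N : Set (Fin n)} {j : ℕ}
    {lev : Fin n → ℕ} {cs : List (Fin n)} {has asg : ℕ → ℕ} {best : ℕ → ℝ}
    (h : LevelState G Bd L H S S N j lev cs has asg best) :
    LevelStart G Bd L H N (j + 1) lev cs has asg best ∧ (S.Nonempty → N.ncard < S.ncard) := by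
  refine ⟨⟨⟨fun _ h => h, fun _ _ h => absurd h (Set.notMem_empty _), Set.empty_subset _, ?_, ?_,
    fun v hv => (h.le v hv).trans (by omega), ?_, h.sorted, ?_, h.packing, h.best,
    fun z hz => absurd hz (Set.notMem_empty _), fun ⟨v, hv⟩ => absurd hv (Set.notMem_empty _)⟩,
    h.bd⟩, fun hS => ?_⟩
  · intro v
    rw [h.memN v]
    constructor
    · rintro ⟨h1, h2⟩; exact ⟨h1, h2.ge⟩
    · rintro ⟨h1, h2⟩; exact ⟨h1, le_antisymm (h.le v h1) h2⟩
  · intro v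
    constructor
    · intro hv; exact absurd hv (Set.notMem_empty _)
    · rintro ⟨h1, h2⟩; have := h.le v h1; omega
  · intro c hc
    have := h.mem c hc
    exact ⟨this.1, by omega, fun e => by omega⟩
  · rintro v hv (hlt | ⟨h1, -⟩)
    · refine h.cover v hv ?_
      by_cases h1 : lev v < j
      · exact Or.inl h1
      · refine Or.inr ⟨(h.memS v).2 ⟨hv, by omega⟩, fun hN => ?_⟩
        have := (h.memN v).1 hN
        omega
    · exact absurd h1 (Set.notMem_empty _)
  · obtain ⟨v, hv, hvN⟩ := h.progress hS
    refine Set.ncard_lt_ncard ?_ (Set.toFinite S)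
    exact ⟨h.sub, fun hs => hvN (hs hv)⟩

theorem LevelStart.init (Bd : ℕ → Set (Fin n) → Prop) (L : ℝ) (H : Set (Fin n)) (has asg : ℕ → ℕ)
    (best : ℕ → ℝ) (hhas : ∀ v : Fin n, has v = 0) (hbd : ∀ z ∈ H, Bd 0 (G.comp H z)) :
    LevelStart G Bd L H H 0 (fun _ => 0) [] has asg best := by
  refine ⟨⟨fun _ h => h, fun _ _ h => absurd h (Set.notMem_empty _), Set.empty_subset _, by simp,
    by simp, by simp, by simp, by simp, by simp, ?_, ?_, fun z hz => absurd hz (Set.notMem_empty _),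
    fun ⟨v, hv⟩ => absurd hv (Set.notMem_empty _)⟩, hbd⟩
  · intro i A M hA _
    rcases A.eq_empty_or_nonempty with rfl | ⟨a, ha⟩
    · simp
    · exact absurd (hA a ha).1 (by simp)
  · intro v
    refine ⟨by simp, fun h => absurd h (by rw [hhas v]; simp)⟩

/-- With nothing left, every vertex of H has been covered in its level, hence received an offer and
has a recorded best center. -/
theorem LevelStart.clustering {Bd : ℕ → Set (Fin n) → Prop} {L : ℝ} {H : Set (Fin n)} {j : ℕ}
    {lev : Fin n → ℕ} {cs : List (Fin n)} {has asg : ℕ → ℕ} {best : ℕ → ℝ}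
    (h : LevelStart G Bd L H ∅ j lev cs has asg best) (hL : 0 ≤ L) (a : Fin n → Fin n)
    (ha : ∀ v ∈ H, asg v = a v) :
    Clustering G L H lev cs a (fun v => best v) j := by
  have hlt : ∀ v ∈ H, lev v < j := fun v hv => by
    by_contra hcon
    exact absurd ((h.1.memS v).2 ⟨hv, by omega⟩) (Set.notMem_empty _)
  have key : ∀ v ∈ H, Best (G.Val L H lev) cs v (a v) (best v) ∧
      ∀ l, G.Val L H lev (a v) v l → best v ≤ l := by
    intro v hv
    obtain ⟨c, hc, e, l, hl, hw⟩ := h.1.cover v hv (Or.inl (hlt v hv))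
    have hhas := (h.1.best v).1 c hc _ ⟨l, by rw [e]; exact hw, rfl⟩
    obtain ⟨u, h1, h2, h3⟩ := (h.1.best v).2 hhas
    have : u = a v := Fin.ext (by rw [← h1, ha v hv])
    rw [← this]
    exact ⟨h2, h3⟩
  exact ⟨hL, fun c hc => (h.1.mem c hc).1, h.1.sorted, fun v hv => h.1.cover v hv (Or.inl (hlt v hv)),
    h.1.packing, fun v hv => (key v hv).1, fun v hv => (key v hv).2, hlt⟩

/-- Every assigned center is a vertex. -/
theorem LevelStart.exists_asg {Bd : ℕ → Set (Fin n) → Prop} {L : ℝ} {H : Set (Fin n)} {j : ℕ}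
    {lev : Fin n → ℕ} {cs : List (Fin n)} {has asg : ℕ → ℕ} {best : ℕ → ℝ}
    (h : LevelStart G Bd L H ∅ j lev cs has asg best) :
    ∃ a : Fin n → Fin n, ∀ v ∈ H, asg v = a v := by
  have key : ∀ v, ∃ u : Fin n, v ∈ H → asg v = u := by
    intro v
    by_cases hv : v ∈ H
    · have hlt : lev v < j := by
        by_contra hcon
        exact absurd ((h.1.memS v).2 ⟨hv, by omega⟩) (Set.notMem_empty _)
      obtain ⟨c, hc, e, l, hl, hw⟩ := h.1.cover v hv (Or.inl hlt)
      have hhas := (h.1.best v).1 c hc _ ⟨l, by rw [e]; exact hw, rfl⟩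
      obtain ⟨u, h1, -, -⟩ := (h.1.best v).2 hhas
      exact ⟨u, fun _ => h1⟩
    · exact ⟨v, fun h => absurd h hv⟩
  choose a ha using key
  exact ⟨a, ha⟩

end WeightedGraph

/-! ### The program for one component -/

namespace Block

/-- The arrays that `p` may write: those in `l`, the counters below `hi`, and scratch arrays. -/
def Within (p : Block) (l : List ℕ) (hi : ℕ) (lr : List ℕ) : Prop :=
  (∀ a ∈ p.natW, a ∈ l ∨ (40 ≤ a ∧ a < hi) ∨ 100 ≤ a) ∧ ∀ a ∈ p.realW, a ∈ lr ∨ 100 ≤ a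

instance (p : Block) (l : List ℕ) (hi : ℕ) (lr : List ℕ) : Decidable (p.Within l hi lr) :=
  inferInstanceAs (Decidable (_ ∧ _))

theorem Within.mono {p : Block} {l l' : List ℕ} {hi hi' : ℕ} {lr lr' : List ℕ}
    (h : p.Within l hi lr) (hl : l ⊆ l') (hhi : hi ≤ hi') (hlr : lr ⊆ lr') :
    p.Within l' hi' lr' := by
  refine ⟨fun a ha => ?_, fun a ha => (h.2 a ha).imp_left fun h => hlr h⟩
  rcases h.1 a ha with h | h | h
  · exact Or.inl (hl h)
  · exact Or.inr (Or.inl ⟨h.1, by omega⟩)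
  · exact Or.inr (Or.inr h)

theorem Within.seq {p q : Block} {l : List ℕ} {hi : ℕ} {lr : List ℕ} (hp : p.Within l hi lr)
    (hq : q.Within l hi lr) : (seq p q).Within l hi lr :=
  ⟨fun a ha => (List.mem_append.1 ha).elim (hp.1 a) (hq.1 a),
    fun a ha => (List.mem_append.1 ha).elim (hp.2 a) (hq.2 a)⟩

theorem Within.ite {p q : Block} {t : Test} {l : List ℕ} {hi : ℕ} {lr : List ℕ}
    (hp : p.Within l hi lr) (hq : q.Within l hi lr) : (ite t p q).Within l hi lr :=
  ⟨fun a ha => (List.mem_append.1 ha).elim (hp.1 a) (hq.1 a),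
    fun a ha => (List.mem_append.1 ha).elim (hp.2 a) (hq.2 a)⟩

theorem Within.loop {p : Block} {x b : ℕ} {l : List ℕ} {hi : ℕ} {lr : List ℕ}
    (hp : p.Within l hi lr) (h1 : 40 ≤ x) (h2 : x < hi) : (loop x b p).Within l hi lr :=
  ⟨fun a ha => (List.mem_cons.1 ha).elim (fun e => Or.inr (Or.inl ⟨e ▸ h1, e ▸ h2⟩)) (hp.1 a),
    hp.2⟩

theorem Within.notMem {p : Block} {l : List ℕ} {hi : ℕ} {lr : List ℕ} (hp : p.Within l hi lr)
    {a : ℕ} (h1 : a ∉ l) (h2 : (a < 40 ∨ hi ≤ a) ∧ a < 100) : a ∉ p.natW := by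
  intro ha
  rcases hp.1 a ha with h | h | h
  · exact h1 h
  · omega
  · omega

theorem Within.nat {p : Block} {l : List ℕ} {hi : ℕ} {lr : List ℕ} (hp : p.Within l hi lr)
    {s r : Memory} (h : Same p s r) {a : ℕ} (h1 : a ∉ l) (h2 : (a < 40 ∨ hi ≤ a) ∧ a < 100) :
    r.nat a = s.nat a := h.1 a (hp.notMem h1 h2)

theorem Within.real {p : Block} {l : List ℕ} {hi : ℕ} {lr : List ℕ} (hp : p.Within l hi lr)
    {s r : Memory} (h : Same p s r) {a : ℕ} (h1 : a ∉ lr) (h2 : a < 100) :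
    r.real a = s.real a := by
  refine h.2 a fun ha => ?_
  rcases hp.2 a ha with h | h
  · exact h1 h
  · omega

theorem Within.graph {n : ℕ} {G : WeightedGraph (Fin n)} {p : Block} {l : List ℕ} {hi : ℕ}
    {lr : List ℕ} (hp : p.Within l hi lr) {s r : Memory} (h : Same p s r) (hG : HoldsGraph G s)
    (h0 : 0 ∉ l) (h1 : 1 ∉ l) (h10 : 10 ∉ l) (hr : 0 ∉ lr) : HoldsGraph G r :=
  hG.of_eq (hp.nat h h0 (by omega)) (hp.nat h h1 (by omega)) (hp.nat h h10 (by omega))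
    (hp.real h hr (by omega))

/-- The precomputed tables agree. -/
def Env (s r : Memory) : Prop :=
  ∀ a, a = 0 ∨ a = 3 ∨ (70 ≤ a ∧ a < 100) → r.nat a = s.nat a

theorem Within.env {p : Block} {l : List ℕ} {hi : ℕ} {lr : List ℕ} (hp : p.Within l hi lr)
    {s₀ s r : Memory} (h : Same p s r) (hE : Env s₀ s) (hl : ∀ a ∈ l, a ≠ 0 ∧ a ≠ 3 ∧ a < 70)
    (hhi : hi ≤ 70) : Env s₀ r := by
  intro a ha
  rw [← hE a ha]
  refine hp.nat h (fun hm => ?_) (by omega)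
  have := hl a hm
  omega

/-- Blocks that write nothing but scratch arrays and the outcome of the choice. -/
abbrev Chooser (ch : Block) : Prop := ch.Within [11, 12, 13, 25, 26] 50 [11, 12]

/-- The block `ch` chooses two vertices of the component in array `14` such that property `Bd`
is handed down to the components of what the path between them does not cover. The level is in
variable `29`, the radius in real variable `13`, and variable `51` holds a vertex of the component. -/
def ChooseSpec {n : ℕ} (G : WeightedGraph (Fin n)) (ch : Block) (s₀ : Memory)
    (Bd : ℝ → ℕ → Set (Fin n) → Prop) : Prop :=
  ∀ (r : Memory) (z : Fin n) (C : Set (Fin n)), HoldsGraph G r → Env s₀ r → 0 ≤ r.real 13 0 →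
    r.nat 51 0 = z → supp (r.nat 14) = C → z ∈ C → G.comp C z = C →
    ∃ x y : Fin n, (ch.run r).nat 25 0 = x ∧ (ch.run r).nat 26 0 = y ∧ x ∈ C ∧ y ∈ C ∧
      (Bd (r.real 13 0) (r.nat 29 0) C → ∀ u ∈ C \ G.cov (r.real 13 0) C x y,
        Bd (r.real 13 0) (r.nat 29 0 + 1) (G.comp (C \ G.cov (r.real 13 0) C x y) u))

/-- Cover along a shortest path between the vertices in variables `X` and `Y`. -/
def coverB (C X Y : ℕ) (b : Bool) : Block := .seq (pathB C X Y) (covB C b)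

/-- Deal with the component of the vertex in variable `51`. -/
def compB (ch : Block) : Block :=
  .ite (.and (pos (.read 17 (vr 51))) (.not (pos (.read 15 (vr 51)))))
    (.seq (distB 17 51) <|
      .seq (.loop 52 0 (.seq (.setNat 14 (vr 52) (.read 11 (vr 52)))
        (.ite (pos (.read 11 (vr 52))) (.setNat 15 (vr 52) (.lit 1)) .skip))) <|
      .seq ch <|
      .seq (coverB 14 25 26 true) <|
      .loop 53 0 (.ite (.and (pos (.read 14 (vr 53))) (.not (pos (.read 13 (vr 53)))))
        (.setNat 16 (vr 53) (.lit 1)) .skip))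
    .skip

variable {n : ℕ} {G : WeightedGraph (Fin n)}

theorem coverB_within (b : Bool) : (coverB 14 25 26 b).Within [11, 12, 13, 18, 19] 50 [11, 12, 15] := by
  cases b <;> decide

theorem compB_within {ch : Block} (h : Chooser ch) :
    (compB ch).Within [11, 12, 13, 14, 15, 16, 18, 19, 25, 26] 54 [11, 12, 15] := by
  refine .ite (.seq (by decide) (.seq (by decide) (.seq ?_ (.seq ?_ (by decide))))) (by decide)
  · exact h.mono (by decide) (by decide) (by decide)
  · exact (coverB_within true).mono (by decide) (by decide) (by decide)

theorem coverB_spec {C X Y : ℕ} {b : Bool} (hC : C ∉ (coverB C X Y true).natW)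
    (hX : X ∉ (coverB C X Y true).natW) (hY : Y ∉ (coverB C X Y true).natW) {s : Memory}
    (hG : HoldsGraph G s) {x y : Fin n} (hx : s.nat X 0 = x) (hy : s.nat Y 0 = y)
    (hxC : x ∈ supp (s.nat C)) (hyC : y ∈ G.comp (supp (s.nat C)) x)
    (J : List (Fin n) → (ℕ → ℕ) → (ℕ → ℕ) → (ℕ → ℝ) → Prop)
    (h0 : J [] (s.nat 18) (s.nat 19) (s.real 15))
    (hJ : ∀ (l : List (Fin n)) (c : Fin n) (r : Memory), r.nat 0 = s.nat 0 →
      r.real 14 = s.real 14 → r.nat 47 0 = c → c ∈ supp (s.nat C) →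
      (∀ v : Fin n, (0 < r.nat 11 v ↔ v ∈ G.comp (supp (s.nat C)) c) ∧
        (0 < r.nat 11 v → G.IsDist (supp (s.nat C)) c v (r.real 11 v))) →
      J l (r.nat 18) (r.nat 19) (r.real 15) →
      J (l ++ [c]) (((updB b).run r).nat 18) (((updB b).run r).nat 19)
        (((updB b).run r).real 15)) :
    supp (((coverB C X Y b).run s).nat 13) = G.cov (s.real 13 0) (supp (s.nat C)) x y ∧
    J (G.net (s.real 13 0) (supp (s.nat C)) x y) (((coverB C X Y b).run s).nat 18)
      (((coverB C X Y b).run s).nat 19) (((coverB C X Y b).run s).real 15) := by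
  simp only [coverB, natW, List.mem_append, not_or] at hC hX hY
  rw [coverB, run_seq]
  have hp := pathB_spec (C := C) (X := X) (Y := Y) hC.1 hX.1 hY.1 hG hx hy hxC hyC
  set r := (pathB C X Y).run s with hr
  have hs : Same _ s r := same_run _ s
  have hGr : HoldsGraph G r := hG.same hs rfl
  have e14 : r.nat C = s.nat C := hs.1 _ hC.1
  have e1 : r.nat 18 = s.nat 18 := hs.1 _ (by simp [pathB, distB, relaxB, natW])
  have e2 : r.nat 19 = s.nat 19 := hs.1 _ (by simp [pathB, distB, relaxB, natW])
  have e3 : r.real 15 = s.real 15 := hs.2 _ (by simp [pathB, distB, relaxB, realW])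
  have e4 : r.real 13 = s.real 13 := hs.2 _ (by simp [pathB, distB, relaxB, realW])
  have e5 : r.nat 0 = s.nat 0 := hs.1 _ (by simp [pathB, distB, relaxB, natW])
  have e6 : r.real 14 = s.real 14 := hs.2 _ (by simp [pathB, distB, relaxB, realW])
  have := covB_spec (C := C) (b := b) hC.2 hGr
    (by rw [hp, e14]; exact WeightedGraph.pathSet_subset _ x y) J (by rw [e1, e2, e3]; exact h0)
    (fun l c q hq h47 hc hd hJl => hJ l c q
      (by rw [hq.1 0 (by cases b <;> simp [covB, distB, relaxB, updB, natW]), e5])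
      (by rw [hq.2 14 (by cases b <;> simp [covB, distB, relaxB, updB, realW]), e6]) h47
      (by rwa [e14] at hc) (by rwa [e14] at hd) hJl)
  rw [hp, e14, e4] at this
  exact this

end Block

namespace WeightedGraph

variable {n : ℕ} {G : WeightedGraph (Fin n)}

/-- A vertex of the component of level j + 1 would lie in N, hence in D, and would pull z into D. -/
theorem LevelState.comp_facts {Bd : ℕ → Set (Fin n) → Prop} {L : ℝ} {H S D N : Set (Fin n)} {j : ℕ}
    {lev : Fin n → ℕ} {cs : List (Fin n)} {has asg : ℕ → ℕ} {best : ℕ → ℝ}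
    (h : LevelState G Bd L H S D N j lev cs has asg best) {z : Fin n} (hzD : z ∉ D) :
    (∀ v ∈ G.comp S z, lev v = j) ∧ levelSet H lev j = S := by
  refine ⟨fun v hv => ?_, ?_⟩
  · have h1 := (h.memS v).1 (comp_subset S z hv)
    have h2 := h.le v h1.1
    by_contra hne
    obtain ⟨l, hl⟩ := hv
    exact hzD (hl.symm.of_closed h.closed (h.sub ((h.memN v).2 ⟨h1.1, by omega⟩))).right_mem
  · ext v; rw [h.memS v]; rfl

/-- The memory inside a level. -/
def LevelMem (G : WeightedGraph (Fin n)) (Bd : ℝ → ℕ → Set (Fin n) → Prop) (H : Set (Fin n))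
    (s : Memory) : Prop :=
  0 ≤ s.real 13 0 ∧ s.real 14 0 = 2 * s.real 13 0 * s.nat 29 0 ∧
  ∃ lev cs, LevelState G (Bd (s.real 13 0)) (s.real 13 0) H (supp (s.nat 17)) (supp (s.nat 15))
    (supp (s.nat 16)) (s.nat 29 0) lev cs (s.nat 18) (s.nat 19) (s.real 15)

end WeightedGraph

namespace Block

variable {n : ℕ} {G : WeightedGraph (Fin n)}

/-- The update of centers implements the extension of the list of centers. -/
theorem updB_assignsBest {val : Fin n → Fin n → ℝ → Prop} {cs : List (Fin n)} {c : Fin n}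
    {C : Set (Fin n)} {off : ℝ} {r : Memory} (h0 : r.nat 0 0 = n) (hoff : r.real 14 0 = off)
    (h47 : r.nat 47 0 = c)
    (hval : ∀ v l, val c v l ↔ ∃ d, G.WalkIn C c v d ∧ l = off + d)
    (hd : ∀ v : Fin n, (0 < r.nat 11 v ↔ v ∈ G.comp C c) ∧
        (0 < r.nat 11 v → G.IsDist C c v (r.real 11 v)))
    (h : WeightedGraph.AssignsBest val cs (r.nat 18) (r.nat 19) (r.real 15)) :
    WeightedGraph.AssignsBest val (cs ++ [c]) (((updB true).run r).nat 18) (((updB true).run r).nat 19)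
        (((updB true).run r).real 15) := by
  refine h.append c (r.nat 11) (r.real 11) off ?_ ?_ ?_ ?_
  · intro v l hl
    obtain ⟨d, hw, rfl⟩ := (hval v l).1 hl
    have h1 := (hd v).1.2 ⟨d, hw⟩
    exact ⟨h1, by linarith [((hd v).2 h1).2 d hw]⟩
  · intro v hv
    exact (hval v _).2 ⟨_, ((hd v).2 hv).1, rfl⟩
  · intro v hv
    have := (updB_spec h0 v).1 (by rw [hoff]; exact hv)
    rw [h47, hoff] at this
    exact this
  · intro v hv
    exact (updB_spec h0 v).2 (by rw [hoff]; exact hv)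

/-- One run of the program realizes one application of `LevelState.step`. If z is not in the current
set, or its component has been dealt with, nothing happens. -/
theorem compB_spec {ch : Block} (hch : Chooser ch) {s₀ : Memory}
    {Bd : ℝ → ℕ → Set (Fin n) → Prop} (hspec : ChooseSpec G ch s₀ Bd) {H : Set (Fin n)} {s : Memory}
    (hG : HoldsGraph G s) (hE : Env s₀ s) {z : Fin n} (hz : s.nat 51 0 = z)
    (h : G.LevelMem Bd H s)
    (hBd : ∀ u ∈ (supp (s.nat 17) : Set (Fin n)),
      Bd (s.real 13 0) (s.nat 29 0) (G.comp (supp (s.nat 17)) u)) :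
    G.LevelMem Bd H ((compB ch).run s) ∧
    (supp (s.nat 15) : Set (Fin n)) ⊆ supp (((compB ch).run s).nat 15) ∧
    (z ∈ (supp (s.nat 17) : Set (Fin n)) → z ∈ (supp (((compB ch).run s).nat 15) : Set (Fin n))) := by
  obtain ⟨hL, hoff, lev, cs, hst⟩ := h
  by_cases hc : 0 < s.nat 17 z ∧ ¬ 0 < s.nat 15 z
  swap
  · rw [compB, run_ite_neg (by simp only [Test.Holds, NatExpr.eval, hz]; exact hc), run_skip]
    refine ⟨⟨hL, hoff, lev, cs, hst⟩, subset_rfl, fun h => ?_⟩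
    by_contra hcon
    exact hc ⟨h, hcon⟩
  rw [compB, run_ite_pos (by simp only [Test.Holds, NatExpr.eval, hz]; exact hc)]
  set S : Set (Fin n) := supp (s.nat 17) with hS
  set L := s.real 13 0 with hLdef
  set j := s.nat 29 0 with hj
  have hzS : z ∈ S := hc.1
  have hzD : z ∉ (supp (s.nat 15) : Set (Fin n)) := hc.2
  set C := G.comp S z with hC
  obtain ⟨hlevC, hSj⟩ := hst.comp_facts hzD
  rw [← hC] at hlevC
  -- the component
  have hd := distB_spec (S := 17) (X := 51) (by decide) (by decide) hG hz hzS
  rw [run_seq]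
  set s1 := (distB 17 51).run s with hs1
  have w1 : (distB 17 51).Within [11] 44 [11] := by decide
  have m1 : Same _ s s1 := same_run _ s
  have hG1 := w1.graph m1 hG (by decide) (by decide) (by decide) (by decide)
  have hE1 := w1.env m1 hE (by decide) (by decide)
  -- mark it
  rw [run_seq]
  set b2 : Block := .loop 52 0 (.seq (.setNat 14 (vr 52) (.read 11 (vr 52)))
        (.ite (pos (.read 11 (vr 52))) (.setNat 15 (vr 52) (.lit 1)) .skip)) with hb2
  set s2 := b2.run s1 with hs2
  have w2 : b2.Within [14, 15] 53 [] := by rw [hb2]; decide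
  have m2 : Same _ s1 s2 := same_run _ s1
  have h14 : ∀ k, s2.nat 14 k = if k < n then s1.nat 11 k else s1.nat 14 k := by
    refine loop_pointwise hG1.size 14 (by decide) (fun k => s1.nat 11 k) ?_
    intro k r hk hr hsr _
    have e : r.nat 11 = s1.nat 11 := hsr.1 11 (by decide)
    by_cases hp : 0 < s1.nat 11 k
    · rw [run_seq, run_setNat, run_ite_pos (by simpa [hr, e, Nat.one_le_iff_ne_zero, Nat.pos_iff_ne_zero] using hp)]
      simp [run_setNat, hr, e]
    · rw [run_seq, run_setNat, run_ite_neg (by simpa [hr, e, Nat.one_le_iff_ne_zero, Nat.pos_iff_ne_zero] using hp)]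
      simp [run_skip, hr, e]
  have h15 : ∀ k, s2.nat 15 k = if k < n then (if 0 < s1.nat 11 k then 1 else s1.nat 15 k)
      else s1.nat 15 k := by
    refine loop_pointwise hG1.size 15 (by decide)
      (fun k => if 0 < s1.nat 11 k then 1 else s1.nat 15 k) ?_
    intro k r hk hr hsr hk15
    have e : r.nat 11 = s1.nat 11 := hsr.1 11 (by decide)
    by_cases hp : 0 < s1.nat 11 k
    · rw [run_seq, run_setNat, run_ite_pos (by simpa [hr, e, Nat.one_le_iff_ne_zero, Nat.pos_iff_ne_zero] using hp), if_pos hp]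
      simp [run_setNat, hr]
    · rw [run_seq, run_setNat, run_ite_neg (by simpa [hr, e, Nat.one_le_iff_ne_zero, Nat.pos_iff_ne_zero] using hp), if_neg hp, ← hk15,
        Function.update_eq_self]
      simp [run_skip]
  have hC14 : supp (s2.nat 14) = C := by
    ext v; rw [mem_supp, h14, if_pos v.2]; exact (hd v).1
  have hD15 : supp (s2.nat 15) = supp (s.nat 15) ∪ C := by
    ext v
    rw [mem_supp, h15, if_pos v.2, Set.mem_union, mem_supp, ← (hd v).1,
      w1.nat m1 (a := 15) (by decide) (by decide)]
    split_ifs with h1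
    · simp [h1]
    · simp [h1]
  have hG2 := w2.graph m2 hG1 (by decide) (by decide) (by decide) (by decide)
  have hE2 := w2.env m2 hE1 (by decide) (by decide)
  have L2 : s2.real 13 = s.real 13 := by
    rw [w2.real m2 (by decide) (by decide), w1.real m1 (by decide) (by decide)]
  have z2 : s2.nat 51 0 = z := by rw [m2.1 51 (by rw [hb2]; decide), m1.1 51 (by decide), hz]
  have j2 : s2.nat 29 = s.nat 29 := by
    rw [w2.nat m2 (by decide) (by decide), w1.nat m1 (by decide) (by decide)]
  have hzC : z ∈ C := WeightedGraph.mem_comp_self hzS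
  -- the choice
  obtain ⟨x, y, hx, hy, hxC, hyC, hb⟩ := hspec s2 z C hG2 hE2 (by rw [L2]; exact hL) z2 hC14 hzC
    (WeightedGraph.comp_comp hzC)
  rw [L2, j2] at hb
  rw [run_seq]
  set s3 := ch.run s2 with hs3
  have m3 : Same _ s2 s3 := same_run _ s2
  have hG3 := hch.graph m3 hG2 (by decide) (by decide) (by decide) (by decide)
  have e314 : s3.nat 14 = s2.nat 14 := hch.nat m3 (by decide) (by decide)
  have hcx : G.comp C x = C := by rw [WeightedGraph.comp_eq_of_mem (z := z)
    (by rw [WeightedGraph.comp_comp hzC]; exact hxC), WeightedGraph.comp_comp hzC]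
  have hxC3 : x ∈ supp (s3.nat 14) := by rw [e314, hC14]; exact hxC
  have hyC3 : y ∈ G.comp (supp (s3.nat 14)) x := by rw [e314, hC14, hcx]; exact hyC
  have hdist := distB_spec (S := 14) (X := 25) (by decide) (by decide) hG3 hx hxC3 y
  replace hdist := hdist.2 (hdist.1.2 hyC3)
  have L3 : s3.real 13 = s.real 13 := by rw [hch.real m3 (by decide) (by decide), L2]
  have off3 : s3.real 14 = s.real 14 := by
    rw [hch.real m3 (by decide) (by decide), w2.real m2 (by decide) (by decide),
      w1.real m1 (by decide) (by decide)]
  have has3 : s3.nat 18 = s.nat 18 := by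
    rw [hch.nat m3 (by decide) (by decide), w2.nat m2 (by decide) (by decide),
      w1.nat m1 (by decide) (by decide)]
  have asg3 : s3.nat 19 = s.nat 19 := by
    rw [hch.nat m3 (by decide) (by decide), w2.nat m2 (by decide) (by decide),
      w1.nat m1 (by decide) (by decide)]
  have best3 : s3.real 15 = s.real 15 := by
    rw [hch.real m3 (by decide) (by decide), w2.real m2 (by decide) (by decide),
      w1.real m1 (by decide) (by decide)]
  -- The program measures distances in the component, while values are defined in the set of level
  -- at least j. The two agree, because a walk in that set that starts in the component stays in it.
  have hcov := coverB_spec (C := 14) (X := 25) (Y := 26) (b := true) (by decide) (by decide)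
    (by decide) hG3 hx hy hxC3 hyC3
    (fun l has asg best => WeightedGraph.AssignsBest (G.Val L H lev) (cs ++ l) has asg best)
    (by simpa [has3, asg3, best3] using hst.best)
    (by
      intro l c r hr0 hr14 h47 hcC hdr hJ
      rw [← List.append_assoc]
      refine updB_assignsBest (G := G) (C := supp (s3.nat 14)) (off := 2 * L * j)
        (by rw [hr0, hG3.size]) (by rw [hr14, off3, hoff]) h47 ?_ hdr hJ
      intro v l'
      rw [e314, hC14] at hcC ⊢
      unfold WeightedGraph.Val
      rw [hlevC c hcC, hSj]
      constructor
      · rintro ⟨d, hw, rfl⟩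
        exact ⟨d, hw.in_comp hcC, rfl⟩
      · rintro ⟨d, hw, rfl⟩
        exact ⟨d, hw.mono (WeightedGraph.comp_subset S z), rfl⟩)
  rw [e314, hC14] at hdist
  rw [e314, hC14, L3] at hcov
  rw [run_seq]
  set s4 := (coverB 14 25 26 true).run s3 with hs4
  have w4 := coverB_within true
  have m4 : Same _ s3 s4 := same_run _ s3
  have hG4 := w4.graph m4 hG3 (by decide) (by decide) (by decide) (by decide)
  have e414 : s4.nat 14 = s2.nat 14 := by rw [w4.nat m4 (by decide) (by decide), e314]
  set b5 : Block := .loop 53 0 (.ite (.and (pos (.read 14 (vr 53))) (.not (pos (.read 13 (vr 53)))))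
        (.setNat 16 (vr 53) (.lit 1)) .skip) with hb5
  set s5 := b5.run s4 with hs5
  have w5 : b5.Within [16] 54 [] := by rw [hb5]; decide
  have m5 : Same _ s4 s5 := same_run _ s4
  have h16 : ∀ k, s5.nat 16 k = if k < n then
      (if 0 < s4.nat 14 k ∧ ¬ 0 < s4.nat 13 k then 1 else s4.nat 16 k) else s4.nat 16 k := by
    refine loop_pointwise hG4.size 16 (by decide)
      (fun k => if 0 < s4.nat 14 k ∧ ¬ 0 < s4.nat 13 k then 1 else s4.nat 16 k) ?_
    intro k r hk hr hsr hk16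
    have e1 : r.nat 14 = s4.nat 14 := hsr.1 14 (by decide)
    have e2 : r.nat 13 = s4.nat 13 := hsr.1 13 (by decide)
    by_cases hp : 0 < s4.nat 14 k ∧ ¬ 0 < s4.nat 13 k
    · rw [run_ite_pos (by simp only [Test.Holds, NatExpr.eval, hr, e1, e2]; exact hp), if_pos hp]
      simp [run_setNat, hr]
    · rw [run_ite_neg (by simp only [Test.Holds, NatExpr.eval, hr, e1, e2]; exact hp), if_neg hp,
        ← hk16, Function.update_eq_self]
      simp [run_skip]
  have hN16 : supp (s5.nat 16) = supp (s.nat 16) ∪ (C \ G.cov L C x y) := by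
    ext v
    have e16 : s4.nat 16 = s.nat 16 := by
      rw [w4.nat m4 (by decide) (by decide), hch.nat m3 (by decide) (by decide),
        w2.nat m2 (by decide) (by decide), w1.nat m1 (by decide) (by decide)]
    rw [mem_supp, h16, if_pos v.2, Set.mem_union, mem_supp, Set.mem_sdiff, ← hcov.1, ← hC14, ← e414,
      e16, mem_supp, mem_supp]
    split_ifs with h1
    · simp [h1]
    · exact ⟨Or.inl, fun h => h.elim id fun h => absurd h h1⟩
  have f15 : s5.nat 15 = s2.nat 15 := by
    rw [w5.nat m5 (by decide) (by decide), w4.nat m4 (by decide) (by decide),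
      hch.nat m3 (by decide) (by decide)]
  have f17 : s5.nat 17 = s.nat 17 := by
    rw [w5.nat m5 (by decide) (by decide), w4.nat m4 (by decide) (by decide),
      hch.nat m3 (by decide) (by decide), w2.nat m2 (by decide) (by decide),
      w1.nat m1 (by decide) (by decide)]
  have f29 : s5.nat 29 = s.nat 29 := by
    rw [w5.nat m5 (by decide) (by decide), w4.nat m4 (by decide) (by decide),
      hch.nat m3 (by decide) (by decide), j2]
  have f13 : s5.real 13 = s.real 13 := by
    rw [w5.real m5 (by decide) (by decide), w4.real m4 (by decide) (by decide), L3]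
  have f14 : s5.real 14 = s.real 14 := by
    rw [w5.real m5 (by decide) (by decide), w4.real m4 (by decide) (by decide), off3]
  have f18 : s5.nat 18 = s4.nat 18 := w5.nat m5 (by decide) (by decide)
  have f19 : s5.nat 19 = s4.nat 19 := w5.nat m5 (by decide) (by decide)
  have fb : s5.real 15 = s4.real 15 := w5.real m5 (by decide) (by decide)
  have hstep := hst.step hL hzD hxC hdist hcov.2 (hb (hBd z hzS))
  refine ⟨⟨by rw [f13]; exact hL, by rw [f13, f14, f29]; exact hoff,
    WeightedGraph.raise lev (C \ G.cov L C x y) j, cs ++ G.net L C x y, ?_⟩, ?_, fun _ => ?_⟩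
  · rw [f13, f17, f15, hD15, hN16, f29, f18, f19, fb]
    exact hstep
  · rw [f15, hD15]; exact Set.subset_union_left
  · rw [f15, hD15]; exact Or.inr hzC

end Block

/-! ### The program for one level and for the clustering -/

namespace WeightedGraph

variable {n : ℕ}

/-- The memory between two levels. -/
def StartMem (G : WeightedGraph (Fin n)) (Bd : ℝ → ℕ → Set (Fin n) → Prop) (H : Set (Fin n))
    (s : Memory) : Prop :=
  0 ≤ s.real 13 0 ∧ s.real 14 0 = 2 * s.real 13 0 * s.nat 29 0 ∧
  ∃ lev cs, LevelStart G (Bd (s.real 13 0)) (s.real 13 0) H (supp (s.nat 17)) (s.nat 29 0) lev cs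
    (s.nat 18) (s.nat 19) (s.real 15)

end WeightedGraph

namespace Block

/-- Deal with one level: all components of the set in array `17`. -/
def levelB (ch : Block) : Block :=
  .seq (.loop 50 0 (.seq (.setNat 15 (vr 50) (.lit 0)) (.setNat 16 (vr 50) (.lit 0)))) <|
  .seq (.loop 51 0 (compB ch)) <|
  .seq (.loop 54 0 (.setNat 17 (vr 54) (.read 16 (vr 54)))) <|
  .seq (.setReal 14 (.lit 0) (.add (rv 14) (.add (rv 13) (rv 13))))
    (.setNat 29 (.lit 0) (.add (vr 29) (.lit 1)))

/-- Set variable `28` if the set in array `A` is not empty. -/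
def anyB (A x : ℕ) : Block :=
  .seq (.setNat 28 (.lit 0) (.lit 0))
    (.loop x 0 (.ite (pos (.read A (vr x))) (.setNat 28 (.lit 0) (.lit 1)) .skip))

/-- Compute a clustering of the vertices that array `20` does not mark. Variable `30` is raised to
the number of levels. -/
def partB (ch : Block) : Block :=
  .seq (.loop 55 0 (.seq (.setNat 17 (vr 55) (.sub (.lit 1) (.read 20 (vr 55))))
    (.setNat 18 (vr 55) (.lit 0)))) <|
  .seq (.setReal 14 (.lit 0) .zero) <|
  .seq (.setNat 29 (.lit 0) (.lit 0)) <|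
  .seq (.loop 56 0 (.seq (anyB 17 57) (.ite (pos (vr 28)) (levelB ch) .skip))) <|
  .ite (.natLe (vr 29) (vr 30)) .skip (.setNat 30 (.lit 0) (vr 29))

variable {n : ℕ} {G : WeightedGraph (Fin n)}

theorem levelB_within {ch : Block} (h : Chooser ch) :
    (levelB ch).Within [11, 12, 13, 14, 15, 16, 17, 18, 19, 25, 26, 29] 55 [11, 12, 14, 15] :=
  .seq (by decide) (.seq (.loop ((compB_within h).mono (by decide) (by decide) (by decide))
    (by decide) (by decide)) (by decide))

theorem partB_within {ch : Block} (h : Chooser ch) :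
    (partB ch).Within [11, 12, 13, 14, 15, 16, 17, 18, 19, 25, 26, 28, 29, 30] 58
      [11, 12, 14, 15] :=
  .seq (by decide) (.seq (by decide) (.seq (by decide) (.seq (.loop (.seq (by decide)
    (.ite ((levelB_within h).mono (by decide) (by decide) (by decide)) (by decide)))
    (by decide) (by decide)) (by decide))))

/-- Real variable `14` carries the constant 2Lj and is advanced by L + L, since the machine cannot
multiply. -/
theorem levelB_spec {ch : Block} (hch : Chooser ch) {s₀ : Memory}
    {Bd : ℝ → ℕ → Set (Fin n) → Prop} (hspec : ChooseSpec G ch s₀ Bd) {H : Set (Fin n)} {s : Memory}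
    (hG : HoldsGraph G s) (hE : Env s₀ s) (h : G.StartMem Bd H s) :
    G.StartMem Bd H ((levelB ch).run s) ∧ ((levelB ch).run s).nat 29 0 = s.nat 29 0 + 1 ∧
    ((supp (s.nat 17) : Set (Fin n)).Nonempty →
      (supp (((levelB ch).run s).nat 17) : Set (Fin n)).ncard <
        (supp (s.nat 17) : Set (Fin n)).ncard) := by
  obtain ⟨hL, hoff, lev, cs, hst, hbd⟩ := h
  rw [levelB, run_seq]
  set b1 : Block := .loop 50 0 (.seq (.setNat 15 (vr 50) (.lit 0)) (.setNat 16 (vr 50) (.lit 0)))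
    with hb1
  set s1 := b1.run s with hs1
  have w1 : b1.Within [15, 16] 51 [] := by rw [hb1]; decide
  have m1 : Same _ s s1 := same_run _ s
  have h15 : ∀ k, s1.nat 15 k = if k < n then 0 else s.nat 15 k := by
    refine loop_pointwise hG.size 15 (by decide) (fun _ => 0) ?_
    intro k r hk hr _ _
    simp [run_seq, run_setNat, hr]
  have h16 : ∀ k, s1.nat 16 k = if k < n then 0 else s.nat 16 k := by
    refine loop_pointwise hG.size 16 (by decide) (fun _ => 0) ?_
    intro k r hk hr _ _
    simp [run_seq, run_setNat, hr]
  have hG1 := w1.graph m1 hG (by decide) (by decide) (by decide) (by decide)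
  have hE1 := w1.env m1 hE (by decide) (by decide)
  have e15 : (supp (s1.nat 15) : Set (Fin n)) = ∅ := by
    ext v; simp [mem_supp, h15]
  have e16 : (supp (s1.nat 16) : Set (Fin n)) = ∅ := by
    ext v; simp [mem_supp, h16]
  have e17 : s1.nat 17 = s.nat 17 := w1.nat m1 (by decide) (by decide)
  have e29 : s1.nat 29 = s.nat 29 := w1.nat m1 (by decide) (by decide)
  have e13 : s1.real 13 = s.real 13 := w1.real m1 (by decide) (by decide)
  have hst1 : G.LevelMem Bd H s1 := by
    refine ⟨by rw [e13]; exact hL, by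
      rw [e13, e29, w1.real m1 (a := 14) (by decide) (by decide)]; exact hoff, lev, cs, ?_⟩
    rw [e13, e17, e15, e16, e29, w1.nat m1 (a := 18) (by decide) (by decide),
      w1.nat m1 (a := 19) (by decide) (by decide), w1.real m1 (a := 15) (by decide) (by decide)]
    exact hst
  rw [run_seq]
  set s2 := (loop 51 0 (compB ch)).run s1 with hs2
  have wc := compB_within hch
  have w2 : (loop 51 0 (compB ch)).Within [11, 12, 13, 14, 15, 16, 18, 19, 25, 26] 54 [11, 12, 15] :=
    .loop wc (by decide) (by decide)
  have m2 : Same _ s1 s2 := same_run _ s1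
  have main : G.LevelMem Bd H s2 ∧ ∀ v : Fin n, (v : ℕ) < n → v ∈ (supp (s1.nat 17) : Set (Fin n)) →
      v ∈ (supp (s2.nat 15) : Set (Fin n)) := by
    refine loop_rule (N := n) hG1.size (fun k r => G.LevelMem Bd H r ∧ ∀ v : Fin n, (v : ℕ) < k →
      v ∈ (supp (s1.nat 17) : Set (Fin n)) → v ∈ (supp (r.nat 15) : Set (Fin n))) ?_ ?_ ?_
    · intro k r j h
      simpa [WeightedGraph.LevelMem] using h
    · exact ⟨hst1, fun v h => absurd h (by omega)⟩
    · intro k r hk hr hsr ⟨hr1, hr2⟩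
      have hGr := w2.graph hsr hG1 (by decide) (by decide) (by decide) (by decide)
      have hEr := w2.env hsr hE1 (by decide) (by decide)
      have r17 : r.nat 17 = s.nat 17 := by rw [w2.nat hsr (by decide) (by decide), e17]
      have r29 : r.nat 29 = s.nat 29 := by rw [w2.nat hsr (by decide) (by decide), e29]
      have r13 : r.real 13 = s.real 13 := by rw [w2.real hsr (by decide) (by decide), e13]
      obtain ⟨c1, c2, c3⟩ := compB_spec hch hspec hGr hEr (z := ⟨k, hk⟩) hr hr1
        (by rw [r17, r29, r13]; exact hbd)
      refine ⟨c1, fun v hv hvS => ?_⟩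
      rcases Nat.lt_succ_iff_lt_or_eq.1 hv with hlt | heq
      · exact c2 (hr2 v hlt hvS)
      · have : v = ⟨k, hk⟩ := Fin.ext heq
        rw [this] at hvS ⊢
        exact c3 (by rw [r17, ← e17]; exact hvS)
  obtain ⟨⟨hL2, hoff2, lev2, cs2, hst2⟩, hall⟩ := main
  have hG2 := w2.graph m2 hG1 (by decide) (by decide) (by decide) (by decide)
  have f17 : s2.nat 17 = s.nat 17 := by rw [w2.nat m2 (by decide) (by decide), e17]
  have f29 : s2.nat 29 = s.nat 29 := by rw [w2.nat m2 (by decide) (by decide), e29]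
  have hDS : supp (s2.nat 15) = (supp (s2.nat 17) : Set (Fin n)) :=
    Set.Subset.antisymm hst2.D_sub fun v hv => hall v v.2 (by rw [e17, ← f17]; exact hv)
  rw [hDS] at hst2
  obtain ⟨hfin, hcard⟩ := hst2.finish
  rw [run_seq]
  set b3 : Block := .loop 54 0 (.setNat 17 (vr 54) (.read 16 (vr 54))) with hb3
  set s3 := b3.run s2 with hs3
  have w3 : b3.Within [17] 55 [] := by rw [hb3]; decide
  have m3 : Same _ s2 s3 := same_run _ s2
  have h17 : ∀ k, s3.nat 17 k = if k < n then s2.nat 16 k else s2.nat 17 k := by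
    refine loop_pointwise hG2.size 17 (by decide) (fun k => s2.nat 16 k) ?_
    intro k r hk hr hsr _
    have : r.nat 16 = s2.nat 16 := hsr.1 16 (by decide)
    simp [run_setNat, hr, this]
  have g17 : (supp (s3.nat 17) : Set (Fin n)) = supp (s2.nat 16) := by
    ext v; rw [mem_supp, h17, if_pos v.2]; rfl
  have g29 : s3.nat 29 = s2.nat 29 := w3.nat m3 (by decide) (by decide)
  have g13 : s3.real 13 = s2.real 13 := w3.real m3 (by decide) (by decide)
  have g14 : s3.real 14 = s2.real 14 := w3.real m3 (by decide) (by decide)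
  have g18 : s3.nat 18 = s2.nat 18 := w3.nat m3 (by decide) (by decide)
  have g19 : s3.nat 19 = s2.nat 19 := w3.nat m3 (by decide) (by decide)
  have g15 : s3.real 15 = s2.real 15 := w3.real m3 (by decide) (by decide)
  rw [run_seq, run_setReal, run_setNat]
  refine ⟨⟨?_, ?_, lev2, cs2, ?_⟩, ?_, ?_⟩
  · simpa [g13] using hL2
  · simp [g13, g14, g29, hoff2]; ring
  · simpa [g13, g17, g29, g18, g19, g15] using hfin
  · simp [g29, f29]
  · intro hne
    simpa [g17, f17] using hcard (by rw [f17]; exact hne)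

theorem anyB_spec {A x : ℕ} (hA : A ≠ 28 ∧ A ≠ x) (hx : x ≠ 28) {s : Memory} (h0 : s.nat 0 0 = n) :
    0 < ((anyB A x).run s).nat 28 0 ↔ (supp (s.nat A) : Set (Fin n)).Nonempty := by
  have := loop_rule (x := x) (b := 0) (p := .ite (pos (.read A (vr x)))
    (.setNat 28 (.lit 0) (.lit 1)) .skip) (s := s.writeNat 28 0 0) (N := n) (by simpa using h0)
    (fun k r => 0 < r.nat 28 0 ↔ ∃ v : Fin n, (v : ℕ) < k ∧ 0 < s.nat A v) ?_ ?_ ?_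
  · rw [anyB, run_seq, run_setNat]
    simp only [NatExpr.eval]
    rw [this]
    exact ⟨fun ⟨v, _, hv⟩ => ⟨v, hv⟩, fun ⟨v, hv⟩ => ⟨v, v.2, hv⟩⟩
  · intro k r j h; simpa [hx.symm] using h
  · simp
  · intro k r hk hr hsr hI
    have rA : r.nat A = s.nat A := by
      rw [hsr.1 A (by simp [natW, hA])]
      simp [hA]
    by_cases hp : 0 < s.nat A k
    · rw [run_ite_pos (by simp only [Test.Holds, NatExpr.eval, hr, rA]; exact hp), run_setNat]
      simp only [NatExpr.eval, Memory.nat_writeNat, if_true, Function.update_self, Nat.one_pos,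
        true_iff]
      exact ⟨⟨k, hk⟩, Nat.lt_succ_self k, hp⟩
    · rw [run_ite_neg (by simp only [Test.Holds, NatExpr.eval, hr, rA]; exact hp), run_skip, hI]
      refine exists_congr fun v => ⟨fun h => ⟨by omega, h.2⟩, fun h => ⟨?_, h.2⟩⟩
      have h2 := h.2
      rcases Nat.lt_succ_iff_lt_or_eq.1 h.1 with h | h
      · exact h
      · rw [h] at h2; exact absurd h2 hp

/-- The number of levels is read off at the end instead of being prescribed. It is at most k as soon
as the property handed down by the chooser rules out nonempty components on level k. -/
theorem partB_spec {ch : Block} (hch : Chooser ch) {s₀ : Memory}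
    {Bd : ℝ → ℕ → Set (Fin n) → Prop} (hspec : ChooseSpec G ch s₀ Bd) {s : Memory}
    {H : Set (Fin n)} (hH : ∀ v : Fin n, v ∈ H ↔ s.nat 20 v = 0)
    (hG : HoldsGraph G s) (hE : Env s₀ s) (hL : 0 ≤ s.real 13 0)
    (hBd : ∀ z ∈ H, Bd (s.real 13 0) 0 (G.comp H z)) :
    ∃ (lev : Fin n → ℕ) (cs : List (Fin n)) (a : Fin n → Fin n),
      (∀ v ∈ H, ((partB ch).run s).nat 19 v = a v) ∧
      WeightedGraph.Clustering G (s.real 13 0) H lev cs a (fun v => ((partB ch).run s).real 15 v)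
        (((partB ch).run s).nat 29 0) ∧
      ((partB ch).run s).real 14 0 = 2 * s.real 13 0 * ((partB ch).run s).nat 29 0 ∧
      ((partB ch).run s).nat 30 0 = max (s.nat 30 0) (((partB ch).run s).nat 29 0) ∧
      ∀ k, (∀ C, C.Nonempty → ¬ Bd (s.real 13 0) k C) → ((partB ch).run s).nat 29 0 ≤ k := by
  rw [partB, run_seq]
  set b1 : Block := .loop 55 0 (.seq (.setNat 17 (vr 55) (.sub (.lit 1) (.read 20 (vr 55))))
    (.setNat 18 (vr 55) (.lit 0))) with hb1
  set s1 := b1.run s with hs1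
  have w1 : b1.Within [17, 18] 56 [] := by rw [hb1]; decide
  have m1 : Same _ s s1 := same_run _ s
  have h17 : ∀ k, s1.nat 17 k = if k < n then 1 - s.nat 20 k else s.nat 17 k := by
    refine loop_pointwise hG.size 17 (by decide) (fun k => 1 - s.nat 20 k) ?_
    intro k r hk hr hsr _
    have : r.nat 20 = s.nat 20 := hsr.1 20 (by decide)
    simp [run_seq, run_setNat, hr, this]
  have h18 : ∀ k, s1.nat 18 k = if k < n then 0 else s.nat 18 k := by
    refine loop_pointwise hG.size 18 (by decide) (fun _ => 0) ?_
    intro k r hk hr _ _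
    simp [run_seq, run_setNat, hr]
  have hG1 := w1.graph m1 hG (by decide) (by decide) (by decide) (by decide)
  have hE1 := w1.env m1 hE (by decide) (by decide)
  have e17 : (supp (s1.nat 17) : Set (Fin n)) = H := by
    ext v; rw [mem_supp, h17, if_pos v.2, hH v]; omega
  have e13 : s1.real 13 = s.real 13 := w1.real m1 (by decide) (by decide)
  rw [run_seq, run_setReal, run_seq, run_setNat]
  set s2 := ((s1.writeReal 14 ((NatExpr.lit 0).eval s1) (RealExpr.zero.eval s1)).writeNat 29
    ((NatExpr.lit 0).eval (s1.writeReal 14 ((NatExpr.lit 0).eval s1) (RealExpr.zero.eval s1)))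
    ((NatExpr.lit 0).eval (s1.writeReal 14 ((NatExpr.lit 0).eval s1) (RealExpr.zero.eval s1))))
    with hs2
  have hG2 : HoldsGraph G s2 := by refine hG1.of_eq ?_ ?_ ?_ ?_ <;> simp [hs2]
  have hE2 : Env s₀ s2 := by
    intro a ha
    rw [← hE1 a ha]
    have : a ≠ 29 := by omega
    simp [hs2, this]
  have e2 : s2.real 13 = s.real 13 := by simp [hs2, e13]
  have n29 : s2.nat 29 0 = 0 := by simp [hs2]
  have n30 : s2.nat 30 = s.nat 30 := by
    simp only [hs2, Memory.nat_writeNat, Memory.nat_writeReal]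
    exact w1.nat m1 (by decide) (by decide)
  have n17 : s2.nat 17 = s1.nat 17 := by simp [hs2]
  have hst2 : G.StartMem Bd H s2 := by
    refine ⟨by rw [e2]; exact hL, by rw [n29]; simp [hs2], fun _ => 0, [], ?_⟩
    rw [e2, n29, n17, e17]
    refine WeightedGraph.LevelStart.init _ _ _ _ _ _ (fun v => ?_) hBd
    have : s2.nat 18 = s1.nat 18 := by simp [hs2]
    rw [this, h18, if_pos v.2]
  rw [run_seq]
  set b3 : Block := .loop 56 0 (.seq (anyB 17 57) (.ite (pos (vr 28)) (levelB ch) .skip)) with hb3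
  set s3 := b3.run s2 with hs3
  have wl := levelB_within hch
  have w3 : b3.Within [11, 12, 13, 14, 15, 16, 17, 18, 19, 25, 26, 28, 29] 58 [11, 12, 14, 15] :=
    .loop (.seq (by decide) (.ite (wl.mono (by decide) (by decide) (by decide)) (by decide)))
      (by decide) (by decide)
  -- Each round with vertices left removes at least one, so n rounds empty the set.
  have main : G.StartMem Bd H s3 ∧ ((supp (s3.nat 17) : Set (Fin n)).ncard + n ≤ n ∨
        (supp (s3.nat 17) : Set (Fin n)) = ∅) ∧
      ∀ k, (∀ C, C.Nonempty → ¬ Bd (s.real 13 0) k C) → s3.nat 29 0 ≤ k := by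
    refine loop_rule (N := n) hG2.size (fun i r => G.StartMem Bd H r ∧
      ((supp (r.nat 17) : Set (Fin n)).ncard + i ≤ n ∨ (supp (r.nat 17) : Set (Fin n)) = ∅) ∧
      ∀ k, (∀ C, C.Nonempty → ¬ Bd (s.real 13 0) k C) → r.nat 29 0 ≤ k) ?_ ?_ ?_
    · intro k r j h
      simpa [WeightedGraph.StartMem] using h
    · refine ⟨hst2, Or.inl ?_, fun k _ => by rw [n29]; exact Nat.zero_le _⟩
      have := Set.ncard_le_card (supp (s2.nat 17) : Set (Fin n))
      simpa using this
    · intro i r hi hr hsr ⟨hr1, hr2, hr3⟩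
      have hGr := w3.graph hsr hG2 (by decide) (by decide) (by decide) (by decide)
      have hEr := w3.env hsr hE2 (by decide) (by decide)
      have hany := anyB_spec (n := n) (A := 17) (x := 57) (by decide) (by decide) hGr.size
      rw [run_seq]
      set q := (anyB 17 57).run r with hq
      have wq : (anyB 17 57).Within [28] 58 [] := by decide
      have mq : Same _ r q := same_run _ r
      have hGq := wq.graph mq hGr (by decide) (by decide) (by decide) (by decide)
      have hEq := wq.env mq hEr (by decide) (by decide)
      have q17 : q.nat 17 = r.nat 17 := wq.nat mq (by decide) (by decide)
      have q29 : q.nat 29 = r.nat 29 := wq.nat mq (by decide) (by decide)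
      have q13 : q.real 13 = r.real 13 := wq.real mq (by decide) (by decide)
      have hq1 : G.StartMem Bd H q := by
        unfold WeightedGraph.StartMem
        rw [q17, q29, q13, wq.real mq (a := 14) (by decide) (by decide),
          wq.nat mq (a := 18) (by decide) (by decide), wq.nat mq (a := 19) (by decide) (by decide),
          wq.real mq (a := 15) (by decide) (by decide)]
        exact hr1
      by_cases hne : (supp (r.nat 17) : Set (Fin n)).Nonempty
      · rw [run_ite_pos (by simp only [Test.Holds, NatExpr.eval]; exact hany.2 hne)]
        obtain ⟨l1, l2, l3⟩ := levelB_spec hch hspec hGq hEq hq1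
        rw [q17] at l3
        rw [q29] at l2
        refine ⟨l1, Or.inl ?_, fun k hk => ?_⟩
        · have := l3 hne
          rcases hr2 with h | h
          · omega
          · rw [h] at hne; exact absurd hne Set.not_nonempty_empty
        -- A level is carried out only if a vertex z is left; its component then has the property
        -- for the current level, which must therefore be below k.
        · obtain ⟨z, hz⟩ := hne
          obtain ⟨-, -, lev, cs, -, hbd⟩ := hr1
          have hrL : r.real 13 = s.real 13 := by rw [w3.real hsr (by decide) (by decide), e2]
          have h1 := hr3 k hk
          rw [l2]
          by_contra hcon
          have h2 : r.nat 29 0 = k := by omega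
          have h3 := hbd z hz
          rw [hrL, h2] at h3
          exact hk _ ⟨z, WeightedGraph.mem_comp_self hz⟩ h3
      · rw [run_ite_neg (by simp only [Test.Holds, NatExpr.eval]; exact fun h => hne (hany.1 h)),
          run_skip]
        refine ⟨hq1, Or.inr ?_, ?_⟩
        · rw [q17]; exact Set.not_nonempty_iff_eq_empty.1 hne
        · rw [q29]; exact hr3
  obtain ⟨⟨-, hoff, lev, cs, hls⟩, hemp, hk⟩ := main
  have m3 : Same _ s2 s3 := same_run _ s2
  have k13 : s3.real 13 = s.real 13 := by rw [w3.real m3 (by decide) (by decide), e2]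
  have k30 : s3.nat 30 = s.nat 30 := by rw [w3.nat m3 (by decide) (by decide), n30]
  have hemp' : (supp (s3.nat 17) : Set (Fin n)) = ∅ := by
    rcases hemp with h | h
    · exact (Set.ncard_eq_zero (Set.toFinite _)).1 (by omega)
    · exact h
  rw [hemp', k13] at hls
  rw [k13] at hoff
  obtain ⟨a, ha⟩ := hls.exists_asg
  have hcl := hls.clustering hL a ha
  refine ⟨lev, cs, a, ?_⟩
  by_cases hle : s3.nat 29 0 ≤ s3.nat 30 0
  · rw [run_ite_pos (by simpa only [Test.Holds, NatExpr.eval] using hle), run_skip]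
    refine ⟨ha, hcl, hoff, ?_, hk⟩
    rw [k30] at hle ⊢
    rw [max_eq_left hle]
  · rw [run_ite_neg (by simpa only [Test.Holds, NatExpr.eval] using hle), run_setNat]
    refine ⟨?_, ?_, ?_, ?_, ?_⟩
    · simpa using ha
    · simpa using hcl
    · simpa using hoff
    · rw [k30] at hle
      simp only [NatExpr.eval, Memory.nat_writeNat, if_true, Function.update_self]
      simp only [show (29 : ℕ) ≠ 30 by decide, if_false]
      omega
    · simpa using hk

end Block

/-! ### Attaching clusters to what has been assigned -/

/-- The number of clusters that a short walk meets, for `k` levels. -/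
def tau (k : ℕ) : ℕ := k * (4 * k + 2)

/-- The diameter of the clusters in units of the scale, plus one, for `k` levels. -/
def kap (k : ℕ) : ℝ := 4 * k + 1

theorem one_le_kap (k : ℕ) : 1 ≤ kap k := by unfold kap; linarith [Nat.cast_nonneg (α := ℝ) k]

namespace WeightedGraph

variable {n : ℕ} {G : WeightedGraph (Fin n)}

/-- `D` is the distance to the set `K`. -/
structure DistTo (G : WeightedGraph (Fin n)) (K : Set (Fin n)) (D : ℕ → ℝ) : Prop where
  walk : ∀ v : Fin n, ∃ t ∈ K, G.WalkIn Set.univ v t (D v)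
  le : ∀ v t : Fin n, t ∈ K → ∀ l, G.WalkIn Set.univ v t l → D v ≤ l

/-- The vertex `v` will be reached in `i` rounds at the latest. -/
def Progress (G : WeightedGraph (Fin n)) (H : Set (Fin n)) (D : ℕ → ℝ) (a : Fin n → Fin n) (L : ℝ)
    (F : ℕ → ℕ) (i : ℕ) : Prop :=
  ∀ (v b u : Fin n) (q : G.graph.Walk v b), (∀ x ∈ q.support, x ∈ H ∧ D x ≤ L) →
    (G.walkLength q : ℝ) ≤ L → G.graph.Adj b u → u ∉ H → G.len b u ≤ L →
    (q.support.toFinset.image a).card ≤ i → 0 < F v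

/-- The cluster with center `c` contains a vertex close to the terminals. -/
def Active (H : Set (Fin n)) (D : ℕ → ℝ) (a : Fin n → Fin n) (L : ℝ) (c : Fin n) : Prop :=
  ∃ v ∈ H, a v = c ∧ D v ≤ L

variable {K H : Set (Fin n)} {D : ℕ → ℝ} {a : Fin n → Fin n} {L : ℝ}

theorem Progress.zero (F : ℕ → ℕ) : G.Progress H D a L F 0 := by
  intro v b u q _ _ _ _ _ hc
  have : a v ∈ q.support.toFinset.image a := Finset.mem_image_of_mem _ (by simp)
  rw [Finset.card_eq_zero.1 (Nat.le_zero.1 hc)] at this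
  simp at this

/-- Follow the walk q to the last vertex x in the cluster of v. If the walk ends in this cluster,
the edge leaving H attaches it. Otherwise the next vertex y has a walk through one cluster less and
was reached a round earlier, and the edge xy attaches the cluster of x, which is that of v. -/
theorem Progress.succ {F F' : ℕ → ℕ} {i : ℕ} (h : G.Progress H D a L F i)
    (hround : ∀ u v : Fin n, 0 < F u → v ∈ H → Active H D a L (a v) → G.graph.Adj u v →
      G.len u v ≤ L → 0 < F' v)
    (hconst : ∀ v ∈ H, ∀ v' ∈ H, a v = a v' → F' v = F' v') (hF : ∀ u : Fin n, u ∉ H → 0 < F u) :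
    G.Progress H D a L F' (i + 1) := by
  intro v b u q hq hl hbu hu hlu hc
  have hact : ∀ x ∈ q.support, Active H D a L (a x) := fun x hx => ⟨x, (hq x hx).1, rfl, (hq x hx).2⟩
  by_cases hb : a b = a v
  · have hbH := (hq b q.end_mem_support).1
    rw [hconst v (hq v q.start_mem_support).1 b hbH hb.symm]
    exact hround u b (hF u hu) hbH (hact b q.end_mem_support) hbu.symm (by rwa [len_comm])
  · obtain ⟨x, y, r, hx, hxy, hxq, hr, hrl, hlen⟩ := exists_last q (fun z => a z = a v)
      ⟨v, q.start_mem_support, rfl⟩ hb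
    have hy : 0 < F y := by
      refine h y b u r (fun z hz => hq z (hr z hz).1)
        ((NNReal.coe_le_coe.2 hrl).trans hl) hbu hu hlu ?_
      have hsub : r.support.toFinset.image a ⊆ (q.support.toFinset.image a).erase (a v) := by
        intro c hc
        obtain ⟨z, hz, rfl⟩ := Finset.mem_image.1 hc
        have := hr z (List.mem_toFinset.1 hz)
        exact Finset.mem_erase.2 ⟨this.2, Finset.mem_image_of_mem _ (by simpa using this.1)⟩
      have := Finset.card_le_card hsub
      rw [Finset.card_erase_of_mem (Finset.mem_image_of_mem _ (by simp))] at this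
      omega
    rw [hconst v (hq v q.start_mem_support).1 x (hq x hxq).1 hx.symm]
    exact hround y x hy (hq x hxq).1 (hact x hxq) hxy.symm
      ((G.len_comm y x).trans_le (hlen.trans hl))

/-- The way from v to its nearest terminal has length at most L, and D ≤ L holds all along it, so
all clusters on it are active. Up to its exit from H it meets at most τ clusters by scattering, and
trivially at most n. -/
theorem Progress.all {lev : Fin n → ℕ} {cs : List (Fin n)} {best : Fin n → ℝ} {k : ℕ}
    (hcl : Clustering G L H lev cs a best k) (hD : G.DistTo K D) (hKH : ∀ t ∈ K, t ∉ H)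
    {F : ℕ → ℕ} {i : ℕ} (hi : tau k ≤ i ∨ n ≤ i) (h : G.Progress H D a L F i) {v : Fin n}
    (hv : v ∈ H) (hvL : D v ≤ L) : 0 < F v := by
  obtain ⟨t, ht, p, -, hp⟩ := hD.walk v
  have hpD : ∀ x ∈ p.support, D x ≤ L := by
    intro x hx
    obtain ⟨l, l', e, h1, h2⟩ := WalkIn.split (S := Set.univ) p (by simp) hx
    have := hD.le x t ht _ h2
    have := h1.nonneg
    linarith
  obtain ⟨b, u, q, r, hu, hbu, hq, -, hql, -, hlen⟩ := exists_first p (fun x => x ∉ H)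
    (by simpa using hv) ⟨t, p.end_mem_support, hKH t ht⟩
  have hql' : (G.walkLength q : ℝ) ≤ L := by
    have := NNReal.coe_le_coe.2 hql
    linarith
  refine h v b u q (fun x hx => ⟨not_not.1 (hq x hx).2, hpD x (hq x hx).1⟩) hql' hbu hu
    (by linarith) ?_
  rcases hi with hi | hi
  · exact (hcl.scattering q (fun x hx => not_not.1 (hq x hx).2) hql').trans hi
  · refine (Finset.card_le_univ _).trans ?_
    rwa [Fintype.card_fin]

/-- The state in a round: `c` is the assignment before the round, `F` the current one, and `F₀` the
one before all rounds. -/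
structure Attach (G : WeightedGraph (Fin n)) (K H : Set (Fin n)) (D : ℕ → ℝ) (a : Fin n → Fin n)
    (L : ℝ) (F₀ c F : ℕ → ℕ) (b b' : ℝ) : Prop where
  old : ∀ v : Fin n, v ∉ H → F v = F₀ v
  act : ∀ v : Fin n, v ∈ H → 0 < F v → Active H D a L (a v)
  const : ∀ v : Fin n, v ∈ H → ∀ v' : Fin n, v' ∈ H → a v = a v' → F v = F v'
  keep : ∀ v : Fin n, 0 < c v → F v = c v
  nearc : ∀ v : Fin n, 0 < c v → ∃ t ∈ K, c v = t + 1 ∧ G.Near {x | F x = c v} b v t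
  near : ∀ v : Fin n, 0 < F v → ∃ t ∈ K, F v = t + 1 ∧ G.Near {x | F x = F v} b' v t

theorem Attach.restart {F₀ c F : ℕ → ℕ} {b b' b'' : ℝ} (h : Attach G K H D a L F₀ c F b b')
    (hb : b' ≤ b'') : Attach G K H D a L F₀ F F b' b'' := by
  refine ⟨h.old, h.act, h.const, fun _ _ => rfl, h.near, fun v hv => ?_⟩
  obtain ⟨t, ht, e, hn⟩ := h.near v hv
  exact ⟨t, ht, e, hn.mono subset_rfl hb⟩

/-- A cluster is hung on a vertex that was assigned before the round began, not on one assigned in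
the same round. Otherwise the distances to the terminals could pile up within a round. The walk to
the terminal goes through the cluster (r), the edge (at most L), and then at most b. -/
theorem Attach.step {F₀ c F F' : ℕ → ℕ} {b b' r : ℝ} (h : Attach G K H D a L F₀ c F b b')
    (hdiam : ∀ v ∈ H, ∀ y ∈ H, a y = a v → G.Near {x | x ∈ H ∧ a x = a v} r y v)
    (hb : b + L + r ≤ b') {u v : Fin n} (hu : 0 < c u) (hv : v ∈ H) (hFv : F v = 0)
    (hact : Active H D a L (a v)) (huv : G.graph.Adj u v) (hlen : G.len u v ≤ L)
    (hF₀ : ∀ x : Fin n, x ∉ H → 0 < F₀ x)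
    (hnew : ∀ y : Fin n, F y = 0 ∧ a y = a v → F' y = c u)
    (hold : ∀ y : Fin n, ¬ (F y = 0 ∧ a y = a v) → F' y = F y) :
    Attach G K H D a L F₀ c F' b b' := by
  have hpos : ∀ y : Fin n, 0 < F y → F' y = F y := fun y hy => hold y fun h => by omega
  have hmono : ∀ k, 0 < k → {x : Fin n | F x = k} ⊆ {x | F' x = k} := fun k hk x hx => by
    have hx' : F x = k := hx
    change F' x = k
    rw [hpos x (by omega), hx']
  have hcl : ∀ y : Fin n, y ∈ H → a y = a v → F' y = c u := fun y hy hay =>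
    hnew y ⟨by rw [h.const y hy v hv hay, hFv], hay⟩
  refine ⟨fun y hy => ?_, fun y hy hFy => ?_, fun y hy y' hy' e => ?_, fun y hy => ?_,
    fun y hy => ?_, fun y hy => ?_⟩
  · rw [hpos y (by rw [h.old y hy]; exact hF₀ y hy), h.old y hy]
  · by_cases hay : a y = a v
    · rw [hay]; exact hact
    · exact h.act y hy (by rwa [hold y fun h => hay h.2] at hFy)
  · by_cases hay : a y = a v
    · rw [hcl y hy hay, hcl y' hy' (e ▸ hay)]
    · rw [hold y fun h => hay h.2, hold y' fun h => hay (e.trans h.2), h.const y hy y' hy' e]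
  · rw [hpos y (by rw [h.keep y hy]; exact hy), h.keep y hy]
  · obtain ⟨t, ht, e, hn⟩ := h.nearc y hy
    exact ⟨t, ht, e, hn.mono (hmono _ hy) le_rfl⟩
  · by_cases hFy : 0 < F y
    · rw [hpos y hFy]
      obtain ⟨t, ht, e, hn⟩ := h.near y hFy
      exact ⟨t, ht, e, hn.mono (hmono _ hFy) le_rfl⟩
    · have hyH : y ∈ H := by
        by_contra hyH
        exact hFy (by rw [h.old y hyH]; exact hF₀ y hyH)
      have hay : a y = a v := by
        by_contra hay
        rw [hold y fun h => hay h.2] at hy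
        exact hFy hy
      obtain ⟨t, ht, e, hn⟩ := h.nearc u hu
      rw [hcl y hyH hay]
      refine ⟨t, ht, e, ?_⟩
      have hu' : F' u = c u := by rw [hpos u (by rw [h.keep u hu]; exact hu), h.keep u hu]
      have h1 : G.Near {x | F' x = c u} r y v :=
        (hdiam v hv y hyH hay).mono (fun x hx => hcl x hx.1 hx.2) le_rfl
      have h2 : G.Near {x | F' x = c u} L v u :=
        ⟨_, (G.len_comm v u).trans_le hlen, .edge huv.symm (hcl v hv rfl) hu'⟩
      exact ((h1.trans h2).trans (hn.mono (hmono _ hu) le_rfl)).mono subset_rfl (by linarith)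

/-- If all active clusters have been assigned, nothing changes any more. -/
theorem Attach.stable {F₀ c F : ℕ → ℕ} {b b' : ℝ} (h : Attach G K H D a L F₀ c F b b')
    (hF₀ : ∀ x : Fin n, x ∉ H → 0 < c x)
    (hall : ∀ v ∈ H, Active H D a L (a v) → 0 < c v) : ∀ v : Fin n, F v = c v := by
  intro v
  by_cases hc : 0 < c v
  · exact h.keep v hc
  · have hvH : v ∈ H := by by_contra hv; exact hc (hF₀ v hv)
    by_contra hne
    exact hc (hall v hvH (h.act v hvH (by omega)))

end WeightedGraph

/-! ### The program that attaches clusters -/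

namespace Block

/-- Copy the vertex array `A` to `B`. -/
def copyB (A B x : ℕ) : Block := .loop x 0 (.setNat B (vr x) (.read A (vr x)))

/-- If the edge between the vertices in variables `62` and `63` allows it, assign the whole cluster
of the latter. -/
def pairB : Block :=
  .ite (.and (.and (pos (.read 21 (vr 62))) (.natLe (.read 20 (vr 63)) (.lit 0)))
      (.and (pos (.read 1 (ix (vr 62) (vr 63)))) (.and (pos (.read 22 (.read 19 (vr 63))))
        (.realLe (.read 0 (ix (vr 62) (vr 63))) (rv 13)))))
    (.seq (.setNat 27 (.lit 0) (.read 19 (vr 63))) <|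
      .loop 64 0 (.ite (.and (.natLe (.read 20 (vr 64)) (.lit 0))
          (.and (.natLe (.read 19 (vr 64)) (vr 27)) (.natLe (vr 27) (.read 19 (vr 64)))))
        (.setNat 20 (vr 64) (.read 21 (vr 62))) .skip))
    .skip

/-- Assign active clusters, in rounds. -/
def attachB : Block :=
  .seq (.loop 58 0 (.setNat 22 (vr 58) (.lit 0))) <|
  .seq (.loop 59 0 (.ite (.and (.natLe (.read 20 (vr 59)) (.lit 0)) (.realLe (.read 16 (vr 59)) (rv 13)))
    (.setNat 22 (.read 19 (vr 59)) (.lit 1)) .skip)) <|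
  .loop 60 0 (.seq (copyB 20 21 61) (.loop 62 0 (.loop 63 0 pairB)))

variable {n : ℕ} {G : WeightedGraph (Fin n)}

theorem attachB_within : attachB.Within [20, 21, 22, 27] 65 [] := by decide

theorem copyB_spec {A B x : ℕ} (h1 : A ≠ B) (h2 : B ≠ x) (h3 : A ≠ x) {s : Memory}
    (h0 : s.nat 0 0 = n) (v : Fin n) : ((copyB A B x).run s).nat B v = s.nat A v := by
  have := loop_pointwise (x := x) (b := 0) (p := .setNat B (vr x) (.read A (vr x))) (s := s) h0 B h2
    (fun k => s.nat A k) (fun k r hk hr hsr _ => by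
      have : r.nat A = s.nat A := hsr.1 A (by simp [natW, h1, h3])
      simp [run_setNat, hr, this]) v
  rw [copyB, this, if_pos v.2]

variable {K H : Set (Fin n)} {D : ℕ → ℝ} {a : Fin n → Fin n} {L : ℝ}

/-- Array `21` is the snapshot from which assignments are copied, array `20` the current assignment,
and array `22` marks the active clusters by their centers. Restricting to active clusters keeps D
small on all that is assigned. -/
theorem pairB_spec {s : Memory} (hG : HoldsGraph G s) {u v : Fin n} (hu : s.nat 62 0 = u)
    (hv : s.nat 63 0 = v) {F₀ : ℕ → ℕ} {b b' r : ℝ}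
    (hF₀ : ∀ x : Fin n, x ∈ H ↔ F₀ x = 0) (hL : s.real 13 0 = L)
    (ha : ∀ x ∈ H, s.nat 19 x = a x)
    (hact : ∀ x : Fin n, 0 < s.nat 22 x ↔ WeightedGraph.Active H D a L x)
    (hdiam : ∀ v ∈ H, ∀ y ∈ H, a y = a v → G.Near {x | x ∈ H ∧ a x = a v} r y v)
    (hb : b + L + r ≤ b') (h : G.Attach K H D a L F₀ (s.nat 21) (s.nat 20) b b') :
    G.Attach K H D a L F₀ (s.nat 21) ((pairB.run s).nat 20) b b' ∧
    (∀ y : Fin n, 0 < s.nat 20 y → 0 < (pairB.run s).nat 20 y) ∧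
    (0 < s.nat 21 u → v ∈ H → WeightedGraph.Active H D a L (a v) → G.graph.Adj u v →
      G.len u v ≤ L → 0 < (pairB.run s).nat 20 v) := by
  have hm : s.nat 10 u = u * n := hG.mul u (by rw [hG.size]; exact Or.inl u.2)
  have hzero : ∀ y : Fin n, s.nat 20 y = 0 → y ∈ H := fun y hy => by
    by_contra hyH
    rw [h.old y hyH] at hy
    exact hyH ((hF₀ y).2 hy)
  by_cases hc : (0 < s.nat 21 u ∧ s.nat 20 v ≤ 0) ∧ 0 < s.nat 1 (u * n + v) ∧
      0 < s.nat 22 (s.nat 19 v) ∧ s.real 0 (u * n + v) ≤ s.real 13 0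
  · obtain ⟨⟨c1, c2⟩, c3, c4, c5⟩ := hc
    have hvH := hzero v (by omega)
    rw [pairB, run_ite_pos (by
      simp only [Test.Holds, NatExpr.eval, RealExpr.eval, hu, hv, hm]
      exact ⟨⟨c1, c2⟩, c3, c4, c5⟩), run_seq, run_setNat]
    simp only [NatExpr.eval, hv]
    rw [ha v hvH, hact] at c4
    rw [hG.adj] at c3
    rw [hG.len u v c3, hL] at c5
    set s1 := s.writeNat 27 0 (s.nat 19 v) with hs1
    have hG1 : HoldsGraph G s1 := by refine hG.of_eq ?_ ?_ ?_ ?_ <;> simp [hs1]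
    set s2 := (loop 64 0 (.ite (.and (.natLe (.read 20 (vr 64)) (.lit 0))
          (.and (.natLe (.read 19 (vr 64)) (vr 27)) (.natLe (vr 27) (.read 19 (vr 64)))))
        (.setNat 20 (vr 64) (.read 21 (vr 62))) .skip)).run s1 with hs2
    have h20 : ∀ k, s2.nat 20 k = if k < n then
        (if s.nat 20 k = 0 ∧ s.nat 19 k = s.nat 19 v then s.nat 21 u else s.nat 20 k)
        else s1.nat 20 k := by
      refine loop_pointwise hG1.size 20 (by decide)
        (fun k => if s.nat 20 k = 0 ∧ s.nat 19 k = s.nat 19 v then s.nat 21 u else s.nat 20 k) ?_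
      intro k q hk hq hsq hk20
      have e19 : q.nat 19 = s.nat 19 := by rw [hsq.1 19 (by decide)]; simp [hs1]
      have e21 : q.nat 21 = s.nat 21 := by rw [hsq.1 21 (by decide)]; simp [hs1]
      have e62 : q.nat 62 0 = u := by rw [hsq.1 62 (by decide)]; simp [hs1, hu]
      have e27 : q.nat 27 0 = s.nat 19 v := by rw [hsq.1 27 (by decide)]; simp [hs1]
      have e20 : q.nat 20 k = s.nat 20 k := by rw [hk20]; simp [hs1]
      by_cases hp : s.nat 20 k = 0 ∧ s.nat 19 k = s.nat 19 v
      · rw [run_ite_pos (by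
          simp only [Test.Holds, NatExpr.eval, hq, e19, e20, e27]; omega), if_pos hp, run_setNat]
        simp [hq, e62, e21]
      · rw [run_ite_neg (by
          simp only [Test.Holds, NatExpr.eval, hq, e19, e20, e27]; omega), if_neg hp, run_skip,
          ← e20, Function.update_eq_self]
    have hiff : ∀ y : Fin n, (s.nat 20 y = 0 ∧ s.nat 19 y = s.nat 19 v) ↔
        (s.nat 20 y = 0 ∧ a y = a v) := fun y => by
      refine and_congr_right fun hy => ?_
      rw [ha y (hzero y hy), ha v hvH]
      exact Fin.ext_iff.symm
    have hnew : ∀ y : Fin n, s.nat 20 y = 0 ∧ a y = a v → s2.nat 20 y = s.nat 21 u := fun y hy => by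
      rw [h20, if_pos y.2, if_pos ((hiff y).2 hy)]
    have hold : ∀ y : Fin n, ¬ (s.nat 20 y = 0 ∧ a y = a v) → s2.nat 20 y = s.nat 20 y :=
      fun y hy => by rw [h20, if_pos y.2, if_neg fun h => hy ((hiff y).1 h)]
    refine ⟨h.step hdiam hb c1 hvH (by omega) c4 c3 c5
      (fun x hx => Nat.pos_of_ne_zero fun h => hx ((hF₀ x).2 h)) hnew hold, fun y hy => ?_,
      fun _ _ _ _ _ => ?_⟩
    · rw [hold y fun h => by omega]; exact hy
    · rw [hnew v ⟨by omega, rfl⟩]; exact c1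
  · rw [pairB, run_ite_neg (by
      simp only [Test.Holds, NatExpr.eval, RealExpr.eval, hu, hv, hm]
      exact hc), run_skip]
    refine ⟨h, fun _ h => h, fun c1 hvH c4 c3 c5 => ?_⟩
    by_contra hF
    refine hc ⟨⟨c1, by omega⟩, (hG.adj u v).2 c3, ?_, ?_⟩
    · rw [ha v hvH]; exact (hact _).2 c4
    · rw [hG.len u v c3, hL]; exact c5

theorem roundB_spec {s : Memory} (hG : HoldsGraph G s) {F₀ : ℕ → ℕ} {b b' r : ℝ}
    (hF₀ : ∀ x : Fin n, x ∈ H ↔ F₀ x = 0) (hL : s.real 13 0 = L)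
    (ha : ∀ x ∈ H, s.nat 19 x = a x)
    (hact : ∀ x : Fin n, 0 < s.nat 22 x ↔ WeightedGraph.Active H D a L x)
    (hdiam : ∀ v ∈ H, ∀ y ∈ H, a y = a v → G.Near {x | x ∈ H ∧ a x = a v} r y v)
    (hb : b + L + r ≤ b') (h : G.Attach K H D a L F₀ (s.nat 21) (s.nat 20) b b') :
    G.Attach K H D a L F₀ (s.nat 21) (((loop 62 0 (.loop 63 0 pairB)).run s).nat 20) b b' ∧
    ∀ u v : Fin n, 0 < s.nat 21 u → v ∈ H → WeightedGraph.Active H D a L (a v) → G.graph.Adj u v →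
      G.len u v ≤ L → 0 < ((loop 62 0 (.loop 63 0 pairB)).run s).nat 20 v := by
  have wp : pairB.Within [20, 27] 65 [] := by decide
  have frame : ∀ q : Memory, Same (loop 62 0 (.loop 63 0 pairB)) s q → HoldsGraph G q ∧
      q.nat 21 = s.nat 21 ∧ q.nat 19 = s.nat 19 ∧ q.nat 22 = s.nat 22 ∧ q.real 13 = s.real 13 := by
    intro q hq
    have w : (loop 62 0 (.loop 63 0 pairB)).Within [20, 27] 65 [] := by decide
    exact ⟨w.graph hq hG (by decide) (by decide) (by decide) (by decide),
      w.nat hq (by decide) (by decide), w.nat hq (by decide) (by decide),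
      w.nat hq (by decide) (by decide), w.real hq (by decide) (by decide)⟩
  have main := loop_rule (x := 62) (b := 0) (p := .loop 63 0 pairB) (s := s) hG.size
    (fun i q => G.Attach K H D a L F₀ (s.nat 21) (q.nat 20) b b' ∧
      ∀ u v : Fin n, (u : ℕ) < i → 0 < s.nat 21 u → v ∈ H → WeightedGraph.Active H D a L (a v) →
        G.graph.Adj u v → G.len u v ≤ L → 0 < q.nat 20 v) ?_ ?_ ?_
  · exact ⟨main.1, fun u v => main.2 u v u.2⟩
  · intro k q j h; simpa using h
  · exact ⟨h, fun u v h => absurd h (by omega)⟩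
  · intro i q hi hq hsq ⟨hq1, hq2⟩
    obtain ⟨hGq, q21, q19, q22, q13⟩ := frame q hsq
    have inner := loop_rule (x := 63) (b := 0) (p := pairB) (s := q) hGq.size
      (fun j r => G.Attach K H D a L F₀ (s.nat 21) (r.nat 20) b b' ∧
        (∀ y : Fin n, 0 < q.nat 20 y → 0 < r.nat 20 y) ∧
        ∀ v : Fin n, (v : ℕ) < j → 0 < s.nat 21 i → v ∈ H → WeightedGraph.Active H D a L (a v) →
          G.graph.Adj ⟨i, hi⟩ v → G.len ⟨i, hi⟩ v ≤ L → 0 < r.nat 20 v) ?_ ?_ ?_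
    · refine ⟨inner.1, fun u v hu => ?_⟩
      rcases Nat.lt_succ_iff_lt_or_eq.1 hu with hlt | heq
      · exact fun h1 h2 h3 h4 h5 => inner.2.1 v (hq2 u v hlt h1 h2 h3 h4 h5)
      · have : u = ⟨i, hi⟩ := Fin.ext heq
        subst this
        exact inner.2.2 v v.2
    · intro k r j h; simpa using h
    · exact ⟨hq1, fun y hy => hy, fun v h => absurd h (by omega)⟩
    · intro j p hj hp hsp ⟨hp1, hp2, hp3⟩
      have w : (loop 63 0 pairB).Within [20, 27] 65 [] := by decide
      have hGp : HoldsGraph G p := w.graph hsp hGq (by decide) (by decide) (by decide) (by decide)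
      have p21 : p.nat 21 = s.nat 21 := by rw [w.nat hsp (by decide) (by decide), q21]
      have p19 : p.nat 19 = s.nat 19 := by rw [w.nat hsp (by decide) (by decide), q19]
      have p22 : p.nat 22 = s.nat 22 := by rw [w.nat hsp (by decide) (by decide), q22]
      have p13 : p.real 13 = s.real 13 := by rw [w.real hsp (by decide) (by decide), q13]
      have p62 : p.nat 62 0 = i := by rw [hsp.1 62 (by decide), hq]
      have := pairB_spec (K := K) (u := ⟨i, hi⟩) (v := ⟨j, hj⟩) hGp p62 hp hF₀ (by rw [p13]; exact hL)
        (by rw [p19]; exact ha) (by rw [p22]; exact hact) hdiam hb (by rw [p21]; exact hp1)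
      rw [p21] at this
      refine ⟨this.1, fun y hy => this.2.1 y (hp2 y hy), fun v hv => ?_⟩
      rcases Nat.lt_succ_iff_lt_or_eq.1 hv with hlt | heq
      · exact fun h1 h2 h3 h4 h5 => this.2.1 v (hp3 v hlt h1 h2 h3 h4 h5)
      · have : v = ⟨j, hj⟩ := Fin.ext heq
        subst this
        exact this.2.2

/-- The program makes n rounds, as it does not compute τ. The error nevertheless grows in the first
τ rounds only, because all active clusters are assigned by then and nothing changes any more. -/
theorem attachB_spec {s : Memory} (hG : HoldsGraph G s) {B : ℝ}
    (hH : ∀ v : Fin n, v ∈ H ↔ s.nat 20 v = 0)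
    {lev : Fin n → ℕ} {cs : List (Fin n)} {best : Fin n → ℝ} {j : ℕ}
    (hcl : WeightedGraph.Clustering G (s.real 13 0) H lev cs a best j)
    (ha : ∀ x ∈ H, s.nat 19 x = a x) (hD : G.DistTo K (s.real 16)) (hKH : ∀ t ∈ K, t ∉ H)
    (hnear : ∀ v : Fin n, 0 < s.nat 20 v →
      ∃ t ∈ K, s.nat 20 v = t + 1 ∧ G.Near {x | s.nat 20 x = s.nat 20 v} B v t) :
    (∃ F, G.Attach K H (s.real 16) a (s.real 13 0) (s.nat 20) F ((attachB.run s).nat 20)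
      (B + tau j * (kap j * s.real 13 0)) (B + tau j * (kap j * s.real 13 0))) ∧
    ∀ v ∈ H, s.real 16 v ≤ s.real 13 0 → 0 < (attachB.run s).nat 20 v := by
  set L := s.real 13 0 with hL
  set D := s.real 16 with hDdef
  have hL0 : 0 ≤ L := hcl.nonneg
  have hkL : 0 ≤ kap j * L := mul_nonneg (by linarith [one_le_kap j]) hL0
  have hdiam : ∀ v ∈ H, ∀ y ∈ H, a y = a v → G.Near {x | x ∈ H ∧ a x = a v} (4 * j * L) y v := by
    intro v hv y hy e
    have h1 := hcl.near_center hv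
    have h2 := hcl.near_center hy
    rw [e] at h2
    exact (h2.symm.trans h1).mono subset_rfl (by linarith)
  -- active clusters
  rw [attachB, run_seq]
  set b1 : Block := .loop 58 0 (.setNat 22 (vr 58) (.lit 0)) with hb1
  set s1 := b1.run s with hs1
  have w1 : b1.Within [22] 59 [] := by rw [hb1]; decide
  have m1 : Same _ s s1 := same_run _ s
  have h22 : ∀ k, s1.nat 22 k = if k < n then 0 else s.nat 22 k := by
    refine loop_pointwise hG.size 22 (by decide) (fun _ => 0) ?_
    intro k r hk hr _ _
    simp [run_setNat, hr]
  have hG1 := w1.graph m1 hG (by decide) (by decide) (by decide) (by decide)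
  rw [run_seq]
  set b2 : Block := .loop 59 0 (.ite (.and (.natLe (.read 20 (vr 59)) (.lit 0))
    (.realLe (.read 16 (vr 59)) (rv 13))) (.setNat 22 (.read 19 (vr 59)) (.lit 1)) .skip) with hb2
  set s2 := b2.run s1 with hs2
  have w2 : b2.Within [22] 60 [] := by rw [hb2]; decide
  have m2 : Same _ s1 s2 := same_run _ s1
  have hact : ∀ c : Fin n, 0 < s2.nat 22 c ↔ WeightedGraph.Active H D a L c := by
    have main : ∀ c : Fin n, 0 < s2.nat 22 c ↔ ∃ v : Fin n, (v : ℕ) < n ∧ v ∈ H ∧ a v = c ∧ D v ≤ L := by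
      refine loop_rule (N := n) hG1.size (fun i r => ∀ c : Fin n, 0 < r.nat 22 c ↔
        ∃ v : Fin n, (v : ℕ) < i ∧ v ∈ H ∧ a v = c ∧ D v ≤ L) ?_ ?_ ?_
      · intro k r j h; simpa using h
      · intro c; simp [h22]
      · intro i r hi hr hsr hI c
        have w2' : b2.Within [22] 60 [] := w2
        have e20 : r.nat 20 = s.nat 20 := by
          rw [w2'.nat hsr (by decide) (by decide), w1.nat m1 (by decide) (by decide)]
        have e19 : r.nat 19 = s.nat 19 := by
          rw [w2'.nat hsr (by decide) (by decide), w1.nat m1 (by decide) (by decide)]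
        have e16 : r.real 16 = D := by
          rw [w2'.real hsr (by decide) (by decide), w1.real m1 (by decide) (by decide)]
        have e13 : r.real 13 0 = L := by
          rw [w2'.real hsr (by decide) (by decide), w1.real m1 (by decide) (by decide)]
        have hsplit : (∃ v : Fin n, (v : ℕ) < i + 1 ∧ v ∈ H ∧ a v = c ∧ D v ≤ L) ↔
            (∃ v : Fin n, (v : ℕ) < i ∧ v ∈ H ∧ a v = c ∧ D v ≤ L) ∨
              ((⟨i, hi⟩ : Fin n) ∈ H ∧ a ⟨i, hi⟩ = c ∧ D i ≤ L) := by
          constructor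
          · rintro ⟨v, hv, h⟩
            rcases Nat.lt_succ_iff_lt_or_eq.1 hv with hlt | heq
            · exact Or.inl ⟨v, hlt, h⟩
            · have : v = ⟨i, hi⟩ := Fin.ext heq
              subst this
              exact Or.inr h
          · rintro (⟨v, hv, h⟩ | h)
            · exact ⟨v, by omega, h⟩
            · exact ⟨⟨i, hi⟩, Nat.lt_succ_self i, h⟩
        rw [hsplit, ← hI c]
        by_cases hp : s.nat 20 i = 0 ∧ D i ≤ L
        · have hiH : (⟨i, hi⟩ : Fin n) ∈ H := (hH ⟨i, hi⟩).2 hp.1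
          have hai : s.nat 19 i = a ⟨i, hi⟩ := ha _ hiH
          rw [run_ite_pos (by
            simp only [Test.Holds, NatExpr.eval, RealExpr.eval, hr, e20, e16, e13]
            exact ⟨hp.1.le, hp.2⟩), run_setNat]
          simp only [NatExpr.eval, hr, e19, hai, Memory.nat_writeNat, if_true]
          by_cases hc : a ⟨i, hi⟩ = c
          · subst hc
            simp [hiH, hp.2]
          · have : (c : ℕ) ≠ a ⟨i, hi⟩ := fun h => hc (Fin.ext h.symm)
            rw [Function.update_of_ne this]
            simp [hc]
        · rw [run_ite_neg (by
            simp only [Test.Holds, NatExpr.eval, RealExpr.eval, hr, e20, e16, e13]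
            exact fun h => hp ⟨Nat.le_zero.1 h.1, h.2⟩), run_skip]
          have : ¬ ((⟨i, hi⟩ : Fin n) ∈ H ∧ a ⟨i, hi⟩ = c ∧ D i ≤ L) := fun h =>
            hp ⟨(hH ⟨i, hi⟩).1 h.1, h.2.2⟩
          simp [this]
    intro c
    rw [main c]
    exact ⟨fun ⟨v, _, h1, h2⟩ => ⟨v, h1, h2⟩, fun ⟨v, h1, h2⟩ => ⟨v, v.2, h1, h2⟩⟩
  have hG2 := w2.graph m2 hG1 (by decide) (by decide) (by decide) (by decide)
  have e20 : s2.nat 20 = s.nat 20 := by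
    rw [w2.nat m2 (by decide) (by decide), w1.nat m1 (by decide) (by decide)]
  have e19 : s2.nat 19 = s.nat 19 := by
    rw [w2.nat m2 (by decide) (by decide), w1.nat m1 (by decide) (by decide)]
  have e13 : s2.real 13 = s.real 13 := by
    rw [w2.real m2 (by decide) (by decide), w1.real m1 (by decide) (by decide)]
  have hF0 : ∀ x : Fin n, x ∉ H → 0 < s.nat 20 x := fun x hx =>
    Nat.pos_of_ne_zero fun h => hx ((hH x).2 h)
  -- rounds
  set b3 : Block := .loop 60 0 (.seq (copyB 20 21 61) (.loop 62 0 (.loop 63 0 pairB))) with hb3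
  have w3 : b3.Within [20, 21, 27] 65 [] := by rw [hb3]; decide
  -- The distance to the terminal after i rounds: κL per round, namely 4jL for the diameter of a
  -- cluster and L for the edge, frozen after τ rounds.
  set bd : ℕ → ℝ := fun i => B + (min i (tau j) : ℕ) * (kap j * L) with hbd
  have main : (∃ F, G.Attach K H D a L (s.nat 20) F ((b3.run s2).nat 20) (bd n) (bd n)) ∧
      G.Progress H D a L ((b3.run s2).nat 20) n := by
    refine loop_rule (N := n) hG2.size (fun i r =>
      (∃ F, G.Attach K H D a L (s.nat 20) F (r.nat 20) (bd i) (bd i)) ∧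
      G.Progress H D a L (r.nat 20) i) ?_ ?_ ?_
    · intro k r j h; simpa using h
    · refine ⟨⟨s.nat 20, ?_⟩, WeightedGraph.Progress.zero _⟩
      rw [e20]
      have : bd 0 = B := by simp [hbd]
      rw [this]
      refine ⟨fun _ _ => rfl, fun v hv h => ?_, fun v hv v' hv' _ => ?_, fun _ _ => rfl, hnear, hnear⟩
      · have := (hH v).1 hv; omega
      · rw [(hH v).1 hv, (hH v').1 hv']
    · intro i r hi hr hsr ⟨⟨F, hatt⟩, hprog⟩
      have hGr := w3.graph hsr hG2 (by decide) (by decide) (by decide) (by decide)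
      rw [run_seq]
      have hcopy := copyB_spec (n := n) (A := 20) (B := 21) (x := 61) (by decide) (by decide)
        (by decide) hGr.size
      set q := (copyB 20 21 61).run r with hq
      have wq : (copyB 20 21 61).Within [21] 62 [] := by decide
      have mq : Same _ r q := same_run _ r
      have hGq := wq.graph mq hGr (by decide) (by decide) (by decide) (by decide)
      have q20 : q.nat 20 = r.nat 20 := wq.nat mq (by decide) (by decide)
      have q19 : q.nat 19 = s.nat 19 := by
        rw [wq.nat mq (by decide) (by decide), w3.nat hsr (by decide) (by decide), e19]
      have q22 : q.nat 22 = s2.nat 22 := by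
        rw [wq.nat mq (by decide) (by decide), w3.nat hsr (by decide) (by decide)]
      have q13 : q.real 13 0 = L := by
        rw [wq.real mq (by decide) (by decide), w3.real hsr (by decide) (by decide), e13]
      have hstart : G.Attach K H D a L (s.nat 20) (q.nat 21) (q.nat 20) (bd i)
          (bd i + kap j * L) := by
        rw [q20]
        have h0 := hatt.restart (b'' := bd i + kap j * L) (by linarith)
        refine ⟨h0.old, h0.act, h0.const, fun v _ => (hcopy v).symm, fun v hv => ?_, h0.near⟩
        rw [hcopy v] at hv ⊢
        exact h0.nearc v hv
      obtain ⟨g1, g2⟩ := roundB_spec hGq hH q13 (by rw [q19]; exact ha) (by rw [q22]; exact hact)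
        hdiam (by unfold kap; linarith) hstart
      have hFr : ∀ u : Fin n, u ∉ H → 0 < r.nat 20 u := fun u hu => by
        rw [hatt.old u hu]; exact hF0 u hu
      refine ⟨?_, hprog.succ (fun u v hu => g2 u v (by rw [hcopy u]; exact hu)) g1.const hFr⟩
      by_cases hlt : i < tau j
      · have e : bd i + kap j * L = bd (i + 1) := by
          simp only [hbd]
          rw [min_eq_left (by omega), min_eq_left (by omega)]
          push_cast; ring
        rw [e] at g1
        exact ⟨_, g1.restart le_rfl⟩
      -- From round τ on, `Progress.all` shows that every active cluster is assigned, so this round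
      -- is idle and the bound need not grow.
      · have hall : ∀ v ∈ H, WeightedGraph.Active H D a L (a v) → 0 < r.nat 20 v := by
          rintro v hv ⟨v', hv', e, hvL⟩
          rw [hatt.const v hv v' hv' e.symm]
          exact hprog.all hcl hD hKH (Or.inl (by omega)) hv' hvL
        have hst := g1.stable (fun x hx => by rw [hcopy x]; exact hFr x hx)
          (fun v hv hA => by rw [hcopy v]; exact hall v hv hA)
        have hst' : ∀ v : Fin n, ((loop 62 0 (.loop 63 0 pairB)).run q).nat 20 v = r.nat 20 v :=
          fun v => (hst v).trans (hcopy v)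
        have e : bd (i + 1) = bd i := by
          simp only [hbd]
          rw [min_eq_right (by omega), min_eq_right (by omega)]
        refine ⟨r.nat 20, ?_⟩
        rw [e]
        have h0 := hatt.restart le_rfl
        refine ⟨g1.old, g1.act, g1.const, fun v _ => hst' v, fun v hv => ?_, fun v hv => ?_⟩
        · simp only [hst']
          exact h0.near v hv
        · simp only [hst'] at hv ⊢
          exact h0.near v hv
  obtain ⟨⟨F, hatt⟩, hprog⟩ := main
  refine ⟨⟨(b3.run s2).nat 20, ?_⟩, fun v hv hvL =>
    hprog.all hcl hD hKH (Or.inr le_rfl) hv hvL⟩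
  have hle : bd n ≤ B + tau j * (kap j * L) := by
    simp only [hbd]
    have : ((min n (tau j) : ℕ) : ℝ) ≤ tau j := by exact_mod_cast min_le_right _ _
    nlinarith
  have h0 := hatt.restart hle
  exact ⟨h0.old, h0.act, h0.const, h0.keep, fun v hv => (h0.near v hv), h0.near⟩

end Block

/-! ### The stages -/

theorem kap_mono {j k : ℕ} (h : j ≤ k) : kap j ≤ kap k := by
  unfold kap
  have : (j : ℝ) ≤ k := by exact_mod_cast h
  linarith

namespace WeightedGraph

variable {n : ℕ} {G : WeightedGraph (Fin n)}

theorem DistTo.nonneg {K : Set (Fin n)} {D : ℕ → ℝ} (h : G.DistTo K D) (v : Fin n) : 0 ≤ D v := by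
  obtain ⟨t, _, hw⟩ := h.walk v
  exact hw.nonneg

theorem DistTo.near {K : Set (Fin n)} {D : ℕ → ℝ} (h : G.DistTo K D) {S : Set (Fin n)}
    {u v : Fin n} {r : ℝ} (hn : G.Near S r u v) : D u ≤ r + D v := by
  obtain ⟨t, ht, hw⟩ := h.walk v
  obtain ⟨l, hl, hlw⟩ := hn
  have := h.le u t ht _ ((hlw.mono (Set.subset_univ S)).trans hw)
  linarith

theorem Clustering.mono {L : ℝ} {H : Set (Fin n)} {lev : Fin n → ℕ} {cs : List (Fin n)}
    {a : Fin n → Fin n} {best : Fin n → ℝ} {j k : ℕ} (h : Clustering G L H lev cs a best j)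
    (hjk : j ≤ k) : Clustering G L H lev cs a best k :=
  ⟨h.nonneg, h.mem, h.sorted, h.cover, h.packing, h.asg_best, h.asg_le,
    fun v hv => (h.lt v hv).trans_le hjk⟩

/-- What is known between two stages: `F` is the current assignment, `Fv` is the same with values
in the set of vertices, `L` is the least possible scale of the next stage. -/
structure StageInv (G : WeightedGraph (Fin n)) (K : Set (Fin n)) (D : ℕ → ℝ) (F : ℕ → ℕ)
    (Fv : Fin n → Fin n) (st : Fin n → ℕ) (Δ : ℕ → ℝ) (cl : ℕ → Fin n → Fin n) (i : ℕ) (L : ℝ)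
    (kmax : ℕ) : Prop where
  nonneg : 0 ≤ L
  zero : ∀ v : Fin n, F v = 0 → v ∉ K ∧ st v = i
  pos : ∀ v : Fin n, 0 < F v → F v = Fv v + 1 ∧ Fv v ∈ K ∧ (v ∉ K → st v < i)
  term : ∀ v : Fin n, v ∈ K → F v = v + 1
  near : ∀ k ≥ kmax, ∀ v : Fin n, 0 < F v →
    G.Near {x | F x = F v} (tau k * (kap k * L)) v (Fv v)
  half : ∀ v : Fin n, v ∉ K → st v < i → 2 * D v ≤ L
  lower : ∀ v : Fin n, F v = 0 → ∀ k ≥ kmax, L ≤ 2 * kap k * D v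
  stages : ∀ k ≥ kmax, Stages G K (fun v => D v) Fv st Δ cl i (tau k) (kap k)

theorem StageInv.init {K : Set (Fin n)} {D : ℕ → ℝ} {F : ℕ → ℕ} (hD : G.DistTo K D)
    (hK : ∀ v : Fin n, v ∈ K → F v = v + 1) (hK' : ∀ v : Fin n, v ∉ K → F v = 0) :
    StageInv G K D F id (fun _ => 0) (fun _ => 0) (fun _ => id) 0 0 0 := by
  have hpos : ∀ v : Fin n, 0 < F v → v ∈ K := fun v hv => by
    by_contra h
    rw [hK' v h] at hv
    exact absurd hv (lt_irrefl 0)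
  refine ⟨le_rfl, fun v hv => ⟨fun h => ?_, rfl⟩, fun v hv => ⟨hK v (hpos v hv), hpos v hv,
    fun h => absurd (hpos v hv) h⟩, hK, fun k _ v hv => ?_, fun v _ h => absurd h (by simp),
    fun v _ k _ => ?_, fun k _ => ?_⟩
  · have := hK v h; omega
  · exact .refl (by simp) rfl
  · have := one_le_kap k
    have := hD.nonneg v
    positivity
  · exact ⟨fun _ _ => le_rfl, fun j hj => absurd hj (by omega), fun _ _ _ _ h => absurd h (by simp),
      fun _ _ h => absurd h (by simp), fun _ _ j hj => absurd hj (by omega),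
      fun _ _ j hj => absurd hj (by simp), fun _ _ h => absurd h (by simp),
      fun _ _ h => absurd h (by simp)⟩

/-- The next scale 2κL' balances three demands. What is assigned now has D ≤ κL', hence 2D is at
most the next scale. What remains has D > L', hence the next scale is at most 2κD. The radius τκL +
τκL' is at most 2τκL', so it is again τκ times the next scale at most and does not accumulate over
the stages. As the number of levels differs between stages, all bounds are stated for every k that
is at least the largest number so far. -/
theorem StageInv.step {K : Set (Fin n)} {D : ℕ → ℝ} {F F' : ℕ → ℕ}
    {Fv : Fin n → Fin n} {st : Fin n → ℕ} {Δ : ℕ → ℝ} {cl : ℕ → Fin n → Fin n} {i : ℕ} {L L' : ℝ}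
    {kmax : ℕ} (h : StageInv G K D F Fv st Δ cl i L kmax) (hD : G.DistTo K D) (hLL : L ≤ L')
    (hL' : L' = L ∨ ∀ v : Fin n, F v = 0 → L' ≤ D v) {H : Set (Fin n)} (hH : ∀ v, v ∈ H ↔ F v = 0)
    {lev : Fin n → ℕ} {cs : List (Fin n)} {a : Fin n → Fin n} {best : Fin n → ℝ} {j : ℕ}
    (hcl : Clustering G L' H lev cs a best j)
    (hatt : ∀ k ≥ max kmax j, ∃ c, Attach G K H D a L' F c F' (tau k * (kap k * L) + tau k * (kap k * L'))
      (tau k * (kap k * L) + tau k * (kap k * L')))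
    (hall : ∀ v ∈ H, D v ≤ L' → 0 < F' v) :
    ∃ Fv' st' Δ' cl', StageInv G K D F' Fv' st' Δ' cl' (i + 1) (2 * (kap j * L')) (max kmax j) := by
  classical
  obtain ⟨c₀, h₀⟩ := hatt _ le_rfl
  have hL0 : 0 ≤ L' := h.nonneg.trans hLL
  have hk0 : ∀ k, 0 ≤ kap k := fun k => by linarith [one_le_kap k]
  have hFpos : ∀ v : Fin n, v ∉ H ↔ 0 < F v := fun v => by rw [hH v]; omega
  have hKH : ∀ v ∈ K, v ∉ H := fun v hv => by rw [hFpos, h.term v hv]; omega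
  have hmono : ∀ v : Fin n, 0 < F v → F' v = F v := fun v hv => h₀.old v ((hFpos v).2 hv)
  have hex : ∀ v : Fin n, ∃ t : Fin n, 0 < F' v → t ∈ K ∧ F' v = t + 1 := fun v => by
    by_cases hv : 0 < F' v
    · obtain ⟨t, ht, e, -⟩ := h₀.near v hv
      exact ⟨t, fun _ => ⟨ht, e⟩⟩
    · exact ⟨v, fun h => absurd h hv⟩
  choose Fv' hFv' using hex
  have hFv : ∀ v : Fin n, 0 < F v → Fv' v = Fv v := fun v hv => by
    have h1 := (hFv' v (by rw [hmono v hv]; exact hv)).2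
    have h2 := (h.pos v hv).1
    rw [hmono v hv] at h1
    exact Fin.ext (by omega)
  set st' : Fin n → ℕ := fun v => if F' v = 0 then i + 1 else st v with hst'
  have st0 : ∀ v : Fin n, F' v = 0 → st' v = i + 1 := fun v hv => if_pos hv
  have st1 : ∀ v : Fin n, 0 < F' v → st' v = st v := fun v hv => if_neg (by omega)
  have hF0 : ∀ v : Fin n, F' v = 0 → F v = 0 := fun v hv => by
    by_contra hne
    rw [hmono v (by omega)] at hv
    exact hne hv
  -- the three kinds of vertices outside `K`
  have kinds : ∀ v : Fin n, v ∉ K → (0 < F v ∧ 0 < F' v ∧ st' v = st v ∧ st v < i) ∨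
      (v ∈ H ∧ 0 < F' v ∧ st' v = i ∧ st v = i) ∨ (v ∈ H ∧ F' v = 0 ∧ st' v = i + 1 ∧ st v = i) := by
    intro v hv
    rcases Nat.eq_zero_or_pos (F v) with h1 | h1
    · rcases Nat.eq_zero_or_pos (F' v) with h2 | h2
      · exact Or.inr (Or.inr ⟨(hH v).2 h1, h2, st0 v h2, (h.zero v h1).2⟩)
      · exact Or.inr (Or.inl ⟨(hH v).2 h1, h2, (st1 v h2).trans (h.zero v h1).2, (h.zero v h1).2⟩)
    · have h2 : 0 < F' v := by rw [hmono v h1]; exact h1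
      exact Or.inl ⟨h1, h2, st1 v h2, (h.pos v h1).2.2 hv⟩
  -- The cluster of v is active: it contains y with D y ≤ L', and its diameter is at most 4jL'.
  have hupper : ∀ v : Fin n, v ∈ H → 0 < F' v → D v ≤ kap j * L' := by
    intro v hv hFv
    obtain ⟨y, hy, e, hyL⟩ := h₀.act v hv hFv
    have h1 := hcl.near_center hv
    have h2 := hcl.near_center hy
    rw [e] at h2
    have := hD.near (h1.symm.trans h2)
    unfold kap
    linarith
  set Δ' : ℕ → ℝ := Function.update Δ i L' with hΔ'
  set cl' : ℕ → Fin n → Fin n := Function.update cl i a with hcl'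
  have hne : ∀ {x}, x < i → x ≠ i := fun h => h.ne
  have hΔo : ∀ x, x < i → Δ' x = Δ x := fun x hx => Function.update_of_ne hx.ne _ _
  have hΔi : Δ' i = L' := Function.update_self _ _ _
  have hclo : ∀ x, x < i → cl' x = cl x := fun x hx => Function.update_of_ne hx.ne _ _
  have hcli : cl' i = a := Function.update_self _ _ _
  have hkL : L' ≤ kap j * L' := by nlinarith [one_le_kap j]
  refine ⟨Fv', st', Δ', cl', by nlinarith [hk0 j], fun v hv => ⟨(h.zero v (hF0 v hv)).1, st0 v hv⟩,
    fun v hv => ⟨(hFv' v hv).2, (hFv' v hv).1, fun hvK => ?_⟩, fun v hv => ?_, fun k hk v hv => ?_,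
    fun v hv hlt => ?_, fun v hv k hk => ?_, fun k hk => ?_⟩
  · rcases kinds v hvK with k1 | k1 | k1 <;> omega
  · rw [hmono v (by rw [h.term v hv]; omega), h.term v hv]
  · obtain ⟨c, hc⟩ := hatt k hk
    obtain ⟨t, ht, e, hn⟩ := hc.near v hv
    have : Fv' v = t := Fin.ext (by have := (hFv' v hv).2; omega)
    rw [this]
    refine hn.mono subset_rfl ?_
    have : (0 : ℝ) ≤ tau k * kap k := mul_nonneg (Nat.cast_nonneg _) (hk0 k)
    have e1 : (tau k : ℝ) * (kap k * L) ≤ tau k * kap k * L' := by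
      rw [← mul_assoc]; exact mul_le_mul_of_nonneg_left hLL this
    have e2 : (tau k : ℝ) * kap k * L' ≤ tau k * kap k * (kap j * L') :=
      mul_le_mul_of_nonneg_left hkL this
    nlinarith
  · rcases kinds v hv with k1 | k1 | k1
    · have := h.half v hv k1.2.2.2
      linarith
    · have := hupper v k1.1 k1.2.1
      linarith
    · omega
  · have h1 : L' < D v := by
      by_contra hcon
      have := hall v ((hH v).2 (hF0 v hv)) (not_lt.1 hcon)
      omega
    have h2 := kap_mono ((le_max_right kmax j).trans hk)
    have h3 : kap j * L' ≤ kap k * D v := mul_le_mul h2 h1.le hL0 (hk0 k)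
    linarith
  · have hS := h.stages k ((le_max_left _ _).trans hk)
    have hck := hcl.mono ((le_max_right kmax j).trans hk)
    obtain ⟨c, hc⟩ := hatt k hk
    refine ⟨fun v hv => ?_, fun x hx u v p hp hl => ?_, fun u v hu hv hlt heq hcc => ?_,
      fun v hv hlt => ?_, fun v hv x hx hlt => ?_, fun v hv x hx => ?_, fun v hv hlt => ?_,
      fun v hv hlt => ?_⟩
    · rcases kinds v hv with k1 | k1 | k1 <;> omega
    · rcases Nat.lt_succ_iff_lt_or_eq.1 hx with hlt | heq
      · rw [hclo x hlt]
        rw [hΔo x hlt] at hl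
        refine hS.scattering x hlt p (fun y hy => ⟨(hp y hy).1, ?_⟩) hl
        have := (hp y hy).2
        rcases kinds y (hp y hy).1 with k1 | k1 | k1 <;> omega
      · rw [heq] at hl hp ⊢
        rw [hcli]
        rw [hΔi] at hl
        refine hck.scattering p (fun y hy => ?_) hl
        have := (hp y hy).2
        rcases kinds y (hp y hy).1 with k1 | k1 | k1
        · omega
        · exact k1.1
        · exact k1.1
    · rcases kinds u hu with k1 | k1 | k1
      · rcases kinds v hv with k2 | k2 | k2
        · rw [hFv u k1.1, hFv v k2.1]
          rw [k1.2.2.1, hclo _ k1.2.2.2] at hcc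
          exact hS.const u v hu hv k1.2.2.2 (by omega) hcc
        · omega
        · omega
      · rcases kinds v hv with k2 | k2 | k2
        · omega
        · rw [k1.2.2.1, hcli] at hcc
          have := hc.const u k1.1 v k2.1 hcc
          have h1 := (hFv' u k1.2.1).2
          have h2 := (hFv' v k2.2.1).2
          exact Fin.ext (by omega)
        · omega
      · omega
    · rcases kinds v hv with k1 | k1 | k1
      · rw [k1.2.2.1, hΔo _ k1.2.2.2]
        exact hS.upper v hv k1.2.2.2
      · rw [k1.2.2.1, hΔi]
        exact (hupper v k1.1 k1.2.1).trans
          (mul_le_mul_of_nonneg_right (kap_mono ((le_max_right kmax j).trans hk)) hL0)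
      · omega
    · rcases kinds v hv with k1 | k1 | k1
      · rcases Nat.lt_succ_iff_lt_or_eq.1 hx with h1 | h1
        · rw [hΔo x h1]
          exact hS.half v hv x h1 (by omega)
        · rw [h1, hΔi]
          exact (h.half v hv k1.2.2.2).trans hLL
      · omega
      · omega
    · rcases kinds v hv with k1 | k1 | k1
      · rw [hΔo x (by omega)]
        exact hS.lower v hv x (by omega)
      · rw [hΔo x (by omega)]
        exact hS.lower v hv x (by omega)
      · by_cases hxi : x < i
        · rw [hΔo x hxi]
          exact hS.lower v hv x (by omega)
        · have : x = i := by omega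
          rw [this, hΔi]
          by_contra hcon
          have := hall v k1.1 (not_lt.1 hcon)
          omega
    · rcases kinds v hv with k1 | k1 | k1
      · rw [k1.2.2.1, hΔo _ k1.2.2.2]
        exact hS.scale v hv k1.2.2.2
      · rw [k1.2.2.1, hΔi]
        have hF := (hH v).1 k1.1
        -- Either the scale was inherited, and `lower` bounds it, or it is the least D among the
        -- unassigned vertices.
        rcases hL' with e | e
        · rw [e]; exact h.lower v hF k ((le_max_left _ _).trans hk)
        · have := e v hF
          have := one_le_kap k
          have := hD.nonneg v
          nlinarith
      · omega
    · rcases kinds v hv with k1 | k1 | k1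
      · rw [k1.2.2.1, hΔo _ k1.2.2.2, hFv v k1.1]
        exact hS.near v hv k1.2.2.2
      · rw [k1.2.2.1, hΔi]
        obtain ⟨t, ht, e, hn⟩ := hc.near v k1.2.1
        have : Fv' v = t := Fin.ext (by have := (hFv' v k1.2.1).2; omega)
        rw [this]
        refine hn.mono (Set.subset_univ _) ?_
        have : (0 : ℝ) ≤ tau k * kap k := mul_nonneg (Nat.cast_nonneg _) (hk0 k)
        nlinarith [mul_le_mul_of_nonneg_left hLL this]
      · omega

end WeightedGraph

/-! ### The program for all stages -/

namespace WeightedGraph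

variable {n : ℕ}

/-- The memory between two stages. -/
def StageMem (G : WeightedGraph (Fin n)) (K : Set (Fin n)) (s : Memory) : Prop :=
  ∃ Fv st Δ cl i, StageInv G K (s.real 16) (s.nat 20) Fv st Δ cl i (s.real 13 0) (s.nat 30 0)

end WeightedGraph

namespace Block

/-- Compute the least distance to the terminals of a vertex that has not been assigned. Variable
`28` is set if there is such a vertex. -/
def minB : Block :=
  .seq (.setNat 28 (.lit 0) (.lit 0))
    (.loop 65 0 (.ite (.and (.natLe (.read 20 (vr 65)) (.lit 0))
        (.not (.and (pos (vr 28)) (.realLe (rv 17) (.read 16 (vr 65))))))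
      (.seq (.setNat 28 (.lit 0) (.lit 1)) (.setReal 17 (.lit 0) (.read 16 (vr 65)))) .skip))

/-- Carry out a stage. -/
def stageB (ch : Block) : Block :=
  .seq minB <|
  .ite (pos (vr 28))
    (.seq (.ite (.realLe (rv 13) (rv 17)) (.setReal 13 (.lit 0) (rv 17)) .skip) <|
      .seq (partB ch) <|
      .seq attachB <|
      .seq (.setReal 13 (.lit 0) (.add (rv 13) (.add (rv 14) (rv 14))))
        (.setReal 13 (.lit 0) (.add (rv 13) (rv 13))))
    .skip

/-- Carry out all stages. -/
def mainB (ch : Block) : Block := .loop 66 0 (stageB ch)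

variable {n : ℕ} {G : WeightedGraph (Fin n)}

theorem stageB_within {ch : Block} (h : Chooser ch) :
    (stageB ch).Within [11, 12, 13, 14, 15, 16, 17, 18, 19, 20, 21, 22, 25, 26, 27, 28, 29, 30] 66
      [11, 12, 13, 14, 15, 17] :=
  .seq (by decide) (.ite (.seq (by decide)
    (.seq ((partB_within h).mono (by decide) (by decide) (by decide)) (.seq (by decide) (by decide))))
    (by decide))

theorem mainB_within {ch : Block} (h : Chooser ch) :
    (mainB ch).Within [11, 12, 13, 14, 15, 16, 17, 18, 19, 20, 21, 22, 25, 26, 27, 28, 29, 30] 67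
      [11, 12, 13, 14, 15, 17] :=
  .loop ((stageB_within h).mono (by decide) (by decide) (by decide)) (by decide) (by decide)

/-- Skipping to the least distance of an unassigned vertex guarantees that a stage assigns
something. Hence the number of stages depends on n and not on the spread of the weights. -/
theorem minB_spec {s : Memory} (h0 : s.nat 0 0 = n) :
    (0 < (minB.run s).nat 28 0 ↔ ∃ v : Fin n, s.nat 20 v = 0) ∧
    (0 < (minB.run s).nat 28 0 → (∀ v : Fin n, s.nat 20 v = 0 → (minB.run s).real 17 0 ≤ s.real 16 v) ∧
      ∃ v : Fin n, s.nat 20 v = 0 ∧ s.real 16 v = (minB.run s).real 17 0) := by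
  rw [minB, run_seq, run_setNat]
  simp only [NatExpr.eval]
  set s1 := s.writeNat 28 0 0 with hs1
  have main := loop_rule (x := 65) (b := 0) (p := .ite (.and (.natLe (.read 20 (vr 65)) (.lit 0))
        (.not (.and (pos (vr 28)) (.realLe (rv 17) (.read 16 (vr 65))))))
      (.seq (.setNat 28 (.lit 0) (.lit 1)) (.setReal 17 (.lit 0) (.read 16 (vr 65)))) .skip)
    (s := s1) (N := n) (by simpa [hs1] using h0) (fun i r =>
      (0 < r.nat 28 0 ↔ ∃ v : Fin n, (v : ℕ) < i ∧ s.nat 20 v = 0) ∧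
      (0 < r.nat 28 0 → (∀ v : Fin n, (v : ℕ) < i → s.nat 20 v = 0 → r.real 17 0 ≤ s.real 16 v) ∧
        ∃ v : Fin n, s.nat 20 v = 0 ∧ s.real 16 v = r.real 17 0)) ?_ ?_ ?_
  · refine ⟨main.1.trans ⟨fun ⟨v, _, h⟩ => ⟨v, h⟩, fun ⟨v, h⟩ => ⟨v, v.2, h⟩⟩, fun h => ?_⟩
    exact ⟨fun v => (main.2 h).1 v v.2, (main.2 h).2⟩
  · intro k r j h; simpa using h
  · simp [hs1]
  · intro i r hi hr hsr ⟨h1, h2⟩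
    have e20 : r.nat 20 = s.nat 20 := by rw [hsr.1 20 (by decide)]; simp [hs1]
    have e16 : r.real 16 = s.real 16 := by rw [hsr.2 16 (by decide)]; simp [hs1]
    have hsucc : ∀ v : Fin n, (v : ℕ) < i + 1 → (v : ℕ) < i ∨ (v : ℕ) = i := fun v hv => by omega
    by_cases hc : s.nat 20 i = 0 ∧ ¬ (0 < r.nat 28 0 ∧ r.real 17 0 ≤ s.real 16 i)
    · rw [run_ite_pos (by
        simp only [Test.Holds, NatExpr.eval, RealExpr.eval, hr, e20, e16]
        exact ⟨hc.1.le, hc.2⟩), run_seq, run_setNat, run_setReal]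
      simp only [NatExpr.eval, RealExpr.eval, Memory.nat_writeReal, Memory.nat_writeNat,
        Memory.real_writeReal, Memory.real_writeNat, if_true, Function.update_self,
        show (65 : ℕ) ≠ 28 by decide, if_false, hr, e16]
      refine ⟨⟨fun _ => ⟨⟨i, hi⟩, Nat.lt_succ_self i, hc.1⟩, fun _ => Nat.one_pos⟩, fun _ =>
        ⟨fun v hv hv0 => ?_, ⟨i, hi⟩, hc.1, rfl⟩⟩
      rcases hsucc v hv with h | h
      · have h3 : 0 < r.nat 28 0 := h1.2 ⟨v, h, hv0⟩
        have h4 : ¬ r.real 17 0 ≤ s.real 16 i := fun h => hc.2 ⟨h3, h⟩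
        have h5 := (h2 h3).1 v h hv0
        linarith
      · rw [h]
    · rw [run_ite_neg (by
        simp only [Test.Holds, NatExpr.eval, RealExpr.eval, hr, e20, e16]
        exact fun h => hc ⟨Nat.le_zero.1 h.1, h.2⟩), run_skip]
      refine ⟨h1.trans ⟨fun ⟨v, h, h'⟩ => ⟨v, by omega, h'⟩, fun ⟨v, h, h'⟩ => ?_⟩, fun h =>
        ⟨fun v hv hv0 => ?_, (h2 h).2⟩⟩
      · rcases hsucc v h with h | h
        · exact ⟨v, h, h'⟩
        · rw [h] at h'
          by_contra hcon
          exact hc ⟨h', fun h => hcon (h1.1 h.1)⟩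
      · rcases hsucc v hv with h' | h'
        · exact (h2 h).1 v h' hv0
        · rw [h'] at hv0 ⊢
          by_contra hcon
          exact hc ⟨hv0, fun h => hcon h.2⟩

theorem stageB_spec {ch : Block} (hch : Chooser ch) {s₀ : Memory}
    {Bd : ℝ → ℕ → Set (Fin n) → Prop} (hspec : ChooseSpec G ch s₀ Bd)
    (hBd : ∀ L, 0 ≤ L → ∀ (H : Set (Fin n)) (z : Fin n), z ∈ H → Bd L 0 (G.comp H z))
    {K : Set (Fin n)} {s : Memory}
    (hG : HoldsGraph G s) (hE : Env s₀ s) (hD : G.DistTo K (s.real 16)) (h : G.StageMem K s) :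
    G.StageMem K ((stageB ch).run s) ∧
    (((∃ v : Fin n, s.nat 20 v = 0) → {v : Fin n | ((stageB ch).run s).nat 20 v = 0}.ncard <
      {v : Fin n | s.nat 20 v = 0}.ncard) ∧
      ((¬ ∃ v : Fin n, s.nat 20 v = 0) → ((stageB ch).run s).nat 20 = s.nat 20)) ∧
    ∀ k, (∀ L, 0 ≤ L → ∀ C, C.Nonempty → ¬ Bd L k C) → s.nat 30 0 ≤ k →
      ((stageB ch).run s).nat 30 0 ≤ k := by
  rw [stageB, run_seq]
  obtain ⟨hm1, hm2⟩ := minB_spec hG.size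
  set s1 := minB.run s with hs1
  have w1 : minB.Within [28] 66 [17] := by decide
  have m1 : Same _ s s1 := same_run _ s
  have hG1 := w1.graph m1 hG (by decide) (by decide) (by decide) (by decide)
  have hE1 := w1.env m1 hE (by decide) (by decide)
  have a20 : s1.nat 20 = s.nat 20 := w1.nat m1 (by decide) (by decide)
  have a30 : s1.nat 30 = s.nat 30 := w1.nat m1 (by decide) (by decide)
  have a16 : s1.real 16 = s.real 16 := w1.real m1 (by decide) (by decide)
  have a13 : s1.real 13 = s.real 13 := w1.real m1 (by decide) (by decide)
  by_cases hne : ∃ v : Fin n, s.nat 20 v = 0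
  swap
  · rw [run_ite_neg (by simp only [Test.Holds, NatExpr.eval]; exact fun h => hne (hm1.1 h)), run_skip]
    refine ⟨?_, ⟨fun h => absurd h hne, fun _ => a20⟩, fun k _ h => by rw [a30]; exact h⟩
    unfold WeightedGraph.StageMem
    rw [a20, a30, a16, a13]
    exact h
  have hpos := hm1.2 hne
  obtain ⟨hmin, x, hx0, hxm⟩ := hm2 hpos
  rw [run_ite_pos (by simp only [Test.Holds, NatExpr.eval]; exact hpos), run_seq]
  obtain ⟨Fv, st, Δ, cl, i, hI⟩ := h
  set b2 : Block := .ite (.realLe (rv 13) (rv 17)) (.setReal 13 (.lit 0) (rv 17)) .skip with hb2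
  set s2 := b2.run s1 with hs2
  have w2 : b2.Within [] 40 [13] := by rw [hb2]; decide
  have m2 : Same _ s1 s2 := same_run _ s1
  have hG2 := w2.graph m2 hG1 (by decide) (by decide) (by decide) (by decide)
  have hE2 := w2.env m2 hE1 (by decide) (by decide)
  have b20 : s2.nat 20 = s.nat 20 := by rw [w2.nat m2 (by decide) (by decide), a20]
  have b30 : s2.nat 30 = s.nat 30 := by rw [w2.nat m2 (by decide) (by decide), a30]
  have b16 : s2.real 16 = s.real 16 := by rw [w2.real m2 (by decide) (by decide), a16]
  have hL2 : s.real 13 0 ≤ s2.real 13 0 ∧ s1.real 17 0 ≤ s2.real 13 0 ∧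
      (s2.real 13 0 = s.real 13 0 ∨ s2.real 13 0 = s1.real 17 0) := by
    by_cases hc : s.real 13 0 ≤ s1.real 17 0
    · have : s2.real 13 0 = s1.real 17 0 := by
        rw [hs2, hb2, run_ite_pos (by simp only [Test.Holds, RealExpr.eval, NatExpr.eval, a13]; exact hc),
          run_setReal]
        simp
      rw [this]
      exact ⟨hc, le_rfl, Or.inr rfl⟩
    · have : s2.real 13 0 = s.real 13 0 := by
        rw [hs2, hb2, run_ite_neg (by simp only [Test.Holds, RealExpr.eval, NatExpr.eval, a13]; exact hc),
          run_skip, a13]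
      rw [this]
      exact ⟨le_rfl, (not_le.1 hc).le, Or.inl rfl⟩
  obtain ⟨hLL, hmL, hL'⟩ := hL2
  set H : Set (Fin n) := {v | s.nat 20 v = 0} with hHdef
  have hH : ∀ v : Fin n, v ∈ H ↔ s.nat 20 v = 0 := fun v => Iff.rfl
  have hL0 : 0 ≤ s2.real 13 0 := hI.nonneg.trans hLL
  -- the clustering
  rw [run_seq]
  obtain ⟨lev, cs, a, ha, hcl, hoff, hmax, hk⟩ := partB_spec hch hspec (s := s2) (H := H)
    (by rw [b20]; exact hH) hG2 hE2 hL0 (fun z hz => hBd _ hL0 H z hz)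
  set s3 := (partB ch).run s2 with hs3
  have w3 := partB_within hch
  have m3 : Same _ s2 s3 := same_run _ s2
  have hG3 := w3.graph m3 hG2 (by decide) (by decide) (by decide) (by decide)
  have c20 : s3.nat 20 = s.nat 20 := by rw [w3.nat m3 (by decide) (by decide), b20]
  have c16 : s3.real 16 = s.real 16 := by rw [w3.real m3 (by decide) (by decide), b16]
  have c13 : s3.real 13 = s2.real 13 := w3.real m3 (by decide) (by decide)
  -- the attachment
  rw [run_seq]
  have hKH : ∀ t ∈ K, t ∉ H := fun t ht h => by
    rw [hH, hI.term t ht] at h; omega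
  have hatt : ∀ k ≥ max (s.nat 30 0) (s3.nat 29 0), (∃ c, G.Attach K H (s.real 16) a (s2.real 13 0)
      (s.nat 20) c ((attachB.run s3).nat 20)
      (tau k * (kap k * s.real 13 0) + tau k * (kap k * s2.real 13 0))
      (tau k * (kap k * s.real 13 0) + tau k * (kap k * s2.real 13 0))) ∧
      ∀ v ∈ H, s.real 16 v ≤ s2.real 13 0 → 0 < (attachB.run s3).nat 20 v := by
    intro k hk
    have := attachB_spec (K := K) (B := tau k * (kap k * s.real 13 0)) hG3
      (by rw [c20]; exact hH) (by rw [c13]; exact hcl.mono ((le_max_right _ _).trans hk)) ha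
      (by rw [c16]; exact hD) hKH (by
        rw [c20]
        intro v hv
        have := hI.pos v hv
        exact ⟨Fv v, this.2.1, this.1, hI.near k ((le_max_left _ _).trans hk) v hv⟩)
    rw [c20, c16, c13] at this
    exact this
  set s4 := attachB.run s3 with hs4
  have w4 := attachB_within
  have m4 : Same _ s3 s4 := same_run _ s3
  have hall := (hatt _ le_rfl).2
  obtain ⟨Fv', st', Δ', cl', hI'⟩ := hI.step hD hLL
    (hL'.imp_right fun e v hv => by rw [e]; exact hmin v hv) hH hcl (fun k hk => (hatt k hk).1) hall
  have d30 : s4.nat 30 0 = max (s.nat 30 0) (s3.nat 29 0) := by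
    rw [w4.nat m4 (by decide) (by decide), hmax, b30]
  have d16 : s4.real 16 = s.real 16 := by rw [w4.real m4 (by decide) (by decide), c16]
  have d13 : s4.real 13 = s2.real 13 := by rw [w4.real m4 (by decide) (by decide), c13]
  have d14 : s4.real 14 0 = 2 * s2.real 13 0 * s3.nat 29 0 := by
    rw [w4.real m4 (by decide) (by decide), hoff]
  rw [run_seq, run_setReal, run_setReal]
  refine ⟨⟨Fv', st', Δ', cl', i + 1, ?_⟩, ⟨fun _ => ?_, fun h => absurd hne h⟩, fun k hk1 hk2 => ?_⟩
  -- After the partition, variable `14` contains 2L times the number j of levels, so L plus twice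
  -- this is (4j + 1)L = κL; a further doubling gives the next scale.
  · have e13 : 2 * (kap (s3.nat 29 0) * s2.real 13 0) =
        s2.real 13 0 + (s4.real 14 0 + s4.real 14 0) +
          (s2.real 13 0 + (s4.real 14 0 + s4.real 14 0)) := by
      rw [d14]; unfold kap; ring
    rw [← d30, e13] at hI'
    simpa [d13, d16] using hI'
  · simp only [Memory.nat_writeReal]
    have hsub : {v : Fin n | s4.nat 20 v = 0} ⊆ H := by
      intro v hv
      obtain ⟨c, hc⟩ := (hatt _ le_rfl).1
      by_contra hvH
      have h1 := hc.old v hvH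
      have h2 : s4.nat 20 v = 0 := hv
      rw [h2] at h1
      exact hvH h1.symm
    -- The vertex x that attains the least distance is active at this scale, so it becomes assigned.
    refine Set.ncard_lt_ncard ⟨hsub, fun hs => ?_⟩ (Set.toFinite _)
    have h1 : s4.nat 20 x = 0 := hs hx0
    have h2 := hall x hx0 (by rw [hxm]; exact hmL)
    omega
  · simp only [Memory.nat_writeReal]
    rw [d30]
    exact max_le hk2 (hk k (hk1 _ hL0))

theorem mainB_spec {ch : Block} (hch : Chooser ch) {s₀ : Memory}
    {Bd : ℝ → ℕ → Set (Fin n) → Prop} (hspec : ChooseSpec G ch s₀ Bd)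
    (hBd : ∀ L, 0 ≤ L → ∀ (H : Set (Fin n)) (z : Fin n), z ∈ H → Bd L 0 (G.comp H z))
    {K : Set (Fin n)} {s : Memory}
    (hG : HoldsGraph G s) (hE : Env s₀ s) (hD : G.DistTo K (s.real 16)) (h : G.StageMem K s) :
    G.StageMem K ((mainB ch).run s) ∧ (∀ v : Fin n, 0 < ((mainB ch).run s).nat 20 v) ∧
    ∀ k, (∀ L, 0 ≤ L → ∀ C, C.Nonempty → ¬ Bd L k C) → s.nat 30 0 ≤ k →
      ((mainB ch).run s).nat 30 0 ≤ k := by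
  have w := mainB_within hch
  have main : G.StageMem K ((mainB ch).run s) ∧
      ({v : Fin n | ((mainB ch).run s).nat 20 v = 0}.ncard + n ≤ n ∨
        ¬ ∃ v : Fin n, ((mainB ch).run s).nat 20 v = 0) ∧
      ∀ k, (∀ L, 0 ≤ L → ∀ C, C.Nonempty → ¬ Bd L k C) → s.nat 30 0 ≤ k →
        ((mainB ch).run s).nat 30 0 ≤ k := by
    refine loop_rule (N := n) hG.size (fun i r => G.StageMem K r ∧
      ({v : Fin n | r.nat 20 v = 0}.ncard + i ≤ n ∨ ¬ ∃ v : Fin n, r.nat 20 v = 0) ∧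
      ∀ k, (∀ L, 0 ≤ L → ∀ C, C.Nonempty → ¬ Bd L k C) → s.nat 30 0 ≤ k → r.nat 30 0 ≤ k) ?_ ?_ ?_
    · intro k r j h; simpa [WeightedGraph.StageMem] using h
    · refine ⟨h, Or.inl ?_, fun _ _ h => h⟩
      have := Set.ncard_le_card {v : Fin n | s.nat 20 v = 0}
      simpa using this
    · intro i r hi hr hsr ⟨h1, h2, h3⟩
      have hGr := w.graph hsr hG (by decide) (by decide) (by decide) (by decide)
      have hEr := w.env hsr hE (by decide) (by decide)
      have e16 : r.real 16 = s.real 16 := w.real hsr (by decide) (by decide)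
      obtain ⟨g1, ⟨g2, g3⟩, g4⟩ := stageB_spec hch hspec hBd hGr hEr (by rw [e16]; exact hD) h1
      refine ⟨g1, ?_, fun k hk hk' => g4 k hk (h3 k hk hk')⟩
      by_cases hne : ∃ v : Fin n, r.nat 20 v = 0
      · have := g2 hne
        rcases h2 with h2 | h2
        · left; omega
        · exact absurd hne h2
      · right
        rw [g3 hne]; exact hne
  refine ⟨main.1, fun v => ?_, main.2.2⟩
  by_contra hv
  have hv0 : ((mainB ch).run s).nat 20 v = 0 := by omega
  rcases main.2.1 with h | h
  · have : {v : Fin n | ((mainB ch).run s).nat 20 v = 0}.ncard = 0 := by omega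
    rw [Set.ncard_eq_zero (Set.toFinite _)] at this
    have h3 : v ∈ {v : Fin n | ((mainB ch).run s).nat 20 v = 0} := hv0
    rw [this] at h3
    exact h3
  · exact h ⟨v, hv0⟩

end Block

/-! ### Preparation -/

theorem mul_add_inj {n a b a' b' : ℕ} (hb : b < n) (hb' : b' < n) (h : a * n + b = a' * n + b') :
    a = a' ∧ b = b' := by
  have hn : 0 < n := by omega
  have key : ∀ a b, b < n → (a * n + b) / n = a ∧ (a * n + b) % n = b := fun a b hb => by
    rw [Nat.add_comm]
    exact ⟨by rw [Nat.add_mul_div_right _ _ hn, Nat.div_eq_of_lt hb, Nat.zero_add],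
      by rw [Nat.add_mul_mod_self_right, Nat.mod_eq_of_lt hb]⟩
  exact ⟨by rw [← (key a b hb).1, h, (key a' b' hb').1],
    by rw [← (key a b hb).2, h, (key a' b' hb').2]⟩

theorem index_inj {n : ℕ} {t v t' v' : Fin n} (h : (t : ℕ) * n + v = t' * n + v') :
    t = t' ∧ v = v' :=
  ⟨Fin.ext (mul_add_inj v.2 v'.2 h).1, Fin.ext (mul_add_inj v.2 v'.2 h).2⟩

/-- The memory holds the input. -/
structure HoldsInput {n : ℕ} (G : WeightedGraph (Fin n)) (K : Set (Fin n)) (s : Memory) : Prop where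
  size : s.nat 0 0 = n
  adj : ∀ u v : Fin n, 0 < s.nat 1 (u * n + v) ↔ G.graph.Adj u v
  len : ∀ u v : Fin n, G.graph.Adj u v → s.real 0 (u * n + v) = G.len u v
  term : ∀ v : Fin n, 0 < s.nat 2 v ↔ v ∈ K

/-- The memory also holds what is computed before the stages. -/
structure Prepared {n : ℕ} (G : WeightedGraph (Fin n)) (K : Set (Fin n)) (s : Memory) : Prop
    extends HoldsGraph G s where
  term : ∀ v : Fin n, 0 < s.nat 2 v ↔ v ∈ K
  distTo : G.DistTo K (s.real 16)
  isDist : ∀ t v : Fin n, G.IsDist Set.univ t v (s.real 1 (t * n + v))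

namespace Block

/-- Compute the multiples of `n`. -/
def mulB : Block :=
  .seq (.setNat 10 (.lit 0) (.lit 0)) <|
  .seq (.loop 67 0 (.setNat 10 (.add (vr 67) (.lit 1)) (.add (.read 10 (vr 67)) (vr 0))))
    (.loop 67 1 (.setNat 10 (.add (vr 67) (.lit 1)) (.add (.read 10 (vr 67)) (vr 0))))

/-- Record the distance of the vertices in variables `68` and `69`. -/
def recordB : Block :=
  .seq (.setReal 1 (ix (vr 68) (vr 69)) (.read 11 (vr 69)))
    (.ite (.and (pos (.read 2 (vr 68)))
        (.not (.and (pos (.read 24 (vr 69))) (.realLe (.read 16 (vr 69)) (.read 11 (vr 69))))))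
      (.seq (.setNat 24 (vr 69) (.lit 1)) (.setReal 16 (vr 69) (.read 11 (vr 69)))) .skip)

/-- Compute all distances and the distances to the terminals. -/
def prepareB : Block :=
  .seq mulB <|
  .seq (.loop 67 0 (.seq (.setNat 23 (vr 67) (.lit 1)) (.setNat 24 (vr 67) (.lit 0)))) <|
  .loop 68 0 (.seq (distB 23 68) (.loop 69 0 recordB))

/-- Start with the terminals only. -/
def resetB : Block :=
  .seq (.loop 67 0 (.ite (pos (.read 2 (vr 67))) (.setNat 20 (vr 67) (.add (vr 67) (.lit 1)))
    (.setNat 20 (vr 67) (.lit 0)))) <|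
  .seq (.setReal 13 (.lit 0) .zero) (.setNat 30 (.lit 0) (.lit 0))

variable {n : ℕ} {G : WeightedGraph (Fin n)} {K : Set (Fin n)}

/-- Used twice, for the bounds n and m. The second pass rewrites the entries of the first with the
same values, so in the end the table reaches as far as the larger bound. -/
theorem mulB_loop {s : Memory} {b : ℕ} (h : ∀ i, s.nat 10 0 = 0 ∧ (i < s.nat 0 0 → s.nat 10 i = i * s.nat 0 0 ∨ b = 0)) :
    ∀ i, (i ≤ s.nat 0 b ∨ (b ≠ 0 ∧ i < s.nat 0 0)) →
      ((loop 67 b (.setNat 10 (.add (vr 67) (.lit 1)) (.add (.read 10 (vr 67)) (vr 0)))).run s).nat 10 i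
        = i * s.nat 0 0 := by
  have main := loop_rule (x := 67) (b := b)
    (p := .setNat 10 (.add (vr 67) (.lit 1)) (.add (.read 10 (vr 67)) (vr 0))) (s := s) rfl
    (fun k r => ∀ i, (i ≤ k ∨ (b ≠ 0 ∧ i < s.nat 0 0)) → r.nat 10 i = i * s.nat 0 0) ?_ ?_ ?_
  · exact main
  · intro k r j h; simpa using h
  · rintro i (hi | hi)
    · rw [Nat.le_zero.1 hi, (h 0).1, Nat.zero_mul]
    · exact ((h i).2 hi.2).resolve_right hi.1
  · intro k r hk hr hsr hI i hi
    have e0 : r.nat 0 = s.nat 0 := hsr.1 0 (by simp [natW])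
    simp only [run_setNat, NatExpr.eval, hr, e0, Memory.nat_writeNat, if_true]
    by_cases hik : i = k + 1
    · subst hik
      rw [Function.update_self, hI k (Or.inl le_rfl)]; ring
    · rw [Function.update_of_ne hik]
      exact hI i (by omega)

theorem mulB_spec {s : Memory} : ∀ i, i < s.nat 0 0 ∨ i < s.nat 0 1 →
    (mulB.run s).nat 10 i = i * s.nat 0 0 := by
  rw [mulB, run_seq, run_setNat, run_seq]
  simp only [NatExpr.eval]
  set s1 := s.writeNat 10 0 0 with hs1
  have e1 : s1.nat 0 = s.nat 0 := by simp [hs1]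
  have h1 := mulB_loop (s := s1) (b := 0) (fun i => ⟨by simp [hs1], fun _ => Or.inr rfl⟩)
  set s2 := (loop 67 0 (.setNat 10 (.add (vr 67) (.lit 1)) (.add (.read 10 (vr 67)) (vr 0)))).run s1
    with hs2
  have e2 : s2.nat 0 = s.nat 0 := by rw [← e1]; exact run_nat (by decide) _
  have h2 := mulB_loop (s := s2) (b := 1) (fun i => ⟨by rw [h1 0 (Or.inl (Nat.zero_le _)), Nat.zero_mul],
    fun hi => Or.inl (by rw [e2] at hi ⊢; rw [h1 i (Or.inl (by rw [e1]; omega)), e1])⟩)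
  rw [e2] at h2
  intro i hi
  exact h2 i (by omega)

/-- The distance of `v` to the first `i` vertices in `K` has been found. -/
def DistFound (G : WeightedGraph (Fin n)) (K : Set (Fin n)) (i : ℕ) (v : Fin n) (seen : ℕ) (d : ℝ) :
    Prop :=
  (0 < seen ↔ ∃ t : Fin n, (t : ℕ) < i ∧ t ∈ K) ∧ (0 < seen → (∃ t ∈ K, G.WalkIn Set.univ v t d) ∧
    ∀ t : Fin n, (t : ℕ) < i → t ∈ K → ∀ l, G.WalkIn Set.univ v t l → d ≤ l)

theorem recordB_spec {r : Memory} (hG : HoldsGraph G r) {t v : Fin n} (ht : r.nat 68 0 = t)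
    (hv : r.nat 69 0 = v) (hterm : ∀ v : Fin n, 0 < r.nat 2 v ↔ v ∈ K)
    (hd : G.IsDist Set.univ t v (r.real 11 v)) (h : DistFound G K t v (r.nat 24 v) (r.real 16 v)) :
    (recordB.run r).real 1 = Function.update (r.real 1) (t * n + v) (r.real 11 v) ∧
    (∀ y : Fin n, y ≠ v → (recordB.run r).nat 24 y = r.nat 24 y ∧
      (recordB.run r).real 16 y = r.real 16 y) ∧
    DistFound G K (t + 1) v ((recordB.run r).nat 24 v) ((recordB.run r).real 16 v) := by
  have hm : r.nat 10 t = t * n := hG.mul t (by rw [hG.size]; exact Or.inl t.2)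
  have hsucc : ∀ x : Fin n, (x : ℕ) < t + 1 → (x : ℕ) < t ∨ x = t := fun x hx => by
    rcases Nat.lt_succ_iff_lt_or_eq.1 hx with h | h
    · exact Or.inl h
    · exact Or.inr (Fin.ext h)
  rw [recordB, run_seq, run_setReal]
  simp only [NatExpr.eval, RealExpr.eval, ht, hv, hm]
  set q := r.writeReal 1 (t * n + v) (r.real 11 v) with hq
  obtain ⟨h1, h2⟩ := h
  by_cases hc : t ∈ K ∧ ¬ (0 < r.nat 24 v ∧ r.real 16 v ≤ r.real 11 v)
  · rw [run_ite_pos (by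
      simp only [Test.Holds, NatExpr.eval, RealExpr.eval]
      simp only [hq, Memory.nat_writeReal, Memory.real_writeReal, ht, hv,
        show (16 : ℕ) ≠ 1 by decide, show (11 : ℕ) ≠ 1 by decide, if_false]
      exact ⟨(hterm t).2 hc.1, hc.2⟩), run_seq, run_setNat, run_setReal]
    refine ⟨by simp [hq], fun y hy => ?_, ?_⟩
    · have : (y : ℕ) ≠ v := fun h => hy (Fin.ext h)
      simp [hq, hv, Function.update_of_ne this]
    · have e1 : (((q.writeNat 24 ((vr 69).eval q) ((NatExpr.lit 1).eval q)).writeReal 16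
        ((vr 69).eval (q.writeNat 24 ((vr 69).eval q) ((NatExpr.lit 1).eval q)))
        ((RealExpr.read 11 (vr 69)).eval (q.writeNat 24 ((vr 69).eval q)
          ((NatExpr.lit 1).eval q)))).nat 24 v) = 1 := by simp [hq, hv]
      have e2 : (((q.writeNat 24 ((vr 69).eval q) ((NatExpr.lit 1).eval q)).writeReal 16
        ((vr 69).eval (q.writeNat 24 ((vr 69).eval q) ((NatExpr.lit 1).eval q)))
        ((RealExpr.read 11 (vr 69)).eval (q.writeNat 24 ((vr 69).eval q)
          ((NatExpr.lit 1).eval q)))).real 16 v) = r.real 11 v := by simp [hq, hv]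
      rw [e1, e2]
      refine ⟨⟨fun _ => ⟨t, Nat.lt_succ_self _, hc.1⟩, fun _ => Nat.one_pos⟩, fun _ =>
        ⟨⟨t, hc.1, hd.1.symm⟩, fun x hx hxK l hl => ?_⟩⟩
      rcases hsucc x hx with hlt | rfl
      · have h3 := h1.2 ⟨x, hlt, hxK⟩
        have h4 := (h2 h3).2 x hlt hxK l hl
        have h5 : ¬ r.real 16 v ≤ r.real 11 v := fun h => hc.2 ⟨h3, h⟩
        linarith
      · exact hd.2 l hl.symm
  · rw [run_ite_neg (by
      simp only [Test.Holds, NatExpr.eval, RealExpr.eval]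
      simp only [hq, Memory.nat_writeReal, Memory.real_writeReal, ht, hv,
        show (16 : ℕ) ≠ 1 by decide, show (11 : ℕ) ≠ 1 by decide, if_false]
      exact fun h => hc ⟨(hterm t).1 h.1, h.2⟩), run_skip]
    refine ⟨by simp [hq], fun y _ => by simp [hq], ?_⟩
    have e1 : q.nat 24 v = r.nat 24 v := by simp [hq]
    have e2 : q.real 16 v = r.real 16 v := by simp [hq]
    rw [e1, e2]
    have hseen : t ∈ K → 0 < r.nat 24 v ∧ r.real 16 v ≤ r.real 11 v := fun h => by
      by_contra hcon; exact hc ⟨h, hcon⟩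
    refine ⟨⟨fun h => ?_, ?_⟩, fun h => ⟨(h2 h).1, fun x hx hxK l hl => ?_⟩⟩
    · obtain ⟨x, hx, hxK⟩ := h1.1 h
      exact ⟨x, by omega, hxK⟩
    · rintro ⟨x, hx, hxK⟩
      rcases hsucc x hx with hlt | rfl
      · exact h1.2 ⟨x, hlt, hxK⟩
      · exact (hseen hxK).1
    · rcases hsucc x hx with hlt | rfl
      · exact (h2 h).2 x hlt hxK l hl
      · exact (hseen hxK).2.trans (hd.2 l hl.symm)

/-- Connectedness makes all distances finite, and a terminal must exist for the distance to the
terminals to make sense. The matrix of distances in real array `1` is at the same time the final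
array of edge weights. -/
theorem prepareB_spec (hconn : G.graph.Connected) {s : Memory} (h : HoldsInput G K s)
    (hK : K.Nonempty) : Prepared G K (prepareB.run s) := by
  rw [prepareB, run_seq]
  have hmul := mulB_spec (s := s)
  set s1 := mulB.run s with hs1
  have w1 : mulB.Within [10] 68 [] := by decide
  have m1 : Same _ s s1 := same_run _ s
  have e0 : s1.nat 0 = s.nat 0 := w1.nat m1 (by decide) (by decide)
  have hG1 : HoldsGraph G s1 := by
    refine ⟨by rw [e0, h.size], ?_, ?_, ?_⟩
    · rw [w1.nat m1 (by decide) (by decide)]; exact h.adj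
    · rw [w1.real m1 (by decide) (by decide)]; exact h.len
    · intro i hi
      rw [e0] at hi
      rw [hmul i hi, h.size]
  rw [run_seq]
  set b2 : Block := .loop 67 0 (.seq (.setNat 23 (vr 67) (.lit 1)) (.setNat 24 (vr 67) (.lit 0)))
    with hb2
  set s2 := b2.run s1 with hs2
  have w2 : b2.Within [23, 24] 68 [] := by rw [hb2]; decide
  have m2 : Same _ s1 s2 := same_run _ s1
  have hG2 := w2.graph m2 hG1 (by decide) (by decide) (by decide) (by decide)
  have h23 : ∀ k, s2.nat 23 k = if k < n then 1 else s1.nat 23 k := by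
    refine loop_pointwise hG1.size 23 (by decide) (fun _ => 1) ?_
    intro k r hk hr _ _
    simp [run_seq, run_setNat, hr]
  have h24 : ∀ k, s2.nat 24 k = if k < n then 0 else s1.nat 24 k := by
    refine loop_pointwise hG1.size 24 (by decide) (fun _ => 0) ?_
    intro k r hk hr _ _
    simp [run_seq, run_setNat, hr]
  have e23 : (supp (s2.nat 23) : Set (Fin n)) = Set.univ := by
    ext v; simp [mem_supp, h23]
  have hcomp : ∀ x y : Fin n, y ∈ G.comp Set.univ x := fun x y => by
    obtain ⟨p⟩ := hconn x y
    exact ⟨_, p, by simp, rfl⟩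
  have hterm2 : ∀ v : Fin n, 0 < s2.nat 2 v ↔ v ∈ K := by
    rw [w2.nat m2 (by decide) (by decide), w1.nat m1 (by decide) (by decide)]
    exact h.term
  set b3 : Block := .loop 68 0 (.seq (distB 23 68) (.loop 69 0 recordB)) with hb3
  have w3 : b3.Within [11, 24] 70 [1, 11, 16] := by rw [hb3]; decide
  have main : (∀ t v : Fin n, (t : ℕ) < n → G.IsDist Set.univ t v ((b3.run s2).real 1 (t * n + v))) ∧
      ∀ v : Fin n, DistFound G K n v ((b3.run s2).nat 24 v) ((b3.run s2).real 16 v) := by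
    refine loop_rule (N := n) hG2.size (fun i r =>
      (∀ t v : Fin n, (t : ℕ) < i → G.IsDist Set.univ t v (r.real 1 (t * n + v))) ∧
      ∀ v : Fin n, DistFound G K i v (r.nat 24 v) (r.real 16 v)) ?_ ?_ ?_
    · intro k r j h; simpa using h
    · refine ⟨fun t v h => absurd h (by omega), fun v => ?_⟩
      rw [h24, if_pos v.2]
      exact ⟨by simp, fun h => absurd h (lt_irrefl 0)⟩
    · intro i r hi hr hsr ⟨hI1, hI2⟩
      have hGr := w3.graph hsr hG2 (by decide) (by decide) (by decide) (by decide)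
      have r23 : r.nat 23 = s2.nat 23 := w3.nat hsr (by decide) (by decide)
      have r2 : r.nat 2 = s2.nat 2 := w3.nat hsr (by decide) (by decide)
      have hd := distB_spec (S := 23) (X := 68) (by decide) (by decide) hGr (x := ⟨i, hi⟩) hr
        (by rw [r23, e23]; trivial)
      rw [r23, e23] at hd
      rw [run_seq]
      set q := (distB 23 68).run r with hq
      have wq : (distB 23 68).Within [11] 44 [11] := by decide
      have mq : Same _ r q := same_run _ r
      have hGq := wq.graph mq hGr (by decide) (by decide) (by decide) (by decide)
      have hd' : ∀ v : Fin n, G.IsDist Set.univ ⟨i, hi⟩ v (q.real 11 v) := fun v =>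
        (hd v).2 ((hd v).1.2 (hcomp _ _))
      have q68 : q.nat 68 = r.nat 68 := mq.1 68 (by decide)
      have q24 : q.nat 24 = r.nat 24 := wq.nat mq (by decide) (by decide)
      have q16 : q.real 16 = r.real 16 := wq.real mq (by decide) (by decide)
      have q1 : q.real 1 = r.real 1 := wq.real mq (by decide) (by decide)
      have inner := loop_rule (x := 69) (b := 0) (p := recordB) (s := q) hGq.size (fun j p =>
        (∀ t v : Fin n, (t : ℕ) < i ∨ ((t : ℕ) = i ∧ (v : ℕ) < j) →
          G.IsDist Set.univ t v (p.real 1 (t * n + v))) ∧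
        ∀ v : Fin n, ((v : ℕ) < j → DistFound G K (i + 1) v (p.nat 24 v) (p.real 16 v)) ∧
          (j ≤ v → DistFound G K i v (p.nat 24 v) (p.real 16 v))) ?_ ?_ ?_
      · refine ⟨fun t v ht => inner.1 t v ?_, fun v => (inner.2 v).1 v.2⟩
        have := v.2
        omega
      · intro k r j h; simpa using h
      · rw [q1, q24, q16]
        refine ⟨fun t v ht => hI1 t v (by omega), fun v => ⟨fun h => absurd h (by omega), fun _ => hI2 v⟩⟩
      · intro j p hj hp hsp ⟨hp1, hp2⟩
        have w : (loop 69 0 recordB).Within [24] 70 [1, 16] := by decide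
        have hGp := w.graph hsp hGq (by decide) (by decide) (by decide) (by decide)
        have p11 : p.real 11 = q.real 11 := w.real hsp (by decide) (by decide)
        have p68 : p.nat 68 0 = i := by rw [hsp.1 68 (by decide), q68, hr]
        have p2 : p.nat 2 = s2.nat 2 := by
          rw [w.nat hsp (by decide) (by decide), wq.nat mq (by decide) (by decide), r2]
        obtain ⟨g1, g2, g3⟩ := recordB_spec (K := K) (t := ⟨i, hi⟩) (v := ⟨j, hj⟩) hGp p68 hp
          (by rw [p2]; exact hterm2) (by rw [p11]; exact hd' _) ((hp2 ⟨j, hj⟩).2 le_rfl)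
        refine ⟨fun t v htv => ?_, fun v => ?_⟩
        · rw [g1]
          by_cases heq : (t : ℕ) * n + v = i * n + j
          · obtain ⟨e1, e2⟩ := index_inj (t := t) (v := v) (t' := ⟨i, hi⟩) (v' := ⟨j, hj⟩) heq
            rw [heq, Function.update_self, p11, e1, e2]
            exact hd' _
          · rw [Function.update_of_ne heq]
            refine hp1 t v ?_
            by_contra hcon
            have h1 : (t : ℕ) = i := by omega
            have h2 : (v : ℕ) = j := by omega
            exact heq (by rw [h1, h2])
        · by_cases hv : v = ⟨j, hj⟩
          · subst hv
            exact ⟨fun _ => g3, fun h => absurd h (by simp)⟩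
          · have hne : (v : ℕ) ≠ j := fun h => hv (Fin.ext h)
            rw [(g2 v hv).1, (g2 v hv).2]
            exact ⟨fun h => (hp2 v).1 (by omega), fun h => (hp2 v).2 (by omega)⟩
  have m3 : Same _ s2 (b3.run s2) := same_run _ s2
  have hG3 := w3.graph m3 hG2 (by decide) (by decide) (by decide) (by decide)
  obtain ⟨t₀, ht₀⟩ := hK
  refine { toHoldsGraph := hG3, term := ?_, distTo := ⟨fun v => ?_, fun v t ht l hl => ?_⟩,
           isDist := fun t v => main.1 t v t.2 }
  · rw [w3.nat m3 (by decide) (by decide)]; exact hterm2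
  · have := main.2 v
    exact (this.2 (this.1.2 ⟨t₀, t₀.2, ht₀⟩)).1
  · have := main.2 v
    exact (this.2 (this.1.2 ⟨t₀, t₀.2, ht₀⟩)).2 t t.2 ht l hl

theorem prepareB_within : prepareB.Within [10, 11, 23, 24] 70 [1, 11, 16] := by decide

theorem resetB_within : resetB.Within [20, 30] 70 [13] := by decide

theorem resetB_spec {s : Memory} (h : Prepared G K s) : G.StageMem K (resetB.run s) := by
  rw [resetB, run_seq]
  set b1 : Block := .loop 67 0 (.ite (pos (.read 2 (vr 67)))
    (.setNat 20 (vr 67) (.add (vr 67) (.lit 1))) (.setNat 20 (vr 67) (.lit 0))) with hb1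
  set s1 := b1.run s with hs1
  have w1 : b1.Within [20] 68 [] := by rw [hb1]; decide
  have m1 : Same _ s s1 := same_run _ s
  have h20 : ∀ k, s1.nat 20 k = if k < n then (if 0 < s.nat 2 k then k + 1 else 0) else s.nat 20 k := by
    refine loop_pointwise h.size 20 (by decide) (fun k => if 0 < s.nat 2 k then k + 1 else 0) ?_
    intro k r hk hr hsr _
    have e : r.nat 2 = s.nat 2 := hsr.1 2 (by decide)
    by_cases hp : 0 < s.nat 2 k
    · rw [run_ite_pos (by simp only [Test.Holds, NatExpr.eval, hr, e]; exact hp), if_pos hp]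
      simp [run_setNat, hr]
    · rw [run_ite_neg (by simp only [Test.Holds, NatExpr.eval, hr, e]; exact hp), if_neg hp]
      simp [run_setNat, hr]
  rw [run_seq, run_setReal, run_setNat]
  refine ⟨id, fun _ => 0, fun _ => 0, fun _ => id, 0, ?_⟩
  have e16 : s1.real 16 = s.real 16 := w1.real m1 (by decide) (by decide)
  have := WeightedGraph.StageInv.init (F := s1.nat 20) h.distTo
    (fun v hv => by rw [h20, if_pos v.2, if_pos ((h.term v).2 hv)])
    (fun v hv => by rw [h20, if_pos v.2, if_neg fun hh => hv ((h.term v).1 hh)])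
  simpa [e16] using this

end Block

/-! ### The output -/

namespace WeightedGraph

variable {n : ℕ} {G : WeightedGraph (Fin n)}

/-- The graph on `K` that arises by contracting the fibers of `Fv`; edges are as long as the
distances `δ` of their ends. -/
noncomputable def contraction (G : WeightedGraph (Fin n)) (K : Finset (Fin n))
    (δ : Fin n → Fin n → ℝ) (Fv : Fin n → Fin n) : WeightedGraph K where
  graph :=
    { Adj := fun t t' => t ≠ t' ∧ ∃ u v, G.graph.Adj u v ∧ Fv u = t ∧ Fv v = t'
      symm := ⟨fun _ _ ⟨h, u, v, h1, h2, h3⟩ => ⟨h.symm, v, u, h1.symm, h3, h2⟩⟩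
      loopless := ⟨fun _ h => h.1 rfl⟩ }
  weight := Sym2.lift ⟨fun t t' => (min (δ t t') (δ t' t)).toNNReal, fun t t' => by
    simp only [min_comm]⟩

/-- The minimum in the definition of `contraction` only serves to make the weight symmetric without
a hypothesis on δ; for distances it does nothing. -/
theorem contraction_weight {K : Finset (Fin n)} {δ : Fin n → Fin n → ℝ} {Fv : Fin n → Fin n}
    (hδ : ∀ t v, G.IsDist Set.univ t v (δ t v)) (t t' : K) :
    ((G.contraction K δ Fv).weight s(t, t') : ℝ) = δ t t' := by
  have h : δ t' t = δ t t' := IsDist.unique (hδ t' t) ⟨(hδ t t').1.symm, fun l hl => (hδ t t').2 l hl.symm⟩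
  change ((min (δ t t') (δ t' t)).toNNReal : ℝ) = _
  rw [h, min_self, Real.coe_toNNReal _ (hδ t t').1.nonneg]

theorem near_of_walk_contraction {K : Finset (Fin n)} {δ : Fin n → Fin n → ℝ} {Fv : Fin n → Fin n}
    (hδ : ∀ t v, G.IsDist Set.univ t v (δ t v)) {t t' : K}
    (p : (G.contraction K δ Fv).graph.Walk t t') :
    G.Near Set.univ ((G.contraction K δ Fv).walkLength p) (t : Fin n) t' := by
  induction p with
  | nil => exact .refl (by simp) trivial
  | cons h p ih =>
    rw [walkLength_cons]
    push_cast
    rw [contraction_weight hδ]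
    exact (hδ _ _).1.near.trans ih

/-- Edges of M have the length of the distances of their ends, so walks in M are never shorter than
distances in G. For the upper bound it is enough to move from the fiber of u to that of v along
edges of G, and this is what the four axioms of `HopRel` express. -/
theorem isSPRSolution_contraction {K : Finset (Fin n)} {δ : Fin n → Fin n → ℝ} {Fv : Fin n → Fin n}
    (hδ : ∀ t v, G.IsDist Set.univ t v (δ t v)) (hF : ∀ v, Fv v ∈ K) (hFK : ∀ t ∈ K, Fv t = t)
    (hfib : ∀ v, ∃ r, G.Near {x | Fv x = Fv v} r v (Fv v)) (α : ℝ≥0)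
    (hα : ∀ R, HopRel R G Fv → ∀ t ∈ K, ∀ (u : Fin n) (p : G.graph.Walk u t),
      R (α * G.walkLength p) (Fv u) (Fv t)) :
    IsSPRSolution G K (G.contraction K δ Fv) α := by
  refine ⟨⟨fun t => {x | Fv x = t}, fun t => hFK t t.2, fun t => ?_, fun t t' hne => ?_,
    fun t t' h => ?_⟩, fun t t' => ⟨?_, ?_⟩⟩
  · rw [SimpleGraph.connected_iff_exists_forall_reachable]
    obtain ⟨t, ht⟩ := t
    refine ⟨⟨t, hFK t ht⟩, fun ⟨v, hv⟩ => ?_⟩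
    obtain ⟨r, l, -, p, hp, -⟩ := hfib v
    have hv' : Fv v = t := hv
    subst hv'
    exact (p.induce _ hp).reverse.reachable
  · rw [Set.disjoint_left]
    intro x h1 h2
    exact hne (Subtype.ext (h1.symm.trans h2))
  · obtain ⟨-, u, v, h1, h2, h3⟩ := h
    exact ⟨u, h2, v, h3, h1⟩
  · refine le_iInf fun p => ?_
    obtain ⟨l, hl, q, -, rfl⟩ := near_of_walk_contraction hδ p
    exact (iInf_le _ q).trans (by exact_mod_cast hl)
  · unfold WeightedGraph.dist
    -- The hop relation is instantiated with "some walk of M has length at most r".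
    set R : ℝ → Fin n → Fin n → Prop := fun r a b => ∃ (ha : a ∈ K) (hb : b ∈ K),
      ∃ q : (G.contraction K δ Fv).graph.Walk ⟨a, ha⟩ ⟨b, hb⟩,
        ((G.contraction K δ Fv).walkLength q : ℝ) ≤ r with hR
    have hop : HopRel R G Fv := by
      refine ⟨fun r u hr => ⟨hF u, hF u, .nil, by simpa using hr⟩, ?_, ?_, ?_⟩
      · rintro r r' a b c ⟨ha, hb, q, hq⟩ ⟨hb', hc, q', hq'⟩
        refine ⟨ha, hc, q.append q', ?_⟩
        rw [walkLength_append]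
        push_cast
        linarith
      · rintro r r' a b hr ⟨ha, hb, q, hq⟩
        exact ⟨ha, hb, q, hq.trans hr⟩
      · intro r u v huv hn
        refine ⟨hF u, hF v, ?_⟩
        by_cases he : Fv u = Fv v
        · have : (⟨Fv v, hF v⟩ : K) = ⟨Fv u, hF u⟩ := Subtype.ext he.symm
          rw [this]
          exact ⟨.nil, by simpa using hn.nonneg⟩
        · have hadj : (G.contraction K δ Fv).graph.Adj ⟨Fv u, hF u⟩ ⟨Fv v, hF v⟩ :=
            ⟨fun h => he (congrArg Subtype.val h), u, v, huv, rfl, rfl⟩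
          refine ⟨.cons hadj .nil, ?_⟩
          rw [walkLength_cons, walkLength_nil, add_zero, contraction_weight hδ]
          exact (near_iff_of_isDist (hδ _ _)).1 hn
    have key : ∀ p : G.graph.Walk (t : Fin n) t', (⨅ q : (G.contraction K δ Fv).graph.Walk t t',
        ((G.contraction K δ Fv).walkLength q : ℝ≥0∞)) ≤ (α : ℝ≥0∞) * (G.walkLength p : ℝ≥0∞) := by
      intro p
      have := hα R hop t' t'.2 t p
      rw [hFK t t.2, hFK t' t'.2] at this
      obtain ⟨_, _, q, hq⟩ := this
      refine (iInf_le _ q).trans ?_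
      exact_mod_cast hq
    -- As α may be 0, pulling it into the infimum requires that a walk exists.
    obtain ⟨p₀, -, -⟩ := (hδ t t').1
    rw [ENNReal.mul_iInf' (by simp) (fun _ => ⟨p₀⟩)]
    exact le_iInf key

end WeightedGraph

namespace Block

/-- Mark the edges between the fibers of the assignment. -/
def outB : Block :=
  .loop 67 0 (.loop 68 0 (.ite (.and (pos (.read 1 (ix (vr 67) (vr 68))))
      (.not (.and (.natLe (.read 20 (vr 67)) (.read 20 (vr 68)))
        (.natLe (.read 20 (vr 68)) (.read 20 (vr 67))))))
    (.setNat 4 (ix (.sub (.read 20 (vr 67)) (.lit 1)) (.sub (.read 20 (vr 68)) (.lit 1))) (.lit 1))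
    .skip))

variable {n : ℕ} {G : WeightedGraph (Fin n)}

theorem outB_within : outB.Within [4] 70 [] := by decide

/-- Assigned terminals are stored with 1 added, 0 meaning unassigned; hence the subtraction of 1 in
the index of the cell that is marked. -/
theorem outB_spec {s : Memory} (hG : HoldsGraph G s) {Fv : Fin n → Fin n}
    (hF : ∀ v : Fin n, s.nat 20 v = Fv v + 1) (h4 : ∀ k, s.nat 4 k = 0) (t t' : Fin n) :
    ((outB.run s).nat 4 (t * n + t') = 1 ∧ t ≠ t' ∧ ∃ u v, G.graph.Adj u v ∧ Fv u = t ∧ Fv v = t') ∨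
    ((outB.run s).nat 4 (t * n + t') = 0 ∧
      ¬ (t ≠ t' ∧ ∃ u v, G.graph.Adj u v ∧ Fv u = t ∧ Fv v = t')) := by
  set E : Fin n → Fin n → Fin n → Fin n → Prop := fun u v t t' =>
    G.graph.Adj u v ∧ Fv u ≠ Fv v ∧ Fv u = t ∧ Fv v = t' with hE
  have w : outB.Within [4] 70 [] := outB_within
  have main : ∀ t t' : Fin n,
      ((outB.run s).nat 4 (t * n + t') = 1 ∧ ∃ u v : Fin n, (u : ℕ) < n ∧ E u v t t') ∨
      ((outB.run s).nat 4 (t * n + t') = 0 ∧ ¬ ∃ u v : Fin n, (u : ℕ) < n ∧ E u v t t') := by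
    refine loop_rule (N := n) hG.size (fun i r => ∀ t t' : Fin n,
      (r.nat 4 (t * n + t') = 1 ∧ ∃ u v : Fin n, (u : ℕ) < i ∧ E u v t t') ∨
      (r.nat 4 (t * n + t') = 0 ∧ ¬ ∃ u v : Fin n, (u : ℕ) < i ∧ E u v t t')) ?_ ?_ ?_
    · intro k r j h; simpa using h
    · intro t t'
      exact Or.inr ⟨h4 _, fun ⟨u, v, h, _⟩ => absurd h (by omega)⟩
    · intro i r hi hr hsr hI
      have hGr := w.graph hsr hG (by decide) (by decide) (by decide) (by decide)
      have r20 : r.nat 20 = s.nat 20 := w.nat hsr (by decide) (by decide)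
      have inner := loop_rule (x := 68) (b := 0) (p := .ite (.and (pos (.read 1 (ix (vr 67) (vr 68))))
          (.not (.and (.natLe (.read 20 (vr 67)) (.read 20 (vr 68)))
            (.natLe (.read 20 (vr 68)) (.read 20 (vr 67))))))
        (.setNat 4 (ix (.sub (.read 20 (vr 67)) (.lit 1)) (.sub (.read 20 (vr 68)) (.lit 1))) (.lit 1))
        .skip) (s := r) hGr.size (fun j q => ∀ t t' : Fin n,
        (q.nat 4 (t * n + t') = 1 ∧
          ∃ u v : Fin n, ((u : ℕ) < i ∨ (u : ℕ) = i ∧ (v : ℕ) < j) ∧ E u v t t') ∨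
        (q.nat 4 (t * n + t') = 0 ∧
          ¬ ∃ u v : Fin n, ((u : ℕ) < i ∨ (u : ℕ) = i ∧ (v : ℕ) < j) ∧ E u v t t')) ?_ ?_ ?_
      · intro t t'
        have e : (∃ u v : Fin n, ((u : ℕ) < i ∨ (u : ℕ) = i ∧ (v : ℕ) < n) ∧ E u v t t') ↔
            ∃ u v : Fin n, (u : ℕ) < i + 1 ∧ E u v t t' := by
          refine exists_congr fun u => exists_congr fun v => and_congr_left fun _ => ?_
          have := v.2
          omega
        rw [← e]
        exact inner t t'
      · intro k r j h; simpa using h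
      · intro t t'
        have e : (∃ u v : Fin n, ((u : ℕ) < i ∨ (u : ℕ) = i ∧ (v : ℕ) < 0) ∧ E u v t t') ↔
            ∃ u v : Fin n, (u : ℕ) < i ∧ E u v t t' := by simp
        rw [e]
        exact hI t t'
      · intro j q hj hq hsq hJ t t'
        have q67 : q.nat 67 0 = i := by rw [hsq.1 67 (by decide), hr]
        have q20 : q.nat 20 = s.nat 20 := by rw [hsq.1 20 (by decide), r20]
        have hGq : HoldsGraph G q := hGr.of_eq (hsq.1 0 (by decide)) (hsq.1 1 (by decide))
          (hsq.1 10 (by decide)) (hsq.2 0 (by decide))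
        have hm : ∀ x : Fin n, q.nat 10 x = x * n := fun x =>
          hGq.mul x (by rw [hGq.size]; exact Or.inl x.2)
        have hFi : s.nat 20 i = Fv ⟨i, hi⟩ + 1 := hF ⟨i, hi⟩
        have hFj : s.nat 20 j = Fv ⟨j, hj⟩ + 1 := hF ⟨j, hj⟩
        have hadj := hGq.adj ⟨i, hi⟩ ⟨j, hj⟩
        have hmi : q.nat 10 i = i * n := hm ⟨i, hi⟩
        have hsplit : (∃ u v : Fin n, ((u : ℕ) < i ∨ (u : ℕ) = i ∧ (v : ℕ) < j + 1) ∧ E u v t t') ↔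
            (∃ u v : Fin n, ((u : ℕ) < i ∨ (u : ℕ) = i ∧ (v : ℕ) < j) ∧ E u v t t') ∨
              E ⟨i, hi⟩ ⟨j, hj⟩ t t' := by
          constructor
          · rintro ⟨u, v, h, hEuv⟩
            by_cases hc : (u : ℕ) = i ∧ (v : ℕ) = j
            · have h1 : u = ⟨i, hi⟩ := Fin.ext hc.1
              have h2 : v = ⟨j, hj⟩ := Fin.ext hc.2
              rw [h1, h2] at hEuv
              exact Or.inr hEuv
            · exact Or.inl ⟨u, v, by omega, hEuv⟩
          · rintro (⟨u, v, h, hEuv⟩ | h)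
            · exact ⟨u, v, by omega, hEuv⟩
            · exact ⟨⟨i, hi⟩, ⟨j, hj⟩, Or.inr ⟨rfl, Nat.lt_succ_self j⟩, h⟩
        rw [hsplit]
        by_cases hc : G.graph.Adj ⟨i, hi⟩ ⟨j, hj⟩ ∧ Fv ⟨i, hi⟩ ≠ Fv ⟨j, hj⟩
        · rw [run_ite_pos (by
            simp only [Test.Holds, NatExpr.eval, q67, hq, q20, hFi, hFj, hmi]
            exact ⟨hadj.2 hc.1, fun h => hc.2 (Fin.ext (by omega))⟩), run_setNat]
          simp only [NatExpr.eval, q67, hq, q20, hFi, hFj, Nat.add_sub_cancel, hm,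
            Memory.nat_writeNat, if_true]
          by_cases heq : (t : ℕ) * n + t' = Fv ⟨i, hi⟩ * n + Fv ⟨j, hj⟩
          · obtain ⟨e1, e2⟩ := index_inj heq
            rw [heq, Function.update_self]
            exact Or.inl ⟨rfl, Or.inr ⟨hc.1, hc.2, e1.symm, e2.symm⟩⟩
          · rw [Function.update_of_ne heq]
            have : ¬ E ⟨i, hi⟩ ⟨j, hj⟩ t t' := fun h => heq (by rw [← h.2.2.1, ← h.2.2.2])
            simpa [this] using hJ t t'
        · rw [run_ite_neg (by
            simp only [Test.Holds, NatExpr.eval, q67, hq, q20, hFi, hFj, hmi]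
            refine fun h => hc ⟨hadj.1 h.1, fun h' => h.2 ?_⟩
            rw [h']; exact ⟨le_rfl, le_rfl⟩), run_skip]
          have : ¬ E ⟨i, hi⟩ ⟨j, hj⟩ t t' := fun h => hc ⟨h.1, h.2.1⟩
          simpa [this] using hJ t t'
  have e : (∃ u v : Fin n, (u : ℕ) < n ∧ E u v t t') ↔
      (t ≠ t' ∧ ∃ u v, G.graph.Adj u v ∧ Fv u = t ∧ Fv v = t') := by
    constructor
    · rintro ⟨u, v, -, h1, h2, rfl, rfl⟩
      exact ⟨h2, u, v, h1, rfl, rfl⟩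
    · rintro ⟨h, u, v, h1, rfl, rfl⟩
      exact ⟨u, v, u.2, h1, h, rfl, rfl⟩
  rw [← e]
  exact main t t'

/-- After all stages, the output is a solution. -/
theorem outB_solution {K : Finset (Fin n)} {s : Memory} (hP : Prepared G K s)
    (hS : G.StageMem K s) (hall : ∀ v : Fin n, 0 < s.nat 20 v) (h4 : ∀ k, s.nat 4 k = 0) {k : ℕ}
    (hk : s.nat 30 0 ≤ k) {α : ℝ≥0} (hα : WeightedGraph.distortion (tau k) (kap k) ≤ α) :
    ∃ M : WeightedGraph K, Outputs (outB.run s) M ∧ IsSPRSolution G K M α := by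
  obtain ⟨Fv, st, Δ, cl, i, hI⟩ := hS
  have hF : ∀ v : Fin n, s.nat 20 v = Fv v + 1 := fun v => (hI.pos v (hall v)).1
  have hFK : ∀ t ∈ K, Fv t = t := fun t ht => by
    have h1 := hI.term t ht
    have h2 := hF t
    exact Fin.ext (by omega)
  set δ : Fin n → Fin n → ℝ := fun t v => s.real 1 (t * n + v) with hδ
  refine ⟨G.contraction K δ Fv, ⟨fun t t' => ?_, fun t t' _ => ?_⟩, ?_⟩
  · rcases outB_spec hP.toHoldsGraph hF h4 t t' with ⟨h1, h2⟩ | ⟨h1, h2⟩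
    · rw [h1, if_pos]
      exact ⟨fun h => h2.1 (congrArg Subtype.val h), h2.2⟩
    · rw [h1, if_neg]
      exact fun h => h2 ⟨fun h' => h.1 (Subtype.ext h'), h.2⟩
  · rw [WeightedGraph.contraction_weight hP.isDist, outB_within.real (same_run _ s) (by decide) (by decide)]
  · refine WeightedGraph.isSPRSolution_contraction hP.isDist (fun v => (hI.pos v (hall v)).2.1) hFK
      (fun v => ⟨tau k * (kap k * s.real 13 0), ?_⟩) α fun R hR t ht u p => ?_
    · have := hI.near k hk v (hall v)
      refine this.mono (fun x hx => ?_) le_rfl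
      have hx' : s.nat 20 x = s.nat 20 v := hx
      rw [hF x, hF v] at hx'
      exact Fin.ext (by omega)
    -- The distance to K is 0 on K, nonnegative, and changes along an edge by at most its length.
    · have := (hI.stages k hk).hop (one_le_kap k) hR
        (fun v hv => (hI.pos v (hall v)).2.2 hv) hFK
        (fun t ht => le_antisymm (hP.distTo.le t t ht 0 (.refl trivial)) (hP.distTo.nonneg t))
        (fun v => hP.distTo.nonneg v)
        (fun u v huv => by
          have h1 : G.WalkIn Set.univ v u (G.len v u) := .edge huv.symm trivial trivial
          have := hP.distTo.near h1.near
          rw [G.len_comm v u] at this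
          linarith) ht p.length p le_rfl
      exact hR.mono _ _ _ _ (mul_le_mul_of_nonneg_right hα (NNReal.coe_nonneg _)) this

end Block

/-! ### Input, output and the distortion -/

/-- For ρ ≥ 1 one has κ ≤ 9ρ and τ ≤ 2ρ·10ρ, and the leading term is of order κ³τ³. -/
theorem distortion_le {k ρ : ℕ} (hρ : 1 ≤ ρ) (hk : k ≤ ρ + 1) :
    WeightedGraph.distortion (tau k) (kap k) ≤ 10 ^ 9 * (ρ : ℝ) ^ 9 := by
  have hr : (1 : ℝ) ≤ ρ := by exact_mod_cast hρ
  have hk' : (k : ℝ) ≤ ρ + 1 := by exact_mod_cast hk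
  have hk0 : (0 : ℝ) ≤ k := Nat.cast_nonneg k
  have hκ0 : 0 ≤ kap k := by unfold kap; positivity
  have hκ : kap k ≤ 9 * ρ := by unfold kap; linarith
  have hτ0 : (0 : ℝ) ≤ tau k := Nat.cast_nonneg _
  have hτ : (tau k : ℝ) ≤ 20 * (ρ : ℝ) ^ 2 := by
    unfold tau
    push_cast
    calc (k : ℝ) * (4 * k + 2) ≤ (2 * ρ) * (10 * ρ) :=
          mul_le_mul (by linarith) (by linarith) (by positivity) (by positivity)
      _ = 20 * (ρ : ℝ) ^ 2 := by ring
  have h2 : (1 : ℝ) ≤ (ρ : ℝ) ^ 2 := one_le_pow₀ hr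
  have h4 : (1 : ℝ) ≤ (ρ : ℝ) ^ 4 := one_le_pow₀ hr
  have hβ : 4 * (tau k : ℝ) * kap k ^ 2 + 1 ≤ 6481 * (ρ : ℝ) ^ 4 := by
    have h3 : kap k ^ 2 ≤ (9 * ρ) ^ 2 := pow_le_pow_left₀ hκ0 hκ 2
    have := mul_le_mul hτ h3 (by positivity) (by positivity)
    nlinarith
  have hβ0 : 0 ≤ 4 * (tau k : ℝ) * kap k ^ 2 + 1 := by positivity
  have hγ : ((tau k : ℝ) + 1) * (tau k + 2) + 1 ≤ 463 * (ρ : ℝ) ^ 4 := by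
    have : ((tau k : ℝ) + 1) * (tau k + 2) ≤ (21 * (ρ : ℝ) ^ 2) * (22 * (ρ : ℝ) ^ 2) :=
      mul_le_mul (by linarith) (by linarith) (by positivity) (by positivity)
    nlinarith
  have hmain : 12 * kap k * (4 * (tau k : ℝ) * kap k ^ 2 + 1) * (((tau k : ℝ) + 1) * (tau k + 2) + 1)
      ≤ (12 * (9 * ρ)) * (6481 * (ρ : ℝ) ^ 4) * (463 * (ρ : ℝ) ^ 4) := by
    refine mul_le_mul (mul_le_mul (by linarith) hβ hβ0 (by positivity)) hγ (by positivity) (by positivity)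
  have h9 : (ρ : ℝ) ^ 4 ≤ (ρ : ℝ) ^ 9 := pow_le_pow_right₀ hr (by norm_num)
  have h9' : (0 : ℝ) ≤ (ρ : ℝ) ^ 9 := by positivity
  unfold WeightedGraph.distortion
  calc _ ≤ (12 * (9 * ρ)) * (6481 * (ρ : ℝ) ^ 4) * (463 * (ρ : ℝ) ^ 4) + 2 * (6481 * (ρ : ℝ) ^ 4) :=
        add_le_add hmain (by linarith)
    _ = 324075924 * (ρ : ℝ) ^ 9 + 12962 * (ρ : ℝ) ^ 4 := by ring
    _ ≤ _ := by nlinarith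

theorem WeightedGraph.dist_self {V : Type*} (G : WeightedGraph V) (v : V) : G.dist v v = 0 :=
  le_antisymm (iInf_le_of_le .nil (by simp)) bot_le

/-- For width 0 the bound 10⁹·0⁹ is 0; it holds because all distances that occur are 0. -/
theorem IsSPRSolution.of_subsingleton {V : Type*} [Subsingleton V] {G : WeightedGraph V}
    {K : Finset V} {M : WeightedGraph K} {α β : ℝ≥0} (h : IsSPRSolution G K M α) :
    IsSPRSolution G K M β := by
  refine ⟨h.1, fun t t' => ?_⟩
  obtain rfl : t = t' := Subsingleton.elim _ _
  simp [WeightedGraph.dist_self]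

/-- Without terminals there is no distance to the terminals and the stages make no sense; any memory
then counts as the output of the empty graph. -/
theorem exists_solution_empty {n : ℕ} (G : WeightedGraph (Fin n)) (s : Memory) (α : ℝ≥0) :
    ∃ M : WeightedGraph (∅ : Finset (Fin n)), Outputs s M ∧ IsSPRSolution G ∅ M α := by
  have h : ∀ t : (∅ : Finset (Fin n)), False := fun t => absurd t.2 (Finset.notMem_empty _)
  exact ⟨⟨⊥, 0⟩, ⟨fun t => (h t).elim, fun t => (h t).elim⟩,
    ⟨fun t => (h t).elim, fun t => (h t).elim, fun t => (h t).elim, fun t => (h t).elim,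
      fun t => (h t).elim⟩, fun t => (h t).elim⟩

theorem PathDecomposition.card_le {V : Type*} {G : SimpleGraph V} (D : PathDecomposition G)
    (i : Fin D.numBags) : (D.bag i).card ≤ D.width + 1 := by
  have := Finset.le_sup (f := fun i => (D.bag i).card) (Finset.mem_univ i)
  unfold width
  omega

/-- Bags with at most one vertex contain no edge, and a connected graph without edges has a single
vertex. -/
theorem PathDecomposition.subsingleton_of_width {V : Type*} {G : SimpleGraph V} (hG : G.Connected)
    (D : PathDecomposition G) (h : D.width = 0) : Subsingleton V := by
  have hadj : ∀ u v, ¬ G.Adj u v := by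
    intro u v huv
    obtain ⟨i, hu, hv⟩ := D.edge_mem u v huv
    have := D.card_le i
    rw [h] at this
    exact huv.ne (Finset.card_le_one.1 (by omega) u hu v hv)
  refine ⟨fun u v => ?_⟩
  obtain ⟨p⟩ := hG.preconnected u v
  cases p with
  | nil => rfl
  | cons h p => exact absurd h (hadj _ _)

theorem holdsInput_initialMemory {n m : ℕ} (G : WeightedGraph (Fin n)) (K : Finset (Fin n))
    (S : Fin m → Finset (Fin n)) : HoldsInput G K (initialMemory G K S) := by
  refine ⟨by simp [initialMemory], fun u v => ?_, fun u v h => ?_, fun v => ?_⟩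
  · by_cases h : G.graph.Adj u v <;> simp [initialMemory, rowMajor_apply, h]
  · simp [initialMemory, rowMajor_apply, h, WeightedGraph.len]
  · have : (∃ t ∈ K, (t : ℕ) = v) ↔ v ∈ K :=
      ⟨fun ⟨t, ht, e⟩ => by rwa [← Fin.ext e], fun h => ⟨v, h, rfl⟩⟩
    by_cases hv : v ∈ K <;> simp [initialMemory, this, hv]

theorem HoldsInput.of_eq {n : ℕ} {G : WeightedGraph (Fin n)} {K : Set (Fin n)} {s r : Memory}
    (h : HoldsInput G K s) (h0 : r.nat 0 0 = s.nat 0 0) (h1 : r.nat 1 = s.nat 1)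
    (h2 : r.nat 2 = s.nat 2) (h3 : r.real 0 = s.real 0) : HoldsInput G K r :=
  ⟨by rw [h0]; exact h.size, by rw [h1]; exact h.adj, by rw [h3]; exact h.len,
    by rw [h2]; exact h.term⟩

namespace WeightedGraph

variable {n : ℕ} {G : WeightedGraph (Fin n)}

/-- It suffices to minimize over walks with fewer than n edges, of which there are finitely many. -/
theorem exists_isDist {S : Set (Fin n)} {u v : Fin n} (h : v ∈ G.comp S u) :
    ∃ d, G.IsDist S u v d := by
  classical
  obtain ⟨_, p, hp, -⟩ := h
  obtain ⟨q, hq, hl, -⟩ := exists_short_walk p hp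
  have hfin : {q : G.graph.Walk u v | q.length < Fintype.card (Fin n)}.Finite :=
    Set.toFinite _
  obtain ⟨d, hd, hmin⟩ := Set.exists_min_image
    {q : G.graph.Walk u v | q.length < Fintype.card (Fin n) ∧ ∀ x ∈ q.support, x ∈ S}
    (fun q => G.walkLength q) (hfin.subset fun q hq => hq.1) ⟨q, hl, hq⟩
  refine ⟨_, ⟨d, hd.2, rfl⟩, ?_⟩
  rintro _ ⟨p, hp, rfl⟩
  obtain ⟨q, hq, hl, hle⟩ := exists_short_walk p hp
  exact_mod_cast (hmin q ⟨hl, hq⟩).trans hle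

end WeightedGraph

namespace Block

/-- Carry out all stages, from the beginning. -/
def solveB (ch : Block) : Block := .seq resetB (mainB ch)

theorem solveB_within {ch : Block} (h : Chooser ch) :
    (solveB ch).Within [11, 12, 13, 14, 15, 16, 17, 18, 19, 20, 21, 22, 25, 26, 27, 28, 29, 30] 70
      [11, 12, 13, 14, 15, 17] :=
  .seq (by decide) ((mainB_within h).mono (by decide) (by decide) (by decide))

variable {n : ℕ} {G : WeightedGraph (Fin n)}

theorem Within.prepared {K : Set (Fin n)} {p : Block} {l : List ℕ} {hi : ℕ}
    {lr : List ℕ} (hp : p.Within l hi lr) {s r : Memory} (h : Same p s r) (hP : Prepared G K s)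
    (h0 : ∀ a ∈ l, a ≠ 0 ∧ a ≠ 1 ∧ a ≠ 2 ∧ a ≠ 10) (hr : ∀ a ∈ lr, a ≠ 0 ∧ a ≠ 1 ∧ a ≠ 16) :
    Prepared G K r := by
  refine ⟨hp.graph h hP.toHoldsGraph (fun h => ?_) (fun h => ?_) (fun h => ?_) (fun h => ?_), ?_, ?_, ?_⟩
  · exact (h0 _ h).1 rfl
  · exact (h0 _ h).2.1 rfl
  · exact (h0 _ h).2.2.2 rfl
  · exact (hr _ h).1 rfl
  · rw [hp.nat h (fun h => (h0 _ h).2.2.1 rfl) (by omega)]; exact hP.term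
  · rw [hp.real h (fun h => (hr _ h).2.2 rfl) (by omega)]; exact hP.distTo
  · rw [hp.real h (fun h => (hr _ h).2.1 rfl) (by omega)]; exact hP.isDist

theorem solveB_spec {ch : Block} (hch : Chooser ch) {s₀ : Memory}
    {Bd : ℝ → ℕ → Set (Fin n) → Prop} (hspec : ChooseSpec G ch s₀ Bd)
    (hBd : ∀ L, 0 ≤ L → ∀ (H : Set (Fin n)) (z : Fin n), z ∈ H → Bd L 0 (G.comp H z))
    {K : Set (Fin n)} {s : Memory} (hP : Prepared G K s) (hE : Env s₀ s) :
    G.StageMem K ((solveB ch).run s) ∧ (∀ v : Fin n, 0 < ((solveB ch).run s).nat 20 v) ∧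
    ∀ k, (∀ L, 0 ≤ L → ∀ C, C.Nonempty → ¬ Bd L k C) → ((solveB ch).run s).nat 30 0 ≤ k := by
  rw [solveB, run_seq]
  have m := same_run resetB s
  have hP' := resetB_within.prepared m hP (by decide) (by decide)
  have h30 : (resetB.run s).nat 30 0 = 0 := by simp [resetB, run_seq, run_setNat]
  obtain ⟨h1, h2, h3⟩ := mainB_spec hch hspec hBd hP'.toHoldsGraph
    (resetB_within.env m hE (by decide) (by decide)) hP'.distTo (resetB_spec hP)
  exact ⟨h1, h2, fun k hk => h3 k hk (by omega)⟩

/-- The output after a round. -/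
theorem outB_solveB {ch : Block} (hch : Chooser ch) {s₀ : Memory}
    {Bd : ℝ → ℕ → Set (Fin n) → Prop} (hspec : ChooseSpec G ch s₀ Bd)
    (hBd : ∀ L, 0 ≤ L → ∀ (H : Set (Fin n)) (z : Fin n), z ∈ H → Bd L 0 (G.comp H z))
    {K : Finset (Fin n)} {s : Memory} (hP : Prepared G K s) (hE : Env s₀ s)
    (h4 : ∀ k, s.nat 4 k = 0) (hconn : G.graph.Connected) {D : PathDecomposition G.graph}
    (hk : ((solveB ch).run s).nat 30 0 ≤ D.width + 1) :
    ∃ M : WeightedGraph K, Outputs (outB.run ((solveB ch).run s)) M ∧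
      IsSPRSolution G K M (10 ^ 9 * (D.width : ℝ≥0) ^ 9) := by
  have w := solveB_within hch
  have m := same_run (solveB ch) s
  have hP' := w.prepared m hP (by decide) (by decide)
  obtain ⟨h1, h2, -⟩ := solveB_spec hch hspec hBd hP hE
  have h4' : ∀ k, ((solveB ch).run s).nat 4 k = 0 := by
    rw [w.nat m (by decide) (by decide)]; exact h4
  rcases Nat.eq_zero_or_pos D.width with h0 | h0
  · have := D.subsingleton_of_width hconn h0
    obtain ⟨M, hM, hS⟩ := outB_solution hP' h1 h2 h4' hk
      (α := (WeightedGraph.distortion (tau (D.width + 1)) (kap (D.width + 1))).toNNReal)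
      (Real.le_coe_toNNReal _)
    exact ⟨M, hM, hS.of_subsingleton⟩
  · exact outB_solution hP' h1 h2 h4' hk (by push_cast; exact distortion_le h0 le_rfl)

end Block

/-! ### Paths and the bags of a path decomposition -/

/-- A walk from one bag to another meets all bags in between. -/
theorem PathDecomposition.exists_mem_support {V : Type*} {G : SimpleGraph V}
    (D : PathDecomposition G) {u v : V} (p : G.Walk u v) {a b i : Fin D.numBags} (ha : u ∈ D.bag a)
    (hb : v ∈ D.bag b) (hai : a ≤ i) (hib : i ≤ b) : ∃ x ∈ p.support, x ∈ D.bag i := by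
  induction p generalizing a with
  | nil => exact ⟨_, by simp, D.consecutive _ a i b hai hib ha hb⟩
  | @cons u x w h p ih =>
    obtain ⟨c, hu, hx⟩ := D.edge_mem _ _ h
    rcases le_total c i with hc | hc
    · obtain ⟨y, hy, hyi⟩ := ih hx hb hc
      exact ⟨y, by simp [hy], hyi⟩
    · exact ⟨u, by simp, D.consecutive _ a i c hai hc ha hu⟩

/-! ### Every level takes a vertex out of every bag that still matters. -/

namespace WeightedGraph

variable {n : ℕ} {G : WeightedGraph (Fin n)}

/-- In level `j`, every bag has lost `j` vertices. -/
def BagBound (D : PathDecomposition G.graph) (w j : ℕ) (C : Set (Fin n)) : Prop :=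
  ∀ i, ({v | v ∈ D.bag i} ∩ C).ncard + j ≤ w + 1

theorem bagBound_zero (D : PathDecomposition G.graph) (C : Set (Fin n)) :
    BagBound D D.width 0 C := by
  intro i
  have h1 : ({v | v ∈ D.bag i} ∩ C).ncard ≤ {v | v ∈ D.bag i}.ncard :=
    Set.ncard_le_ncard Set.inter_subset_left (Set.toFinite _)
  have h2 : {v | v ∈ D.bag i}.ncard = (D.bag i).card := by
    rw [← Set.ncard_coe_finset]; rfl
  have := D.card_le i
  omega

/-- A vertex of C lies in some bag, which therefore has not lost all of its w + 1 places. -/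
theorem BagBound.lt {D : PathDecomposition G.graph} {w j : ℕ} {C : Set (Fin n)}
    (h : BagBound D w j C) (hC : C.Nonempty) : j < w + 1 := by
  obtain ⟨v, hv⟩ := hC
  obtain ⟨i, hi⟩ := D.vertex_mem v
  have h1 : 0 < ({v | v ∈ D.bag i} ∩ C).ncard := (Set.ncard_pos (Set.toFinite _)).2 ⟨v, hi, hv⟩
  have := h i
  omega

/-- `x` is in the first bag that meets `C`, and `y` is in the last one. -/
def Extremal (D : PathDecomposition G.graph) (C : Set (Fin n)) (x y : Fin n) : Prop :=
  ∃ a b, x ∈ D.bag a ∧ y ∈ D.bag b ∧ ∀ i, ∀ v ∈ D.bag i, v ∈ C → a ≤ i ∧ i ≤ b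

theorem BagBound.mono {D : PathDecomposition G.graph} {w j : ℕ} {C C' : Set (Fin n)}
    (h : BagBound D w j C) (hC : C' ⊆ C) : BagBound D w j C' := fun i =>
  le_trans (Nat.add_le_add_right (Set.ncard_le_ncard (Set.inter_subset_inter_right _ hC)
    (Set.toFinite _)) j) (h i)

/-- The path starts in the first and ends in the last bag that meets C, so it has a vertex in each
bag between them, and the covered set contains the path. -/
theorem BagBound.step {D : PathDecomposition G.graph} {w j : ℕ} {C : Set (Fin n)}
    (h : BagBound D w j C) {x y : Fin n} {L : ℝ} (hL : 0 ≤ L) (hy : y ∈ G.comp C x)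
    (he : Extremal D C x y) : BagBound D w (j + 1) (C \ G.cov L C x y) := by
  obtain ⟨a, b, ha, hb, hab⟩ := he
  obtain ⟨d, hd⟩ := exists_isDist hy
  obtain ⟨p, hp, -⟩ := exists_walk_pathSet hd
  intro i
  by_cases hi : ∃ v ∈ D.bag i, v ∈ C
  · obtain ⟨v, hv, hvC⟩ := hi
    obtain ⟨h1, h2⟩ := hab i v hv hvC
    obtain ⟨z, hz, hzi⟩ := D.exists_mem_support p ha hb h1 h2
    have hzP := (hp z).1 hz
    have hlt : ({v | v ∈ D.bag i} ∩ (C \ G.cov L C x y)).ncard <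
        ({v | v ∈ D.bag i} ∩ C).ncard := by
      refine Set.ncard_lt_ncard ⟨fun q hq => ⟨hq.1, hq.2.1⟩, fun hs => ?_⟩
        (Set.toFinite _)
      exact (hs ⟨hzi, pathSet_subset C x y hzP⟩).2.2
        (pathSet_subset_cov hL C x y hzP)
    have := h i
    omega
  · have h0 : {v | v ∈ D.bag i} ∩ (C \ G.cov L C x y) = ∅ := by
      ext v
      simp only [Set.mem_inter_iff, Set.mem_empty_iff_false, iff_false]
      exact fun hv => hi ⟨v, hv.1, hv.2.1⟩
    -- A bag that misses C loses nothing, but its bound must also move on to j + 1; this is possible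
    -- because C is nonempty, so j < w + 1.
    have := h.lt ⟨y, hd.1.right_mem⟩
    rw [h0, Set.ncard_empty]
    omega

theorem exists_extremal (D : PathDecomposition G.graph) {C : Set (Fin n)} (hC : C.Nonempty) :
    ∃ x ∈ C, ∃ y ∈ C, Extremal D C x y := by
  obtain ⟨v, hv⟩ := hC
  obtain ⟨i, hi⟩ := D.vertex_mem v
  obtain ⟨a, ⟨x, hx, hxC⟩, ha⟩ := Set.exists_min_image {i | ∃ v ∈ D.bag i, v ∈ C} id
    (Set.toFinite _) ⟨i, v, hi, hv⟩
  obtain ⟨b, ⟨y, hy, hyC⟩, hb⟩ := Set.exists_max_image {i | ∃ v ∈ D.bag i, v ∈ C} id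
    (Set.toFinite _) ⟨i, v, hi, hv⟩
  exact ⟨x, hxC, y, hyC, a, b, hx, hy, fun j u hu huC => ⟨ha j ⟨u, hu, huC⟩, hb j ⟨u, hu, huC⟩⟩⟩

end WeightedGraph

namespace Block

/-- Choose a vertex of the first bag that meets the component and one of the last. -/
def bagChoose : Block :=
  .seq (.setNat 100 (.lit 0) (.lit 0)) <|
  .loop 40 1 (.loop 41 0 (.ite (.and (pos (.read 3 (ix (vr 40) (vr 41)))) (pos (.read 14 (vr 41))))
    (.seq (.setNat 26 (.lit 0) (vr 41))
      (.ite (pos (vr 100)) .skip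
        (.seq (.setNat 25 (.lit 0) (vr 41)) (.setNat 100 (.lit 0) (.lit 1)))))
    .skip))

variable {n : ℕ} {G : WeightedGraph (Fin n)}

theorem bagChoose_chooser : Chooser bagChoose := by decide

/-- What has been found after some of the pairs of a bag and a vertex. -/
def BagFound (D : PathDecomposition G.graph) (C : Set (Fin n)) (done : ℕ → Fin n → Prop)
    (flag X Y : ℕ) : Prop :=
  (flag = 0 → ∀ i : Fin D.numBags, ∀ v ∈ D.bag i, v ∈ C → ¬ done i v) ∧
  (0 < flag → ∃ x y : Fin n, X = x ∧ Y = y ∧ x ∈ C ∧ y ∈ C ∧ ∃ a b : Fin D.numBags,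
    x ∈ D.bag a ∧ y ∈ D.bag b ∧ done a x ∧ done b y ∧
    ∀ i, ∀ v ∈ D.bag i, v ∈ C → done i v → a ≤ i ∧ i ≤ b)

/-- Scanning the bags in order, x is the first vertex of the component that is found and y the last
one. Variable `100` tells whether x has been found. -/
theorem bagChoose_spec {D : PathDecomposition G.graph} {s : Memory} (hG : HoldsGraph G s)
    (hm : s.nat 0 1 = D.numBags)
    (hbag : ∀ (i : Fin D.numBags) (v : Fin n), 0 < s.nat 3 (i * n + v) ↔ v ∈ D.bag i)
    {C : Set (Fin n)} (hC : supp (s.nat 14) = C) (hne : C.Nonempty) :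
    ∃ x y : Fin n, (bagChoose.run s).nat 25 0 = x ∧ (bagChoose.run s).nat 26 0 = y ∧ x ∈ C ∧
      y ∈ C ∧ G.Extremal D C x y := by
  rw [bagChoose, run_seq, run_setNat]
  simp only [NatExpr.eval]
  set s1 := s.writeNat 100 0 0 with hs1
  have hG1 : HoldsGraph G s1 := hG.of_eq (by simp [hs1]) (by simp [hs1]) (by simp [hs1]) rfl
  set b : Block := .ite (.and (pos (.read 3 (ix (vr 40) (vr 41)))) (pos (.read 14 (vr 41))))
    (.seq (.setNat 26 (.lit 0) (vr 41))
      (.ite (pos (vr 100)) .skip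
        (.seq (.setNat 25 (.lit 0) (vr 41)) (.setNat 100 (.lit 0) (.lit 1)))))
    .skip with hb
  have main := loop_rule (x := 40) (b := 1) (p := .loop 41 0 b) (s := s1) (N := D.numBags)
    (by simpa [hs1] using hm)
    (fun k r => BagFound D C (fun i _ => i < k) (r.nat 100 0) (r.nat 25 0) (r.nat 26 0)) ?_ ?_ ?_
  · set r := (loop 40 1 (.loop 41 0 b)).run s1
    obtain ⟨v, hv⟩ := hne
    obtain ⟨i, hi⟩ := D.vertex_mem v
    have hpos : 0 < r.nat 100 0 := by
      by_contra hcon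
      exact main.1 (by omega) i v hi hv i.2
    obtain ⟨x, y, h1, h2, h3, h4, a, c, h5, h6, -, -, h7⟩ := main.2 hpos
    exact ⟨x, y, h1, h2, h3, h4, a, c, h5, h6, fun i v hi hv => h7 i v hi hv i.2⟩
  · intro k r j h; simpa using h
  · exact ⟨fun _ i v _ _ h => absurd h (by omega), fun h => by simp [hs1] at h⟩
  · intro k r hk hr hsr hI
    have e0 : r.nat 0 = s.nat 0 := by rw [hsr.1 0 (by rw [hb]; decide)]; simp [hs1]
    have inner := loop_rule (x := 41) (b := 0) (p := b) (s := r) (N := n) (by rw [e0, hG.size])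
      (fun l q => BagFound D C (fun i v => i < k ∨ (i = k ∧ (v : ℕ) < l)) (q.nat 100 0) (q.nat 25 0)
        (q.nat 26 0)) ?_ ?_ ?_
    · have e : (fun (i : ℕ) (v : Fin n) => i < k ∨ (i = k ∧ (v : ℕ) < n)) = fun i _ => i < k + 1 := by
        funext i v
        have := v.2
        exact propext ⟨fun h => by omega, fun h => by omega⟩
      rwa [e] at inner
    · intro k r j h; simpa using h
    · simpa using hI
    · intro l q hl hq hsq hJ
      have e3 : q.nat 3 = s.nat 3 := by
        rw [hsq.1 3 (by rw [hb]; decide), hsr.1 3 (by rw [hb]; decide)]; simp [hs1]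
      have e14 : q.nat 14 = s.nat 14 := by
        rw [hsq.1 14 (by rw [hb]; decide), hsr.1 14 (by rw [hb]; decide)]; simp [hs1]
      have e10 : q.nat 10 k = k * n := by
        rw [hsq.1 10 (by rw [hb]; decide), hsr.1 10 (by rw [hb]; decide)]
        exact hG1.mul k (Or.inr (by simpa [hs1, hm] using hk))
      have e40 : q.nat 40 0 = k := by rw [hsq.1 40 (by rw [hb]; decide), hr]
      have hcond : (0 < q.nat 3 (k * n + l) ∧ 0 < q.nat 14 l) ↔
          (⟨l, hl⟩ ∈ D.bag ⟨k, hk⟩ ∧ ⟨l, hl⟩ ∈ C) := by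
        rw [e3, e14, ← hbag ⟨k, hk⟩ ⟨l, hl⟩, ← hC]; rfl
      have hdone : ∀ (i : Fin D.numBags) (v : Fin n),
          ((i : ℕ) < k ∨ ((i : ℕ) = k ∧ (v : ℕ) < l + 1)) →
          ((i : ℕ) < k ∨ ((i : ℕ) = k ∧ (v : ℕ) < l)) ∨ (i = ⟨k, hk⟩ ∧ v = ⟨l, hl⟩) := by
        intro i v h
        by_cases hc : (i : ℕ) = k ∧ (v : ℕ) = l
        · exact Or.inr ⟨Fin.ext hc.1, Fin.ext hc.2⟩
        · left; omega
      by_cases hc : 0 < q.nat 3 (k * n + l) ∧ 0 < q.nat 14 l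
      · obtain ⟨hin, hinC⟩ := hcond.1 hc
        have hlast : ∀ (i : Fin D.numBags) (v : Fin n),
            ((i : ℕ) < k ∨ ((i : ℕ) = k ∧ (v : ℕ) < l + 1)) → i ≤ ⟨k, hk⟩ := by
          intro i v h
          rw [Fin.le_def]
          show (i : ℕ) ≤ k
          omega
        rw [hb, run_ite_pos (by simp only [Test.Holds, NatExpr.eval, e40, hq, e10]; exact hc), run_seq,
          run_setNat]
        simp only [NatExpr.eval, hq]
        by_cases hf : 0 < q.nat 100 0
        · rw [run_ite_pos (by simpa [Nat.one_le_iff_ne_zero, Nat.pos_iff_ne_zero] using hf), run_skip]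
          obtain ⟨x, y, h1, h2, h3, h4, a, c, h5, h6, h7, h8, h9⟩ := hJ.2 hf
          refine ⟨fun h => by simp at h; omega, fun _ => ⟨x, ⟨l, hl⟩, by simpa using h1, by simp, h3,
            hinC, a, ⟨k, hk⟩, h5, hin, by omega, by simp, fun i v hi hv hd =>
              ⟨?_, hlast i v hd⟩⟩⟩
          rcases hdone i v hd with hd | ⟨rfl, rfl⟩
          · exact (h9 i v hi hv hd).1
          · rw [Fin.le_def]
            show (a : ℕ) ≤ k
            omega
        · rw [run_ite_neg (by simpa [Nat.one_le_iff_ne_zero, Nat.pos_iff_ne_zero] using hf), run_seq,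
            run_setNat, run_setNat]
          refine ⟨fun h => by simp at h, fun _ => ⟨⟨l, hl⟩, ⟨l, hl⟩, by simp [hq], by simp, hinC,
            hinC, ⟨k, hk⟩, ⟨k, hk⟩, hin, hin, by simp, by simp, fun i v hi hv hd =>
              ⟨?_, hlast i v hd⟩⟩⟩
          rcases hdone i v hd with hd | ⟨rfl, rfl⟩
          · exact absurd hd (hJ.1 (by omega) i v hi hv)
          · exact le_rfl
      · rw [hb, run_ite_neg (by simp only [Test.Holds, NatExpr.eval, e40, hq, e10]; exact hc), run_skip]
        have hnew : ∀ (i : Fin D.numBags) (v : Fin n), v ∈ D.bag i → v ∈ C →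
            ((i : ℕ) < k ∨ ((i : ℕ) = k ∧ (v : ℕ) < l + 1)) →
            ((i : ℕ) < k ∨ ((i : ℕ) = k ∧ (v : ℕ) < l)) := by
          intro i v hi hv hd
          rcases hdone i v hd with hd | ⟨rfl, rfl⟩
          · exact hd
          · exact absurd (hcond.2 ⟨hi, hv⟩) hc
        refine ⟨fun h i v hi hv hd => hJ.1 h i v hi hv (hnew i v hi hv hd), fun h => ?_⟩
        obtain ⟨x, y, h1, h2, h3, h4, a, c, h5, h6, h7, h8, h9⟩ := hJ.2 h
        exact ⟨x, y, h1, h2, h3, h4, a, c, h5, h6, by omega, by omega,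
          fun i v hi hv hd => h9 i v hi hv (hnew i v hi hv hd)⟩

/-- The bound on the bags passes from C minus the covered set to its components because it is
inherited by subsets. -/
theorem bagChoose_chooseSpec {D : PathDecomposition G.graph} {s₀ : Memory}
    (hm : s₀.nat 0 1 = D.numBags)
    (hbag : ∀ (i : Fin D.numBags) (v : Fin n), 0 < s₀.nat 3 (i * n + v) ↔ v ∈ D.bag i) :
    ChooseSpec G bagChoose s₀ fun _ j C => G.BagBound D D.width j C := by
  intro r z C hG hE hL _ hC hz hcomp
  obtain ⟨x, y, h1, h2, h3, h4, h5⟩ := bagChoose_spec (D := D) hG (by rw [hE 0 (Or.inl rfl), hm])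
    (by rw [hE 3 (Or.inr (Or.inl rfl))]; exact hbag) hC ⟨z, hz⟩
  refine ⟨x, y, h1, h2, h3, h4, fun h u _ =>
    (h.step hL ?_ h5).mono (WeightedGraph.comp_subset _ u)⟩
  rw [WeightedGraph.comp_eq_of_mem (z := z) (by rw [hcomp]; exact h3), hcomp]
  exact h4

/-- The algorithm for graphs that are given with a path decomposition. -/
def decompositionB : Block :=
  .seq (anyB 2 67) (.ite (pos (vr 28)) (.seq prepareB (.seq (solveB bagChoose) outB)) .skip)

theorem decompositionB_spec (hconn : G.graph.Connected) (K : Finset (Fin n))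
    (D : PathDecomposition G.graph) :
    ∃ M : WeightedGraph K, Outputs (decompositionB.run (inputMemoryWith G K D)) M ∧
      IsSPRSolution G K M (10 ^ 9 * (D.width : ℝ≥0) ^ 9) := by
  have hin := holdsInput_initialMemory G K D.bag
  set s := inputMemoryWith G K D with hs
  change HoldsInput G K s at hin
  have hany := anyB_spec (n := n) (A := 2) (x := 67) (by decide) (by decide) hin.size
  have w1 : (anyB 2 67).Within [28] 68 [] := by decide
  rw [decompositionB, run_seq]
  set s1 := (anyB 2 67).run s with hs1
  have m1 : Same _ s s1 := same_run _ s
  have e0 : s1.nat 0 = s.nat 0 := w1.nat m1 (by decide) (by decide)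
  have hin1 : HoldsInput G K s1 := hin.of_eq (by rw [e0])
    (w1.nat m1 (by decide) (by decide)) (w1.nat m1 (by decide) (by decide))
    (w1.real m1 (by decide) (by decide))
  have hterm : (supp (s.nat 2) : Set (Fin n)) = K := by
    ext v; exact hin.term v
  rw [hterm] at hany
  rcases K.eq_empty_or_nonempty with rfl | hK
  · exact exists_solution_empty G _ _
  rw [run_ite_pos (by simp only [Test.Holds, NatExpr.eval]; exact hany.2 hK), run_seq, run_seq]
  have m2 := same_run prepareB s1
  have hP := prepareB_spec hconn hin1 hK
  set s2 := prepareB.run s1 with hs2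
  have hspec : ChooseSpec G bagChoose s2 fun _ j C => G.BagBound D D.width j C := by
    refine bagChoose_chooseSpec ?_ ?_
    · rw [prepareB_within.nat m2 (by decide) (by decide), e0]; rfl
    · intro i v
      rw [prepareB_within.nat m2 (by decide) (by decide), w1.nat m1 (by decide) (by decide)]
      have : s.nat 3 (i * n + v) = if v ∈ D.bag i then 1 else 0 := by
        simp [hs, inputMemoryWith, initialMemory, rowMajor_apply]
      rw [this]
      split_ifs with h <;> simp [h]
  have hE : Env s2 s2 := fun _ _ => rfl
  have hBd : ∀ L : ℝ, 0 ≤ L → ∀ (H : Set (Fin n)) (z : Fin n), z ∈ H →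
      G.BagBound D D.width 0 (G.comp H z) := fun _ _ H z _ => WeightedGraph.bagBound_zero D _
  refine outB_solveB bagChoose_chooser hspec hBd hP hE (fun k => ?_) hconn
    ((solveB_spec bagChoose_chooser hspec hBd hP hE).2.2 _ fun L _ C hC h => ?_)
  · rw [prepareB_within.nat m2 (by decide) (by decide), w1.nat m1 (by decide) (by decide)]; rfl
  · exact absurd (h.lt hC) (lt_irrefl _)

/-- All loop bounds are n or m, so the time is a polynomial in n + m; the width influences the
distortion only. -/
theorem decompositionB_runs : ∃ P : Program, ∃ p : Polynomial ℕ,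
    ∀ (n : ℕ) (G : WeightedGraph (Fin n)) (K : Finset (Fin n)) (D : PathDecomposition G.graph),
      G.graph.Connected → SolvesSPRWithin P (inputMemoryWith G K D) (p.eval (n + D.numBags)) G K
        (10 ^ 9 * (D.width : ℝ≥0) ^ 9) := by
  refine ⟨decompositionB.compile, decompositionB.time, fun n G K D hconn => ?_⟩
  obtain ⟨t, ht, hr⟩ := runs decompositionB (by decide) (inputMemoryWith G K D) (n + D.numBags)
    (fun b => by
      simp only [inputMemoryWith, initialMemory]
      split_ifs <;> omega)
  exact ⟨t, ht, _, hr, decompositionB_spec hconn K D⟩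

end Block

/-! ### The search tree -/

/-- A single bag with all vertices shows that the infimum is taken over a nonempty set of natural
numbers, hence attained. -/
theorem exists_pathDecomposition {n : ℕ} (G : SimpleGraph (Fin n)) :
    ∃ D : PathDecomposition G, D.width = pathwidth G := by
  have h : {w | ∃ D : PathDecomposition G, D.width = w}.Nonempty :=
    ⟨_, ⟨1, fun _ => Finset.univ, by simp, by simp, by simp⟩, rfl⟩
  exact Nat.sInf_mem h

namespace WeightedGraph

variable {n : ℕ} {G : WeightedGraph (Fin n)}

/-- Choosing paths in the components well, `T` is used up after `e` levels. -/
def Good (G : WeightedGraph (Fin n)) (L : ℝ) : ℕ → Set (Fin n) → Prop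
  | 0, T => T = ∅
  | e + 1, T => ∀ z ∈ T, ∃ x y, y ∈ G.comp T x ∧ z ∈ G.comp T x ∧
      Good G L e (G.comp T x \ G.cov L (G.comp T x) x y)

theorem comp_symm {T : Set (Fin n)} {x z : Fin n} (h : z ∈ G.comp T x) : x ∈ G.comp T z := by
  obtain ⟨l, h⟩ := h
  exact ⟨l, h.symm⟩

theorem Good.comp {L : ℝ} {e : ℕ} {T : Set (Fin n)} (h : G.Good L e T) {u : Fin n} (hu : u ∈ T) :
    G.Good L e (G.comp T u) := by
  cases e with
  | zero =>
    have h' : T = ∅ := h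
    rw [h'] at hu
    exact absurd hu (Set.notMem_empty _)
  | succ e =>
    intro z hz
    obtain ⟨x, y, h1, h2, h3⟩ := h z (comp_subset _ _ hz)
    have e1 : G.comp T x = G.comp T u := by
      rw [← comp_eq_of_mem hz, comp_eq_of_mem h2]
    have hx : x ∈ G.comp T u := by
      rw [← comp_eq_of_mem hz]; exact comp_symm h2
    refine ⟨x, y, ?_⟩
    rw [comp_comp hx, ← e1]
    exact ⟨h1, h2, h3⟩

/-- Choosing the ends of the paths by a path decomposition is one of the strategies that the search
tree tries. So w + 1 levels are enough for the search as well. -/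
theorem BagBound.good {D : PathDecomposition G.graph} {w : ℕ} {L : ℝ} (hL : 0 ≤ L) {e : ℕ} :
    ∀ {j : ℕ} {C : Set (Fin n)}, BagBound D w j C → j + e = w + 1 → G.Good L e C := by
  induction e with
  | zero =>
    intro j C h hj
    by_contra hC
    have := h.lt (Set.nonempty_iff_ne_empty.2 hC)
    omega
  | succ e ih =>
    intro j C h hj z hz
    obtain ⟨x, hx, y, hy, he⟩ := exists_extremal (G := G) D ⟨z, mem_comp_self hz⟩
    have e1 := comp_eq_of_mem hx
    refine ⟨x, y, by rw [e1]; exact hy, comp_symm hx, ?_⟩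
    rw [e1]
    refine ih ((h.mono (comp_subset _ z)).step hL ?_ he) (by omega)
    rw [comp_comp hx]
    exact hy

/-- The number of nodes of the search tree of depth `k`. -/
def treeSize (n : ℕ) : ℕ → ℕ
  | 0 => 1
  | k + 1 => 1 + n * n * treeSize n k

/-- This fails for n = 0, where there are no vertices to branch on. -/
theorem treeSize_mono {n : ℕ} (hn : 0 < n) : Monotone (treeSize n) := by
  refine monotone_nat_of_le_succ fun k => ?_
  have : 1 * treeSize n k ≤ n * n * treeSize n k := Nat.mul_le_mul_right _ (Nat.mul_pos hn hn)
  rw [treeSize]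
  omega

/-- The nodes `0, …, P - 1` of a search tree: node `p` belongs to the set `T p`, has `td p` levels
left, and comes from the component `CV p` of the set of its parent. -/
structure Forest (G : WeightedGraph (Fin n)) (L : ℝ) (C : Set (Fin n)) (k P : ℕ)
    (T CV : ℕ → Set (Fin n)) (td val par px py : ℕ → ℕ) : Prop where
  root : T 0 = C
  root_td : td 0 = k
  root_val : val 0 = 0
  child : ∀ p, 0 < p → p < P → ∃ (q : ℕ) (x y : Fin n), p = 1 + (q * n + x) * n + y ∧
    par p = q * n ∧ px p = x ∧ py p = y ∧ (0 < val p ↔ 0 < td q ∧ y ∈ G.comp (T q) x) ∧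
    (val p = 0 → td p = 0) ∧ (0 < val p → CV p = G.comp (T q) x ∧
      T p = G.comp (T q) x \ G.cov L (G.comp (T q) x) x y ∧ td p + 1 = td q)

theorem parent_lt {q : ℕ} {x y : Fin n} : q < 1 + (q * n + x) * n + y := by
  have hn : 0 < n := x.pos
  have h1 : q * 1 ≤ q * n := Nat.mul_le_mul_left _ hn
  have h2 : (q * n + x) * 1 ≤ (q * n + x) * n := Nat.mul_le_mul_left _ hn
  omega

theorem node_inj {q q' : ℕ} {x y x' y' : Fin n}
    (h : 1 + (q * n + x) * n + y = 1 + (q' * n + x') * n + y') : q = q' ∧ x = x' ∧ y = y' := by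
  obtain ⟨h1, h2⟩ := mul_add_inj y.2 y'.2 (a := q * n + x) (a' := q' * n + x') (by omega)
  obtain ⟨h3, h4⟩ := mul_add_inj x.2 x'.2 h1
  exact ⟨h3, Fin.ext h4, Fin.ext h2⟩

theorem treeSize_pos (n k : ℕ) : 0 < treeSize n k := by
  cases k <;> rw [treeSize] <;> omega

variable {L : ℝ} {C : Set (Fin n)} {k P : ℕ} {T CV T' CV' : ℕ → Set (Fin n)}
  {td val par px py td' val' par' px' py' : ℕ → ℕ}

/-- Adding one node leaves the old ones untouched, and each node refers only to its parent, which
has a smaller number. -/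
theorem Forest.extend (h : Forest G L C k P T CV td val par px py) (hP : 0 < P)
    (old : ∀ p < P, T' p = T p ∧ CV' p = CV p ∧ td' p = td p ∧ val' p = val p ∧ par' p = par p ∧
      px' p = px p ∧ py' p = py p)
    {q : ℕ} {x y : Fin n} (hPq : P = 1 + (q * n + x) * n + y) (hpar : par' P = q * n)
    (hx : px' P = x) (hy : py' P = y) (hval : 0 < val' P ↔ 0 < td q ∧ y ∈ G.comp (T q) x)
    (h0 : val' P = 0 → td' P = 0) (h1 : 0 < val' P → CV' P = G.comp (T q) x ∧
      T' P = G.comp (T q) x \ G.cov L (G.comp (T q) x) x y ∧ td' P + 1 = td q) :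
    Forest G L C k (P + 1) T' CV' td' val' par' px' py' := by
  obtain ⟨r1, -, r3, r4, -⟩ := old 0 hP
  refine ⟨r1.trans h.root, r3.trans h.root_td, r4.trans h.root_val, fun p hp hpP => ?_⟩
  rcases Nat.lt_succ_iff_lt_or_eq.1 hpP with hlt | rfl
  · obtain ⟨q, x, y, e, h⟩ := h.child p hp hlt
    have hq : q < P := by have := parent_lt (q := q) (x := x) (y := y); omega
    obtain ⟨a1, a2, a3, a4, a5, a6, a7⟩ := old p hlt
    obtain ⟨b1, -, b3, -⟩ := old q hq
    refine ⟨q, x, y, e, ?_⟩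
    rw [a1, a2, a3, a4, a5, a6, a7, b1, b3]
    exact h
  · have hq : q < p := by have := parent_lt (q := q) (x := x) (y := y); omega
    obtain ⟨b1, -, b3, -⟩ := old q hq
    refine ⟨q, x, y, hPq, hpar, hx, hy, ?_⟩
    rw [b1, b3]
    exact ⟨hval, h0, h1⟩

theorem child_le {q M : ℕ} {x y : Fin n} (hq : q < M) : 1 + (q * n + x) * n + y ≤ n * n * M := by
  have h2 : q * n + x + 1 ≤ (q + 1) * n := by have := x.2; rw [Nat.add_mul]; omega
  have h3 : (q * n + x) * n + y + 1 ≤ (q * n + x + 1) * n := by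
    have := y.2; rw [Nat.add_mul (q * n + x) 1]; omega
  have h4 : (q * n + x + 1) * n ≤ (q + 1) * n * n := Nat.mul_le_mul_right _ h2
  have h5 : (q + 1) * (n * n) ≤ M * (n * n) := Nat.mul_le_mul_right _ hq
  rw [← Nat.mul_assoc, Nat.mul_comm _ (n * n)] at h5
  omega

/-- Nodes are numbered as in a heap with n² children each, so a node at depth d has a number below
treeSize n d. Nodes without levels left need no such bound, because nothing is required of their
children. -/
theorem Forest.depth (h : Forest G L C k P T CV td val par px py) : ∀ q < P, 0 < td q →
    ∃ d, d + td q = k ∧ q < treeSize n d := by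
  intro q
  induction q using Nat.strong_induction_on with
  | _ p ih =>
    intro hp htd
    rcases Nat.eq_zero_or_pos p with rfl | h0
    · exact ⟨0, by rw [h.root_td, Nat.zero_add], by simp [treeSize]⟩
    · obtain ⟨q, x, y, e, -, -, -, hval, hz, h1⟩ := h.child p h0 hp
      have hq : q < p := by have := parent_lt (q := q) (x := x) (y := y); omega
      have hv : 0 < val p := by
        by_contra hcon
        have := hz (by omega)
        omega
      have ht := (h1 hv).2.2
      obtain ⟨d, hd, hqd⟩ := ih q hq (by omega) (by omega)
      refine ⟨d + 1, by omega, ?_⟩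
      have := child_le (x := x) (y := y) hqd
      rw [treeSize]
      omega

/-- The nodes whose sets are used up in time are determined by their children. -/
theorem Forest.good_iff (h : Forest G L C k P T CV td val par px py) {m : ℕ} (hkm : k ≤ m)
    (hP : P = 1 + treeSize n m * n * n) {q : ℕ} (hq : q < treeSize n m) :
    (∀ v ∈ T q, ∃ p, q < p ∧ p < treeSize n m ∧ par p = q * n ∧ 0 < val p ∧ G.Good L (td p) (T p) ∧
      v ∈ CV p) ↔ G.Good L (td q) (T q) := by
  have hM : ∀ v : Fin n, treeSize n m ≤ n * n * treeSize n m := fun v => by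
    have := Nat.mul_le_mul_right (treeSize n m) (Nat.mul_pos v.pos v.pos)
    omega
  have eP : P = 1 + n * n * treeSize n m := by rw [hP]; ring
  have hchild : ∀ p v, v ∈ CV p → q < p → p < treeSize n m → par p = q * n → 0 < val p →
      ∃ x y : Fin n, 0 < td q ∧ y ∈ G.comp (T q) x ∧ CV p = G.comp (T q) x ∧
      T p = G.comp (T q) x \ G.cov L (G.comp (T q) x) x y ∧ td p + 1 = td q := by
    intro p v _ hp hpm hpar hv
    obtain ⟨q', x, y, -, h1, -, -, h2, -, h3⟩ := h.child p (by omega) (by have := hM v; omega)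
    have : q' = q := Nat.eq_of_mul_eq_mul_right v.pos (h1.symm.trans hpar)
    rw [this] at h2 h3
    exact ⟨x, y, (h2.1 hv).1, (h2.1 hv).2, h3 hv⟩
  rcases etd : td q with - | e
  · refine ⟨fun hall => Set.eq_empty_iff_forall_notMem.2 fun v hv => ?_, fun hT v hv => ?_⟩
    · obtain ⟨p, h1, h2, h3, h4, -, h5⟩ := hall v hv
      obtain ⟨x, y, h6, -⟩ := hchild p v h5 h1 h2 h3 h4
      omega
    · have hT' : T q = ∅ := hT
      rw [hT'] at hv
      exact absurd hv (Set.notMem_empty _)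
  · refine ⟨fun hall z hz => ?_, fun hT v hv => ?_⟩
    · obtain ⟨p, h1, h2, h3, h4, h5, h6⟩ := hall z hz
      obtain ⟨x, y, -, h7, h8, h9, h10⟩ := hchild p z h6 h1 h2 h3 h4
      refine ⟨x, y, h7, h8 ▸ h6, ?_⟩
      rw [← h9, show e = td p by omega]
      exact h5
    · obtain ⟨x, y, h1, h2, h3⟩ := hT v hv
      have hlt := parent_lt (q := q) (x := x) (y := y)
      obtain ⟨q', x', y', e', h4, -, -, h5, -, h6⟩ := h.child (1 + (q * n + x) * n + y) (by omega)
        (by have := child_le (x := x) (y := y) hq; omega)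
      obtain ⟨rfl, rfl, rfl⟩ := node_inj e'
      have hv := h5.2 ⟨by omega, h1⟩
      -- The child that is wanted has depth d + 1 ≤ m, so its number is below treeSize n m: it is
      -- among the nodes that are evaluated.
      obtain ⟨d, hd, hqd⟩ := h.depth q (by have := hM v; omega) (by omega)
      have hm := treeSize_mono v.pos (show d + 1 ≤ m by omega)
      rw [treeSize] at hm
      have hc := child_le (x := x) (y := y) hqd
      refine ⟨_, hlt, by omega, h4, hv, ?_, by rw [(h6 hv).1]; exact h2⟩
      rw [(h6 hv).2.1, show td (1 + (q * n + x) * n + y) = e by have := (h6 hv).2.2; omega]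
      exact h3

end WeightedGraph

/-! ### Growing the search tree -/

namespace Block

/-- Store the difference of the sets in arrays `103` and `13`, and the former, in the rows of arrays
`110` and `111` that start at variable `104`. -/
def rowsB : Block :=
  .loop 122 0 (.seq (.setNat 111 (.add (vr 104) (vr 122)) (.read 103 (vr 122)))
    (.ite (pos (.read 13 (vr 122))) (.setNat 110 (.add (vr 104) (vr 122)) (.lit 0))
      (.setNat 110 (.add (vr 104) (vr 122)) (.read 103 (vr 122)))))

/-- The set of node `105`, in array `102`, and its component that contains vertex `106`, in array
`103`. -/
def openB : Block :=
  .seq (.loop 120 0 (.setNat 102 (vr 120) (.read 110 (.add (.read 114 (vr 105)) (vr 120))))) <|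
  .seq (distB 102 106) (copyB 11 103 121)

/-- Prepare the node `101`, the child of node `105` for the vertices `106` and `107`. -/
def linkB : Block :=
  .seq (.setNat 112 (vr 101) (.lit 0)) <|
  .seq (.setNat 113 (vr 101) (.lit 0)) <|
  .seq (.setNat 114 (vr 101) (vr 104)) <|
  .seq (.setNat 115 (vr 101) (.read 114 (vr 105))) <|
  .seq (.setNat 116 (vr 101) (vr 106)) (.setNat 117 (vr 101) (vr 107))

/-- Fill in the node `101` if vertices `106` and `107` belong to one component. -/
def fillB : Block :=
  .ite (.and (pos (.read 112 (vr 105))) (.and (pos (.read 102 (vr 106))) (pos (.read 103 (vr 107)))))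
    (.seq (coverB 103 106 107 false) <| .seq rowsB <|
      .seq (.setNat 112 (vr 101) (.sub (.read 112 (vr 105)) (.lit 1)))
        (.setNat 113 (vr 101) (.lit 1)))
    .skip

/-- Create a node. -/
def childB : Block :=
  .seq openB <| .seq linkB <| .seq fillB <|
  .seq (.setNat 101 (.lit 0) (.add (vr 101) (.lit 1)))
    (.setNat 104 (.lit 0) (.add (vr 104) (vr 0)))

/-- Create the search tree for the component in array `14`. Variable `71` is the number of levels,
and cell `2` of array `0` is the number of nodes that get children. -/
def forestB : Block :=
  .seq (.setNat 101 (.lit 0) (.lit 1)) <|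
  .seq (.setNat 104 (.lit 0) (vr 0)) <|
  .seq (.setNat 112 (.lit 0) (.sub (vr 71) (vr 29))) <|
  .seq (.setNat 113 (.lit 0) (.lit 0)) <|
  .seq (.setNat 114 (.lit 0) (.lit 0)) <|
  .seq (copyB 14 110 123) (.loop 105 2 (.loop 106 0 (.loop 107 0 childB)))

variable {n : ℕ} {G : WeightedGraph (Fin n)}

/-- The row of a matrix with `n` columns that starts at `b`. -/
def row (f : ℕ → ℕ) (b : ℕ) (k : ℕ) : ℕ := f (b + k)

/-- The memory holds the nodes `0, …, P - 1`. -/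
structure HoldsForest (G : WeightedGraph (Fin n)) (L : ℝ) (C : Set (Fin n)) (k P : ℕ) (s : Memory) :
    Prop where
  forest : G.Forest L C k P (fun p => supp (row (s.nat 110) (p * n)))
    (fun p => supp (row (s.nat 111) (p * n))) (s.nat 112) (s.nat 113) (s.nat 115) (s.nat 116)
    (s.nat 117)
  base : ∀ p < P, s.nat 114 p = p * n
  pos : 0 < P

/-- The rows of the new node are filled and all cells before them are preserved, so earlier nodes
survive. -/
theorem rowsB_spec {s : Memory} (h0 : s.nat 0 0 = n) {b : ℕ} (hb : s.nat 104 0 = b) :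
    (∀ i < b, (rowsB.run s).nat 110 i = s.nat 110 i ∧ (rowsB.run s).nat 111 i = s.nat 111 i) ∧
    ∀ v : Fin n, (rowsB.run s).nat 110 (b + v) = (if 0 < s.nat 13 v then 0 else s.nat 103 v) ∧
      (rowsB.run s).nat 111 (b + v) = s.nat 103 v := by
  have main := loop_rule (x := 122) (b := 0)
    (p := .seq (.setNat 111 (.add (vr 104) (vr 122)) (.read 103 (vr 122)))
      (.ite (pos (.read 13 (vr 122))) (.setNat 110 (.add (vr 104) (vr 122)) (.lit 0))
        (.setNat 110 (.add (vr 104) (vr 122)) (.read 103 (vr 122))))) (s := s) h0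
    (fun k r => (∀ i < b, r.nat 110 i = s.nat 110 i ∧ r.nat 111 i = s.nat 111 i) ∧
      ∀ v < k, r.nat 110 (b + v) = (if 0 < s.nat 13 v then 0 else s.nat 103 v) ∧
        r.nat 111 (b + v) = s.nat 103 v) ?_ ?_ ?_
  · exact ⟨main.1, fun v => main.2 v v.2⟩
  · intro k r j h; simpa using h
  · exact ⟨fun i _ => ⟨rfl, rfl⟩, fun v h => absurd h (by omega)⟩
  · intro k r hk hr hsr ⟨hI1, hI2⟩
    have e104 : r.nat 104 0 = b := by rw [hsr.1 104 (by decide), hb]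
    have e103 : r.nat 103 = s.nat 103 := hsr.1 103 (by decide)
    have e13 : r.nat 13 = s.nat 13 := hsr.1 13 (by decide)
    rw [run_seq, run_setNat]
    simp only [NatExpr.eval, hr, e104, e103]
    set q := r.writeNat 111 (b + k) (s.nat 103 k) with hq
    have hres : ∀ (z : ℕ), z = (if 0 < s.nat 13 k then 0 else s.nat 103 k) →
        (∀ i < b, (q.writeNat 110 (b + k) z).nat 110 i = s.nat 110 i ∧
          (q.writeNat 110 (b + k) z).nat 111 i = s.nat 111 i) ∧
        ∀ v < k + 1, (q.writeNat 110 (b + k) z).nat 110 (b + v) =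
          (if 0 < s.nat 13 v then 0 else s.nat 103 v) ∧
          (q.writeNat 110 (b + k) z).nat 111 (b + v) = s.nat 103 v := by
      rintro z rfl
      refine ⟨fun i hi => ?_, fun v hv => ?_⟩
      · have : i ≠ b + k := by omega
        simpa [hq, Function.update_of_ne this] using hI1 i hi
      · by_cases hvk : v = k
        · subst hvk; simp [hq]
        · have : b + v ≠ b + k := by omega
          simpa [hq, Function.update_of_ne this] using hI2 v (by omega)
    by_cases hc : 0 < s.nat 13 k
    · rw [run_ite_pos (by simp only [Test.Holds, NatExpr.eval]; simpa [hq, hr, e13, Nat.one_le_iff_ne_zero, Nat.pos_iff_ne_zero] using hc),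
        run_setNat]
      have e : (NatExpr.add (vr 104) (vr 122)).eval q = b + k := by simp [hq, hr, e104]
      rw [e]
      exact hres _ (by simp [hc])
    · rw [run_ite_neg (by simp only [Test.Holds, NatExpr.eval]; simpa [hq, hr, e13, Nat.one_le_iff_ne_zero, Nat.pos_iff_ne_zero] using hc),
        run_setNat]
      have e : (NatExpr.add (vr 104) (vr 122)).eval q = b + k := by simp [hq, hr, e104]
      have e' : (NatExpr.read 103 (vr 122)).eval q = s.nat 103 k := by simp [hq, hr, e103]
      rw [e, e']
      exact hres _ (by simp [hc])

theorem openB_spec {s : Memory} (hG : HoldsGraph G s) {q : ℕ} {x : Fin n} (hq : s.nat 105 0 = q)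
    (hb : s.nat 114 q = q * n) (hx : s.nat 106 0 = x) :
    supp ((openB.run s).nat 102) = (supp (row (s.nat 110) (q * n)) : Set (Fin n)) ∧
    (x ∈ (supp (row (s.nat 110) (q * n)) : Set (Fin n)) →
      supp ((openB.run s).nat 103) = G.comp (supp (row (s.nat 110) (q * n))) x) := by
  set T : Set (Fin n) := supp (row (s.nat 110) (q * n)) with hT
  rw [openB, run_seq, run_seq]
  set b1 : Block := .loop 120 0 (.setNat 102 (vr 120) (.read 110 (.add (.read 114 (vr 105)) (vr 120))))
    with hb1
  set s1 := b1.run s with hs1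
  have m1 : Same _ s s1 := same_run _ s
  have h102 : ∀ k, s1.nat 102 k = if k < n then s.nat 110 (q * n + k) else s.nat 102 k := by
    refine loop_pointwise hG.size 102 (by decide) (fun k => s.nat 110 (q * n + k)) ?_
    intro k r hk hr hsr _
    have e1 : r.nat 110 = s.nat 110 := hsr.1 110 (by decide)
    have e2 : r.nat 114 = s.nat 114 := hsr.1 114 (by decide)
    have e3 : r.nat 105 = s.nat 105 := hsr.1 105 (by decide)
    simp [run_setNat, hr, e1, e2, e3, hq, hb]
  have hT1 : supp (s1.nat 102) = T := by
    ext v; rw [mem_supp, h102, if_pos v.2]; rfl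
  have hG1 : HoldsGraph G s1 := hG.of_eq (m1.1 0 (by rw [hb1]; decide)) (m1.1 1 (by rw [hb1]; decide))
    (m1.1 10 (by rw [hb1]; decide)) (m1.2 0 (by rw [hb1]; decide))
  have hx1 : s1.nat 106 0 = x := by rw [m1.1 106 (by rw [hb1]; decide), hx]
  set s2 := (distB 102 106).run s1 with hs2
  have m2 : Same _ s1 s2 := same_run _ s1
  have hG2 : HoldsGraph G s2 := hG1.of_eq (m2.1 0 (by decide)) (m2.1 1 (by decide))
    (m2.1 10 (by decide)) (m2.2 0 (by decide))
  refine ⟨?_, fun hxT => ?_⟩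
  · rw [run_nat (by decide), m2.1 102 (by decide), hT1]
  · have hd := distB_spec (S := 102) (X := 106) (by decide) (by decide) hG1 hx1 (by rw [hT1]; exact hxT)
    ext v
    rw [mem_supp, copyB_spec (by decide) (by decide) (by decide) hG2.size, ← hT1]
    exact (hd v).1

theorem supp_row_eq {f g : ℕ → ℕ} {P p : ℕ} (h : ∀ i < P * n, f i = g i) (hp : p < P) :
    (supp (row f (p * n)) : Set (Fin n)) = supp (row g (p * n)) := by
  ext v
  have : p * n + v < P * n := by
    have h1 : (p + 1) * n ≤ P * n := Nat.mul_le_mul_right _ hp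
    have h2 := v.2
    rw [Nat.add_mul] at h1
    omega
  rw [mem_supp, mem_supp, row, row, h _ this]

/-- A child is valid only if the parent has levels left and y lies in the component of x. Otherwise
it keeps the flag 0 and no levels, but it still occupies its number, so that numbers can be computed
from q, x and y. -/
theorem fillB_spec {s : Memory} (hG : HoldsGraph G s) {q P : ℕ}
    {x y : Fin n} (hq : s.nat 105 0 = q) (hx : s.nat 106 0 = x) (hy : s.nat 107 0 = y)
    (hP : s.nat 101 0 = P) (hb : s.nat 104 0 = P * n) (h0 : s.nat 112 P = 0) (h0' : s.nat 113 P = 0)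
    {T : Set (Fin n)} (hT : supp (s.nat 102) = T) (hC : x ∈ T → supp (s.nat 103) = G.comp T x) :
    (∀ i < P * n, (fillB.run s).nat 110 i = s.nat 110 i ∧ (fillB.run s).nat 111 i = s.nat 111 i) ∧
    (∀ p < P, (fillB.run s).nat 112 p = s.nat 112 p ∧ (fillB.run s).nat 113 p = s.nat 113 p) ∧
    (0 < (fillB.run s).nat 113 P ↔ 0 < s.nat 112 q ∧ y ∈ G.comp T x) ∧
    ((fillB.run s).nat 113 P = 0 → (fillB.run s).nat 112 P = 0) ∧
    (0 < (fillB.run s).nat 113 P →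
      supp (row ((fillB.run s).nat 111) (P * n)) = G.comp T x ∧
      supp (row ((fillB.run s).nat 110) (P * n)) =
        G.comp T x \ G.cov (s.real 13 0) (G.comp T x) x y ∧
      (fillB.run s).nat 112 P + 1 = s.nat 112 q) := by
  have hiff : (0 < s.nat 112 q ∧ 0 < s.nat 102 x ∧ 0 < s.nat 103 y) ↔
      0 < s.nat 112 q ∧ y ∈ G.comp T x := by
    constructor
    · rintro ⟨h1, h2, h3⟩
      have hxT : x ∈ T := hT ▸ h2
      refine ⟨h1, ?_⟩
      rw [← hC hxT]; exact h3
    · rintro ⟨h1, h2⟩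
      have hxT : x ∈ T := by obtain ⟨l, hl⟩ := h2; exact hl.left_mem
      refine ⟨h1, ?_, ?_⟩
      · have : x ∈ (supp (s.nat 102) : Set (Fin n)) := hT ▸ hxT
        exact this
      · have : y ∈ (supp (s.nat 103) : Set (Fin n)) := by rw [hC hxT]; exact h2
        exact this
  by_cases hc : 0 < s.nat 112 q ∧ 0 < s.nat 102 x ∧ 0 < s.nat 103 y
  swap
  · rw [fillB, run_ite_neg (by simp only [Test.Holds, NatExpr.eval, hq, hx, hy]; exact hc), run_skip]
    refine ⟨fun _ _ => ⟨rfl, rfl⟩, fun _ _ => ⟨rfl, rfl⟩, ?_, fun _ => h0, fun h => ?_⟩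
    · rw [h0', ← hiff]
      exact ⟨fun h => absurd h (lt_irrefl 0), fun h => absurd h hc⟩
    · rw [h0'] at h; exact absurd h (lt_irrefl 0)
  rw [fillB, run_ite_pos (by simp only [Test.Holds, NatExpr.eval, hq, hx, hy]; exact hc), run_seq,
    run_seq]
  have hc' := hiff.1 hc
  have hxT : x ∈ T := hT ▸ hc.2.1
  have hCx := hC hxT
  have hxC : x ∈ G.comp T x := WeightedGraph.mem_comp_self hxT
  have hcov := coverB_spec (C := 103) (X := 106) (Y := 107) (b := false) (by decide) (by decide)
    (by decide) hG hx hy (by rw [hCx]; exact hxC)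
    (by rw [hCx, WeightedGraph.comp_comp hxC]; exact hc'.2) (fun _ _ _ _ => True) trivial
    (fun _ _ _ _ _ _ _ _ _ => trivial)
  rw [hCx] at hcov
  set s1 := (coverB 103 106 107 false).run s with hs1
  have m1 : Same _ s s1 := same_run _ s
  have b1 : s1.nat 104 0 = P * n := by rw [m1.1 104 (by decide), hb]
  have hr := rowsB_spec (n := n) (s := s1) (by rw [m1.1 0 (by decide), hG.size]) b1
  set s2 := rowsB.run s1 with hs2
  have m2 : Same _ s1 s2 := same_run _ s1
  have f112 : s2.nat 112 = s.nat 112 := by rw [m2.1 112 (by decide), m1.1 112 (by decide)]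
  have f113 : s2.nat 113 = s.nat 113 := by rw [m2.1 113 (by decide), m1.1 113 (by decide)]
  have f101 : s2.nat 101 0 = P := by rw [m2.1 101 (by decide), m1.1 101 (by decide), hP]
  have f105 : s2.nat 105 0 = q := by rw [m2.1 105 (by decide), m1.1 105 (by decide), hq]
  have g110 : s1.nat 110 = s.nat 110 := m1.1 110 (by decide)
  have g111 : s1.nat 111 = s.nat 111 := m1.1 111 (by decide)
  have g103 : s1.nat 103 = s.nat 103 := m1.1 103 (by decide)
  rw [g110, g111] at hr
  rw [run_seq, run_setNat, run_setNat]
  refine ⟨fun i hi => by simpa using hr.1 i hi, fun p hp => ?_, ?_, ?_, fun _ => ⟨?_, ?_, ?_⟩⟩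
  · have : p ≠ P := by omega
    simp [f101, f112, f113, Function.update_of_ne this]
  · simpa [f101] using hc'
  · simp [f101]
  · rw [← hCx]
    ext v
    simp only [Memory.nat_writeNat, mem_supp, row]
    rw [← g103, ← (hr.2 v).2]
    simp
  · ext v
    have h1 : v ∈ G.cov (s.real 13 0) (G.comp T x) x y ↔ 0 < s1.nat 13 v := by rw [← hcov.1]; rfl
    have h2 : v ∈ G.comp T x ↔ 0 < s1.nat 103 v := by rw [← hCx, g103]; rfl
    have h3 := (hr.2 v).1
    rw [Set.mem_sdiff, h1, h2, mem_supp, row]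
    simp only [Memory.nat_writeNat, show (110 : ℕ) ≠ 113 by decide, show (110 : ℕ) ≠ 112 by decide,
      if_false, h3]
    split_ifs with h <;> simp [h]
  · have : 0 < s.nat 112 q := hc.1
    simp [f101, f105, f112]
    omega

/-- Variable `104` follows the row offset P·n by additions of n. For the same reason parents are
stored as the offset q·n of their rows and not as q. -/
theorem childB_spec {s : Memory} (hG : HoldsGraph G s) {C : Set (Fin n)}
    {k P q : ℕ} {x y : Fin n} (hq : s.nat 105 0 = q) (hx : s.nat 106 0 = x) (hy : s.nat 107 0 = y)
    (hP : s.nat 101 0 = P) (hb : s.nat 104 0 = P * n) (hPq : P = 1 + (q * n + x) * n + y)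
    (h : HoldsForest G (s.real 13 0) C k P s) :
    HoldsForest G (s.real 13 0) C k (P + 1) (childB.run s) ∧ (childB.run s).nat 101 0 = P + 1 ∧
      (childB.run s).nat 104 0 = (P + 1) * n := by
  have hqP : q < P := by rw [hPq]; exact WeightedGraph.parent_lt
  rw [childB, run_seq, run_seq, run_seq]
  obtain ⟨o1, o2⟩ := openB_spec hG hq (h.base q hqP) hx
  set T : Set (Fin n) := supp (row (s.nat 110) (q * n)) with hT
  set s1 := openB.run s with hs1
  have m1 : Same _ s s1 := same_run _ s
  set s2 := linkB.run s1 with hs2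
  have m2 : Same _ s1 s2 := same_run _ s1
  have hu : ∀ a, a ∉ openB.natW → a ∉ linkB.natW → s2.nat a = s.nat a := fun a h1 h2 => by
    rw [m2.1 a h2, m1.1 a h1]
  have hur : ∀ a, a ∉ openB.realW → a ∉ linkB.realW → s2.real a = s.real a := fun a h1 h2 => by
    rw [m2.2 a h2, m1.2 a h1]
  have hG2 : HoldsGraph G s2 := hG.of_eq (hu 0 (by decide) (by decide)) (hu 1 (by decide) (by decide))
    (hu 10 (by decide) (by decide)) (hur 0 (by decide) (by decide))
  have c101 : s1.nat 101 0 = P := by rw [m1.1 101 (by decide), hP]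
  have c104 : s1.nat 104 0 = P * n := by rw [m1.1 104 (by decide), hb]
  have c105 : s1.nat 105 0 = q := by rw [m1.1 105 (by decide), hq]
  have c106 : s1.nat 106 0 = x := by rw [m1.1 106 (by decide), hx]
  have c107 : s1.nat 107 0 = y := by rw [m1.1 107 (by decide), hy]
  have c114 : s1.nat 114 = s.nat 114 := m1.1 114 (by decide)
  have l112 : s2.nat 112 = Function.update (s.nat 112) P 0 := by
    simp [hs2, linkB, run_seq, run_setNat, c101, m1.1 112 (by decide)]
  have l113 : s2.nat 113 = Function.update (s.nat 113) P 0 := by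
    simp [hs2, linkB, run_seq, run_setNat, c101, m1.1 113 (by decide)]
  have l114 : s2.nat 114 = Function.update (s.nat 114) P (P * n) := by
    simp [hs2, linkB, run_seq, run_setNat, c101, c104, c114]
  have l115 : s2.nat 115 = Function.update (s.nat 115) P (q * n) := by
    simp [hs2, linkB, run_seq, run_setNat, c101, c105, c114, Function.update_of_ne hqP.ne,
      h.base q hqP, m1.1 115 (by decide)]
  have l116 : s2.nat 116 = Function.update (s.nat 116) P x := by
    simp [hs2, linkB, run_seq, run_setNat, c101, c106, m1.1 116 (by decide)]
  have l117 : s2.nat 117 = Function.update (s.nat 117) P y := by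
    simp [hs2, linkB, run_seq, run_setNat, c101, c107, m1.1 117 (by decide)]
  have e13 : s2.real 13 = s.real 13 := hur 13 (by decide) (by decide)
  have hf := fillB_spec (G := G) (s := s2) hG2 (x := x) (y := y)
    (by rw [hu 105 (by decide) (by decide), hq]) (by rw [hu 106 (by decide) (by decide), hx])
    (by rw [hu 107 (by decide) (by decide), hy]) (by rw [hu 101 (by decide) (by decide), hP])
    (by rw [hu 104 (by decide) (by decide), hb]) (by rw [l112]; simp) (by rw [l113]; simp) (T := T)
    (by rw [m2.1 102 (by decide)]; exact o1) (by rw [m2.1 103 (by decide)]; exact o2)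
  rw [e13, hu 110 (by decide) (by decide), hu 111 (by decide) (by decide)] at hf
  set s3 := fillB.run s2 with hs3
  have m3 : Same _ s2 s3 := same_run _ s2
  obtain ⟨f1, f2, f3, f4, f5⟩ := hf
  have e112 : s2.nat 112 q = s.nat 112 q := by rw [l112, Function.update_of_ne hqP.ne]
  rw [e112] at f3 f5
  rw [run_seq, run_setNat, run_setNat]
  have d101 : s3.nat 101 0 = P := by
    rw [m3.1 101 (by decide), hu 101 (by decide) (by decide), hP]
  have d104 : s3.nat 104 0 = P * n := by
    rw [m3.1 104 (by decide), hu 104 (by decide) (by decide), hb]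
  have d0 : s3.nat 0 0 = n := by
    rw [m3.1 0 (by decide), hu 0 (by decide) (by decide), hG.size]
  have d114 : s3.nat 114 = Function.update (s.nat 114) P (P * n) := by
    rw [m3.1 114 (by decide), l114]
  have d115 : s3.nat 115 = Function.update (s.nat 115) P (q * n) := by
    rw [m3.1 115 (by decide), l115]
  have d116 : s3.nat 116 = Function.update (s.nat 116) P x := by rw [m3.1 116 (by decide), l116]
  have d117 : s3.nat 117 = Function.update (s.nat 117) P y := by rw [m3.1 117 (by decide), l117]
  refine ⟨⟨?_, ?_, by omega⟩, by simp [d101], ?_⟩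
  · simp only [Memory.nat_writeNat, show (110 : ℕ) ≠ 104 by decide, show (110 : ℕ) ≠ 101 by decide,
      show (111 : ℕ) ≠ 104 by decide, show (111 : ℕ) ≠ 101 by decide,
      show (112 : ℕ) ≠ 104 by decide, show (112 : ℕ) ≠ 101 by decide,
      show (113 : ℕ) ≠ 104 by decide, show (113 : ℕ) ≠ 101 by decide,
      show (115 : ℕ) ≠ 104 by decide, show (115 : ℕ) ≠ 101 by decide,
      show (116 : ℕ) ≠ 104 by decide, show (116 : ℕ) ≠ 101 by decide,
      show (117 : ℕ) ≠ 104 by decide, show (117 : ℕ) ≠ 101 by decide, if_false]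
    refine h.forest.extend h.pos (fun p hp => ?_) hPq (by rw [d115]; simp) (by rw [d116]; simp)
      (by rw [d117]; simp) f3 f4 (fun hv => ⟨(f5 hv).1, (f5 hv).2.1, (f5 hv).2.2⟩)
    refine ⟨supp_row_eq (fun i hi => (f1 i hi).1) hp, supp_row_eq (fun i hi => (f1 i hi).2) hp, ?_,
      ?_, ?_, ?_, ?_⟩
    · rw [(f2 p hp).1, l112, Function.update_of_ne hp.ne]
    · rw [(f2 p hp).2, l113, Function.update_of_ne hp.ne]
    · rw [d115, Function.update_of_ne hp.ne]
    · rw [d116, Function.update_of_ne hp.ne]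
    · rw [d117, Function.update_of_ne hp.ne]
  · intro p hp
    simp only [Memory.nat_writeNat, show (114 : ℕ) ≠ 104 by decide, show (114 : ℕ) ≠ 101 by decide,
      if_false, d114]
    by_cases hpP : p = P
    · subst hpP; simp
    · rw [Function.update_of_ne hpP]
      exact h.base p (by omega)
  · simp [d104, d0]
    ring

end Block

/-! ### Searching for good paths -/

namespace Block

/-- Unmark all vertices of the sets of the nodes in array `118`. -/
def clearB : Block :=
  .loop 124 2 (.loop 125 0 (.setNat 118 (.add (.read 114 (vr 124)) (vr 125)) (.lit 0)))

/-- Test if all vertices of the set of node `127` are marked. -/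
def testB : Block :=
  .seq (.setNat 119 (.lit 0) (.lit 1)) <|
  .loop 128 0 (.ite (.and (pos (.read 110 (.add (.read 114 (vr 127)) (vr 128))))
      (.not (pos (.read 118 (.add (.read 114 (vr 127)) (vr 128))))))
    (.setNat 119 (.lit 0) (.lit 0)) .skip)

/-- Mark the component that node `127` comes from. -/
def markB : Block :=
  .seq (.loop 129 0 (.ite (pos (.read 111 (.add (.read 114 (vr 127)) (vr 129))))
    (.setNat 118 (.add (.read 115 (vr 127)) (vr 129)) (.lit 1)) .skip)) <|
  .ite (pos (.read 115 (vr 127))) .skip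
    (.seq (.setNat 25 (.lit 0) (.read 116 (vr 127))) (.setNat 26 (.lit 0) (.read 117 (vr 127))))

/-- Decide whether the set of a node is used up in time. -/
def visitB : Block :=
  .seq (.setNat 127 (.lit 0) (.sub (.sub (.read 0 (.lit 2)) (vr 126)) (.lit 1))) <|
  .seq testB (.ite (.and (pos (.read 113 (vr 127))) (pos (vr 119))) markB .skip)

/-- Choose two vertices by means of the search tree. -/
def treeChoose : Block :=
  .seq forestB <| .seq clearB <|
  .seq (.setNat 25 (.lit 0) (vr 51)) <| .seq (.setNat 26 (.lit 0) (vr 51)) (.loop 126 2 visitB)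

theorem treeChoose_chooser : Chooser treeChoose := by decide

variable {n : ℕ} {G : WeightedGraph (Fin n)} {L : ℝ} {C : Set (Fin n)} {k P : ℕ}

theorem HoldsForest.of_eq {s r : Memory} (h : HoldsForest G L C k P s)
    (he : ∀ a ∈ [110, 111, 112, 113, 114, 115, 116, 117], r.nat a = s.nat a) :
    HoldsForest G L C k P r := by
  simp only [List.mem_cons, List.not_mem_nil, or_false, forall_eq_or_imp, forall_eq] at he
  obtain ⟨e1, e2, e3, e4, e5, e6, e7, e8⟩ := he
  obtain ⟨h1, h2, h3⟩ := h
  refine ⟨?_, by rw [e5]; exact h2, h3⟩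
  rw [e1, e2, e3, e4, e6, e7, e8]
  exact h1

/-- The memory while the tree is grown. -/
def Growing (G : WeightedGraph (Fin n)) (L : ℝ) (C : Set (Fin n)) (k P : ℕ) (s : Memory) : Prop :=
  HoldsForest G L C k P s ∧ s.nat 101 0 = P ∧ s.nat 104 0 = P * n

theorem Growing.writeNat {s : Memory} (h : Growing G L C k P s) {a i z : ℕ}
    (ha : a ∉ [101, 104, 110, 111, 112, 113, 114, 115, 116, 117]) :
    Growing G L C k P (s.writeNat a i z) := by
  have hne : ∀ b ∈ [101, 104, 110, 111, 112, 113, 114, 115, 116, 117],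
      (s.writeNat a i z).nat b = s.nat b := fun b hb => by
    have : b ≠ a := fun e => ha (e ▸ hb)
    simp [this]
  refine ⟨h.1.of_eq fun b hb => hne b (by simp at hb ⊢; tauto), ?_, ?_⟩
  · rw [hne 101 (by decide)]; exact h.2.1
  · rw [hne 104 (by decide)]; exact h.2.2

theorem growB_spec {s : Memory} (hG : HoldsGraph G s) {M : ℕ} (hM : s.nat 0 2 = M)
    (h : Growing G (s.real 13 0) C k 1 s) :
    Growing G (s.real 13 0) C k (1 + M * n * n)
      ((loop 105 2 (.loop 106 0 (.loop 107 0 childB))).run s) := by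
  have main := loop_rule (x := 105) (b := 2) (p := .loop 106 0 (.loop 107 0 childB)) (s := s) hM
    (fun q r => Growing G (s.real 13 0) C k (1 + q * n * n) r) ?_ ?_ ?_
  · exact main
  · exact fun _ r j hr => hr.writeNat (by decide)
  · simpa using h
  · intro q r hq hr hsr hI
    have m1 := loop_rule (x := 106) (b := 0) (p := .loop 107 0 childB) (s := r) (N := n)
      (by rw [hsr.1 0 (by decide), hG.size])
      (fun i p => Growing G (s.real 13 0) C k (1 + (q * n + i) * n) p) ?_ ?_ ?_
    · have e : 1 + (q * n + n) * n = 1 + (q + 1) * n * n := by ring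
      rwa [e] at m1
    · exact fun _ r j hr => hr.writeNat (by decide)
    · simpa using hI
    · intro x p hx hp hsp hJ
      have m2 := loop_rule (x := 107) (b := 0) (p := childB) (s := p) (N := n)
        (by rw [hsp.1 0 (by decide), hsr.1 0 (by decide), hG.size])
        (fun j t => Growing G (s.real 13 0) C k (1 + (q * n + x) * n + j) t) ?_ ?_ ?_
      · have e : 1 + (q * n + x) * n + n = 1 + (q * n + (x + 1)) * n := by ring
        rwa [e] at m2
      · exact fun _ r j hr => hr.writeNat (by decide)
      · simpa using hJ
      · intro y t hy ht hst ⟨h1, h2, h3⟩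
        have hGt : HoldsGraph G t := hG.of_eq
          (by rw [hst.1 0 (by decide), hsp.1 0 (by decide), hsr.1 0 (by decide)])
          (by rw [hst.1 1 (by decide), hsp.1 1 (by decide), hsr.1 1 (by decide)])
          (by rw [hst.1 10 (by decide), hsp.1 10 (by decide), hsr.1 10 (by decide)])
          (by rw [hst.2 0 (by decide), hsp.2 0 (by decide), hsr.2 0 (by decide)])
        have e13 : t.real 13 = s.real 13 := by
          rw [hst.2 13 (by decide), hsp.2 13 (by decide), hsr.2 13 (by decide)]
        have := childB_spec (G := G) (C := C) (k := k) (q := q) (x := ⟨x, hx⟩) (y := ⟨y, hy⟩) hGt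
          (by rw [hst.1 105 (by decide), hsp.1 105 (by decide), hr])
          (by rw [hst.1 106 (by decide), hp]) ht h2 h3 rfl (by rw [e13]; exact h1)
        rw [e13] at this
        exact this

theorem forestB_spec {s : Memory} (hG : HoldsGraph G s) {M : ℕ} (hM : s.nat 0 2 = M)
    (hC : supp (s.nat 14) = C) :
    HoldsForest G (s.real 13 0) C (s.nat 71 0 - s.nat 29 0) (1 + M * n * n) (forestB.run s) := by
  simp only [forestB, run_seq]
  rw [run_setNat 101, run_setNat 104, run_setNat 112, run_setNat 113, run_setNat 114]
  set s1 := (((((s.writeNat 101 _ _).writeNat 104 _ _).writeNat 112 _ _).writeNat 113 _ _).writeNat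
    114 _ _) with hs1
  set s2 := (copyB 14 110 123).run s1 with hs2
  have m2 : Same _ s1 s2 := same_run _ s1
  have hu : ∀ a ∉ [101, 104, 110, 112, 113, 114, 123], s2.nat a = s.nat a := fun a ha => by
    have ha' := ha
    simp only [List.mem_cons, List.not_mem_nil, or_false, not_or] at ha
    obtain ⟨h1, h2, h3, h4, h5, h6, h7⟩ := ha
    rw [m2.1 a (by simp [copyB, natW]; omega), hs1]
    simp [h1, h2, h4, h5, h6]
  have hG1 : s1.nat 0 0 = n := by simp [hs1, hG.size]
  have hG2 : HoldsGraph G s2 := hG.of_eq (hu 0 (by decide)) (hu 1 (by decide)) (hu 10 (by decide))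
    (by rw [m2.2 0 (by decide)]; rfl)
  have e13 : s2.real 13 = s.real 13 := by rw [m2.2 13 (by decide)]; rfl
  have h110 : (supp (row (s2.nat 110) (0 * n)) : Set (Fin n)) = C := by
    rw [← hC]
    ext v
    have := copyB_spec (A := 14) (B := 110) (x := 123) (by decide) (by decide) (by decide) hG1 v
    rw [mem_supp, mem_supp, row, Nat.zero_mul, Nat.zero_add, hs2, this]
    simp [hs1]
  have g : Growing G (s2.real 13 0) C (s.nat 71 0 - s.nat 29 0) 1 s2 := by
    refine ⟨⟨⟨h110, ?_, ?_, fun p h1 h2 => absurd h1 (by omega)⟩, fun p hp => ?_, Nat.one_pos⟩, ?_, ?_⟩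
    · rw [m2.1 112 (by decide)]; simp [hs1]
    · rw [m2.1 113 (by decide)]; simp [hs1]
    · obtain rfl : p = 0 := by omega
      rw [m2.1 114 (by decide)]; simp [hs1]
    · rw [m2.1 101 (by decide)]; simp [hs1]
    · rw [m2.1 104 (by decide)]; simp [hs1, hG.size]
  have := growB_spec hG2 (M := M) (by rw [hu 0 (by decide), hM]) g
  rw [e13] at this
  exact this.1

theorem clearB_spec {s : Memory} (h0 : s.nat 0 0 = n) {M : ℕ} (hM : s.nat 0 2 = M)
    (hb : ∀ p < M, s.nat 114 p = p * n) {q : ℕ} (hq : q < M) (v : Fin n) :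
    (clearB.run s).nat 118 (q * n + v) = 0 := by
  have main := loop_rule (x := 124) (b := 2)
    (p := .loop 125 0 (.setNat 118 (.add (.read 114 (vr 124)) (vr 125)) (.lit 0))) (s := s) hM
    (fun k r => ∀ q < k, ∀ v : Fin n, r.nat 118 (q * n + v) = 0) ?_ ?_ ?_
  · exact main q hq v
  · intro k r j h; simpa using h
  · exact fun q hq => absurd hq (by omega)
  · intro k r hk hr hsr hI
    have inner := loop_rule (x := 125) (b := 0)
      (p := .setNat 118 (.add (.read 114 (vr 124)) (vr 125)) (.lit 0)) (s := r) (N := n)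
      (by rw [hsr.1 0 (by decide), h0])
      (fun j t => ∀ (q : ℕ) (v : Fin n), (q < k ∨ q = k ∧ (v : ℕ) < j) → t.nat 118 (q * n + v) = 0)
      ?_ ?_ ?_
    · intro q hq v
      exact inner q v (by have := v.2; omega)
    · intro k r j h; simpa using h
    · exact fun q v h => hI q (by omega) v
    · intro j t hj ht hst hJ q v hqv
      have e1 : t.nat 124 0 = k := by rw [hst.1 124 (by decide), hr]
      have e2 : t.nat 114 k = k * n := by
        rw [hst.1 114 (by decide), hsr.1 114 (by decide), hb k hk]
      simp only [run_setNat, NatExpr.eval, e1, e2, ht, Memory.nat_writeNat, if_true]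
      by_cases heq : q * n + v = k * n + j
      · rw [heq, Function.update_self]
      · rw [Function.update_of_ne heq]
        refine hJ q v ?_
        by_contra hcon
        have h1 : q = k := by omega
        have h2 : (v : ℕ) = j := by omega
        exact heq (by rw [h1, h2])

/-- A node is good when each vertex of its set lies in a component for which some child succeeds,
that is, when its row is completely marked. -/
theorem testB_spec {s : Memory} (h0 : s.nat 0 0 = n) {q b : ℕ} (hq : s.nat 127 0 = q)
    (hb : s.nat 114 q = b) :
    0 < (testB.run s).nat 119 0 ↔ ∀ v ∈ (supp (row (s.nat 110) b) : Set (Fin n)),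
      0 < s.nat 118 (b + v) := by
  rw [testB, run_seq, run_setNat]
  simp only [NatExpr.eval]
  set s1 := s.writeNat 119 0 1 with hs1
  have main := loop_rule (x := 128) (b := 0)
    (p := .ite (.and (pos (.read 110 (.add (.read 114 (vr 127)) (vr 128))))
      (.not (pos (.read 118 (.add (.read 114 (vr 127)) (vr 128))))))
    (.setNat 119 (.lit 0) (.lit 0)) .skip) (s := s1) (N := n) (by simpa [hs1] using h0)
    (fun k r => 0 < r.nat 119 0 ↔ ∀ v : Fin n, (v : ℕ) < k →
      v ∈ (supp (row (s.nat 110) b) : Set (Fin n)) → 0 < s.nat 118 (b + v)) ?_ ?_ ?_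
  · exact main.trans ⟨fun h v => h v v.2, fun h v _ => h v⟩
  · intro k r j h; simpa using h
  · simp [hs1]
  · intro k r hk hr hsr hI
    have e1 : r.nat 127 0 = q := by rw [hsr.1 127 (by decide)]; simpa [hs1] using hq
    have e2 : r.nat 114 q = b := by rw [hsr.1 114 (by decide)]; simpa [hs1] using hb
    have e3 : r.nat 110 = s.nat 110 := by rw [hsr.1 110 (by decide)]; simp [hs1]
    have e4 : r.nat 118 = s.nat 118 := by rw [hsr.1 118 (by decide)]; simp [hs1]
    have hsplit : (∀ v : Fin n, (v : ℕ) < k + 1 →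
        v ∈ (supp (row (s.nat 110) b) : Set (Fin n)) → 0 < s.nat 118 (b + v)) ↔
        (∀ v : Fin n, (v : ℕ) < k →
        v ∈ (supp (row (s.nat 110) b) : Set (Fin n)) → 0 < s.nat 118 (b + v)) ∧
        (0 < s.nat 110 (b + k) → 0 < s.nat 118 (b + k)) := by
      refine ⟨fun h => ⟨fun v hv => h v (by omega), h ⟨k, hk⟩ (Nat.lt_succ_self k)⟩,
        fun h v hv hvT => ?_⟩
      rcases Nat.lt_succ_iff_lt_or_eq.1 hv with hlt | heq
      · exact h.1 v hlt hvT
      · rw [heq]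
        exact h.2 (by rw [← heq]; exact hvT)
    rw [hsplit]
    by_cases hc : 0 < s.nat 110 (b + k) ∧ ¬ 0 < s.nat 118 (b + k)
    · rw [run_ite_pos (by simp only [Test.Holds, NatExpr.eval, e1, e2, e3, e4, hr]; exact hc), run_setNat]
      refine iff_of_false (by simp) fun h => hc.2 (h.2 hc.1)
    · rw [run_ite_neg (by simp only [Test.Holds, NatExpr.eval, e1, e2, e3, e4, hr]; exact hc), run_skip,
        hI]
      exact ⟨fun h => ⟨h, fun h1 => by by_contra h2; exact hc ⟨h1, h2⟩⟩, fun h => h.1⟩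

/-- A good node marks its component in the row of its parent. If the parent is the root, recognized
by the offset 0, its pair of vertices is also recorded as the choice. -/
theorem markB_spec {s : Memory} (h0 : s.nat 0 0 = n) {p q b : ℕ} (hp : s.nat 127 0 = p)
    (hb : s.nat 114 p = b) (hq : s.nat 115 p = q * n) :
    (∀ (q' : ℕ) (v : Fin n), 0 < (markB.run s).nat 118 (q' * n + v) ↔
      (0 < s.nat 118 (q' * n + v) ∨ q' = q ∧ v ∈ (supp (row (s.nat 111) b) : Set (Fin n)))) ∧
    (0 < q * n → (markB.run s).nat 25 = s.nat 25 ∧ (markB.run s).nat 26 = s.nat 26) ∧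
    (q * n = 0 → (markB.run s).nat 25 0 = s.nat 116 p ∧ (markB.run s).nat 26 0 = s.nat 117 p) := by
  rw [markB, run_seq]
  set b1 : Block := .loop 129 0 (.ite (pos (.read 111 (.add (.read 114 (vr 127)) (vr 129))))
    (.setNat 118 (.add (.read 115 (vr 127)) (vr 129)) (.lit 1)) .skip) with hb1
  set s1 := b1.run s with hs1
  have m1 : Same _ s s1 := same_run _ s
  have main : ∀ (q' : ℕ) (v : Fin n), 0 < s1.nat 118 (q' * n + v) ↔ (0 < s.nat 118 (q' * n + v) ∨
      q' = q ∧ (v : ℕ) < n ∧ v ∈ (supp (row (s.nat 111) b) : Set (Fin n))) := by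
    refine loop_rule (N := n) h0 (fun k r => ∀ (q' : ℕ) (v : Fin n), 0 < r.nat 118 (q' * n + v) ↔
      (0 < s.nat 118 (q' * n + v) ∨
        q' = q ∧ (v : ℕ) < k ∧ v ∈ (supp (row (s.nat 111) b) : Set (Fin n)))) ?_ ?_ ?_
    · intro k r j h; simpa using h
    · intro q' v; simp
    · intro k r hk hr hsr hI q' v
      have e1 : r.nat 127 0 = p := by rw [hsr.1 127 (by decide), hp]
      have e2 : r.nat 114 p = b := by rw [hsr.1 114 (by decide), hb]
      have e3 : r.nat 111 = s.nat 111 := hsr.1 111 (by decide)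
      have e4 : r.nat 115 p = q * n := by rw [hsr.1 115 (by decide), hq]
      have hdec : q' * n + v = q * n + k ↔ q' = q ∧ (v : ℕ) = k := by
        constructor
        · exact mul_add_inj v.2 hk
        · rintro ⟨rfl, h⟩; rw [h]
      by_cases hc : 0 < s.nat 111 (b + k)
      · rw [run_ite_pos (by simp only [Test.Holds, NatExpr.eval, e1, e2, e3, hr]; exact hc), run_setNat]
        simp only [NatExpr.eval, e1, e4, hr, Memory.nat_writeNat, if_true]
        by_cases heq : q' * n + v = q * n + k
        · obtain ⟨h1, h2⟩ := hdec.1 heq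
          rw [heq, Function.update_self]
          refine iff_of_true Nat.one_pos (Or.inr ⟨h1, by omega, ?_⟩)
          rw [mem_supp, row, h2]; exact hc
        · rw [Function.update_of_ne heq, hI q' v]
          refine or_congr_right (and_congr_right fun h1 => and_congr_left fun _ => ?_)
          have : (v : ℕ) ≠ k := fun h2 => heq (hdec.2 ⟨h1, h2⟩)
          omega
      · rw [run_ite_neg (by simp only [Test.Holds, NatExpr.eval, e1, e2, e3, hr]; exact hc), run_skip,
          hI q' v]
        refine or_congr_right (and_congr_right fun h1 => ?_)
        constructor
        · exact fun h => ⟨by omega, h.2⟩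
        · rintro ⟨h2, h3⟩
          refine ⟨?_, h3⟩
          by_contra hcon
          have : (v : ℕ) = k := by omega
          rw [mem_supp, row, this] at h3
          exact hc h3
  have f127 : s1.nat 127 0 = p := by rw [m1.1 127 (by rw [hb1]; decide), hp]
  have f115 : s1.nat 115 p = q * n := by rw [m1.1 115 (by rw [hb1]; decide), hq]
  have f25 : s1.nat 25 = s.nat 25 := m1.1 25 (by rw [hb1]; decide)
  have f26 : s1.nat 26 = s.nat 26 := m1.1 26 (by rw [hb1]; decide)
  have f116 : s1.nat 116 = s.nat 116 := m1.1 116 (by rw [hb1]; decide)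
  have f117 : s1.nat 117 = s.nat 117 := m1.1 117 (by rw [hb1]; decide)
  have main' : ∀ (q' : ℕ) (v : Fin n), 0 < s1.nat 118 (q' * n + v) ↔ (0 < s.nat 118 (q' * n + v) ∨
      q' = q ∧ v ∈ (supp (row (s.nat 111) b) : Set (Fin n))) := fun q' v => by
    rw [main q' v]; simp
  by_cases hz : 0 < q * n
  · rw [run_ite_pos (by simp only [Test.Holds, NatExpr.eval, f127, f115]; exact hz), run_skip]
    exact ⟨main', fun _ => ⟨f25, f26⟩, fun h => absurd h hz.ne'⟩
  · rw [run_ite_neg (by simp only [Test.Holds, NatExpr.eval, f127, f115]; exact hz), run_seq,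
      run_setNat, run_setNat]
    refine ⟨by simpa using main', fun h => absurd h hz, fun _ => ?_⟩
    simp [f127, f116, f117]

end Block

/-! ### Evaluating the search tree from the leaves to the root. -/

namespace Block

variable {n : ℕ} {G : WeightedGraph (Fin n)}

/-- The node `p` shows that the component it comes from is used up in time. -/
def Witness (G : WeightedGraph (Fin n)) (L : ℝ) (s : Memory) (q p : ℕ) : Prop :=
  s.nat 115 p = q * n ∧ 0 < s.nat 113 p ∧
    G.Good L (s.nat 112 p) (supp (row (s.nat 110) (p * n)) : Set (Fin n))

/-- The marks and the choice after the nodes `b, …, M - 1` have been visited. -/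
def Visited (G : WeightedGraph (Fin n)) (L : ℝ) (s : Memory) (M b : ℕ) (z : Fin n) (r : Memory) :
    Prop :=
  (∀ q < M, ∀ v : Fin n, 0 < r.nat 118 (q * n + v) ↔ ∃ p, b ≤ p ∧ p < M ∧ Witness G L s q p ∧
    v ∈ (supp (row (s.nat 111) (p * n)) : Set (Fin n))) ∧
  ((∃ p, p < M ∧ Witness G L s 0 p ∧ r.nat 25 0 = s.nat 116 p ∧ r.nat 26 0 = s.nat 117 p) ∨
    (r.nat 25 0 = z ∧ r.nat 26 0 = z ∧ ¬ ∃ p, b ≤ p ∧ p < M ∧ Witness G L s 0 p))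

/-- Nodes are visited in decreasing order. Children have larger numbers than their parents, so all
marks in a row are final when its node is tested. -/
theorem visitB_spec {L : ℝ} {C : Set (Fin n)} {k m : ℕ} (hkm : k ≤ m) {s : Memory}
    (h0 : s.nat 0 0 = n) (hM : s.nat 0 2 = WeightedGraph.treeSize n m)
    (hF : HoldsForest G L C k (1 + WeightedGraph.treeSize n m * n * n) s) {z : Fin n} {i : ℕ}
    (hi : i < WeightedGraph.treeSize n m) {r : Memory} (hr : r.nat 126 0 = i)
    (hs : Same (.loop 126 2 visitB) s r)
    (h : Visited G L s (WeightedGraph.treeSize n m) (WeightedGraph.treeSize n m - i) z r) :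
    Visited G L s (WeightedGraph.treeSize n m) (WeightedGraph.treeSize n m - (i + 1)) z
      (visitB.run r) := by
  have hn : 0 < n := z.pos
  set M := WeightedGraph.treeSize n m with hMdef
  obtain ⟨b, hb⟩ : ∃ b, M - (i + 1) = b := ⟨_, rfl⟩
  have hb1 : M - i = b + 1 := by omega
  have hbM : b < M := by omega
  rw [hb1] at h
  rw [hb]
  obtain ⟨h1, h2⟩ := h
  have e0 : r.nat 0 = s.nat 0 := hs.1 0 (by decide)
  have hbase : ∀ p < M, s.nat 114 p = p * n := fun p hp => hF.base p (by
    have := Nat.mul_le_mul_left M (Nat.mul_pos hn hn)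
    rw [← Nat.mul_assoc] at this
    omega)
  rw [visitB, run_seq, run_setNat, run_seq]
  set r1 := r.writeNat 127 ((NatExpr.lit 0).eval r)
    ((NatExpr.sub (.sub (.read 0 (.lit 2)) (vr 126)) (.lit 1)).eval r) with hr1
  have a127 : r1.nat 127 0 = b := by
    simp only [hr1, NatExpr.eval, e0, hM, hr, Memory.nat_writeNat, if_true, Function.update_self]
    omega
  have au : ∀ a, a ≠ 127 → r1.nat a = r.nat a := fun a ha => by simp [hr1, ha]
  have ht := testB_spec (n := n) (s := r1) (b := b * n) (by rw [au 0 (by decide), e0, h0]) a127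
    (by rw [au 114 (by decide), hs.1 114 (by decide), hbase b hbM])
  rw [au 110 (by decide), hs.1 110 (by decide), au 118 (by decide)] at ht
  have hgood : 0 < (testB.run r1).nat 119 0 ↔
      G.Good L (s.nat 112 b) (supp (row (s.nat 110) (b * n)) : Set (Fin n)) := by
    rw [ht, ← hF.forest.good_iff hkm rfl hbM]
    refine forall₂_congr fun v _ => ?_
    rw [h1 b hbM v]
    exact exists_congr fun p => ⟨fun ⟨g1, g2, ⟨g3, g4, g5⟩, g6⟩ => ⟨g1, g2, g3, g4, g5, g6⟩,
      fun ⟨g1, g2, g3, g4, g5, g6⟩ => ⟨g1, g2, ⟨g3, g4, g5⟩, g6⟩⟩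
  set r2 := testB.run r1 with hr2
  have m2 : Same _ r1 r2 := same_run _ r1
  have bu : ∀ a, a ∉ (loop 126 2 visitB).natW → r2.nat a = s.nat a := fun a ha => by
    have ha' : a ≠ 127 ∧ a ∉ testB.natW := by
      simp only [visitB, natW, List.mem_cons, List.mem_append, not_or] at ha
      tauto
    rw [m2.1 a ha'.2, au a ha'.1, hs.1 a ha]
  have b118 : r2.nat 118 = r.nat 118 := by rw [m2.1 118 (by decide), au 118 (by decide)]
  have b25 : r2.nat 25 = r.nat 25 := by rw [m2.1 25 (by decide), au 25 (by decide)]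
  have b26 : r2.nat 26 = r.nat 26 := by rw [m2.1 26 (by decide), au 26 (by decide)]
  have b127 : r2.nat 127 0 = b := by rw [m2.1 127 (by decide), a127]
  have hsucc : ∀ p, b ≤ p ↔ p = b ∨ b + 1 ≤ p := fun p => by omega
  by_cases hc : 0 < s.nat 113 b ∧ 0 < r2.nat 119 0
  · have hg := hgood.1 hc.2
    have hb0 : 0 < b := by
      rcases Nat.eq_zero_or_pos b with h | h
      · rw [h, hF.forest.root_val] at hc
        exact absurd hc.1 (lt_irrefl 0)
      · exact h
    obtain ⟨q, -, -, -, hpar, -⟩ := hF.forest.child b hb0 (by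
      have := Nat.mul_le_mul_left M (Nat.mul_pos hn hn)
      rw [← Nat.mul_assoc] at this
      omega)
    have hw : ∀ q', Witness G L s q' b ↔ q' = q := fun q' =>
      ⟨fun hw => Nat.eq_of_mul_eq_mul_right hn (hw.1.symm.trans hpar),
        fun e => ⟨by rw [e]; exact hpar, hc.1, hg⟩⟩
    rw [run_ite_pos (by simp only [Test.Holds, NatExpr.eval, b127]; rw [bu 113 (by decide)]; exact hc)]
    obtain ⟨k1, k2, k3⟩ := markB_spec (n := n) (s := r2) (b := b * n) (by rw [bu 0 (by decide), h0]) b127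
      (by rw [bu 114 (by decide)]; exact hbase b hbM) (by rw [bu 115 (by decide)]; exact hpar)
    rw [b118, bu 111 (by decide)] at k1
    rw [b25, b26] at k2
    rw [bu 116 (by decide), bu 117 (by decide)] at k3
    refine ⟨fun q' hq' v => ?_, ?_⟩
    · rw [k1 q' v, h1 q' hq' v]
      constructor
      · rintro (⟨p, g1, g2⟩ | ⟨g1, g2⟩)
        · exact ⟨p, by omega, g2⟩
        · exact ⟨b, le_rfl, hbM, (hw q').2 g1, g2⟩
      · rintro ⟨p, g1, g2, g3, g4⟩
        rcases (hsucc p).1 g1 with rfl | g1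
        · exact Or.inr ⟨(hw q').1 g3, g4⟩
        · exact Or.inl ⟨p, g1, g2, g3, g4⟩
    · rcases Nat.eq_zero_or_pos (q * n) with hz | hz
      · left
        have : q = 0 := by
          rcases Nat.mul_eq_zero.1 hz with h | h
          · exact h
          · omega
        exact ⟨b, hbM, (hw 0).2 this.symm, k3 hz⟩
      · rw [(k2 hz).1, (k2 hz).2]
        refine h2.imp_right fun ⟨g1, g2, g3⟩ => ⟨g1, g2, ?_⟩
        rintro ⟨p, g4, g5, g6⟩
        rcases (hsucc p).1 g4 with rfl | g4
        · rw [← (hw 0).1 g6] at hz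
          omega
        · exact g3 ⟨p, g4, g5, g6⟩
  · rw [run_ite_neg (by simp only [Test.Holds, NatExpr.eval, b127]; rw [bu 113 (by decide)]; exact hc),
      run_skip]
    have hw : ∀ q', ¬ Witness G L s q' b := fun q' hw => hc ⟨hw.2.1, hgood.2 hw.2.2⟩
    have hex : ∀ (q' : ℕ) (Q : ℕ → Prop), (∃ p, b ≤ p ∧ p < M ∧ Witness G L s q' p ∧ Q p) ↔
        ∃ p, b + 1 ≤ p ∧ p < M ∧ Witness G L s q' p ∧ Q p := fun q' Q => by
      refine exists_congr fun p => ⟨fun ⟨g1, g2, g3, g4⟩ => ⟨?_, g2, g3, g4⟩,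
        fun ⟨g1, g2⟩ => ⟨by omega, g2⟩⟩
      rcases (hsucc p).1 g1 with rfl | g1
      · exact absurd g3 (hw q')
      · exact g1
    refine ⟨fun q' hq' v => ?_, ?_⟩
    · rw [b118, h1 q' hq' v, hex]
    · rw [b25, b26]
      refine h2.imp_right fun ⟨g1, g2, g3⟩ => ⟨g1, g2, ?_⟩
      rintro ⟨p, g4, g5, g6⟩
      obtain ⟨p', g7, g8, g9, -⟩ := (hex 0 fun _ => True).1 ⟨p, g4, g5, g6, trivial⟩
      exact g3 ⟨p', g7, g8, g9⟩

/-- If the root has a good child, its pair of vertices hands goodness down to the components that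
remain. If not, the component is not good and nothing has to be handed down; then the pair (z, z) is
chosen, which still gives a legitimate clustering, but possibly with too many levels. -/
theorem treeChoose_chooseSpec {s₀ : Memory} {k : ℕ}
    (hM : s₀.nat 0 2 = WeightedGraph.treeSize n k) (hk : s₀.nat 71 0 = k) :
    ChooseSpec G treeChoose s₀ fun L j C => G.Good L (k - j) C := by
  intro r z C hG hE hL hz hC hzC hcomp
  set L := r.real 13 0 with hLdef
  set M := WeightedGraph.treeSize n k with hMdef
  have hn : 0 < n := z.pos
  have hM1 : r.nat 0 2 = M := by rw [hE 0 (Or.inl rfl), hM]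
  have hF := forestB_spec hG hM1 hC
  rw [hE 71 (by decide), hk] at hF
  simp only [treeChoose, run_seq]
  set s1 := forestB.run r with hs1
  have m1 : Same _ r s1 := same_run _ r
  have hbase : ∀ p < M, s1.nat 114 p = p * n := fun p hp => hF.base p (by
    have := Nat.mul_le_mul_left M (Nat.mul_pos hn hn)
    rw [← Nat.mul_assoc] at this
    omega)
  have hcl : ∀ q < M, ∀ v : Fin n, (clearB.run s1).nat 118 (q * n + v) = 0 := fun q hq v =>
    clearB_spec (by rw [m1.1 0 (by decide), hG.size]) (by rw [m1.1 0 (by decide), hM1]) hbase hq v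
  set s2 := clearB.run s1 with hs2
  have m2 : Same _ s1 s2 := same_run _ s1
  rw [run_setNat, run_setNat]
  set s3 := (s2.writeNat 25 _ _).writeNat 26 _ _ with hs3
  have e51 : s2.nat 51 0 = z := by rw [m2.1 51 (by decide), m1.1 51 (by decide), hz]
  have u3 : ∀ a, a ≠ 25 → a ≠ 26 → s3.nat a = s2.nat a := fun a h1 h2 => by simp [hs3, h1, h2]
  have h25 : s3.nat 25 0 = z := by simp [hs3, e51]
  have h26 : s3.nat 26 0 = z := by simp [hs3, e51]
  have u1 : ∀ a ∈ [110, 111, 112, 113, 114, 115, 116, 117], s3.nat a = s1.nat a := by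
    intro a ha
    have ha' : a ≠ 25 ∧ a ≠ 26 ∧ a ∉ clearB.natW := by
      revert a
      decide
    rw [u3 a ha'.1 ha'.2.1, m2.1 a ha'.2.2]
  have hF3 := hF.of_eq u1
  have f0 : s3.nat 0 = r.nat 0 := by
    rw [u3 0 (by decide) (by decide), m2.1 0 (by decide), m1.1 0 (by decide)]
  have main := loop_rule (x := 126) (b := 2) (p := visitB) (s := s3) (N := M) (by rw [f0, hM1])
    (fun i t => Visited G L s3 M (M - i) z t) ?_ ?_ ?_
  · obtain ⟨-, hch⟩ := main
    set s4 := (loop 126 2 visitB).run s3 with hs4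
    rw [Nat.sub_self] at hch
    have hroot := hF3.forest.root
    have htd := hF3.forest.root_td
    rcases hch with ⟨p, hp, ⟨w1, w2, w3⟩, e25, e26⟩ | ⟨e25, e26, hno⟩
    · have hp0 : 0 < p := by
        rcases Nat.eq_zero_or_pos p with h | h
        · rw [h, hF3.forest.root_val] at w2
          exact absurd w2 (lt_irrefl 0)
        · exact h
      obtain ⟨q, x, y, -, g1, g2, g3, g4, -, g5⟩ := hF3.forest.child p hp0 (by
        have := Nat.mul_le_mul_left M (Nat.mul_pos hn hn)
        rw [← Nat.mul_assoc] at this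
        omega)
      have hq : q = 0 := Nat.eq_of_mul_eq_mul_right hn (g1.symm.trans w1)
      subst hq
      obtain ⟨-, hy⟩ := g4.1 w2
      obtain ⟨-, g6, g7⟩ := g5 w2
      rw [hroot] at hy g6
      have hx : x ∈ C := by obtain ⟨l, hl⟩ := hy; exact hl.left_mem
      have hCx : G.comp C x = C := by
        rw [WeightedGraph.comp_eq_of_mem (z := z) (by rw [hcomp]; exact hx), hcomp]
      rw [hCx] at hy g6
      refine ⟨x, y, by rw [e25, g2], by rw [e26, g3], hx, hy, fun _ u hu => ?_⟩
      refine WeightedGraph.Good.comp ?_ hu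
      rw [← g6, show k - (r.nat 29 0 + 1) = s3.nat 112 p by omega]
      exact w3
    · refine ⟨z, z, e25, e26, hzC, hzC, fun hgood => ?_⟩
      -- Were the component good, `good_iff` at the root would produce a good child whose mark
      -- covers z, and then a choice would have been recorded.
      have hM0 : 0 < M := WeightedGraph.treeSize_pos n k
      have := (hF3.forest.good_iff (Nat.sub_le k _) rfl hM0).2 (by rw [hroot, htd]; exact hgood) z
        (by rw [hroot]; exact hzC)
      obtain ⟨p, -, g2, g3, g4, g5, -⟩ := this
      exact absurd ⟨p, Nat.zero_le p, g2, g3, g4, g5⟩ hno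
  · intro k t j h
    simpa [Visited] using h
  · rw [Nat.sub_zero]
    refine ⟨fun q hq v => ?_, Or.inr ⟨h25, h26, fun ⟨p, h1, h2, _⟩ => by omega⟩⟩
    rw [u3 118 (by decide) (by decide), hcl q hq v]
    exact iff_of_false (lt_irrefl 0) fun ⟨p, h1, h2, _⟩ => by omega
  · intro i t hi ht hst hI
    exact visitB_spec (Nat.sub_le k _) (by rw [f0, hG.size]) (by rw [f0, hM1]) hF3 hi ht hst hI

end Block

/-! ### The algorithm for graphs of unknown pathwidth -/

/-- The size of the search tree as a polynomial. -/
noncomputable def treePoly : ℕ → Polynomial ℕ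
  | 0 => 1
  | k + 1 => 1 + Polynomial.X * Polynomial.X * treePoly k

theorem treePoly_eval (n k : ℕ) : (treePoly k).eval n = WeightedGraph.treeSize n k := by
  induction k with
  | zero => simp [treePoly, WeightedGraph.treeSize]
  | succ k ih => simp [treePoly, WeightedGraph.treeSize, ih]

namespace Block

/-- Increase the number of levels, and compute the size of the search tree. -/
def growSizeB : Block :=
  .seq (.setNat 71 (.lit 0) (.add (vr 71) (.lit 1))) <|
  .seq (.setNat 70 (.lit 0) (.lit 1))
    (.loop 67 0 (.loop 68 0 (.setNat 70 (.lit 0) (.add (vr 70) (.read 0 (.lit 2))))))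

/-- Try the next number of levels. -/
def roundP : Program :=
  .seq growSizeB.compile (.seq (.setNat 0 (.lit 2) (vr 70)) (solveB treeChoose).compile)

/-- Try all numbers of levels until one suffices. -/
def roundsP : Program := .loop (.not (.natLe (vr 30) (vr 71))) roundP

/-- The algorithm for graphs that are given without a path decomposition. -/
def pathwidthP : Program :=
  .seq (anyB 2 67).compile <|
  .branch (pos (vr 28))
    (.seq prepareB.compile <|
      .seq (.setNat 0 (.lit 2) (.lit 1)) <|
      .seq (.setNat 30 (.lit 0) (.lit 1)) <|
      .seq roundsP outB.compile)
    .skip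

variable {n : ℕ} {G : WeightedGraph (Fin n)}

/-- The recursion 1 + n²·size is carried out by n² additions. -/
theorem growSizeB_spec {s : Memory} (h0 : s.nat 0 0 = n) :
    (growSizeB.run s).nat 70 0 = 1 + n * n * s.nat 0 2 ∧
    (growSizeB.run s).nat 71 0 = s.nat 71 0 + 1 := by
  rw [growSizeB, run_seq, run_seq, run_setNat, run_setNat]
  simp only [NatExpr.eval]
  set s1 := (s.writeNat 71 0 (s.nat 71 0 + 1)).writeNat 70 0 1 with hs1
  have a0 : s1.nat 0 = s.nat 0 := by simp [hs1]
  refine ⟨?_, by rw [run_nat (by decide)]; simp [hs1]⟩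
  have main := loop_rule (x := 67) (b := 0)
    (p := .loop 68 0 (.setNat 70 (.lit 0) (.add (vr 70) (.read 0 (.lit 2))))) (s := s1) (N := n)
    (by rw [a0, h0]) (fun i r => r.nat 70 0 = 1 + i * n * s.nat 0 2) ?_ ?_ ?_
  · exact main
  · intro k r j h; simpa using h
  · simp [hs1]
  · intro i r _ _ hsr hI
    have inner := loop_rule (x := 68) (b := 0)
      (p := .setNat 70 (.lit 0) (.add (vr 70) (.read 0 (.lit 2)))) (s := r) (N := n)
      (by rw [hsr.1 0 (by decide), a0, h0])
      (fun j t => t.nat 70 0 = 1 + (i * n + j) * s.nat 0 2) ?_ ?_ ?_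
    · have e : i * n + n = (i + 1) * n := by ring
      rwa [e] at inner
    · intro k r j h; simpa using h
    · simpa using hI
    · intro j t _ _ hst hJ
      have e0 : t.nat 0 2 = s.nat 0 2 := by rw [hst.1 0 (by decide), hsr.1 0 (by decide), a0]
      simp only [run_setNat, NatExpr.eval, Memory.nat_writeNat, if_true, Function.update_self, hJ, e0]
      ring

theorem Prepared.writeSize {K : Set (Fin n)} {s : Memory} (h : Prepared G K s) (z : ℕ) :
    Prepared G K (s.writeNat 0 2 z) := by
  obtain ⟨⟨h1, h2, h3, h4⟩, h5, h6, h7⟩ := h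
  refine ⟨⟨by simpa using h1, by simpa using h2, by simpa using h3, fun i hi => ?_⟩,
    by simpa using h5, by simpa using h6, by simpa using h7⟩
  have : (s.writeNat 0 2 z).nat 10 = s.nat 10 := by simp
  rw [this]
  exact h4 i (by simpa using hi)

/-- The memory after `k` rounds, on a graph of pathwidth `w`. -/
structure RoundMem (G : WeightedGraph (Fin n)) (K : Finset (Fin n)) (w k : ℕ) (s : Memory) :
    Prop where
  prepared : Prepared G (K : Set (Fin n)) s
  out : ∀ i, s.nat 4 i = 0
  level : s.nat 71 0 = k
  size : s.nat 0 2 = WeightedGraph.treeSize n k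
  small : ∀ b, b ≠ 2 → s.nat 0 b ≤ n
  start : k = 0 → s.nat 30 0 = 1
  done : w + 1 ≤ k → s.nat 30 0 ≤ k
  solution : 0 < k → s.nat 30 0 ≤ w + 1 → ∃ M : WeightedGraph K, Outputs (outB.run s) M ∧
    IsSPRSolution G K M (10 ^ 9 * (w : ℝ≥0) ^ 9)

theorem RoundMem.bound {K : Finset (Fin n)} {w k : ℕ} {s : Memory} (h : RoundMem G K w k s)
    (hn : 0 < n) (hk : k ≤ w + 1) (b : ℕ) : s.nat 0 b ≤ n + WeightedGraph.treeSize n (w + 1) := by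
  by_cases hb : b = 2
  · rw [hb, h.size]
    have := WeightedGraph.treeSize_mono hn hk
    omega
  · have := h.small b hb
    omega

/-- The size of the tree is a loop bound, so it has to be written into array `0` between two blocks.
Correctness of the output and termination use different properties of the chooser. -/
theorem roundP_spec {K : Finset (Fin n)} {w k : ℕ} (hconn : G.graph.Connected)
    {D : PathDecomposition G.graph} (hD : D.width = w) (hn : 0 < n) {s : Memory}
    (h : RoundMem G K w k s) (hk : k < w + 1) :
    ∃ t ≤ (growSizeB.time + (solveB treeChoose).time + Polynomial.C 10).eval
        (n + WeightedGraph.treeSize n (w + 1)),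
      ∃ s', Runs roundP s t s' ∧ RoundMem G K w (k + 1) s' := by
  set N := n + WeightedGraph.treeSize n (w + 1) with hN
  obtain ⟨t1, ht1, r1⟩ := runs growSizeB (by decide) s N (h.bound hn hk.le)
  obtain ⟨g1, g2⟩ := growSizeB_spec h.prepared.size
  set s1 := growSizeB.run s with hs1
  have m1 : Same _ s s1 := same_run _ s
  have w1 : growSizeB.Within [70, 71] 70 [] := by decide
  have hP1 : Prepared G (K : Set (Fin n)) s1 := w1.prepared m1 h.prepared (by decide) (by decide)
  have g1' : s1.nat 70 0 = WeightedGraph.treeSize n (k + 1) := by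
    rw [g1, h.size, WeightedGraph.treeSize]
  set s2 := s1.writeNat 0 2 (s1.nat 70 0) with hs2
  have r2 : Runs (.setNat 0 (.lit 2) (vr 70)) s1 4 s2 := .setNat 0 (.lit 2) (vr 70) s1
  have hP2 : Prepared G (K : Set (Fin n)) s2 := Prepared.writeSize hP1 _
  have e02 : s2.nat 0 2 = WeightedGraph.treeSize n (k + 1) := by simp [hs2, g1']
  have e71 : s2.nat 71 0 = k + 1 := by simp [hs2, g2, h.level]
  have e4 : ∀ i, s2.nat 4 i = 0 := fun i => by
    have : s2.nat 4 i = s1.nat 4 i := by simp [hs2]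
    rw [this, m1.1 4 (by decide), h.out]
  have esmall : ∀ b, b ≠ 2 → s2.nat 0 b ≤ n := fun b hb => by
    have : s2.nat 0 b = s1.nat 0 b := by simp [hs2, Function.update_of_ne hb]
    rw [this, m1.1 0 (by decide)]
    exact h.small b hb
  have ebound : ∀ b, s2.nat 0 b ≤ N := fun b => by
    by_cases hb : b = 2
    · rw [hb, e02]
      have := WeightedGraph.treeSize_mono hn (show k + 1 ≤ w + 1 by omega)
      omega
    · have := esmall b hb
      omega
  obtain ⟨t3, ht3, r3⟩ := runs (solveB treeChoose) (by decide) s2 N ebound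
  have hspec := treeChoose_chooseSpec (G := G) e02 e71
  -- With the trivial property, the chooser guarantees a valid clustering for any k. The distortion
  -- then depends only on the number of levels that was observed, so a round may succeed before k
  -- reaches w + 1.
  have htrue : ChooseSpec G treeChoose s2 fun _ _ _ => True := by
    intro r z C a1 a2 a3 a4 a5 a6 a7
    obtain ⟨x, y, b1, b2, b3, b4, -⟩ := hspec r z C a1 a2 a3 a4 a5 a6 a7
    exact ⟨x, y, b1, b2, b3, b4, fun _ _ _ => trivial⟩
  have hE : Env s2 s2 := fun _ _ => rfl
  have w3 := solveB_within treeChoose_chooser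
  have m3 := same_run (solveB treeChoose) s2
  refine ⟨t1 + (4 + t3), ?_, _, .seq r1 (.seq r2 r3), ?_, ?_, ?_, ?_, ?_, ?_, ?_, ?_⟩
  · simp only [Polynomial.eval_add, Polynomial.eval_C]
    omega
  · exact w3.prepared m3 hP2 (by decide) (by decide)
  · rw [w3.nat m3 (by decide) (by decide)]; exact e4
  · rw [w3.nat m3 (by decide) (by decide)]; exact e71
  · rw [w3.nat m3 (by decide) (by decide)]; exact e02
  · rw [w3.nat m3 (by decide) (by decide)]; exact esmall
  · exact fun h => absurd h (Nat.succ_ne_zero k)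
  · intro hw
    obtain rfl : k = w := by omega
    refine (solveB_spec treeChoose_chooser hspec (fun L hL H z _ => ?_) hP2 hE).2.2 _ ?_
    -- For k + 1 = w + 1 levels every component is good at level 0, so the observed number of levels
    -- is at most k + 1 and the loop stops.
    · refine (WeightedGraph.bagBound_zero D _).good hL ?_
      rw [hD, Nat.zero_add, Nat.sub_zero]
    · rintro L - C ⟨v, hv⟩ hgood
      rw [Nat.sub_self] at hgood
      have hC : C = ∅ := hgood
      rw [hC] at hv
      exact absurd hv (Set.notMem_empty _)
  · intro _ hle
    have := outB_solveB treeChoose_chooser htrue (fun _ _ _ _ _ => trivial) hP2 hE e4 hconn (D := D)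
      (by rw [hD]; exact hle)
    rwa [hD] at this

/-- Induction on the number d = w + 1 - k of rounds that may still be needed. All trees are at most
as large as the one for w + 1 levels, so a common time bound holds for the rounds. -/
theorem roundsP_spec {K : Finset (Fin n)} {w : ℕ} (hconn : G.graph.Connected)
    {D : PathDecomposition G.graph} (hD : D.width = w) (hn : 0 < n) (d : ℕ) :
    ∀ k s, k + d = w + 1 → RoundMem G K w k s →
      ∃ t ≤ d * ((growSizeB.time + (solveB treeChoose).time + Polynomial.C 10).eval
          (n + WeightedGraph.treeSize n (w + 1)) + 10) + 10,
        ∃ s', Runs roundsP s t s' ∧ ∃ k ≤ w + 1, RoundMem G K w k s' ∧ s'.nat 30 0 ≤ k := by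
  have hcost : (Test.not (.natLe (vr 30) (vr 71))).cost = 6 := rfl
  induction d with
  | zero =>
    intro k s hk h
    have hle := h.done (by omega)
    refine ⟨6, by omega, s, hcost ▸ .loopDone ?_, k, by omega, h, hle⟩
    simpa [h.level] using hle
  | succ d ih =>
    intro k s hk h
    by_cases hle : s.nat 30 0 ≤ k
    · refine ⟨6, by omega, s, hcost ▸ .loopDone ?_, k, by omega, h, hle⟩
      simpa [h.level] using hle
    · obtain ⟨t1, ht1, s1, r1, h1⟩ := roundP_spec hconn hD hn h (by omega)
      obtain ⟨t2, ht2, s2, r2, h2⟩ := ih (k + 1) s1 (by omega) h1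
      refine ⟨6 + t1 + t2, ?_, s2, hcost ▸ .loopStep ?_ r1 r2, h2⟩
      · rw [Nat.succ_mul]; omega
      · simpa [h.level] using hle

theorem pathwidthP_spec (hconn : G.graph.Connected) (K : Finset (Fin n))
    {w : ℕ} (hw : pathwidth G.graph = w) :
    SolvesSPRWithin pathwidthP (inputMemory G K)
      (((anyB 2 67).time + prepareB.time + outB.time + Polynomial.C 100 + Polynomial.C (w + 1) *
        (growSizeB.time + (solveB treeChoose).time + Polynomial.C 20)).eval
        (n + WeightedGraph.treeSize n (w + 1))) G K (10 ^ 9 * (w : ℝ≥0) ^ 9) := by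
  obtain ⟨D, hD⟩ := exists_pathDecomposition G.graph
  rw [hw] at hD
  have hn : 0 < n := by
    obtain ⟨v⟩ := hconn.nonempty
    exact v.pos
  have hin : HoldsInput G K (inputMemory G K) := holdsInput_initialMemory G K _
  set s := inputMemory G K with hs
  set N := n + WeightedGraph.treeSize n (w + 1) with hN
  have hs0 : ∀ b, s.nat 0 b ≤ n := fun b => by
    simp only [hs, inputMemory, initialMemory]
    split_ifs <;> omega
  obtain ⟨t1, ht1, r1⟩ := runs (anyB 2 67) (by decide) s N (fun b => (hs0 b).trans (by omega))
  have hany := anyB_spec (n := n) (A := 2) (x := 67) (by decide) (by decide) hin.size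
  have w1 : (anyB 2 67).Within [28] 68 [] := by decide
  set s1 := (anyB 2 67).run s with hs1
  have m1 : Same _ s s1 := same_run _ s
  have e0 : s1.nat 0 = s.nat 0 := w1.nat m1 (by decide) (by decide)
  have hin1 : HoldsInput G K s1 := hin.of_eq (by rw [e0])
    (w1.nat m1 (by decide) (by decide)) (w1.nat m1 (by decide) (by decide))
    (w1.real m1 (by decide) (by decide))
  have hterm : (supp (s.nat 2) : Set (Fin n)) = K := by
    ext v; exact hin.term v
  rw [hterm] at hany
  have hcost : (pos (vr 28)).cost = 4 := rfl
  simp only [Polynomial.eval_add, Polynomial.eval_C, Polynomial.eval_mul]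
  rcases K.eq_empty_or_nonempty with hK | hK
  · have hneg : ¬ (pos (vr 28)).Holds s1 := by
      simp only [Test.Holds, NatExpr.eval]
      exact fun h => absurd (hany.1 h) (by simp [hK])
    subst hK
    exact ⟨t1 + (4 + 1), by omega, s1, .seq r1 (hcost ▸ .branchFalse hneg (.skip s1)),
      exists_solution_empty G _ _⟩
  obtain ⟨t2, ht2, r2⟩ := runs prepareB (by decide) s1 N
    (fun b => by rw [e0]; exact (hs0 b).trans (by omega))
  have m2 := same_run prepareB s1
  have hP := prepareB_spec hconn hin1 hK
  set s2 := prepareB.run s1 with hs2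
  -- The value 1 is the size of the tree of depth 0.
  set s3 := s2.writeNat 0 2 1 with hs3
  have r3 : Runs (.setNat 0 (.lit 2) (.lit 1)) s2 3 s3 := .setNat 0 (.lit 2) (.lit 1) s2
  -- The observed number of levels is set to 1 > 0, so that the loop does not stop before its first
  -- round.
  set s4 := s3.writeNat 30 0 1 with hs4
  have r4 : Runs (.setNat 30 (.lit 0) (.lit 1)) s3 3 s4 := .setNat 30 (.lit 0) (.lit 1) s3
  have hP3 : Prepared G (K : Set (Fin n)) s3 := Prepared.writeSize hP _
  have w4 : (setNat 30 (.lit 0) (.lit 1)).Within [30] 40 [] := by decide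
  have hu : ∀ a, a ≠ 0 → a ≠ 30 → a ∉ prepareB.natW → a ∉ (anyB 2 67).natW → s4.nat a = s.nat a := by
    intro a h1 h2 h3 h4
    rw [← m1.1 a h4, ← m2.1 a h3]
    simp [hs4, hs3, h1, h2]
  have hR : RoundMem G K w 0 s4 := by
    refine ⟨w4.prepared (same_run _ s3) hP3 (by decide) (by decide), fun i => ?_, ?_, ?_,
      fun b hb => ?_, fun _ => by simp [hs4], fun h => absurd h (by omega),
      fun h => absurd h (lt_irrefl 0)⟩
    · rw [hu 4 (by decide) (by decide) (by decide) (by decide)]; rfl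
    · rw [hu 71 (by decide) (by decide) (by decide) (by decide)]; rfl
    · simp [hs4, hs3, WeightedGraph.treeSize]
    · have : s4.nat 0 b = s2.nat 0 b := by simp [hs4, hs3, Function.update_of_ne hb]
      rw [this, m2.1 0 (by decide), e0]
      exact hs0 b
  obtain ⟨t5, ht5, s5, r5, k, hk, h5, hle⟩ := roundsP_spec hconn hD hn (w + 1) 0 s4 (by omega) hR
  obtain ⟨t6, ht6, r6⟩ := runs outB (by decide) s5 N (h5.bound hn hk)
  have hpos : (pos (vr 28)).Holds s1 := by
    simp only [Test.Holds, NatExpr.eval]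
    exact hany.2 hK
  have hk0 : 0 < k := by
    by_contra hk0
    have := h5.start (by omega)
    omega
  refine ⟨t1 + (4 + (t2 + (3 + (3 + (t5 + t6))))), ?_, _, .seq r1 (hcost ▸ .branchTrue hpos
    (.seq r2 (.seq r3 (.seq r4 (.seq r5 r6))))), h5.solution hk0 (hle.trans hk)⟩
  rw [Polynomial.eval_add, Polynomial.eval_add, Polynomial.eval_C, ← hN, Nat.add_assoc _ 10 10, show 10 + 10 = 20 from rfl] at ht5
  omega

end Block

theorem mainTheorem2 :
    ∃ C : ℝ≥0,
      -- one algorithm, given the graph and the terminals; for each pathwidth, polynomial time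
      (∃ P : Program, ∀ ρ : ℕ, ∃ p : Polynomial ℕ,
        ∀ (n : ℕ) (G : WeightedGraph (Fin n)) (K : Finset (Fin n)),
          G.graph.Connected → pathwidth G.graph = ρ →
            SolvesSPRWithin P (inputMemory G K) (p.eval n) G K (C * (ρ : ℝ≥0) ^ 9)) ∧
      -- one algorithm, given also a path decomposition; polynomial time uniformly in the width
      (∃ P : Program, ∃ p : Polynomial ℕ,
        ∀ (n : ℕ) (G : WeightedGraph (Fin n)) (K : Finset (Fin n))
          (D : PathDecomposition G.graph),
          G.graph.Connected →
            SolvesSPRWithin P (inputMemoryWith G K D) (p.eval (n + D.numBags)) G K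
              (C * (D.width : ℝ≥0) ^ 9)) := by
  -- The time is a polynomial in n + treeSize n (ρ + 1), and for fixed ρ the size of the tree is
  -- itself a polynomial in n.
  refine ⟨10 ^ 9, ⟨Block.pathwidthP, fun ρ => ⟨((Block.anyB 2 67).time + Block.prepareB.time +
    Block.outB.time + Polynomial.C 100 + Polynomial.C (ρ + 1) * (Block.growSizeB.time +
      (Block.solveB Block.treeChoose).time + Polynomial.C 20)).comp
    (Polynomial.X + treePoly (ρ + 1)), fun n G K hconn hρ => ?_⟩⟩, Block.decompositionB_runs⟩
  have := Block.pathwidthP_spec hconn K hρ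
  rwa [Polynomial.eval_comp, show (Polynomial.X + treePoly (ρ + 1) : Polynomial ℕ).eval n =
    n + WeightedGraph.treeSize n (ρ + 1) by simp [treePoly_eval]]
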